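/- Let $M$ be a smooth $n$-manifold (Hausdorff, $\sigma$-compact, without boundary) carrying smooth fields $(\hat g,\beta,\phi)$: a nondegenerate metric $\hat g^{ab}$ of any signature on $T^*M$ with inverse $\hat g_{ab}$, a nondegenerate bivector $\beta^{ab}$ (so $n$ is even if $M\neq\emptyset$) with inverse $\beta_{ab}$, $\beta_{am}\beta^{mb}=\delta_a^b$, and a function $\phi$. In local coordinates put $D^a=\beta^{am}\partial_m$, $Q_c{}^{ab}=\partial_c\beta^{ab}$, $\Theta^{abc}=D^a\beta^{bc}+D^b\beta^{ca}+D^c\beta^{ab}$, $\mathcal Q_c{}^{ab}=Q_c{}^{ab}+\Theta^{abm}\beta_{mc}$, $$\hat\Gamma_c{}^{ab}=\tfrac12\hat g_{cm}\big(D^a\hat g^{bm}+D^b\hat g^{am}-D^m\hat g^{ab}\big)-\tfrac12\hat g_{cm}\big(\hat g^{an}\mathcal Q_n{}^{bm}+\hat g^{bn}\mathcal Q_n{}^{am}\big)+\tfrac12\mathcal Q_c{}^{ab},$$ $$\hat R_a{}^{bcd}=D^c\hat\Gamma_a{}^{db}-D^d\hat\Gamma_a{}^{cb}+\hat\Gamma_a{}^{cm}\hat\Gamma_m{}^{db}-\hat\Gamma_a{}^{dm}\hat\Gamma_m{}^{cb}-\hat\Gamma_a{}^{mb}\mathcal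 Q_m{}^{cd},$$ $\hat R^{ab}=\hat R_m{}^{amb}$, $\hat R=\hat g_{ab}\hat R^{ab}$; on lower indices $\hat\nabla^c\eta_b=D^c\eta_b+\hat\Gamma_b{}^{cm}\eta_m$, on upper indices $\hat\nabla^cX^b=D^cX^b-\hat\Gamma_m{}^{cb}X^m$, and $\hat\nabla^a\phi=D^a\phi$. Indices of $\Theta$ are lowered with $\hat g_{ab}$. Put $$\hat{\mathscr L}=\sqrt{|\det\hat g^{ab}|}\;\det(\beta^{-1})\,e^{-2\phi}\Big(\hat R-\tfrac1{12}\Theta^{abc}\Theta_{abc}+4\hat g_{ab}D^a\phi D^b\phi\Big),\qquad \hat S_K=\frac1{2\kappa^2}\int_K d^nx\,\hat{\mathscr L}\quad(\kappa\ne0)$$ for compact $K\subset M$, the integral being computed in charts. Then $\hat{\mathscr L}$ is smooth in every chart, and: 1. (Diffeomorphisms.) $\hat S_K$ does not depend on the charts used, and $\hat S_K[\psi^*(\hat g,\beta,\phi)]=\hat S_{\psi(K)}[\hat g,\beta,\phi]$ for every diffeomorphism $\psi$ onto another such manifold, where $(\hat g,\beta,\phi)$ are fields on that manifold. For every smooth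 vector field $X$ the Lie derivatives $\delta_X$ of the fields are smooth tensor variations, and varying all the fields by them gives $\delta_X\hat{\mathscr L}=\partial_m(X^m\hat{\mathscr L})$ in every chart; hence $\delta_X\hat S_K=0$ if $X$ vanishes outside $K$. 2. ($\beta$-diffeomorphisms.) For every smooth one-form $\xi$ put $$\hat\delta_\xi\hat g^{ij}=\xi_mD^m\hat g^{ij}+\hat g^{mj}(D^i\xi_m+\xi_kQ_m{}^{ik})+\hat g^{im}(D^j\xi_m+\xi_kQ_m{}^{jk}),\quad \hat\delta_\xi\beta^{ij}=\xi_m\Theta^{mij},\quad \hat\delta_\xi\phi=\xi_mD^m\phi .$$ These are smooth tensor variations of the fields, and $\hat\delta_\xi\hat{\mathscr L}=\partial_m(\xi_k\beta^{km}\hat{\mathscr L})$ in every chart; hence $\hat\delta_\xi\hat S_K=0$ if $\xi$ vanishes outside $K$. 3. (Relation to the bosonic string.) The relations $\beta=B^{-1}$, $\hat g=-\beta G\beta$ (i.e. $\hat g^{ij}=\beta^{im}\beta^{jn}G_{mn}$) define a bijection between the fields $(\hat g,\beta,\phi)$ above and triples $(G,B,\phi)$ of a nondegenerate metric $G_{ij}$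 on $TM$, a nondegenerate two-form $B$ and a function. Under it $\sqrt{|\det G|}\,e^{-2\phi}\big(R-\tfrac1{12}H_{abc}H^{abc}+4G^{ab}\partial_a\phi\partial_b\phi\big)=\hat{\mathscr L}$, where $R$ is the scalar curvature of $G$ and $H=dB$. So for every compact $K$ $$S_K\big(G(\hat g,\beta),B(\hat g,\beta),\phi\big)=\hat S_K(\hat g,\beta,\phi),\qquad S_K=\frac1{2\kappa^2}\int_K d^nx\,\sqrt{|\det G|}\,e^{-2\phi}\Big(R-\tfrac1{12}H_{abc}H^{abc}+4G^{ab}\partial_a\phi\,\partial_b\phi\Big).$$ 4. (Field equations.) $\hat S$ is stationary at $(\hat g,\beta,\phi)$ with respect to all smooth compactly supported variations of $\hat g$, $\beta$ and $\phi$ if and only if everywhere on $M$ $$0=-\tfrac12\hat g_{ab}\hat\nabla^a\hat\nabla^b\phi+\hat g_{ab}\hat\nabla^a\phi\hat\nabla^b\phi-\tfrac1{24}\Theta^{abc}\Theta_{abc},$$ $$0=\hat R^{ab}+2\hat\nabla^a\hat\nabla^b\phi-\tfrac14\Theta^{amn}\Theta^b{}_{mn},$$ $$0=\tfrac12\hat\nabla^m\Theta_{mab}-(\hat\nabla^m\phi)\Theta_{mab}.$$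 -/

import Mathlib

open scoped Manifold ContDiff

noncomputable section

namespace SymplecticGravity

/-! ## Local fields on a coordinate domain -/

/-- Coordinate space `ℝⁿ` (with Lebesgue measure as `volume`). -/
abbrev Coord (n : ℕ) : Type := Fin n → ℝ

/-- The partial derivative `∂_i f` at `y`. -/
def pd {n : ℕ} (i : Fin n) (f : Coord n → ℝ) (y : Coord n) : ℝ :=
  fderiv ℝ f y (Pi.single i 1)

/-- Component functions, in one coordinate system, of a metric `ĝ^{ij}` on the cotangent bundle,
a bivector `β^{ij}` and a dilaton `φ` (or of variations of these). -/
structure SymplecticTriple (n : ℕ) where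
  g : Coord n → Matrix (Fin n) (Fin n) ℝ
  β : Coord n → Matrix (Fin n) (Fin n) ℝ
  φ : Coord n → ℝ

/-- Component functions, in one coordinate system, of a metric `G_{ij}` on the tangent bundle,
a two-form `B_{ij}` and a dilaton `φ`. -/
structure StringTriple (n : ℕ) where
  G : Coord n → Matrix (Fin n) (Fin n) ℝ
  B : Coord n → Matrix (Fin n) (Fin n) ℝ
  φ : Coord n → ℝ

namespace SymplecticTriple

variable {n : ℕ} (F : SymplecticTriple n)

/-- `ĝ_{ij}`, the inverse of `ĝ^{ij}`. -/
def gInv (y : Coord n) : Matrix (Fin n) (Fin n) ℝ := (F.g y)⁻¹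

/-- `β_{ij}`, the components of the inverse `β⁻¹`. -/
def βInv (y : Coord n) : Matrix (Fin n) (Fin n) ℝ := (F.β y)⁻¹

/-- `D^a f = β^{am} ∂_m f`. -/
def D (a : Fin n) (f : Coord n → ℝ) (y : Coord n) : ℝ :=
  ∑ m, F.β y a m * pd m f y

/-- `Q_k^{ij} = ∂_k β^{ij}`. -/
def Q (k i j : Fin n) (y : Coord n) : ℝ := pd k (fun z => F.β z i j) y

/-- The flux `Θ^{ijk} = β^{im}∂_m β^{jk} + β^{jm}∂_m β^{ki} + β^{km}∂_m β^{ij}`, the components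
of the trivector `½ [β, β]_SN`. -/
def Θ (i j k : Fin n) (y : Coord n) : ℝ :=
  F.D i (fun z => F.β z j k) y + F.D j (fun z => F.β z k i) y + F.D k (fun z => F.β z i j) y

/-- Structure functions `𝒬_k^{ij} = Q_k^{ij} + Θ^{ijn} β_{nk}` of the `H`-twisted Koszul–Schouten
bracket: `[dx^i, dx^j] = 𝒬_k^{ij} dx^k`. -/
def twistedQ (k i j : Fin n) (y : Coord n) : ℝ :=
  F.Q k i j y + ∑ m, F.Θ i j m y * F.βInv y m k

/-- Coefficients `Γ̂_c^{ab}` of the Levi-Civita connection of `ĝ` (torsion-free and metric) for the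
Lie algebroid of the `H`-twisted Koszul–Schouten bracket with anchor `β^♯`;
`∇̂_{dx^a} dx^b = Γ̂_c^{ab} dx^c`. -/
def Γ (c a b : Fin n) (y : Coord n) : ℝ :=
  (1 / 2) * ∑ m, F.gInv y c m *
      (F.D a (fun z => F.g z b m) y + F.D b (fun z => F.g z a m) y - F.D m (fun z => F.g z a b) y)
    - (1 / 2) * ∑ m, ∑ k, F.gInv y c m *
        (F.g y a k * F.twistedQ k b m y + F.g y b k * F.twistedQ k a m y)
    + (1 / 2) * F.twistedQ c a b y

/-- The Riemann tensor `R̂_a^{bcd}`, the `a`-component of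
`([∇̂_{dx^c}, ∇̂_{dx^d}] - ∇̂_{[dx^c, dx^d]}) dx^b`. -/
def Riem (a b c d : Fin n) (y : Coord n) : ℝ :=
  F.D c (F.Γ a d b) y - F.D d (F.Γ a c b) y
    + ∑ m, (F.Γ a c m y * F.Γ m d b y - F.Γ a d m y * F.Γ m c b y)
    - ∑ m, F.Γ a m b y * F.twistedQ m c d y

/-- The Ricci tensor `R̂^{ab} = R̂_m^{amb}`. -/
def Ric (a b : Fin n) (y : Coord n) : ℝ := ∑ m, F.Riem m a m b y

/-- The Ricci scalar `R̂ = ĝ_{ab} R̂^{ab}`. -/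
def scalarCurv (y : Coord n) : ℝ := ∑ a, ∑ b, F.gInv y a b * F.Ric a b y

/-- `Θ_{abc}`, indices lowered with `ĝ_{ab}`. -/
def ΘLow (a b c : Fin n) (y : Coord n) : ℝ :=
  ∑ i, ∑ j, ∑ k, F.gInv y a i * F.gInv y b j * F.gInv y c k * F.Θ i j k y

/-- `Θ^{abc} Θ_{abc}`. -/
def ΘSq (y : Coord n) : ℝ := ∑ a, ∑ b, ∑ c, F.Θ a b c y * F.ΘLow a b c y

/-- `Θ^{amn} Θ^b_{mn}`. -/
def ΘSqTensor (a b : Fin n) (y : Coord n) : ℝ :=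
  ∑ m, ∑ k, ∑ p, ∑ q, F.Θ a m k y * F.Θ b p q y * F.gInv y m p * F.gInv y k q

/-- `ĝ_{ab} D^a φ D^b φ`. -/
def kinetic (y : Coord n) : ℝ :=
  ∑ a, ∑ b, F.gInv y a b * F.D a F.φ y * F.D b F.φ y

/-- `∇̂^a ∇̂^b φ = D^a D^b φ - Γ̂_m^{ab} D^m φ`. -/
def hess (a b : Fin n) (y : Coord n) : ℝ :=
  F.D a (F.D b F.φ) y - ∑ m, F.Γ m a b y * F.D m F.φ y

/-- The covariant derivative `∇̂^d Θ_{abc}`. -/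
def covΘ (d a b c : Fin n) (y : Coord n) : ℝ :=
  F.D d (F.ΘLow a b c) y
    + ∑ k, (F.Γ a d k y * F.ΘLow k b c y + F.Γ b d k y * F.ΘLow a k c y
        + F.Γ c d k y * F.ΘLow a b k y)

/-- The integrand
`√|ĝ| |β⁻¹| e^{-2φ} (R̂ - (1/12) Θ^{abc} Θ_{abc} + 4 ĝ_{ab} D^aφ D^bφ)`. -/
def density (y : Coord n) : ℝ :=
  Real.sqrt |(F.g y).det| * (F.βInv y).det * Real.exp (-2 * F.φ y) *
    (F.scalarCurv y - (1 / 12) * F.ΘSq y + 4 * F.kinetic y)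

/-- The equations of motion of symplectic gravity at the point `y`. -/
def EquationsOfMotionAt (y : Coord n) : Prop :=
  (-(1 / 2) * (∑ a, ∑ b, F.gInv y a b * F.hess a b y) + F.kinetic y
      - (1 / 24) * F.ΘSq y = 0) ∧
  (∀ a b, F.Ric a b y + 2 * F.hess a b y - (1 / 4) * F.ΘSqTensor a b y = 0) ∧
  (∀ a b, (1 / 2) * (∑ m, F.covΘ m m a b y) - ∑ m, F.D m F.φ y * F.ΘLow m a b y = 0)

/-- The varied fields `F + t V`. -/
def shift (t : ℝ) (V : SymplecticTriple n) : SymplecticTriple n where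
  g y := F.g y + t • V.g y
  β y := F.β y + t • V.β y
  φ y := F.φ y + t * V.φ y

/-- The infinitesimal diffeomorphism along a vector field `X`: all fields vary by their
Lie derivatives. -/
def diffeoVariation (X : Coord n → Coord n) : SymplecticTriple n where
  g y := Matrix.of fun i j => ∑ m, (X y m * pd m (fun z => F.g z i j) y
    - F.g y m j * pd m (fun z => X z i) y - F.g y i m * pd m (fun z => X z j) y)
  β y := Matrix.of fun i j => ∑ m, (X y m * pd m (fun z => F.β z i j) y
    - F.β y m j * pd m (fun z => X z i) y - F.β y i m * pd m (fun z => X z j) y)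
  φ y := ∑ m, X y m * pd m F.φ y

/-- The infinitesimal `β`-diffeomorphism along a one-form `ξ`: `ĝ` and `φ` vary by the quasi-Lie
derivative, `δ̂_ξ ĝ^{ij} = ξ_m D^m ĝ^{ij} + ĝ^{mj}(D^i ξ_m + ξ_k Q_m^{ik})
+ ĝ^{im}(D^j ξ_m + ξ_k Q_m^{jk})` and `δ̂_ξ φ = ξ_m D^m φ`, and `δ̂_ξ β^{ij} = ξ_m Θ^{mij}`. -/
def betaVariation (ξ : Coord n → Coord n) : SymplecticTriple n where
  g y := Matrix.of fun i j =>
    (∑ m, ξ y m * F.D m (fun z => F.g z i j) y)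
    + (∑ m, F.g y m j * (F.D i (fun z => ξ z m) y + ∑ k, ξ y k * F.Q m i k y))
    + ∑ m, F.g y i m * (F.D j (fun z => ξ z m) y + ∑ k, ξ y k * F.Q m j k y)
  β y := Matrix.of fun i j => ∑ m, ξ y m * F.Θ m i j y
  φ y := ∑ m, ξ y m * F.D m F.φ y

/-- The field redefinition `B = β⁻¹`, `G = -β⁻¹ ĝ β⁻¹`, i.e. `G_{ij} = β_{im} β_{jn} ĝ^{mn}`. -/
def toStringTriple : StringTriple n where
  G y := -(F.βInv y * F.g y * F.βInv y)
  B y := F.βInv y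
  φ := F.φ

end SymplecticTriple

namespace StringTriple

variable {n : ℕ} (T : StringTriple n)

/-- `G^{ij}`. -/
def GInv (y : Coord n) : Matrix (Fin n) (Fin n) ℝ := (T.G y)⁻¹

/-- `H = dB`: `H_{abc} = ∂_a B_{bc} + ∂_b B_{ca} + ∂_c B_{ab}`. -/
def H (a b c : Fin n) (y : Coord n) : ℝ :=
  pd a (fun z => T.B z b c) y + pd b (fun z => T.B z c a) y + pd c (fun z => T.B z a b) y

/-- Christoffel symbols `Γ^i_{jk}` of `G`. -/
def Γ (i j k : Fin n) (y : Coord n) : ℝ :=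
  (1 / 2) * ∑ m, T.GInv y i m *
    (pd j (fun z => T.G z k m) y + pd k (fun z => T.G z j m) y - pd m (fun z => T.G z j k) y)

/-- Riemann tensor `R^d_{cab} = ∂_a Γ^d_{bc} - ∂_b Γ^d_{ac} + Γ^d_{ae} Γ^e_{bc} - Γ^d_{be} Γ^e_{ac}`. -/
def Riem (d c a b : Fin n) (y : Coord n) : ℝ :=
  pd a (T.Γ d b c) y - pd b (T.Γ d a c) y
    + ∑ e, (T.Γ d a e y * T.Γ e b c y - T.Γ d b e y * T.Γ e a c y)

/-- Ricci tensor `R_{cb} = R^a_{cab}`. -/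
def Ric (c b : Fin n) (y : Coord n) : ℝ := ∑ a, T.Riem a c a b y

/-- Ricci scalar `R = G^{ab} R_{ab}`. -/
def scalarCurv (y : Coord n) : ℝ := ∑ a, ∑ b, T.GInv y a b * T.Ric a b y

/-- `H_{abc} H^{abc}`. -/
def HSq (y : Coord n) : ℝ :=
  ∑ a, ∑ b, ∑ c, ∑ i, ∑ j, ∑ k,
    T.GInv y a i * T.GInv y b j * T.GInv y c k * T.H a b c y * T.H i j k y

/-- `G^{ab} ∂_a φ ∂_b φ`. -/
def kinetic (y : Coord n) : ℝ := ∑ a, ∑ b, T.GInv y a b * pd a T.φ y * pd b T.φ y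

/-- The integrand `√|G| e^{-2φ} (R - (1/12) H_{abc} H^{abc} + 4 G^{ab} ∂_aφ ∂_bφ)`. -/
def density (y : Coord n) : ℝ :=
  Real.sqrt |(T.G y).det| * Real.exp (-2 * T.φ y) *
    (T.scalarCurv y - (1 / 12) * T.HSq y + 4 * T.kinetic y)

/-- The field redefinition `β = B⁻¹`, `ĝ = -β G β`, i.e. `ĝ^{ij} = β^{im} β^{jn} G_{mn}`. -/
def toSymplecticTriple : SymplecticTriple n where
  g y := -((T.B y)⁻¹ * T.G y * (T.B y)⁻¹)
  β y := (T.B y)⁻¹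
  φ := T.φ

end StringTriple

/-! ## Fields on a manifold, given by their components in all charts -/

section Global

variable {n : ℕ} {M N : Type*}
  [TopologicalSpace M] [ChartedSpace (Coord n) M]
  [TopologicalSpace N] [ChartedSpace (Coord n) N]

/-- An assignment of data of type `α` to coordinate charts of `M`. Only the values at charts of the
smooth maximal atlas matter. -/
abbrev ChartFamily (n : ℕ) (M : Type*) [TopologicalSpace M] (α : Type*) : Type _ :=
  OpenPartialHomeomorph M (Coord n) → α

/-- The charts of the smooth structure of `M`. -/
abbrev smoothCharts (n : ℕ) (M : Type*) [TopologicalSpace M] [ChartedSpace (Coord n) M] :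
    Set (OpenPartialHomeomorph M (Coord n)) :=
  IsManifold.maximalAtlas 𝓘(ℝ, Coord n) ∞ M

/-- The Jacobian matrix `∂τ^k/∂y^i` (row `k`, column `i`). -/
def jac (τ : Coord n → Coord n) (y : Coord n) : Matrix (Fin n) (Fin n) ℝ :=
  LinearMap.toMatrix' (fderiv ℝ τ y : Coord n →ₗ[ℝ] Coord n)

/-- `law J a a' y y'` holds between the components in `e` at `y` and those in `e'` at `y'`,
whenever `ψ` maps the point with coordinates `y` to the point with coordinates `y'`; here `J` is the
Jacobian matrix at `y` of `ψ` expressed in the charts `e` and `e'`. -/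
def RelatedUnder {α : Type*}
    (law : Matrix (Fin n) (Fin n) ℝ → α → α → Coord n → Coord n → Prop)
    (ψ : M → N) (F : ChartFamily n M α) (F' : ChartFamily n N α) : Prop :=
  ∀ e ∈ smoothCharts n M, ∀ e' ∈ smoothCharts n N, ∀ y ∈ e.target, ψ (e.symm y) ∈ e'.source →
    law (jac (fun z => e' (ψ (e.symm z))) y) (F e) (F' e') y (e' (ψ (e.symm y)))

/-- `ĝ^{ij}` and `β^{ij}` transform as contravariant tensors, `φ` as a scalar. -/
def symplecticLaw (J : Matrix (Fin n) (Fin n) ℝ) (F F' : SymplecticTriple n) (y y' : Coord n) :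
    Prop :=
  F'.g y' = J * F.g y * J.transpose ∧ F'.β y' = J * F.β y * J.transpose ∧ F'.φ y' = F.φ y

/-- `G_{ij}` and `B_{ij}` transform as covariant tensors, `φ` as a scalar. -/
def stringLaw (J : Matrix (Fin n) (Fin n) ℝ) (T T' : StringTriple n) (y y' : Coord n) : Prop :=
  T.G y = J.transpose * T'.G y' * J ∧ T.B y = J.transpose * T'.B y' * J ∧ T'.φ y' = T.φ y

def vectorLaw (J : Matrix (Fin n) (Fin n) ℝ) (X X' : Coord n → Coord n) (y y' : Coord n) : Prop :=
  X' y' = J.mulVec (X y)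

def oneFormLaw (J : Matrix (Fin n) (Fin n) ℝ) (ξ ξ' : Coord n → Coord n) (y y' : Coord n) : Prop :=
  ξ y = J.transpose.mulVec (ξ' y')

/-- A smooth variation of `(ĝ, β, φ)`: a symmetric contravariant two-tensor, a bivector and a
function on `M`. -/
structure IsVariation (V : ChartFamily n M (SymplecticTriple n)) : Prop where
  smooth_g : ∀ e ∈ smoothCharts n M, ∀ i j, ContDiffOn ℝ ∞ (fun y => (V e).g y i j) e.target
  smooth_β : ∀ e ∈ smoothCharts n M, ∀ i j, ContDiffOn ℝ ∞ (fun y => (V e).β y i j) e.target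
  smooth_φ : ∀ e ∈ smoothCharts n M, ContDiffOn ℝ ∞ (V e).φ e.target
  symm_g : ∀ e ∈ smoothCharts n M, ∀ y ∈ e.target, ((V e).g y).transpose = (V e).g y
  skew_β : ∀ e ∈ smoothCharts n M, ∀ y ∈ e.target, ((V e).β y).transpose = -(V e).β y
  tensorial : RelatedUnder symplecticLaw (id : M → M) V V

/-- A smooth field configuration of symplectic gravity on `M`: a (pseudo-Riemannian) metric `ĝ` on
the cotangent bundle, a nondegenerate bivector `β` and a dilaton `φ`. -/
structure IsSymplecticConfig (F : ChartFamily n M (SymplecticTriple n)) : Prop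
    extends IsVariation F where
  nondeg_g : ∀ e ∈ smoothCharts n M, ∀ y ∈ e.target, IsUnit ((F e).g y).det
  nondeg_β : ∀ e ∈ smoothCharts n M, ∀ y ∈ e.target, IsUnit ((F e).β y).det

/-- A smooth field configuration of the bosonic string: a (pseudo-Riemannian) metric `G` on the
tangent bundle, a two-form `B` and a dilaton `φ`. -/
structure IsStringConfig (T : ChartFamily n M (StringTriple n)) : Prop where
  smooth_G : ∀ e ∈ smoothCharts n M, ∀ i j, ContDiffOn ℝ ∞ (fun y => (T e).G y i j) e.target
  smooth_B : ∀ e ∈ smoothCharts n M, ∀ i j, ContDiffOn ℝ ∞ (fun y => (T e).B y i j) e.target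
  smooth_φ : ∀ e ∈ smoothCharts n M, ContDiffOn ℝ ∞ (T e).φ e.target
  symm_G : ∀ e ∈ smoothCharts n M, ∀ y ∈ e.target, ((T e).G y).transpose = (T e).G y
  skew_B : ∀ e ∈ smoothCharts n M, ∀ y ∈ e.target, ((T e).B y).transpose = -(T e).B y
  nondeg_G : ∀ e ∈ smoothCharts n M, ∀ y ∈ e.target, IsUnit ((T e).G y).det
  tensorial : RelatedUnder stringLaw (id : M → M) T T

/-- A smooth vector field on `M`. -/
structure IsVectorField (X : ChartFamily n M (Coord n → Coord n)) : Prop where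
  smooth : ∀ e ∈ smoothCharts n M, ContDiffOn ℝ ∞ (X e) e.target
  tensorial : RelatedUnder vectorLaw (id : M → M) X X

/-- A smooth one-form on `M`. -/
structure IsOneForm (ξ : ChartFamily n M (Coord n → Coord n)) : Prop where
  smooth : ∀ e ∈ smoothCharts n M, ContDiffOn ℝ ∞ (ξ e) e.target
  tensorial : RelatedUnder oneFormLaw (id : M → M) ξ ξ

/-- The family vanishes outside `K` (all components are `0` at every point outside `K`). -/
def VanishesOutside (K : Set M) (X : ChartFamily n M (Coord n → Coord n)) : Prop :=
  ∀ e ∈ smoothCharts n M, ∀ y ∈ e.target, e.symm y ∉ K → X e y = 0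

/-- The variation vanishes outside `K`. -/
def VariationVanishesOutside (K : Set M) (V : ChartFamily n M (SymplecticTriple n)) : Prop :=
  ∀ e ∈ smoothCharts n M, ∀ y ∈ e.target, e.symm y ∉ K →
    (V e).g y = 0 ∧ (V e).β y = 0 ∧ (V e).φ y = 0

/-- A finite list of pairs `(e, C)` of a chart and a compact subset of its domain. It describes the
compact region `⋃ C` of `M` (every compact subset of `M` arises in this way). -/
abbrev Patches (n : ℕ) (M : Type*) [TopologicalSpace M] : Type _ :=
  List (OpenPartialHomeomorph M (Coord n) × Set M)

def ValidPatches (P : Patches n M) : Prop :=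
  ∀ p ∈ P, p.1 ∈ smoothCharts n M ∧ IsCompact p.2 ∧ p.2 ⊆ p.1.source

/-- The region covered by the patches. -/
def region (P : Patches n M) : Set M := {x | ∃ p ∈ P, x ∈ p.2}

/-- The integral of a density (given in every chart by a function) over the part of the region of
the patches that lies in `A`: the region is cut into the disjoint pieces `C₁`, `C₂ \ C₁`,
`C₃ \ (C₁ ∪ C₂)`, …, and each piece is integrated in the coordinates of its chart. -/
def patchIntegral (ρ : ChartFamily n M (Coord n → ℝ)) : Patches n M → Set M → ℝ
  | [], _ => 0
  | (e, C) :: P, A => (∫ y in e '' (A ∩ C), ρ e y) + patchIntegral ρ P (A \ C)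

/-- The symplectic gravity action over the region of `P`. -/
def symplecticAction (κ : ℝ) (F : ChartFamily n M (SymplecticTriple n)) (P : Patches n M) : ℝ :=
  1 / (2 * κ ^ 2) * patchIntegral (fun e => (F e).density) P Set.univ

/-- The low energy effective action of the bosonic string over the region of `P`. -/
def stringAction (κ : ℝ) (T : ChartFamily n M (StringTriple n)) (P : Patches n M) : ℝ :=
  1 / (2 * κ ^ 2) * patchIntegral (fun e => (T e).density) P Set.univ

/-- The action is stationary at `F`: its first variation vanishes for every smooth
compactly supported variation of `(ĝ, β, φ)`. -/
def IsStationary (κ : ℝ) (F : ChartFamily n M (SymplecticTriple n)) : Prop :=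
  ∀ V : ChartFamily n M (SymplecticTriple n), IsVariation V →
    ∀ P : Patches n M, ValidPatches P → VariationVanishesOutside (region P) V →
      HasDerivAt (fun t : ℝ => symplecticAction κ (fun e => (F e).shift t (V e)) P) 0 0

end Global

end SymplecticGravity

end

/-!
Put `B = β⁻¹` and `G = -β⁻¹ ĝ β⁻¹`. At each point the vectors `E^a = β^{am} ∂_m` form a frame of the
tangent space. In this frame `G` has the components `ĝ^{ab}`, the three-form `H = dB` has the
components `Θ^{abc}` (`IsConfigOn.Θ_eq`), and the Lie brackets are
`[E^a, E^b] = 𝒬_k{}^{ab} E^k`. So the formula for `Γ̂` is the Koszul formula: `Γ̂` is the Levi-Civita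
connection of `G` written in a non-holonomic frame (`IsConfigOn.isLeviCivitaFrame`), and `R̂`, `∇̂∇̂φ`
and `∇̂Θ` are the frame components of the curvature of `G`, of `∇∇φ` and of `∇H`. A nondegenerate
skew matrix has positive determinant, hence `√|det ĝ| det β⁻¹ = √|det G|`, and the two Lagrangians
agree (`IsConfigOn.density_eq`), as do the two systems of field equations
(`IsConfigOn.equationsOfMotion_iff`). Everything else is proved for the string Lagrangian and carried
over.

*Diffeomorphisms.* The inverse Jacobian of a change of coordinates is again a frame, with vanishing
brackets. The same frame calculus therefore shows that the curvature is a tensor and that the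
Lagrangian is a density (`IsLocalCoordChange.string_density_eq`). The change of variables formula then
makes its integral independent of the charts and invariant under diffeomorphisms
(`patchIntegral_univ_eq`).

*First variation.* With Palatini's formula (`StringVar.div_palatini`) the derivative of the Lagrangian
along a family of fields is the Euler–Lagrange pairing with the velocity plus the divergence of a
current (`StringVar.varDensity_eq`). Both depend on the velocity only, so the derivative along
`F + t V` may be computed along any other family with the same velocity.

*Infinitesimal symmetries.* To first order a diffeomorphism is `z ↦ z + t X(z)`; pulling back along it
and adding an exact form to `B` multiplies the Lagrangian by a Jacobian determinant, whose derivative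
gives `∂_m (X^m ℒ)` (`IsStringConfigOn.elPairing_lieGauge`). A `β`-diffeomorphism along `ξ` is the
Lie derivative along the vector field `ξ_k β^{km}` together with `δB = -dξ` at fixed `G`
(`IsConfigOn.stringVelocity_eq`). Both symmetries are thus cases of
`IsConfigOn.firstVariation_lieGauge`. The vector field or one-form is cut into pieces supported in
single charts by a partition of unity, and the divergence theorem for compactly supported fields
(`setIntegral_div_eq_zero`) gives invariance of the action.

*Field equations.* If the Euler–Lagrange expressions vanish, the first variation of every compactly
supported variation is a sum of divergences supported in charts. Conversely stationarity passes to
coordinate domains, since variations with compact support in a chart extend by zero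
(`extendVariation`). There, variations whose pairing with the field equations is nonnegative are
multiplied by a bump function, which forces the pairing to vanish
(`IsConfigOn.elPairing_eq_zero_of_nonneg`); variations proportional to the equations themselves then
give the equations (`IsConfigOn.equationsOfMotion_of_isStationaryOn`).
-/

noncomputable section
namespace SymplecticGravity

/-! ### Calculus of partial derivatives -/

section Calculus

/-- `f` is smooth at every point of `U`. -/
def Sm {E : Type*} [NormedAddCommGroup E] [NormedSpace ℝ E] (U : Set E) (f : E → ℝ) : Prop :=
  ∀ y ∈ U, ContDiffAt ℝ ∞ f y

/-- All entries of the matrix-valued function `M` are smooth at every point of `U`. -/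
def SmM {E : Type*} [NormedAddCommGroup E] [NormedSpace ℝ E] {n : ℕ} (U : Set E)
    (M : E → Matrix (Fin n) (Fin n) ℝ) : Prop :=
  ∀ a b, Sm U (fun z => M z a b)

variable {E : Type*} [NormedAddCommGroup E] [NormedSpace ℝ E] {n : ℕ} {U : Set E}
  {f g : E → ℝ} {M N : E → Matrix (Fin n) (Fin n) ℝ}

theorem Sm.differentiableAt (hf : Sm U f) {y : E} (hy : y ∈ U) : DifferentiableAt ℝ f y :=
  (hf y hy).differentiableAt (by simp)

theorem Sm.mono {V : Set E} (hf : Sm U f) (h : V ⊆ U) : Sm V f := fun y hy => hf y (h hy)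

theorem SmM.mono {V : Set E} (hf : SmM U M) (h : V ⊆ U) : SmM V M := fun a b => (hf a b).mono h

theorem Sm.const (c : ℝ) : Sm U (fun _ => c) := fun _ _ => contDiffAt_const

theorem Sm.add (hf : Sm U f) (hg : Sm U g) : Sm U (fun z => f z + g z) :=
  fun y hy => (hf y hy).add (hg y hy)

theorem Sm.sub (hf : Sm U f) (hg : Sm U g) : Sm U (fun z => f z - g z) :=
  fun y hy => (hf y hy).sub (hg y hy)

theorem Sm.neg (hf : Sm U f) : Sm U (fun z => -f z) := fun y hy => (hf y hy).neg

theorem Sm.mul (hf : Sm U f) (hg : Sm U g) : Sm U (fun z => f z * g z) :=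
  fun y hy => (hf y hy).mul (hg y hy)

theorem Sm.sum {ι : Type*} {s : Finset ι} {F : ι → E → ℝ} (h : ∀ i, Sm U (F i)) :
    Sm U (fun z => ∑ i ∈ s, F i z) :=
  fun y hy => ContDiffAt.sum fun i _ => h i y hy

theorem Sm.exp (hf : Sm U f) : Sm U (fun z => Real.exp (f z)) := fun y hy => (hf y hy).exp

theorem Sm.congr (hU : IsOpen U) (hf : Sm U f) (h : ∀ z ∈ U, g z = f z) : Sm U g :=
  fun y hy => (hf y hy).congr_of_eventuallyEq
    (Filter.eventuallyEq_of_mem (hU.mem_nhds hy) h)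

theorem Sm.contDiffOn (hf : Sm U f) : ContDiffOn ℝ ∞ f U := fun y hy => (hf y hy).contDiffWithinAt

theorem Sm.of_contDiffOn (hU : IsOpen U) (hf : ContDiffOn ℝ ∞ f U) : Sm U f :=
  fun _ hy => hf.contDiffAt (hU.mem_nhds hy)

theorem Sm.continuousOn (hf : Sm U f) : ContinuousOn f U := hf.contDiffOn.continuousOn

theorem SmM.add (hM : SmM U M) (hN : SmM U N) : SmM U (fun z => M z + N z) :=
  fun a b => (hM a b).add (hN a b)

theorem SmM.neg (hM : SmM U M) : SmM U (fun z => -M z) := fun a b => (hM a b).neg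

theorem SmM.mul (hM : SmM U M) (hN : SmM U N) : SmM U (fun z => M z * N z) := by
  intro a b
  simp only [Matrix.mul_apply]
  exact Sm.sum fun m => (hM a m).mul (hN m b)

theorem SmM.transpose (hM : SmM U M) : SmM U (fun z => (M z).transpose) := fun a b => hM b a

theorem SmM.det (hM : SmM U M) : Sm U (fun z => (M z).det) := by
  intro y hy
  simp only [Matrix.det_apply]
  refine ContDiffAt.sum fun σ _ => ?_
  exact (contDiffAt_prod fun i _ => hM _ _ y hy).const_smul _

theorem SmM.inv (hM : SmM U M) (hu : ∀ y ∈ U, IsUnit (M y).det) : SmM U (fun z => (M z)⁻¹) := by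
  intro a b y hy
  simp only [Matrix.inv_def, Ring.inverse_eq_inv', Matrix.smul_apply, smul_eq_mul,
    Matrix.adjugate_apply]
  refine ((hM.det y hy).inv (hu y hy).ne_zero).mul ?_
  have : SmM U (fun z => (M z).updateRow b (Pi.single a 1)) := by
    intro i j
    by_cases h : i = b
    · subst h
      simpa using Sm.const _
    · simpa [Matrix.updateRow_ne h] using hM i j
  exact this.det y hy

theorem hasDerivAt_sqrt_abs {x : ℝ} (hx : x ≠ 0) :
    HasDerivAt (fun x : ℝ => Real.sqrt |x|) (Real.sqrt |x| / (2 * x)) x := by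
  rcases lt_or_gt_of_ne hx with h | h
  · have h1 := (hasDerivAt_neg x).sqrt (by simpa using hx)
    refine (h1.congr_of_eventuallyEq ?_).congr_deriv ?_
    · filter_upwards [gt_mem_nhds h] with z hz
      rw [abs_of_neg hz]
    · rw [abs_of_neg h]
      have h2 : 0 < Real.sqrt (-x) := Real.sqrt_pos.2 (by linarith)
      have h3 : Real.sqrt (-x) * Real.sqrt (-x) = -x := Real.mul_self_sqrt (by linarith)
      field_simp
      nlinarith
  · have h1 := (hasDerivAt_id x).sqrt (by simpa using hx)
    refine (h1.congr_of_eventuallyEq ?_).congr_deriv ?_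
    · filter_upwards [lt_mem_nhds h] with z hz
      rw [abs_of_pos hz, id]
    · rw [abs_of_pos h]
      have h2 : 0 < Real.sqrt x := Real.sqrt_pos.2 h
      have h3 : Real.sqrt x * Real.sqrt x = x := Real.mul_self_sqrt h.le
      simp only [id]
      field_simp
      nlinarith

theorem SmM.sqrt_abs_det (hM : SmM U M) (hu : ∀ y ∈ U, IsUnit (M y).det) :
    Sm U (fun z => Real.sqrt |(M z).det|) := by
  intro y hy
  have h0 := (hu y hy).ne_zero
  have h1 : ContDiffAt ℝ ∞ (fun z => |(M z).det|) y := 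
    (contDiffAt_abs h0).comp (f := fun z => (M z).det) y (hM.det y hy)
  exact h1.sqrt (abs_ne_zero.2 h0)

/-- Jacobi's formula along a curve of matrices. -/
theorem hasDerivAt_det {c : ℝ → Matrix (Fin n) (Fin n) ℝ} {H : Matrix (Fin n) (Fin n) ℝ} {s : ℝ}
    (hc : ∀ a b, HasDerivAt (fun t => c t a b) (H a b) s) (hu : IsUnit (c s).det) :
    HasDerivAt (fun t => (c t).det) ((c s).det * ((c s)⁻¹ * H).trace) s := by
  let d : (Fin n → Fin n → ℝ) → ℝ := fun m => Matrix.det (Matrix.of m)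
  have hd : DifferentiableAt ℝ d (c s) := by
    have : SmM (Set.univ : Set (Fin n → Fin n → ℝ)) (fun m => Matrix.of m) := by
      intro a b y _
      simp only [Matrix.of_apply]
      fun_prop
    exact this.det.differentiableAt (Set.mem_univ _)
  have h1 : ∀ (γ : ℝ → Fin n → Fin n → ℝ) (r : ℝ), γ r = c s → HasDerivAt γ H r →
      HasDerivAt (fun t => d (γ t)) (fderiv ℝ d (c s) H) r := by
    intro γ r hr hγ
    have h2 : HasFDerivAt d (fderiv ℝ d (c s)) (γ r) := by rw [hr]; exact hd.hasFDerivAt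
    exact h2.comp_hasDerivAt r hγ
  have h3 := h1 c s rfl (hasDerivAt_pi.2 fun a => hasDerivAt_pi.2 fun b => hc a b)
  have h4 := h1 (fun t => c s + t • H) 0 (by funext a b; simp) (by
    refine hasDerivAt_pi.2 fun a => hasDerivAt_pi.2 fun b => ?_
    simpa using ((hasDerivAt_id (0 : ℝ)).mul_const (H a b)).const_add (c s a b))
  have h5 : ∀ t : ℝ, d (c s + t • H) = (c s).det * (1 + t • ((c s)⁻¹ * H)).det := by
    intro t
    rw [← Matrix.det_mul, mul_add, mul_one, Matrix.mul_smul, Matrix.mul_nonsing_inv_cancel_left _ _ hu]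
    rfl
  have h6 : HasDerivAt (fun t : ℝ => (1 + t • ((c s)⁻¹ * H)).det) (((c s)⁻¹ * H).trace) 0 := by
    generalize (c s)⁻¹ * H = K
    have h7 := (((1 : Matrix (Fin n) (Fin n) (Polynomial ℝ))
      + (Polynomial.X : Polynomial ℝ) • K.map Polynomial.C).det).hasDerivAt 0
    rw [Matrix.derivative_det_one_add_X_smul] at h7
    refine h7.congr_of_eventuallyEq (Filter.Eventually.of_forall fun t => ?_)
    have h8 := RingHom.map_det (Polynomial.evalRingHom t) ((1 : Matrix (Fin n) (Fin n) (Polynomial ℝ))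
      + (Polynomial.X : Polynomial ℝ) • K.map Polynomial.C)
    rw [Polynomial.coe_evalRingHom] at h8
    simp only [h8]
    congr 1
    ext i j
    simp [Matrix.one_apply, apply_ite, mul_comm t]
  have h9 : HasDerivAt (fun t : ℝ => d (c s + t • H)) ((c s).det * ((c s)⁻¹ * H).trace) 0 := by
    simp only [h5]
    exact h6.const_mul _
  rw [← h4.unique h9]
  exact h3

end Calculus

section Pd

variable {n : ℕ} {U : Set (Coord n)} {f g : Coord n → ℝ} {y : Coord n} (i : Fin n)

theorem Sm.pd (hf : Sm U f) : Sm U (pd i f) := fun y hy =>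
  ((hf y hy).fderiv_right (m := ∞) (by simp)).clm_apply contDiffAt_const

theorem pd_congr (hU : IsOpen U) (h : ∀ z ∈ U, f z = g z) (hy : y ∈ U) : pd i f y = pd i g y := by
  unfold SymplecticGravity.pd
  rw [Filter.EventuallyEq.fderiv_eq (Filter.eventuallyEq_of_mem (hU.mem_nhds hy) h)]

theorem pd_const (c : ℝ) : pd i (fun _ : Coord n => c) y = 0 := by simp [pd]

theorem pd_add (hf : Sm U f) (hg : Sm U g) (hy : y ∈ U) :
    pd i (fun z => f z + g z) y = pd i f y + pd i g y := by
  simp [pd, fderiv_fun_add (hf.differentiableAt hy) (hg.differentiableAt hy)]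

theorem pd_sub (hf : Sm U f) (hg : Sm U g) (hy : y ∈ U) :
    pd i (fun z => f z - g z) y = pd i f y - pd i g y := by
  simp [pd, fderiv_fun_sub (hf.differentiableAt hy) (hg.differentiableAt hy)]

theorem pd_neg : pd i (fun z => -f z) y = -pd i f y := by
  simp [pd, fderiv_fun_neg]

theorem pd_mul (hf : Sm U f) (hg : Sm U g) (hy : y ∈ U) :
    pd i (fun z => f z * g z) y = pd i f y * g y + f y * pd i g y := by
  simp [pd, fderiv_fun_mul (hf.differentiableAt hy) (hg.differentiableAt hy)]
  ring

theorem pd_const_mul (c : ℝ) (hf : Sm U f) (hy : y ∈ U) :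
    pd i (fun z => c * f z) y = c * pd i f y := by
  rw [pd_mul i (Sm.const c) hf hy, pd_const]; ring

theorem pd_sum {ι : Type*} {s : Finset ι} {F : ι → Coord n → ℝ} (hF : ∀ k, Sm U (F k))
    (hy : y ∈ U) : pd i (fun z => ∑ k ∈ s, F k z) y = ∑ k ∈ s, pd i (F k) y := by
  simp [pd, fderiv_fun_sum (fun k _ => (hF k).differentiableAt hy)]

theorem pd_sum_mul {ι : Type*} {s : Finset ι} {F G : ι → Coord n → ℝ} (hF : ∀ k, Sm U (F k))
    (hG : ∀ k, Sm U (G k)) (hy : y ∈ U) :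
    pd i (fun z => ∑ k ∈ s, F k z * G k z) y
      = ∑ k ∈ s, (pd i (F k) y * G k y + F k y * pd i (G k) y) := by
  rw [pd_sum i (fun k => (hF k).mul (hG k)) hy]
  exact Finset.sum_congr rfl fun k _ => pd_mul i (hF k) (hG k) hy

theorem pd_comm (j : Fin n) (hf : Sm U f) (hy : y ∈ U) : pd i (pd j f) y = pd j (pd i f) y := by
  have hs : IsSymmSndFDerivAt ℝ f y := (hf y hy).isSymmSndFDerivAt (by
    rw [minSmoothness_of_isRCLikeNormedField]; exact WithTop.coe_le_coe.2 le_top)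
  have hd : DifferentiableAt ℝ (fderiv ℝ f) y :=
    ((hf y hy).fderiv_right (m := ∞) (by simp)).differentiableAt (by simp)
  have key : ∀ v w : Coord n, fderiv ℝ (fun z => fderiv ℝ f z v) y w = fderiv ℝ (fderiv ℝ f) y w v := by
    intro v w
    rw [fderiv_clm_apply hd (by fun_prop)]
    simp
  unfold SymplecticGravity.pd
  rw [key, key]
  exact hs.eq _ _

/-- Entrywise partial derivative of a matrix-valued function. -/
def pdM (i : Fin n) (M : Coord n → Matrix (Fin n) (Fin n) ℝ) (y : Coord n) :
    Matrix (Fin n) (Fin n) ℝ :=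
  Matrix.of fun a b => pd i (fun z => M z a b) y

variable {M N : Coord n → Matrix (Fin n) (Fin n) ℝ}

@[simp] theorem pdM_apply (a b : Fin n) : pdM i M y a b = pd i (fun z => M z a b) y := rfl

theorem pdM_congr (hU : IsOpen U) (h : ∀ z ∈ U, M z = N z) (hy : y ∈ U) : pdM i M y = pdM i N y := by
  ext a b
  exact pd_congr i hU (fun z hz => by rw [h z hz]) hy

theorem pdM_mul (hM : SmM U M) (hN : SmM U N) (hy : y ∈ U) :
    pdM i (fun z => M z * N z) y = pdM i M y * N y + M y * pdM i N y := by
  ext a b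
  simp only [pdM_apply, Matrix.mul_apply, Matrix.add_apply]
  rw [pd_sum_mul i (fun k => hM a k) (fun k => hN k b) hy, Finset.sum_add_distrib]

theorem pdM_neg : pdM i (fun z => -M z) y = -pdM i M y := by
  ext a b
  exact pd_neg i

theorem pdM_transpose : pdM i (fun z => (M z).transpose) y = (pdM i M y).transpose := rfl

theorem pdM_const (A : Matrix (Fin n) (Fin n) ℝ) : pdM i (fun _ => A) y = 0 := by
  ext a b
  exact pd_const i _

theorem pdM_inv (hU : IsOpen U) (hM : SmM U M) (hu : ∀ y ∈ U, IsUnit (M y).det) (hy : y ∈ U) :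
    pdM i (fun z => (M z)⁻¹) y = -((M y)⁻¹ * pdM i M y * (M y)⁻¹) := by
  have h1 := pdM_mul i hM (hM.inv hu) hy
  rw [pdM_congr i hU (N := fun _ => 1) (fun z hz => Matrix.mul_nonsing_inv _ (hu z hz)) hy,
    pdM_const] at h1
  have h2 : (M y)⁻¹ * (pdM i M y * (M y)⁻¹ + M y * pdM i (fun z => (M z)⁻¹) y) = 0 := by
    rw [← h1, mul_zero]
  rw [mul_add, Matrix.nonsing_inv_mul_cancel_left _ _ (hu y hy)] at h2
  rw [eq_neg_of_add_eq_zero_right h2, mul_assoc]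

theorem hasDerivAt_line {E : Type*} [NormedAddCommGroup E] [NormedSpace ℝ E] {f : E → ℝ} {p v : E}
    (hf : DifferentiableAt ℝ f p) : HasDerivAt (fun t : ℝ => f (p + t • v)) (fderiv ℝ f p v) 0 := by
  have h1 : HasDerivAt (fun t : ℝ => p + t • v) v 0 := by
    simpa using ((hasDerivAt_id (0 : ℝ)).smul_const v).const_add p
  have h2 : HasFDerivAt f (fderiv ℝ f p) (p + (0 : ℝ) • v) := by simpa using hf.hasFDerivAt
  exact h2.comp_hasDerivAt 0 h1

theorem pd_sqrt_abs_det (hM : SmM U M) (hu : ∀ y ∈ U, IsUnit (M y).det) (hy : y ∈ U) :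
    pd i (fun z => Real.sqrt |(M z).det|) y
      = (1 / 2) * Real.sqrt |(M y).det| * ((M y)⁻¹ * pdM i M y).trace := by
  have h0 := (hu y hy).ne_zero
  have h1 := hasDerivAt_line (v := Pi.single i (1 : ℝ)) ((hM.sqrt_abs_det hu).differentiableAt hy)
  have h2 := hasDerivAt_det (c := fun t : ℝ => M (y + t • Pi.single i (1 : ℝ))) (H := pdM i M y)
    (s := 0) (fun a b => hasDerivAt_line ((hM a b).differentiableAt hy)) (by simpa using hu y hy)
  simp only [zero_smul, add_zero] at h2
  have h3 := HasDerivAt.comp_of_eq (0 : ℝ) (hasDerivAt_sqrt_abs h0) h2 (by simp)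
  have h4 := h1.unique h3
  unfold SymplecticGravity.pd
  rw [h4]
  field_simp

end Pd

/-! ### Riemannian geometry in an arbitrary frame -/

/-- A metric on a set of `ℝⁿ`: smooth, symmetric and nondegenerate. -/
structure IsMetricOn {n : ℕ} (U : Set (Coord n)) (G : Coord n → Matrix (Fin n) (Fin n) ℝ) :
    Prop where
  smooth : SmM U G
  symm : ∀ y ∈ U, (G y).transpose = G y
  unit : ∀ y ∈ U, IsUnit (G y).det

section

variable {n : ℕ} {U : Set (Coord n)} {G : Coord n → Matrix (Fin n) (Fin n) ℝ}

theorem IsMetricOn.mono {V : Set (Coord n)} (h : IsMetricOn U G) (hV : V ⊆ U) : IsMetricOn V G :=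
  ⟨h.smooth.mono hV, fun y hy => h.symm y (hV hy), fun y hy => h.unit y (hV hy)⟩

theorem IsMetricOn.inv_symm (h : IsMetricOn U G) {y : Coord n} (hy : y ∈ U) :
    ((G y)⁻¹).transpose = (G y)⁻¹ := by
  rw [Matrix.transpose_nonsing_inv, h.symm y hy]

theorem IsMetricOn.smooth_inv (h : IsMetricOn U G) : SmM U (fun z => (G z)⁻¹) :=
  h.smooth.inv h.unit

end

/-- The derivative `E_a^m ∂_m f` along the `a`-th vector of the frame `E` (the `a`-th row). -/
def frameD {n : ℕ} (E : Coord n → Matrix (Fin n) (Fin n) ℝ) (a : Fin n) (f : Coord n → ℝ)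
    (y : Coord n) : ℝ :=
  ∑ m, E y a m * pd m f y

/-- Entrywise derivative of a matrix-valued function along a frame vector. -/
def frameDM {n : ℕ} (E : Coord n → Matrix (Fin n) (Fin n) ℝ) (a : Fin n)
    (M : Coord n → Matrix (Fin n) (Fin n) ℝ) (y : Coord n) : Matrix (Fin n) (Fin n) ℝ :=
  Matrix.of fun b k => frameD E a (fun z => M z b k) y

namespace StringTriple

variable {n : ℕ} (T : StringTriple n)

/-- The connection matrix `(Γ_i)_l^k = Γ^k_{il}` in the coordinate direction `i`. -/
def ΓM (i : Fin n) (y : Coord n) : Matrix (Fin n) (Fin n) ℝ := Matrix.of fun l k => T.Γ k i l y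

/-- The curvature matrix `R^k_{lij}`, with row index `l` and column index `k`. -/
def RM (i j : Fin n) (y : Coord n) : Matrix (Fin n) (Fin n) ℝ := Matrix.of fun l k => T.Riem k l i j y

/-- The connection matrix in the direction of the `a`-th frame vector. -/
def ΓE (E : Coord n → Matrix (Fin n) (Fin n) ℝ) (a : Fin n) (y : Coord n) :
    Matrix (Fin n) (Fin n) ℝ :=
  Matrix.of fun b k => ∑ i, E y a i * T.ΓM i y b k

/-- The coordinate Hessian `∇_i ∇_j φ`. -/
def hess (i j : Fin n) (y : Coord n) : ℝ :=
  pd i (pd j T.φ) y - ∑ k, T.Γ k i j y * pd k T.φ y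

variable {T} {U : Set (Coord n)} {y : Coord n}

theorem sm_Γ (hG : IsMetricOn U T.G) (i j k : Fin n) : Sm U (T.Γ i j k) := by
  unfold StringTriple.Γ
  exact (Sm.const _).mul (Sm.sum fun m => (hG.smooth_inv i m).mul
    ((((hG.smooth k m).pd j).add ((hG.smooth j m).pd k)).sub ((hG.smooth j k).pd m)))

theorem smM_ΓM (hG : IsMetricOn U T.G) (i : Fin n) : SmM U (T.ΓM i) := fun l k => sm_Γ hG k i l

theorem pd_G_symm (hU : IsOpen U) (hG : IsMetricOn U T.G) (hy : y ∈ U) (m i j : Fin n) :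
    pd m (fun z => T.G z i j) y = pd m (fun z => T.G z j i) y :=
  pd_congr m hU (fun z hz => congrFun (congrFun (hG.symm z hz) j) i) hy

theorem Γ_symm (hU : IsOpen U) (hG : IsMetricOn U T.G) (hy : y ∈ U) (i j k : Fin n) :
    T.Γ i j k y = T.Γ i k j y := by
  unfold StringTriple.Γ
  congr 1
  refine Finset.sum_congr rfl fun m _ => ?_
  rw [pd_G_symm hU hG hy m j k]
  ring

/-- Lowering the upper index of the Christoffel symbols. -/
theorem sum_Γ_mul_G (hG : IsMetricOn U T.G) (hy : y ∈ U) (i j k : Fin n) :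
    ∑ l, T.Γ l i j y * T.G y l k = (1 / 2) * (pd i (fun z => T.G z j k) y
      + pd j (fun z => T.G z i k) y - pd k (fun z => T.G z i j) y) := by
  unfold StringTriple.Γ
  set X : Fin n → ℝ := fun m => pd i (fun z => T.G z j m) y
      + pd j (fun z => T.G z i m) y - pd m (fun z => T.G z i j) y with hX
  have h1 : ∀ l m, T.GInv y l m = T.GInv y m l := fun l m => by
    unfold GInv
    conv_lhs => rw [← hG.inv_symm hy]
    rfl
  have h2 : T.GInv y * T.G y = 1 := Matrix.nonsing_inv_mul _ (hG.unit y hy)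
  calc ∑ l, (1 / 2 * ∑ m, T.GInv y l m * X m) * T.G y l k
      = ∑ m, (1 / 2) * X m * (T.GInv y * T.G y) m k := by
        simp only [Matrix.mul_apply, Finset.mul_sum, Finset.sum_mul]
        rw [Finset.sum_comm]
        refine Finset.sum_congr rfl fun m _ => Finset.sum_congr rfl fun l _ => ?_
        rw [h1 l m]; ring
    _ = 1 / 2 * X k := by
        rw [h2]
        simp [Matrix.one_apply]

theorem pdM_G (hU : IsOpen U) (hG : IsMetricOn U T.G) (hy : y ∈ U) (i : Fin n) :
    pdM i T.G y = T.ΓM i y * T.G y + T.G y * (T.ΓM i y).transpose := by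
  ext j k
  have hs : ∀ a b, T.G y a b = T.G y b a := fun a b => by
    conv_lhs => rw [← hG.symm y hy]
    rfl
  have h1 := sum_Γ_mul_G hG hy i j k
  have h2 := sum_Γ_mul_G hG hy i k j
  simp only [pdM_apply, Matrix.add_apply, Matrix.mul_apply, Matrix.transpose_apply, ΓM,
    Matrix.of_apply]
  rw [h1, Finset.sum_congr rfl (fun l _ => by rw [hs j l, mul_comm]), h2,
    pd_G_symm hU hG hy i k j]
  ring

theorem RM_eq (i j : Fin n) :
    T.RM i j y = pdM i (T.ΓM j) y - pdM j (T.ΓM i) y + T.ΓM j y * T.ΓM i y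
      - T.ΓM i y * T.ΓM j y := by
  ext l k
  simp only [RM, StringTriple.Riem, Matrix.of_apply, Matrix.add_apply, Matrix.sub_apply, pdM_apply,
    Matrix.mul_apply, Finset.sum_sub_distrib]
  have h1 : ∀ a b, (∑ e, T.Γ k a e y * T.Γ e b l y) = ∑ e, T.ΓM b y l e * T.ΓM a y e k := fun a b =>
    Finset.sum_congr rfl fun e _ => by simp only [ΓM, Matrix.of_apply]; ring
  rw [h1, h1]
  simp only [ΓM, Matrix.of_apply]
  ring

end StringTriple

/-- `γ` is the Levi-Civita connection, in the frame `E` with structure functions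
`[E_a, E_b] = c_m^{ab} E_m`, of the metric `G` of `T`; here `g` is the matrix of that metric in the
frame. -/
structure IsLeviCivitaFrame {n : ℕ} (U : Set (Coord n)) (T : StringTriple n)
    (E g : Coord n → Matrix (Fin n) (Fin n) ℝ) (c γ : Fin n → Fin n → Fin n → Coord n → ℝ) :
    Prop where
  isOpen : IsOpen U
  metric : IsMetricOn U T.G
  smE : SmM U E
  unitE : ∀ y ∈ U, IsUnit (E y).det
  g_eq : ∀ y ∈ U, g y = E y * T.G y * (E y).transpose
  bracket : ∀ y ∈ U, ∀ a b k, frameD E a (fun z => E z b k) y - frameD E b (fun z => E z a k) y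
    = ∑ m, c m a b y * E y m k
  koszul : ∀ y ∈ U, ∀ p a b, γ p a b y =
    (1 / 2) * ∑ m, (g y)⁻¹ p m * (frameD E a (fun z => g z b m) y + frameD E b (fun z => g z a m) y
        - frameD E m (fun z => g z a b) y)
    - (1 / 2) * ∑ m, ∑ k, (g y)⁻¹ p m * (g y a k * c k b m y + g y b k * c k a m y)
    + (1 / 2) * c p a b y

/-- The curvature of the connection `γ` in a frame with structure functions `c`. -/
def frameRiem {n : ℕ} (E : Coord n → Matrix (Fin n) (Fin n) ℝ)
    (c γ : Fin n → Fin n → Fin n → Coord n → ℝ) (a b p q : Fin n) (y : Coord n) : ℝ :=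
  frameD E p (γ a q b) y - frameD E q (γ a p b) y
    + ∑ m, (γ a p m y * γ m q b y - γ a q m y * γ m p b y) - ∑ m, γ a m b y * c m p q y

/-- The matrix of the connection `γ` in the direction of the `a`-th frame vector. -/
def connM {n : ℕ} (γ : Fin n → Fin n → Fin n → Coord n → ℝ) (a : Fin n) (y : Coord n) :
    Matrix (Fin n) (Fin n) ℝ :=
  Matrix.of fun b k => γ k a b y

section FrameD

variable {n : ℕ} {U : Set (Coord n)} {y : Coord n} {E : Coord n → Matrix (Fin n) (Fin n) ℝ}
  {M N : Coord n → Matrix (Fin n) (Fin n) ℝ}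

theorem frameD_congr (hU : IsOpen U) {f g : Coord n → ℝ} (h : ∀ z ∈ U, f z = g z) (hy : y ∈ U)
    (a : Fin n) : frameD E a f y = frameD E a g y :=
  Finset.sum_congr rfl fun m _ => by rw [pd_congr m hU h hy]

theorem frameD_mul {f g : Coord n → ℝ} (hf : Sm U f) (hg : Sm U g) (hy : y ∈ U) (a : Fin n) :
    frameD E a (fun z => f z * g z) y = frameD E a f y * g y + f y * frameD E a g y := by
  simp only [frameD, Finset.mul_sum, Finset.sum_mul, ← Finset.sum_add_distrib]
  refine Finset.sum_congr rfl fun m _ => ?_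
  rw [pd_mul m hf hg hy]
  ring

theorem frameD_sum {ι : Type*} {s : Finset ι} {f : ι → Coord n → ℝ} (hf : ∀ k, Sm U (f k))
    (hy : y ∈ U) (a : Fin n) :
    frameD E a (fun z => ∑ k ∈ s, f k z) y = ∑ k ∈ s, frameD E a (f k) y := by
  simp only [frameD]
  rw [Finset.sum_comm]
  refine Finset.sum_congr rfl fun m _ => ?_
  rw [pd_sum m hf hy, Finset.mul_sum]

theorem frameDM_congr (hU : IsOpen U) (h : ∀ z ∈ U, M z = N z) (hy : y ∈ U) (a : Fin n) :
    frameDM E a M y = frameDM E a N y := by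
  ext i j
  exact frameD_congr hU (fun z hz => by rw [h z hz]) hy a

theorem frameDM_mul (hM : SmM U M) (hN : SmM U N) (hy : y ∈ U) (a : Fin n) :
    frameDM E a (fun z => M z * N z) y = frameDM E a M y * N y + M y * frameDM E a N y := by
  ext i j
  simp only [frameDM, Matrix.of_apply, Matrix.mul_apply, Matrix.add_apply]
  rw [frameD_sum (fun k => (hM i k).mul (hN k j)) hy, ← Finset.sum_add_distrib]
  exact Finset.sum_congr rfl fun k _ => frameD_mul (hM i k) (hN k j) hy a

theorem frameDM_add (hM : SmM U M) (hN : SmM U N) (hy : y ∈ U) (a : Fin n) :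
    frameDM E a (fun z => M z + N z) y = frameDM E a M y + frameDM E a N y := by
  ext i j
  simp only [frameDM, Matrix.of_apply, Matrix.add_apply, frameD, ← Finset.sum_add_distrib]
  refine Finset.sum_congr rfl fun m _ => ?_
  rw [pd_add m (hM i j) (hN i j) hy]
  ring

theorem Sm.frameD {f : Coord n → ℝ} (hE : SmM U E) (hf : Sm U f) (a : Fin n) :
    Sm U (frameD E a f) :=
  Sm.sum fun m => (hE a m).mul (hf.pd m)

theorem SmM.frameDM (hE : SmM U E) (hM : SmM U M) (a : Fin n) : SmM U (frameDM E a M) :=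
  fun i j => (hM i j).frameD hE a

end FrameD

namespace IsLeviCivitaFrame

variable {n : ℕ} {U : Set (Coord n)} {T : StringTriple n} {y : Coord n}
  {E g : Coord n → Matrix (Fin n) (Fin n) ℝ} {c γ : Fin n → Fin n → Fin n → Coord n → ℝ}

/-- The commutator of two frame derivatives, applied to the frame components of a one-form with
values in the functions `f j`. -/
theorem commutator (h : IsLeviCivitaFrame U T E g c γ) (hy : y ∈ U) {f : Fin n → Coord n → ℝ}
    (hf : ∀ j, Sm U (f j)) (p q : Fin n) :
    frameD E p (fun z => ∑ j, E z q j * f j z) y - frameD E q (fun z => ∑ j, E z p j * f j z) y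
      = ∑ m, c m p q y * ∑ j, E y m j * f j y
        + ∑ i, ∑ j, E y p i * E y q j * (pd i (f j) y - pd j (f i) y) := by
  have h1 : ∀ p q, frameD E p (fun z => ∑ j, E z q j * f j z) y
      = ∑ j, frameD E p (fun z => E z q j) y * f j y
        + ∑ i, ∑ j, E y p i * E y q j * pd i (f j) y := by
    intro p q
    rw [frameD_sum (fun j => (h.smE q j).mul (hf j)) hy, Finset.sum_comm, ← Finset.sum_add_distrib]
    refine Finset.sum_congr rfl fun j _ => ?_
    rw [frameD_mul (h.smE q j) (hf j) hy]
    simp only [frameD, Finset.mul_sum]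
    congr 1
    exact Finset.sum_congr rfl fun i _ => by ring
  have h2 : ∑ m, c m p q y * ∑ j, E y m j * f j y
      = ∑ j, frameD E p (fun z => E z q j) y * f j y
        - ∑ j, frameD E q (fun z => E z p j) y * f j y := by
    rw [← Finset.sum_sub_distrib]
    simp only [Finset.mul_sum]
    rw [Finset.sum_comm]
    refine Finset.sum_congr rfl fun j _ => ?_
    rw [← sub_mul, h.bracket y hy, Finset.sum_mul]
    exact Finset.sum_congr rfl fun m _ => by ring
  have h3 : ∑ i, ∑ j, E y p i * E y q j * (pd i (f j) y - pd j (f i) y)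
      = ∑ i, ∑ j, E y p i * E y q j * pd i (f j) y
        - ∑ i, ∑ j, E y q i * E y p j * pd i (f j) y := by
    rw [Finset.sum_comm (f := fun i j => E y q i * E y p j * pd i (f j) y),
      ← Finset.sum_sub_distrib]
    refine Finset.sum_congr rfl fun i _ => ?_
    rw [← Finset.sum_sub_distrib]
    exact Finset.sum_congr rfl fun j _ => by ring
  rw [h1, h1, h2, h3]
  ring

theorem smM_ΓE (h : IsLeviCivitaFrame U T E g c γ) (a : Fin n) : SmM U (T.ΓE E a) := fun b k =>
  show Sm U (fun z => ∑ i, E z a i * T.ΓM i z b k) from Sm.sum fun i => (h.smE a i).mul (StringTriple.smM_ΓM h.metric i b k)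

theorem metricOn_g (h : IsLeviCivitaFrame U T E g c γ) : IsMetricOn U g where
  smooth := fun a b => (((h.smE.mul h.metric.smooth).mul h.smE.transpose) a b).congr h.isOpen
    fun z hz => by rw [h.g_eq z hz]
  symm := fun z hz => by
    simp only [h.g_eq z hz, Matrix.transpose_mul, Matrix.transpose_transpose, h.metric.symm z hz,
      mul_assoc]
  unit := fun z hz => by
    rw [h.g_eq z hz, Matrix.det_mul, Matrix.det_mul, Matrix.det_transpose]
    exact ((h.unitE z hz).mul (h.metric.unit z hz)).mul (h.unitE z hz)

/-- The inverse metric in coordinates, in terms of its frame components. -/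
theorem inv_g (h : IsLeviCivitaFrame U T E g c γ) (hy : y ∈ U) :
    (E y).transpose * (g y)⁻¹ * E y = (T.G y)⁻¹ := by
  have h1 := h.unitE y hy
  have h2 : IsUnit (E y).transpose.det := by rwa [Matrix.det_transpose]
  rw [h.g_eq y hy, Matrix.mul_inv_rev, Matrix.mul_inv_rev,
    Matrix.mul_nonsing_inv_cancel_left _ _ h2, mul_assoc, Matrix.nonsing_inv_mul _ h1, mul_one]

/-- The covariant derivatives `∇_{E_a} E_b`, in coordinates. -/
theorem connM_mul (h : IsLeviCivitaFrame U T E g c γ) (hy : y ∈ U) (a : Fin n) :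
    connM γ a y * E y = frameDM E a E y + E y * T.ΓE E a y := by
  set N : Fin n → Matrix (Fin n) (Fin n) ℝ := fun a => frameDM E a E y + E y * T.ΓE E a y with hN
  set L : Fin n → Matrix (Fin n) (Fin n) ℝ := fun a => N a * T.G y * (E y).transpose with hL
  have hgm := h.metricOn_g
  have hgs : ∀ a b, g y a b = g y b a := fun a b => by
    conv_lhs => rw [← hgm.symm y hy]
    rfl
  -- compatibility with the metric
  have hmet : ∀ a b m, frameD E a (fun z => g z b m) y = L a b m + L a m b := by
    intro a b m
    have h1 : frameDM E a g y = frameDM E a (fun z => E z * T.G z * (E z).transpose) y :=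
      frameDM_congr h.isOpen h.g_eq hy a
    have h2 : frameDM E a T.G y = T.ΓE E a y * T.G y + T.G y * (T.ΓE E a y).transpose := by
      ext b k
      have h3 : ∀ i, pd i (fun z => T.G z b k) y = _ := fun i =>
        congrFun (congrFun (StringTriple.pdM_G h.isOpen h.metric hy i) b) k
      simp only [frameDM, frameD, Matrix.of_apply, h3, Matrix.add_apply, Matrix.mul_apply, mul_add,
        Finset.sum_add_distrib, StringTriple.ΓE, Matrix.transpose_apply, Finset.sum_mul,
        Finset.mul_sum]
      congr 1
      · rw [Finset.sum_comm]
        exact Finset.sum_congr rfl fun i _ => Finset.sum_congr rfl fun j _ => by ring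
      · rw [Finset.sum_comm]
        exact Finset.sum_congr rfl fun i _ => Finset.sum_congr rfl fun j _ => by ring
    have h4 : frameDM E a (fun z => (E z).transpose) y = (frameDM E a E y).transpose := rfl
    rw [frameDM_mul (h.smE.mul h.metric.smooth) h.smE.transpose hy,
      frameDM_mul h.smE h.metric.smooth hy, h2, h4] at h1
    have h5 : frameDM E a g y = L a + (L a).transpose := by
      rw [h1]
      simp only [hL, hN, Matrix.transpose_mul, Matrix.transpose_add, Matrix.transpose_transpose,
        h.metric.symm y hy]
      noncomm_ring
    exact congrFun (congrFun h5 b) m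
  -- vanishing torsion
  have htor : ∀ a b m, L a b m - L b a m = ∑ k, c k a b y * g y k m := by
    intro a b m
    have h1 : ∀ k, N a b k - N b a k = ∑ m, c m a b y * E y m k := by
      intro k
      rw [← h.bracket y hy]
      have h2 : (E y * T.ΓE E a y) b k = (E y * T.ΓE E b y) a k := by
        simp only [Matrix.mul_apply, StringTriple.ΓE, StringTriple.ΓM, Matrix.of_apply,
          Finset.mul_sum]
        rw [Finset.sum_comm]
        refine Finset.sum_congr rfl fun i _ => Finset.sum_congr rfl fun j _ => ?_
        rw [StringTriple.Γ_symm h.isOpen h.metric hy k i j]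
        ring
      simp only [hN, Matrix.add_apply, h2, frameDM, Matrix.of_apply]
      ring
    have h3 : ∀ a b m, L a b m = ∑ k, N a b k * (T.G y * (E y).transpose) k m := fun a b m => by
      simp only [hL, mul_assoc]
      rw [Matrix.mul_apply]
    rw [h3, h3, ← Finset.sum_sub_distrib]
    simp only [← sub_mul, h1, Finset.sum_mul]
    rw [Finset.sum_comm]
    refine Finset.sum_congr rfl fun p _ => ?_
    rw [h.g_eq y hy, mul_assoc (E y), Matrix.mul_apply (M := E y), Finset.mul_sum]
    exact Finset.sum_congr rfl fun k _ => by ring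
  have hkos : connM γ a y = L a * (g y)⁻¹ := by
    ext b p
    rw [connM, Matrix.of_apply, h.koszul y hy]
    have h1 : c p a b y = ∑ m, (g y)⁻¹ p m * ∑ k, c k a b y * g y k m := by
      have h2 : (1 : Matrix (Fin n) (Fin n) ℝ) = (g y)⁻¹ * g y :=
        (Matrix.nonsing_inv_mul _ (hgm.unit y hy)).symm
      have h3 : c p a b y = ∑ k, (1 : Matrix (Fin n) (Fin n) ℝ) p k * c k a b y := by
        simp [Matrix.one_apply]
      rw [h3, h2]
      simp only [Matrix.mul_apply, Finset.sum_mul, Finset.mul_sum]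
      rw [Finset.sum_comm]
      refine Finset.sum_congr rfl fun i _ => Finset.sum_congr rfl fun k _ => ?_
      rw [hgs k i]
      ring
    have h4 : ∀ m, ∑ k, (g y)⁻¹ p m * (g y a k * c k b m y + g y b k * c k a m y)
        = (g y)⁻¹ p m * ((∑ k, c k b m y * g y k a) + ∑ k, c k a m y * g y k b) := by
      intro m
      rw [← Finset.mul_sum, ← Finset.sum_add_distrib]
      congr 1
      refine Finset.sum_congr rfl fun k _ => ?_
      rw [hgs a k, hgs b k]
      ring
    rw [h1, Matrix.mul_apply]
    simp only [h4, ← htor, hmet, Finset.mul_sum, ← Finset.sum_sub_distrib,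
      ← Finset.sum_add_distrib]
    refine Finset.sum_congr rfl fun m _ => ?_
    have h5 : (g y)⁻¹ m p = (g y)⁻¹ p m := by
      conv_lhs => rw [← hgm.inv_symm hy]
      rfl
    rw [h5]
    ring
  have h6 := h.unitE y hy
  have h7 : IsUnit (E y).transpose.det := by rwa [Matrix.det_transpose]
  rw [hkos, h.g_eq y hy, Matrix.mul_inv_rev, Matrix.mul_inv_rev, hL]
  simp only [mul_assoc]
  rw [Matrix.nonsing_inv_mul _ h6, mul_one, Matrix.mul_nonsing_inv_cancel_left _ _ h7, Matrix.mul_nonsing_inv _ (h.metric.unit y hy),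
    mul_one]

theorem sm_γ (h : IsLeviCivitaFrame U T E g c γ) (p a b : Fin n) : Sm U (γ p a b) := by
  have h1 : SmM U (fun z => (frameDM E a E z + E z * T.ΓE E a z) * (E z)⁻¹) :=
    ((h.smE.frameDM h.smE a).add (h.smE.mul (h.smM_ΓE a))).mul (h.smE.inv h.unitE)
  refine (h1 b p).congr h.isOpen fun z hz => ?_
  have h2 : connM γ a z = (frameDM E a E z + E z * T.ΓE E a z) * (E z)⁻¹ := by
    rw [← h.connM_mul hz, Matrix.mul_nonsing_inv_cancel_right _ _ (h.unitE z hz)]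
  exact congrFun (congrFun h2 b) p

theorem smM_connM (h : IsLeviCivitaFrame U T E g c γ) (a : Fin n) : SmM U (connM γ a) :=
  fun b k => h.sm_γ k a b

/-- The curvature is a tensor: its frame components. -/
theorem frameRiem_mul (h : IsLeviCivitaFrame U T E g c γ) (hy : y ∈ U) (p q : Fin n) :
    (Matrix.of fun b a => frameRiem E c γ a b p q y) * E y
      = E y * Matrix.of fun l k => ∑ i, ∑ j, E y p i * E y q j * T.Riem k l i j y := by
  have hD : ∀ a, frameDM E a E y = connM γ a y * E y - E y * T.ΓE E a y := fun a => by
    rw [h.connM_mul hy]; abel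
  -- the structure of both curvatures in terms of connection matrices
  have hR : (Matrix.of fun b a => frameRiem E c γ a b p q y) = frameDM E p (connM γ q) y
      - frameDM E q (connM γ p) y + connM γ q y * connM γ p y - connM γ p y * connM γ q y
      - ∑ m, c m p q y • connM γ m y := by
    ext b a
    simp only [frameRiem, Matrix.of_apply, Matrix.sub_apply, Matrix.add_apply, Matrix.mul_apply,
      Matrix.sum_apply, Matrix.smul_apply, smul_eq_mul, frameDM, connM, Finset.sum_sub_distrib]
    rw [Finset.sum_congr rfl (fun m _ => mul_comm (γ a p m y) _),
      Finset.sum_congr rfl (fun m _ => mul_comm (γ a q m y) _),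
      Finset.sum_congr rfl (fun m _ => mul_comm (γ a m b y) _)]
    ring
  have hΓ : frameDM E p (T.ΓE E q) y - frameDM E q (T.ΓE E p) y + T.ΓE E q y * T.ΓE E p y
      - T.ΓE E p y * T.ΓE E q y
      = ∑ m, c m p q y • T.ΓE E m y
        + Matrix.of fun l k => ∑ i, ∑ j, E y p i * E y q j * T.Riem k l i j y := by
    ext l k
    have h1 := h.commutator hy (f := fun j z => T.ΓM j z l k)
      (fun j => StringTriple.smM_ΓM h.metric j l k) p q
    have h2 : ∀ i j, T.Riem k l i j y = pd i (fun z => T.ΓM j z l k) y - pd j (fun z => T.ΓM i z l k) y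
        + (T.ΓM j y * T.ΓM i y) l k - (T.ΓM i y * T.ΓM j y) l k := fun i j =>
      congrFun (congrFun (StringTriple.RM_eq (T := T) (y := y) i j) l) k
    have h3 : ∀ p q, (T.ΓE E q y * T.ΓE E p y) l k
        = ∑ i, ∑ j, E y p i * E y q j * (T.ΓM j y * T.ΓM i y) l k := by
      intro p q
      simp only [Matrix.mul_apply, StringTriple.ΓE, Matrix.of_apply, Finset.sum_mul, Finset.mul_sum]
      rw [Finset.sum_comm]
      refine Finset.sum_congr rfl fun i _ => ?_
      rw [Finset.sum_comm]
      refine Finset.sum_congr rfl fun i _ => Finset.sum_congr rfl fun j _ => ?_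
      ring
    have h4 : ∑ i, ∑ j, E y p i * E y q j * (T.ΓM i y * T.ΓM j y) l k
        = ∑ i, ∑ j, E y q i * E y p j * (T.ΓM j y * T.ΓM i y) l k := by
      rw [Finset.sum_comm]
      exact Finset.sum_congr rfl fun i _ => Finset.sum_congr rfl fun j _ => by ring
    simp only [Matrix.sub_apply, Matrix.add_apply, h3, Matrix.of_apply, Matrix.sum_apply,
      Matrix.smul_apply, smul_eq_mul, h2]
    rw [← h4]
    simp only [mul_sub, mul_add, Finset.sum_add_distrib, Finset.sum_sub_distrib] at h1 ⊢
    simp only [frameDM, StringTriple.ΓE, Matrix.of_apply]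
    linarith
  have hE : frameDM E p (frameDM E q E) y - frameDM E q (frameDM E p E) y
      = ∑ m, c m p q y • frameDM E m E y := by
    ext l k
    have h1 := h.commutator hy (f := fun j z => pd j (fun w => E w l k) z)
      (fun j => (h.smE l k).pd j) p q
    have h2 : ∀ i j, pd i (pd j fun w => E w l k) y - pd j (pd i fun w => E w l k) y = 0 :=
      fun i j => sub_eq_zero.2 (pd_comm i j (h.smE l k) hy)
    simp only [h2, mul_zero, Finset.sum_const_zero, add_zero] at h1
    simp only [Matrix.sub_apply, Matrix.sum_apply, Matrix.smul_apply, smul_eq_mul, frameDM,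
      Matrix.of_apply]
    exact h1
  -- differentiate the relation between the two connections
  have hdiff : ∀ p q, frameDM E p (connM γ q) y * E y = frameDM E p (frameDM E q E) y
      + frameDM E p E y * T.ΓE E q y + E y * frameDM E p (T.ΓE E q) y
      - connM γ q y * frameDM E p E y := by
    intro p q
    have h1 := frameDM_congr (E := E) h.isOpen (fun z hz => h.connM_mul hz q) hy p
    rw [frameDM_mul (h.smM_connM q) h.smE hy,
      frameDM_add (h.smE.frameDM h.smE q) (h.smE.mul (h.smM_ΓE q)) hy,
      frameDM_mul h.smE (h.smM_ΓE q) hy] at h1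
    rw [eq_sub_iff_add_eq, h1]
    abel
  have hsum : (∑ m, c m p q y • connM γ m y) * E y
      = ∑ m, c m p q y • frameDM E m E y + E y * ∑ m, c m p q y • T.ΓE E m y := by
    rw [Finset.sum_mul, Finset.mul_sum, ← Finset.sum_add_distrib]
    refine Finset.sum_congr rfl fun m _ => ?_
    rw [smul_mul_assoc, h.connM_mul hy, smul_add, mul_smul_comm]
  have hX : (Matrix.of fun l k => ∑ i, ∑ j, E y p i * E y q j * T.Riem k l i j y)
      = frameDM E p (T.ΓE E q) y - frameDM E q (T.ΓE E p) y + T.ΓE E q y * T.ΓE E p y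
      - T.ΓE E p y * T.ΓE E q y - ∑ m, c m p q y • T.ΓE E m y := by
    rw [hΓ]; abel
  rw [hR, hX, sub_mul, sub_mul, add_mul, sub_mul, hdiff p q, hdiff q p, hsum, ← hE, hD p, hD q]
  noncomm_ring

/-- The Ricci tensor in the frame. -/
theorem frameRic_eq (h : IsLeviCivitaFrame U T E g c γ) (hy : y ∈ U) :
    (Matrix.of fun a b => ∑ m, frameRiem E c γ m a m b y)
      = E y * (Matrix.of fun a b => T.Ric a b y) * (E y).transpose := by
  have hu := h.unitE y hy
  have h1 : ∀ p q b a, frameRiem E c γ a b p q y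
      = ∑ l, E y b l * ∑ k, (∑ i, ∑ j, E y p i * E y q j * T.Riem k l i j y) * (E y)⁻¹ k a := by
    intro p q b a
    have h2 : (Matrix.of fun b a => frameRiem E c γ a b p q y)
      = E y * (Matrix.of (fun l k => ∑ i, ∑ j, E y p i * E y q j * T.Riem k l i j y) * (E y)⁻¹) := by
      rw [← mul_assoc, ← h.frameRiem_mul hy, Matrix.mul_nonsing_inv_cancel_right _ _ hu]
    have h3 := congrFun (congrFun h2 b) a
    rw [Matrix.mul_apply] at h3
    simp only [Matrix.mul_apply (N := (E y)⁻¹), Matrix.of_apply] at h3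
    exact h3
  ext a b
  have h4 : ∀ k i, ∑ m, (E y)⁻¹ k m * E y m i = if k = i then 1 else 0 := fun k i => by
    rw [← Matrix.mul_apply, Matrix.nonsing_inv_mul _ hu, Matrix.one_apply]
  calc ∑ m, frameRiem E c γ m a m b y
      = ∑ l, ∑ k, ∑ i, ∑ j, E y a l * E y b j * T.Riem k l i j y * ∑ m, (E y)⁻¹ k m * E y m i := by
        simp only [h1, Finset.mul_sum, Finset.sum_mul]
        rw [Finset.sum_comm]
        refine Finset.sum_congr rfl fun l _ => ?_
        rw [Finset.sum_comm]
        refine Finset.sum_congr rfl fun k _ => ?_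
        rw [Finset.sum_comm]
        refine Finset.sum_congr rfl fun i _ => ?_
        rw [Finset.sum_comm]
        exact Finset.sum_congr rfl fun j _ => Finset.sum_congr rfl fun m _ => by ring
    _ = ∑ l, ∑ j, E y a l * T.Ric l j y * E y b j := by
        simp only [h4, mul_ite, mul_one, mul_zero, StringTriple.Ric, Finset.mul_sum, Finset.sum_mul]
        refine Finset.sum_congr rfl fun l _ => ?_
        rw [Finset.sum_comm (s := Finset.univ) (t := Finset.univ)
          (f := fun j k => E y a l * T.Riem k l k j y * E y b j)]
        refine Finset.sum_congr rfl fun k _ => ?_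
        rw [Finset.sum_comm]
        refine Finset.sum_congr rfl fun j _ => ?_
        simp only [Finset.sum_ite_eq, Finset.mem_univ, if_true]
        ring
    _ = _ := by
        simp only [Matrix.mul_apply, Matrix.of_apply, Matrix.transpose_apply, Finset.sum_mul]
        rw [Finset.sum_comm]

/-- The Hessian of the dilaton in the frame. -/
theorem frameHess_eq (h : IsLeviCivitaFrame U T E g c γ) (hy : y ∈ U) (hφ : Sm U T.φ) :
    (Matrix.of fun a b => frameD E a (frameD E b T.φ) y - ∑ m, γ m a b y * frameD E m T.φ y)
      = E y * (Matrix.of fun a b => T.hess a b y) * (E y).transpose := by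
  ext a b
  have h1 : ∀ k, ∑ m, γ m a b y * E y m k = frameD E a (fun z => E z b k) y
      + ∑ l, E y b l * ∑ i, E y a i * T.Γ k i l y := fun k =>
    congrFun (congrFun (h.connM_mul hy a) b) k
  have h2 : ∑ m, γ m a b y * frameD E m T.φ y
      = ∑ k, (frameD E a (fun z => E z b k) y + ∑ l, E y b l * ∑ i, E y a i * T.Γ k i l y)
        * pd k T.φ y := by
    simp only [← h1, Finset.sum_mul]
    rw [Finset.sum_comm]
    simp only [frameD, Finset.mul_sum]
    exact Finset.sum_congr rfl fun i _ => Finset.sum_congr rfl fun j _ => by ring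
  have h3 : frameD E a (frameD E b T.φ) y = ∑ k, (frameD E a (fun z => E z b k) y * pd k T.φ y
      + E y b k * frameD E a (pd k T.φ) y) := by
    show frameD E a (fun z => ∑ k, E z b k * pd k T.φ z) y = _
    rw [frameD_sum (fun k => (h.smE b k).mul (hφ.pd k)) hy]
    exact Finset.sum_congr rfl fun k _ => frameD_mul (h.smE b k) (hφ.pd k) hy a
  rw [Matrix.of_apply, h2, h3, ← Finset.sum_sub_distrib]
  simp only [Matrix.mul_apply, Matrix.transpose_apply, Matrix.of_apply, StringTriple.hess]
  have h4 : ∑ k, ((frameD E a (fun z => E z b k) y * pd k T.φ y + E y b k * frameD E a (pd k T.φ) y)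
      - (frameD E a (fun z => E z b k) y + ∑ l, E y b l * ∑ i, E y a i * T.Γ k i l y) * pd k T.φ y)
      = ∑ l, ∑ i, E y a i * E y b l * pd i (pd l T.φ) y
        - ∑ l, ∑ i, E y a i * E y b l * ∑ k, T.Γ k i l y * pd k T.φ y := by
    simp only [frameD, add_mul, Finset.sum_add_distrib, Finset.sum_sub_distrib, Finset.mul_sum,
      Finset.sum_mul]
    have h5 : ∑ k, ∑ l, ∑ i, E y b l * (E y a i * T.Γ k i l y) * pd k T.φ y
        = ∑ l, ∑ i, ∑ k, E y a i * E y b l * (T.Γ k i l y * pd k T.φ y) := by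
      rw [Finset.sum_comm]
      refine Finset.sum_congr rfl fun l _ => ?_
      rw [Finset.sum_comm]
      exact Finset.sum_congr rfl fun i _ => Finset.sum_congr rfl fun k _ => by ring
    have h6 : ∑ k, ∑ i, E y b k * (E y a i * pd i (pd k T.φ) y)
        = ∑ l, ∑ i, E y a i * E y b l * pd i (pd l T.φ) y :=
      Finset.sum_congr rfl fun i _ => Finset.sum_congr rfl fun k _ => by ring
    rw [h5, h6]
    ring
  rw [h4, ← Finset.sum_sub_distrib]
  refine Finset.sum_congr rfl fun l _ => ?_
  rw [← Finset.sum_sub_distrib, Finset.sum_mul]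
  refine Finset.sum_congr rfl fun i _ => ?_
  ring

end IsLeviCivitaFrame

/-- Contraction of a two-tensor given in a frame. -/
theorem sum_mul_congr_frame {n : ℕ} (A X E : Matrix (Fin n) (Fin n) ℝ) :
    ∑ a, ∑ b, A a b * (E * X * E.transpose) a b = ∑ a, ∑ b, (E.transpose * A * E) a b * X a b := by
  have key : ∀ B Y : Matrix (Fin n) (Fin n) ℝ, ∑ a, ∑ b, B a b * Y a b = (B * Y.transpose).trace := by
    intro B Y
    simp [Matrix.trace, Matrix.mul_apply]
  rw [key, key, Matrix.transpose_mul, Matrix.transpose_mul, Matrix.transpose_transpose,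
    ← mul_assoc, ← mul_assoc, Matrix.trace_mul_comm, ← mul_assoc, ← mul_assoc]

/-! ### Three-index tensors -/

/-- Components of an object with three indices. -/
abbrev Tensor3 (n : ℕ) : Type := Fin n → Fin n → Fin n → ℝ

section Slots

variable {n : ℕ} (A B : Matrix (Fin n) (Fin n) ℝ) (X Y : Tensor3 n)

/-- The matrix `A` acting on the first index. -/
def slot1 : Tensor3 n := fun a b c => ∑ i, A a i * X i b c

/-- The matrix `A` acting on the second index. -/
def slot2 : Tensor3 n := fun a b c => ∑ i, A b i * X a i c

/-- The matrix `A` acting on the third index. -/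
def slot3 : Tensor3 n := fun a b c => ∑ i, A c i * X a b i

/-- The matrix `A` acting on all three indices. -/
def act3 : Tensor3 n := slot1 A (slot2 A (slot3 A X))

theorem act3_apply (a b c : Fin n) :
    act3 A X a b c = ∑ i, ∑ j, ∑ k, A a i * A b j * A c k * X i j k := by
  simp only [act3, slot1, slot2, slot3, Finset.mul_sum, mul_assoc]

theorem sum_mul_sum_mul {m : ℕ} (f : Fin m → ℝ) (h : Fin m → Fin m → ℝ) (g : Fin m → ℝ) :
    ∑ i, f i * ∑ j, h i j * g j = ∑ j, (∑ i, f i * h i j) * g j := by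
  simp only [Finset.mul_sum, Finset.sum_mul]
  rw [Finset.sum_comm]
  exact Finset.sum_congr rfl fun _ _ => Finset.sum_congr rfl fun _ _ => by ring

theorem slot1_slot1 : slot1 A (slot1 B X) = slot1 (A * B) X := by
  funext a b c
  simp only [slot1, Matrix.mul_apply]
  exact sum_mul_sum_mul _ _ _

theorem slot2_slot2 : slot2 A (slot2 B X) = slot2 (A * B) X := by
  funext a b c
  simp only [slot2, Matrix.mul_apply]
  exact sum_mul_sum_mul _ _ _

theorem slot3_slot3 : slot3 A (slot3 B X) = slot3 (A * B) X := by
  funext a b c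
  simp only [slot3, Matrix.mul_apply]
  exact sum_mul_sum_mul _ _ _

theorem slot2_slot1 : slot2 A (slot1 B X) = slot1 B (slot2 A X) := by
  funext a b c
  simp only [slot1, slot2, Finset.mul_sum]
  rw [Finset.sum_comm]
  exact Finset.sum_congr rfl fun _ _ => Finset.sum_congr rfl fun _ _ => by ring

theorem slot3_slot1 : slot3 A (slot1 B X) = slot1 B (slot3 A X) := by
  funext a b c
  simp only [slot1, slot3, Finset.mul_sum]
  rw [Finset.sum_comm]
  exact Finset.sum_congr rfl fun _ _ => Finset.sum_congr rfl fun _ _ => by ring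

theorem slot3_slot2 : slot3 A (slot2 B X) = slot2 B (slot3 A X) := by
  funext a b c
  simp only [slot2, slot3, Finset.mul_sum]
  rw [Finset.sum_comm]
  exact Finset.sum_congr rfl fun _ _ => Finset.sum_congr rfl fun _ _ => by ring

theorem act3_act3 : act3 A (act3 B X) = act3 (A * B) X := by
  unfold act3
  rw [slot3_slot1, slot3_slot2, slot3_slot3, slot2_slot1, slot2_slot2, slot1_slot1]

theorem act3_one : act3 (1 : Matrix (Fin n) (Fin n) ℝ) X = X := by
  funext a b c
  simp [act3, slot1, slot2, slot3, Matrix.one_apply]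

/-- Contraction over the last two indices. -/
def pair23 : Matrix (Fin n) (Fin n) ℝ := Matrix.of fun a b => ∑ i, ∑ j, X a i j * Y b i j

theorem pair23_slot2 : pair23 (slot2 A X) Y = pair23 X (slot2 A.transpose Y) := by
  ext a b
  simp only [pair23, Matrix.of_apply, slot2, Finset.mul_sum, Finset.sum_mul, Matrix.transpose_apply]
  rw [Finset.sum_comm]
  rw [Finset.sum_comm (γ := Fin n) (s := (Finset.univ : Finset (Fin n)))
    (f := fun i j => ∑ k, X a i j * (A k i * Y b k j))]
  refine Finset.sum_congr rfl fun _ _ => ?_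
  rw [Finset.sum_comm]
  exact Finset.sum_congr rfl fun _ _ => Finset.sum_congr rfl fun _ _ => by ring

theorem pair23_slot3 : pair23 (slot3 A X) Y = pair23 X (slot3 A.transpose Y) := by
  ext a b
  simp only [pair23, Matrix.of_apply, slot3, Finset.mul_sum, Finset.sum_mul, Matrix.transpose_apply]
  refine Finset.sum_congr rfl fun _ _ => ?_
  rw [Finset.sum_comm]
  exact Finset.sum_congr rfl fun _ _ => Finset.sum_congr rfl fun _ _ => by ring

theorem pair23_slot1_left : pair23 (slot1 A X) Y = A * pair23 X Y := by
  ext a b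
  simp only [pair23, Matrix.of_apply, slot1, Finset.mul_sum, Finset.sum_mul, Matrix.mul_apply]
  rw [Finset.sum_congr rfl (fun i _ => Finset.sum_comm), Finset.sum_comm]
  exact Finset.sum_congr rfl fun _ _ => Finset.sum_congr rfl fun _ _ =>
    Finset.sum_congr rfl fun _ _ => by ring

theorem pair23_comm : (pair23 X Y).transpose = pair23 Y X := by
  ext a b
  simp only [pair23, Matrix.of_apply, Matrix.transpose_apply, mul_comm]

theorem pair23_slot1_right : pair23 X (slot1 A Y) = pair23 X Y * A.transpose := by
  rw [← pair23_comm, pair23_slot1_left, Matrix.transpose_mul, pair23_comm]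

/-- The contraction of two three-index tensors with the help of an inverse metric, as a matrix in the
remaining indices, in a frame. -/
theorem pair23_act3 (E g : Matrix (Fin n) (Fin n) ℝ) :
    pair23 (act3 E X) (slot2 g (slot3 g (act3 E Y)))
      = E * pair23 X (slot2 (E.transpose * g * E) (slot3 (E.transpose * g * E) Y)) * E.transpose := by
  unfold act3
  rw [pair23_slot1_left, slot3_slot1, slot2_slot1, pair23_slot1_right, pair23_slot2, pair23_slot3]
  simp only [slot3_slot2, slot3_slot3, slot2_slot2, mul_assoc]

theorem pair23_trace (g : Matrix (Fin n) (Fin n) ℝ) :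
    ∑ a, ∑ b, ∑ c, X a b c * act3 g X a b c
      = ∑ a, ∑ b, g a b * pair23 X (slot2 g (slot3 g X)) a b := by
  unfold act3
  refine Finset.sum_congr rfl fun a _ => ?_
  simp only [pair23, Matrix.of_apply, slot1, Finset.mul_sum]
  rw [Finset.sum_congr rfl (fun i _ => Finset.sum_comm), Finset.sum_comm]
  refine Finset.sum_congr rfl fun d _ => Finset.sum_congr rfl fun b _ =>
    Finset.sum_congr rfl fun c _ => ?_
  ring

end Slots

/-! ### Symplectic gravity as string theory in the frame `β` -/

/-- A field configuration of symplectic gravity on a coordinate domain. -/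
structure IsConfigOn {n : ℕ} (U : Set (Coord n)) (F : SymplecticTriple n) : Prop where
  metric : IsMetricOn U F.g
  smβ : SmM U F.β
  skew : ∀ y ∈ U, (F.β y).transpose = -F.β y
  unitβ : ∀ y ∈ U, IsUnit (F.β y).det
  smφ : Sm U F.φ

/-- A field configuration of the bosonic string on a coordinate domain. -/
structure IsStringConfigOn {n : ℕ} (U : Set (Coord n)) (T : StringTriple n) : Prop where
  metric : IsMetricOn U T.G
  smB : SmM U T.B
  skew : ∀ y ∈ U, (T.B y).transpose = -T.B y
  smφ : Sm U T.φ

theorem inv_neg_matrix {n : ℕ} {A : Matrix (Fin n) (Fin n) ℝ} (hA : IsUnit A.det) :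
    (-A)⁻¹ = -A⁻¹ :=
  Matrix.inv_eq_left_inv (by rw [neg_mul_neg, Matrix.nonsing_inv_mul _ hA])

/-- The determinant of an invertible skew matrix is positive: it does not vanish along the segment
from the identity matrix. -/
theorem det_pos_of_skew {n : ℕ} {A : Matrix (Fin n) (Fin n) ℝ} (hA : A.transpose = -A)
    (hu : IsUnit A.det) : 0 < A.det := by
  by_contra hneg
  have hlt : A.det < 0 := lt_of_le_of_ne (not_lt.1 hneg) hu.ne_zero
  let f : ℝ → ℝ := fun s => ((1 - s) • (1 : Matrix (Fin n) (Fin n) ℝ) + s • A).det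
  have hf : Continuous f := by
    have : SmM (Set.univ : Set ℝ)
        (fun s => (1 - s) • (1 : Matrix (Fin n) (Fin n) ℝ) + s • A) := by
      intro a b y _
      simp only [Matrix.add_apply, Matrix.smul_apply, smul_eq_mul]
      fun_prop
    exact continuousOn_univ.1 this.det.continuousOn
  have h0 : f 0 = 1 := by simp [f]
  have h1 : f 1 = A.det := by simp [f]
  obtain ⟨s, hs, hs0⟩ : (0 : ℝ) ∈ f '' Set.Icc 0 1 :=
    intermediate_value_Icc' zero_le_one hf.continuousOn (by rw [h0, h1]; exact ⟨hlt.le, zero_le_one⟩)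
  obtain ⟨v, hv, hv0⟩ := Matrix.exists_mulVec_eq_zero_iff.2 hs0
  have hskew : v ⬝ᵥ A.mulVec v = 0 := by
    have h2 : v ⬝ᵥ A.mulVec v = -(v ⬝ᵥ A.mulVec v) := by
      conv_lhs => rw [Matrix.dotProduct_mulVec, ← Matrix.mulVec_transpose, hA, Matrix.neg_mulVec,
        neg_dotProduct, dotProduct_comm]
    linarith
  have h3 : (1 - s) * (v ⬝ᵥ v) = 0 := by
    have h4 := congrArg (fun w => v ⬝ᵥ w) hv0
    simpa [Matrix.add_mulVec, Matrix.smul_mulVec, hskew] using h4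
  have h5 : v ⬝ᵥ v ≠ 0 := fun h => hv (dotProduct_self_eq_zero.1 h)
  have h6 : s = 1 := by
    rcases mul_eq_zero.1 h3 with h | h
    · linarith
    · exact absurd h h5
  rw [h6, h1] at hs0
  exact hu.ne_zero hs0

namespace StringTriple

variable {n : ℕ} (T : StringTriple n)

/-- The weight `√|det G| e^{-2φ}`. -/
def weight (y : Coord n) : ℝ := Real.sqrt |(T.G y).det| * Real.exp (-2 * T.φ y)

/-- The components of `H` at a point. -/
def H3 (y : Coord n) : Tensor3 n := fun a b c => T.H a b c y

/-- `H^{abc}`. -/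
def Hup (y : Coord n) : Tensor3 n := act3 (T.GInv y) (T.H3 y)

/-- `H_{amn} H_b^{mn}`. -/
def HSqM (y : Coord n) : Matrix (Fin n) (Fin n) ℝ :=
  pair23 (T.H3 y) (slot2 (T.GInv y) (slot3 (T.GInv y) (T.H3 y)))

/-- `∇^i ∇_i φ`. -/
def lap (y : Coord n) : ℝ := ∑ a, ∑ b, T.GInv y a b * T.hess a b y

/-- The equation of the metric, up to a multiple of the equation of the dilaton. -/
def eomG (a b : Fin n) (y : Coord n) : ℝ :=
  T.Ric a b y + 2 * T.hess a b y - (1 / 4) * T.HSqM y a b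

/-- The equation of the dilaton. -/
def eomφ (y : Coord n) : ℝ :=
  T.scalarCurv y - (1 / 12) * T.HSq y + 4 * T.lap y - 4 * T.kinetic y

/-- The equation of the two-form, `∂_a (√|det G| e^{-2φ} H^{abc})`. -/
def eomB (b c : Fin n) (y : Coord n) : ℝ := ∑ a, pd a (fun z => T.weight z * T.Hup z a b c) y

variable {T} {U : Set (Coord n)} {y : Coord n}

theorem HSq_eq : T.HSq y = ∑ a, ∑ b, ∑ c, T.H3 y a b c * T.Hup y a b c := by
  unfold HSq Hup
  simp only [act3_apply, H3, Finset.mul_sum]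
  refine Finset.sum_congr rfl fun a _ => Finset.sum_congr rfl fun b _ =>
    Finset.sum_congr rfl fun c _ => Finset.sum_congr rfl fun i _ => Finset.sum_congr rfl fun j _ =>
    Finset.sum_congr rfl fun k _ => by ring

theorem HSq_eq_trace : T.HSq y = ∑ a, ∑ b, T.GInv y a b * T.HSqM y a b := by
  rw [HSq_eq]
  exact pair23_trace _ _

theorem sm_H (h : IsStringConfigOn U T) (a b c : Fin n) : Sm U (T.H a b c) :=
  (((h.smB b c).pd a).add ((h.smB c a).pd b)).add ((h.smB a b).pd c)

theorem sm_Hup (h : IsStringConfigOn U T) (a b c : Fin n) : Sm U (fun z => T.Hup z a b c) := by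
  have : (fun z => T.Hup z a b c) = fun z => ∑ i, ∑ j, ∑ k, T.GInv z a i * T.GInv z b j
      * T.GInv z c k * T.H i j k z := by
    funext z
    exact act3_apply _ _ _ _ _
  rw [this]
  exact Sm.sum fun i => Sm.sum fun j => Sm.sum fun k => (((h.metric.smooth_inv a i).mul
    (h.metric.smooth_inv b j)).mul (h.metric.smooth_inv c k)).mul (sm_H h i j k)

theorem sm_weight (hG : IsMetricOn U T.G) (hφ : Sm U T.φ) : Sm U T.weight :=
  (hG.smooth.sqrt_abs_det hG.unit).mul ((Sm.const _).mul hφ).exp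

theorem weight_pos (hG : IsMetricOn U T.G) (hy : y ∈ U) : 0 < T.weight y :=
  mul_pos (Real.sqrt_pos.2 (abs_pos.2 (hG.unit y hy).ne_zero)) (Real.exp_pos _)

theorem half_trace_pdM_G (hU : IsOpen U) (hG : IsMetricOn U T.G) (hy : y ∈ U) (i : Fin n) :
    (1 / 2) * (T.GInv y * pdM i T.G y).trace = ∑ e, T.Γ e i e y := by
  have hu := hG.unit y hy
  rw [pdM_G hU hG hy, mul_add, Matrix.trace_add, GInv, Matrix.nonsing_inv_mul_cancel_left _ _ hu,
    Matrix.trace_mul_comm, Matrix.mul_nonsing_inv_cancel_right _ _ hu, Matrix.trace_transpose]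
  simp only [Matrix.trace, Matrix.diag, ΓM, Matrix.of_apply]
  ring

theorem pd_weight (hU : IsOpen U) (hG : IsMetricOn U T.G) (hφ : Sm U T.φ) (hy : y ∈ U) (i : Fin n) :
    pd i T.weight y = T.weight y * ((∑ e, T.Γ e i e y) - 2 * pd i T.φ y) := by
  have h1 : pd i (fun z => Real.exp (-2 * T.φ z)) y = Real.exp (-2 * T.φ y) * (-2 * pd i T.φ y) := by
    rw [← pd_const_mul i (-2) hφ hy]
    unfold pd
    rw [fderiv_exp (((Sm.const (-2)).mul hφ).differentiableAt hy)]
    simp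
  have h2 : pd i T.weight y = _ :=
    pd_mul i (hG.smooth.sqrt_abs_det hG.unit) ((Sm.const (-2)).mul hφ).exp hy
  rw [h2, h1, pd_sqrt_abs_det i hG.smooth hG.unit hy, ← half_trace_pdM_G hU hG hy, weight, GInv]
  ring

theorem pd_B_skew (hU : IsOpen U) (h : IsStringConfigOn U T) (hy : y ∈ U) (m i j : Fin n) :
    pd m (fun z => T.B z i j) y = -pd m (fun z => T.B z j i) y := by
  rw [← pd_neg]
  exact pd_congr m hU (fun z hz => congrFun (congrFun (h.skew z hz) j) i) hy

theorem H_skew12 (hU : IsOpen U) (h : IsStringConfigOn U T) (hy : y ∈ U) (a b c : Fin n) :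
    T.H a b c y = -T.H b a c y := by
  unfold H
  rw [pd_B_skew hU h hy a b c, pd_B_skew hU h hy b c a, pd_B_skew hU h hy c a b]
  ring

theorem H_cyc (a b c : Fin n) : T.H a b c y = T.H b c a y := by
  unfold H
  ring

theorem Hup_cyc (a b c : Fin n) : T.Hup y a b c = T.Hup y b c a := by
  simp only [Hup, act3_apply, H3]
  rw [Finset.sum_comm]
  refine Finset.sum_congr rfl fun j _ => ?_
  rw [Finset.sum_comm]
  exact Finset.sum_congr rfl fun k _ => Finset.sum_congr rfl fun i _ => by rw [H_cyc i j k]; ring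

theorem Hup_skew12 (hU : IsOpen U) (h : IsStringConfigOn U T) (hy : y ∈ U) (a b c : Fin n) :
    T.Hup y a b c = -T.Hup y b a c := by
  simp only [Hup, act3_apply, H3, ← Finset.sum_neg_distrib]
  rw [Finset.sum_comm]
  exact Finset.sum_congr rfl fun j _ => Finset.sum_congr rfl fun i _ =>
    Finset.sum_congr rfl fun k _ => by rw [H_skew12 hU h hy i j k]; ring

theorem Hup_skew23 (hU : IsOpen U) (h : IsStringConfigOn U T) (hy : y ∈ U) (a b c : Fin n) :
    T.Hup y a b c = -T.Hup y a c b := by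
  rw [Hup_cyc, Hup_skew12 hU h hy, ← Hup_cyc]

/-- The covariant derivative `∇_i H^{abc}`. -/
def covHup (T : StringTriple n) (i : Fin n) (y : Coord n) : Tensor3 n := fun a b c =>
  pd i (fun z => T.Hup z a b c) y + (slot1 (T.ΓM i y).transpose (T.Hup y) a b c
    + slot2 (T.ΓM i y).transpose (T.Hup y) a b c + slot3 (T.ΓM i y).transpose (T.Hup y) a b c)

theorem sum_eq_zero_of_skew {n : ℕ} (f : Fin n → Fin n → ℝ) (h : ∀ a b, f a b = -f b a) :
    ∑ a, ∑ b, f a b = 0 := by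
  have h1 : ∑ a, ∑ b, f a b = -∑ a, ∑ b, f a b := by
    conv_lhs => rw [Finset.sum_comm]
    simp only [← Finset.sum_neg_distrib]
    exact Finset.sum_congr rfl fun a _ => Finset.sum_congr rfl fun b _ => h b a
  linarith

/-- The divergence of the antisymmetric tensor density `√|det G| e^{-2φ} H^{abc}` is a covariant
divergence. -/
theorem eomB_eq (hU : IsOpen U) (h : IsStringConfigOn U T) (hy : y ∈ U) (b c : Fin n) :
    T.eomB b c y = T.weight y * (∑ i, T.covHup i y i b c - 2 * ∑ i, pd i T.φ y * T.Hup y i b c) := by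
  have h1 : ∀ a, pd a (fun z => T.weight z * T.Hup z a b c) y
      = T.weight y * ((∑ e, T.Γ e a e y) - 2 * pd a T.φ y) * T.Hup y a b c
        + T.weight y * pd a (fun z => T.Hup z a b c) y := by
    intro a
    rw [pd_mul a (sm_weight h.metric h.smφ) (sm_Hup h a b c) hy, pd_weight hU h.metric h.smφ hy]
  have hs2 : ∑ i, slot2 (T.ΓM i y).transpose (T.Hup y) i b c = 0 := by
    simp only [slot2, ΓM, Matrix.transpose_apply, Matrix.of_apply]
    refine sum_eq_zero_of_skew _ fun i j => ?_
    rw [Hup_skew12 hU h hy, Γ_symm hU h.metric hy]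
    ring
  have hs3 : ∑ i, slot3 (T.ΓM i y).transpose (T.Hup y) i b c = 0 := by
    simp only [slot3, ΓM, Matrix.transpose_apply, Matrix.of_apply]
    refine sum_eq_zero_of_skew _ fun i j => ?_
    rw [Hup_cyc i b j, Hup_skew23 hU h hy, ← Hup_cyc j b i, Γ_symm hU h.metric hy]
    ring
  have hs1 : ∑ i, slot1 (T.ΓM i y).transpose (T.Hup y) i b c
      = ∑ i, (∑ e, T.Γ e i e y) * T.Hup y i b c := by
    simp only [slot1, ΓM, Matrix.transpose_apply, Matrix.of_apply, Finset.sum_mul]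
    rw [Finset.sum_comm]
    exact Finset.sum_congr rfl fun i _ => Finset.sum_congr rfl fun j _ => by
      rw [Γ_symm hU h.metric hy]
  simp only [eomB, h1, covHup, Finset.sum_add_distrib, hs1, hs2, hs3]
  simp only [add_zero, ← Finset.sum_add_distrib, Finset.mul_sum, ← Finset.sum_sub_distrib]
  refine Finset.sum_congr rfl fun a _ => ?_
  ring

theorem scalarCurv_eq_of_frame {E g : Coord n → Matrix (Fin n) (Fin n) ℝ}
    {c γ : Fin n → Fin n → Fin n → Coord n → ℝ} (h : IsLeviCivitaFrame U T E g c γ) (hy : y ∈ U) :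
    ∑ a, ∑ b, (g y)⁻¹ a b * ∑ m, frameRiem E c γ m a m b y = T.scalarCurv y := by
  have h1 := sum_mul_congr_frame (g y)⁻¹ (Matrix.of fun a b => T.Ric a b y) (E y)
  rw [← h.frameRic_eq hy, h.inv_g hy] at h1
  exact h1

theorem kinetic_eq_of_frame {E g : Coord n → Matrix (Fin n) (Fin n) ℝ}
    {c γ : Fin n → Fin n → Fin n → Coord n → ℝ} (h : IsLeviCivitaFrame U T E g c γ) (hy : y ∈ U) :
    ∑ a, ∑ b, (g y)⁻¹ a b * frameD E a T.φ y * frameD E b T.φ y = T.kinetic y := by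
  have h1 := sum_mul_congr_frame (g y)⁻¹ (Matrix.of fun a b => pd a T.φ y * pd b T.φ y) (E y)
  have h2 : E y * (Matrix.of fun a b => pd a T.φ y * pd b T.φ y) * (E y).transpose
      = Matrix.of fun a b => frameD E a T.φ y * frameD E b T.φ y := by
    ext a b
    simp only [Matrix.mul_apply, Matrix.of_apply, Matrix.transpose_apply, frameD, Finset.sum_mul,
      Finset.mul_sum]
    exact Finset.sum_congr rfl fun _ _ => Finset.sum_congr rfl fun _ _ => by ring
  rw [h2, h.inv_g hy] at h1
  simpa only [Matrix.of_apply, kinetic, GInv, mul_assoc] using h1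

theorem HSqM_of_frame {E g : Coord n → Matrix (Fin n) (Fin n) ℝ}
    {c γ : Fin n → Fin n → Fin n → Coord n → ℝ} (h : IsLeviCivitaFrame U T E g c γ) (hy : y ∈ U) :
    pair23 (act3 (E y) (T.H3 y)) (slot2 (g y)⁻¹ (slot3 (g y)⁻¹ (act3 (E y) (T.H3 y))))
      = E y * T.HSqM y * (E y).transpose := by
  rw [pair23_act3, h.inv_g hy]
  rfl

theorem HSq_of_frame {E g : Coord n → Matrix (Fin n) (Fin n) ℝ}
    {c γ : Fin n → Fin n → Fin n → Coord n → ℝ} (h : IsLeviCivitaFrame U T E g c γ) (hy : y ∈ U) :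
    ∑ a, ∑ b, ∑ c, act3 (E y) (T.H3 y) a b c * act3 (g y)⁻¹ (act3 (E y) (T.H3 y)) a b c
      = T.HSq y := by
  rw [pair23_trace, HSqM_of_frame h hy, sum_mul_congr_frame, h.inv_g hy, HSq_eq_trace]
  rfl

end StringTriple

section TensorDerivative

variable {n : ℕ} {U : Set (Coord n)} {y : Coord n} {E : Coord n → Matrix (Fin n) (Fin n) ℝ}
  {M : Coord n → Matrix (Fin n) (Fin n) ℝ} {X : Coord n → Tensor3 n}

/-- Componentwise derivative of a tensor along a frame vector. -/
def frameDT (E : Coord n → Matrix (Fin n) (Fin n) ℝ) (d : Fin n) (X : Coord n → Tensor3 n)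
    (y : Coord n) : Tensor3 n := fun a b c => frameD E d (fun z => X z a b c) y

theorem frameD_sum_mul {f g : Fin n → Coord n → ℝ} (hf : ∀ k, Sm U (f k)) (hg : ∀ k, Sm U (g k))
    (hy : y ∈ U) (d : Fin n) : frameD E d (fun z => ∑ k, f k z * g k z) y
      = ∑ k, frameD E d (f k) y * g k y + ∑ k, f k y * frameD E d (g k) y := by
  rw [frameD_sum (fun k => (hf k).mul (hg k)) hy, ← Finset.sum_add_distrib]
  exact Finset.sum_congr rfl fun k _ => frameD_mul (hf k) (hg k) hy d

theorem frameDT_slot1 (hM : SmM U M) (hX : ∀ a b c, Sm U fun z => X z a b c) (hy : y ∈ U)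
    (d : Fin n) : frameDT E d (fun z => slot1 (M z) (X z)) y
      = slot1 (frameDM E d M y) (X y) + slot1 (M y) (frameDT E d X y) := by
  funext a b c
  exact frameD_sum_mul (fun k => hM a k) (fun k => hX k b c) hy d

theorem frameDT_slot2 (hM : SmM U M) (hX : ∀ a b c, Sm U fun z => X z a b c) (hy : y ∈ U)
    (d : Fin n) : frameDT E d (fun z => slot2 (M z) (X z)) y
      = slot2 (frameDM E d M y) (X y) + slot2 (M y) (frameDT E d X y) := by
  funext a b c
  exact frameD_sum_mul (fun k => hM b k) (fun k => hX a k c) hy d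

theorem frameDT_slot3 (hM : SmM U M) (hX : ∀ a b c, Sm U fun z => X z a b c) (hy : y ∈ U)
    (d : Fin n) : frameDT E d (fun z => slot3 (M z) (X z)) y
      = slot3 (frameDM E d M y) (X y) + slot3 (M y) (frameDT E d X y) := by
  funext a b c
  exact frameD_sum_mul (fun k => hM c k) (fun k => hX a b k) hy d

theorem slot1_add (A : Matrix (Fin n) (Fin n) ℝ) (X Y : Tensor3 n) :
    slot1 A (X + Y) = slot1 A X + slot1 A Y := by
  funext a b c; simp [slot1, mul_add, Finset.sum_add_distrib]

theorem slot2_add (A : Matrix (Fin n) (Fin n) ℝ) (X Y : Tensor3 n) :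
    slot2 A (X + Y) = slot2 A X + slot2 A Y := by
  funext a b c; simp [slot2, mul_add, Finset.sum_add_distrib]

theorem slot3_add (A : Matrix (Fin n) (Fin n) ℝ) (X Y : Tensor3 n) :
    slot3 A (X + Y) = slot3 A X + slot3 A Y := by
  funext a b c; simp [slot3, mul_add, Finset.sum_add_distrib]

theorem slot1_sub (A B : Matrix (Fin n) (Fin n) ℝ) (X : Tensor3 n) :
    slot1 (A - B) X = slot1 A X - slot1 B X := by
  funext a b c; simp [slot1, sub_mul, Finset.sum_sub_distrib]

theorem slot2_sub (A B : Matrix (Fin n) (Fin n) ℝ) (X : Tensor3 n) :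
    slot2 (A - B) X = slot2 A X - slot2 B X := by
  funext a b c; simp [slot2, sub_mul, Finset.sum_sub_distrib]

theorem slot3_sub (A B : Matrix (Fin n) (Fin n) ℝ) (X : Tensor3 n) :
    slot3 (A - B) X = slot3 A X - slot3 B X := by
  funext a b c; simp [slot3, sub_mul, Finset.sum_sub_distrib]

theorem slot1_sub_right (A : Matrix (Fin n) (Fin n) ℝ) (X Y : Tensor3 n) :
    slot1 A (X - Y) = slot1 A X - slot1 A Y := by
  funext a b c; simp [slot1, mul_sub, Finset.sum_sub_distrib]

theorem slot2_sub_right (A : Matrix (Fin n) (Fin n) ℝ) (X Y : Tensor3 n) :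
    slot2 A (X - Y) = slot2 A X - slot2 A Y := by
  funext a b c; simp [slot2, mul_sub, Finset.sum_sub_distrib]

theorem sm_slot3 (hM : SmM U M) (hX : ∀ a b c, Sm U fun z => X z a b c) (a b c : Fin n) :
    Sm U fun z => slot3 (M z) (X z) a b c :=
  show Sm U (fun z => ∑ k, M z c k * X z a b k) from Sm.sum fun k => (hM c k).mul (hX a b k)

theorem sm_slot2 (hM : SmM U M) (hX : ∀ a b c, Sm U fun z => X z a b c) (a b c : Fin n) :
    Sm U fun z => slot2 (M z) (X z) a b c :=
  show Sm U (fun z => ∑ k, M z b k * X z a k c) from Sm.sum fun k => (hM b k).mul (hX a k c)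

end TensorDerivative

namespace IsLeviCivitaFrame

variable {n : ℕ} {U : Set (Coord n)} {T : StringTriple n} {y : Coord n}
  {E g : Coord n → Matrix (Fin n) (Fin n) ℝ} {c γ : Fin n → Fin n → Fin n → Coord n → ℝ}

/-- Covariant differentiation of a three-index tensor commutes with the passage from the frame to
coordinates. -/
theorem act3_cov (h : IsLeviCivitaFrame U T E g c γ) (hy : y ∈ U) {N : Coord n → Tensor3 n}
    (hN : ∀ a b c, Sm U fun z => N z a b c) (d : Fin n) :
    act3 (E y).transpose (frameDT E d N y + (slot1 (connM γ d y).transpose (N y)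
        + slot2 (connM γ d y).transpose (N y) + slot3 (connM γ d y).transpose (N y)))
      = frameDT E d (fun z => act3 (E z).transpose (N z)) y
        + (slot1 (T.ΓE E d y).transpose (act3 (E y).transpose (N y))
          + slot2 (T.ΓE E d y).transpose (act3 (E y).transpose (N y))
          + slot3 (T.ΓE E d y).transpose (act3 (E y).transpose (N y))) := by
  have hD : frameDM E d (fun z => (E z).transpose) y = (E y).transpose * (connM γ d y).transpose
      - (T.ΓE E d y).transpose * (E y).transpose := by
    rw [← Matrix.transpose_mul, ← Matrix.transpose_mul, h.connM_mul hy, ← Matrix.transpose_sub,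
      add_sub_cancel_right]
    rfl
  have hE := h.smE.transpose
  have h3 := sm_slot3 hE hN
  have h2 := sm_slot2 hE h3
  unfold act3
  rw [frameDT_slot1 hE h2 hy, frameDT_slot2 hE h3 hy, frameDT_slot3 hE hN hy, hD]
  simp only [slot1_add, slot2_add, slot3_add, slot1_sub, slot2_sub, slot3_sub, slot1_sub_right,
    slot2_sub_right, slot2_slot1, slot3_slot1, slot3_slot2, slot1_slot1, slot2_slot2, slot3_slot3]
  abel

end IsLeviCivitaFrame

namespace IsConfigOn

variable {n : ℕ} {U : Set (Coord n)} {F : SymplecticTriple n} {y : Coord n}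

theorem mono {V : Set (Coord n)} (h : IsConfigOn U F) (hV : V ⊆ U) : IsConfigOn V F :=
  ⟨h.metric.mono hV, h.smβ.mono hV, fun y hy => h.skew y (hV hy), fun y hy => h.unitβ y (hV hy),
    h.smφ.mono hV⟩

theorem skew_inv (h : IsConfigOn U F) (hy : y ∈ U) : (F.βInv y).transpose = -F.βInv y := by
  rw [SymplecticTriple.βInv, Matrix.transpose_nonsing_inv, h.skew y hy, inv_neg_matrix (h.unitβ y hy)]

theorem unit_inv (h : IsConfigOn U F) (hy : y ∈ U) : IsUnit (F.βInv y).det := by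
  have h1 := h.unitβ y hy
  have h2 : (F.βInv y).det * (F.β y).det = 1 := by
    rw [← Matrix.det_mul, SymplecticTriple.βInv, Matrix.nonsing_inv_mul _ h1, Matrix.det_one]
  exact .of_mul_eq_one _ h2

theorem toStringTriple (h : IsConfigOn U F) : IsStringConfigOn U F.toStringTriple where
  metric :=
    { smooth := (((h.smβ.inv h.unitβ).mul h.metric.smooth).mul (h.smβ.inv h.unitβ)).neg
      symm := fun z hz => by
        have h1 := h.skew_inv hz
        have h2 := h.metric.symm z hz
        simp only [SymplecticTriple.toStringTriple, Matrix.transpose_neg, Matrix.transpose_mul, h1, h2,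
          neg_mul, mul_neg, neg_neg, mul_assoc]
      unit := fun z hz => by
        simp only [SymplecticTriple.toStringTriple, Matrix.det_neg, Matrix.det_mul]
        have h1 := h.unit_inv hz
        exact ((isUnit_neg_one (α := ℝ)).pow _).mul ((h1.mul (h.metric.unit z hz)).mul h1) }
  smB := h.smβ.inv h.unitβ
  skew := fun z hz => h.skew_inv hz
  smφ := h.smφ

theorem g_eq (h : IsConfigOn U F) (hy : y ∈ U) :
    F.g y = F.β y * F.toStringTriple.G y * (F.β y).transpose := by
  have hu := h.unitβ y hy
  simp only [SymplecticTriple.toStringTriple, SymplecticTriple.βInv, h.skew y hy, mul_neg, neg_mul,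
    neg_neg, mul_assoc]
  rw [Matrix.mul_nonsing_inv_cancel_left _ _ hu, Matrix.nonsing_inv_mul _ hu, mul_one]

theorem D_β_skew (hU : IsOpen U) (h : IsConfigOn U F) (hy : y ∈ U) (a b c : Fin n) :
    F.D a (fun z => F.β z b c) y = -F.D a (fun z => F.β z c b) y := by
  simp only [SymplecticTriple.D, ← Finset.sum_neg_distrib, ← mul_neg, ← pd_neg]
  refine Finset.sum_congr rfl fun m _ => ?_
  exact congrArg _ (pd_congr m hU (fun z hz => congrFun (congrFun (h.skew z hz) c) b) hy)

theorem bracket (hU : IsOpen U) (h : IsConfigOn U F) (hy : y ∈ U) (a b k : Fin n) :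
    F.D a (fun z => F.β z b k) y - F.D b (fun z => F.β z a k) y
      = ∑ m, F.twistedQ m a b y * F.β y m k := by
  have hu := h.unitβ y hy
  have h1 : ∑ m, F.Q m a b y * F.β y m k = -F.D k (fun z => F.β z a b) y := by
    simp only [SymplecticTriple.D, SymplecticTriple.Q, ← Finset.sum_neg_distrib]
    refine Finset.sum_congr rfl fun m _ => ?_
    have h2 : F.β y m k = -F.β y k m := congrFun (congrFun (h.skew y hy) k) m
    rw [h2]
    ring
  have h3 : ∑ m, (∑ p, F.Θ a b p y * F.βInv y p m) * F.β y m k = F.Θ a b k y := by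
    have h6 := sum_mul_sum_mul (fun p => F.Θ a b p y) (F.βInv y) (fun m => F.β y m k)
    rw [← h6]
    have h4 : F.βInv y * F.β y = 1 := Matrix.nonsing_inv_mul _ hu
    have h5 : ∀ p, ∑ m, F.βInv y p m * F.β y m k = (1 : Matrix (Fin n) (Fin n) ℝ) p k := fun p => by
      rw [← Matrix.mul_apply, h4]
    simp [h5, Matrix.one_apply]
  simp only [SymplecticTriple.twistedQ, add_mul, Finset.sum_add_distrib, h1, h3]
  rw [SymplecticTriple.Θ, h.D_β_skew hU hy b k a]
  ring

/-- `Γ̂` is the Levi-Civita connection of `G` in the frame `β^{am} ∂_m`; the structure functions of this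
frame are those of the twisted Koszul–Schouten bracket. -/
theorem isLeviCivitaFrame (hU : IsOpen U) (h : IsConfigOn U F) :
    IsLeviCivitaFrame U F.toStringTriple F.β F.g F.twistedQ F.Γ where
  isOpen := hU
  metric := h.toStringTriple.metric
  smE := h.smβ
  unitE := h.unitβ
  g_eq := fun _ hy => h.g_eq hy
  bracket := fun _ hy => h.bracket hU hy
  koszul := fun _ _ _ _ _ => rfl

/-- The flux `Θ` is `H` in the frame `β^{am} ∂_m`. -/
theorem Θ_eq (hU : IsOpen U) (h : IsConfigOn U F) (hy : y ∈ U) :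
    (fun a b c => F.Θ a b c y) = act3 (F.β y) (F.toStringTriple.H3 y) := by
  have hu := h.unitβ y hy
  have key : ∀ i b c, ∑ j, ∑ k, F.β y b j * F.β y c k * pd i (fun z => F.βInv z j k) y
      = pd i (fun z => F.β z b c) y := by
    intro i b c
    have h1 : F.β y * pdM i F.βInv y * (F.β y).transpose = pdM i F.β y := by
      have h2 : pdM i F.βInv y = _ := pdM_inv i hU h.smβ h.unitβ hy
      rw [h2, h.skew y hy]
      simp only [mul_neg, neg_mul, neg_neg, mul_assoc]
      rw [Matrix.mul_nonsing_inv_cancel_left _ _ hu, Matrix.nonsing_inv_mul _ hu, mul_one]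
    have h3 := congrFun (congrFun h1 b) c
    rw [pdM_apply] at h3
    rw [← h3]
    simp only [Matrix.mul_apply, Matrix.transpose_apply, pdM_apply, Finset.sum_mul]
    rw [Finset.sum_comm]
    exact Finset.sum_congr rfl fun _ _ => Finset.sum_congr rfl fun _ _ => by ring
  have key2 : ∀ a b c, ∑ i, ∑ j, ∑ k, F.β y a i * F.β y b j * F.β y c k
      * pd i (fun z => F.βInv z j k) y = F.D a (fun z => F.β z b c) y := by
    intro a b c
    simp only [SymplecticTriple.D, ← key, Finset.mul_sum]
    exact Finset.sum_congr rfl fun _ _ => Finset.sum_congr rfl fun _ _ =>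
      Finset.sum_congr rfl fun _ _ => by ring
  funext a b c
  rw [act3_apply]
  simp only [StringTriple.H3, StringTriple.H, SymplecticTriple.toStringTriple, mul_add,
    Finset.sum_add_distrib, SymplecticTriple.Θ, ← key2]
  congr 1
  · congr 1
    rw [Finset.sum_congr rfl (fun i _ => Finset.sum_comm), Finset.sum_comm]
    exact Finset.sum_congr rfl fun _ _ => Finset.sum_congr rfl fun _ _ =>
      Finset.sum_congr rfl fun _ _ => by ring
  · rw [Finset.sum_comm]
    rw [Finset.sum_congr rfl (fun i _ => Finset.sum_comm)]
    exact Finset.sum_congr rfl fun _ _ => Finset.sum_congr rfl fun _ _ =>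
      Finset.sum_congr rfl fun _ _ => by ring

theorem scalarCurv_eq (hU : IsOpen U) (h : IsConfigOn U F) (hy : y ∈ U) :
    F.scalarCurv y = F.toStringTriple.scalarCurv y :=
  StringTriple.scalarCurv_eq_of_frame (h.isLeviCivitaFrame hU) hy

theorem kinetic_eq (hU : IsOpen U) (h : IsConfigOn U F) (hy : y ∈ U) :
    F.kinetic y = F.toStringTriple.kinetic y := by
  have h1 := StringTriple.kinetic_eq_of_frame (h.isLeviCivitaFrame hU) hy
  exact h1

theorem ΘLow_eq : (fun a b c => F.ΘLow a b c y) = act3 (F.gInv y) (fun a b c => F.Θ a b c y) := by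
  funext a b c
  rw [act3_apply]
  rfl

theorem ΘSq_eq (hU : IsOpen U) (h : IsConfigOn U F) (hy : y ∈ U) :
    F.ΘSq y = F.toStringTriple.HSq y := by
  rw [← StringTriple.HSq_of_frame (h.isLeviCivitaFrame hU) hy, ← h.Θ_eq hU hy]
  have h1 := ΘLow_eq (F := F) (y := y)
  rw [SymplecticTriple.gInv] at h1
  rw [← h1]
  rfl

theorem ΘSqTensor_eq (hU : IsOpen U) (h : IsConfigOn U F) (hy : y ∈ U) :
    (Matrix.of fun a b => F.ΘSqTensor a b y)
      = F.β y * F.toStringTriple.HSqM y * (F.β y).transpose := by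
  rw [← StringTriple.HSqM_of_frame (h.isLeviCivitaFrame hU) hy, ← h.Θ_eq hU hy]
  ext a b
  simp only [Matrix.of_apply, SymplecticTriple.ΘSqTensor, pair23, slot2, slot3, Finset.mul_sum,
    SymplecticTriple.gInv]
  exact Finset.sum_congr rfl fun _ _ => Finset.sum_congr rfl fun _ _ =>
      Finset.sum_congr rfl fun _ _ => Finset.sum_congr rfl fun _ _ => by ring

theorem weight_eq (h : IsConfigOn U F) (hy : y ∈ U) :
    Real.sqrt |(F.g y).det| * (F.βInv y).det * Real.exp (-2 * F.φ y)
      = F.toStringTriple.weight y := by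
  have h1 : 0 < (F.βInv y).det := det_pos_of_skew (h.skew_inv hy) (h.unit_inv hy)
  have h2 : |(F.toStringTriple.G y).det| = |(F.g y).det| * (F.βInv y).det ^ 2 := by
    simp only [SymplecticTriple.toStringTriple, Matrix.det_neg, Matrix.det_mul, abs_mul, abs_pow,
      abs_neg, abs_one, one_pow, abs_of_pos h1]
    ring
  rw [StringTriple.weight, h2, Real.sqrt_mul (abs_nonneg _), Real.sqrt_sq h1.le]
  rfl

/-- The Lagrangian of symplectic gravity is that of the bosonic string. -/
theorem density_eq (hU : IsOpen U) (h : IsConfigOn U F) (hy : y ∈ U) :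
    F.density y = F.toStringTriple.density y := by
  rw [SymplecticTriple.density, h.weight_eq hy, h.scalarCurv_eq hU hy, h.kinetic_eq hU hy,
    h.ΘSq_eq hU hy]
  rfl

/-- `∇̂^m Θ_{mab}` in coordinates. -/
theorem div_Θ_eq (hU : IsOpen U) (h : IsConfigOn U F) (hy : y ∈ U) :
    (F.β y).transpose * (Matrix.of fun a b => ∑ m, F.covΘ m m a b y) * F.β y
      = Matrix.of fun a b => ∑ i, F.toStringTriple.covHup i y i a b := by
  have hf := h.isLeviCivitaFrame hU
  have hu := h.unitβ y hy
  set T := F.toStringTriple with hT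
  have hup : ∀ z ∈ U, act3 (F.β z).transpose (fun a b c => F.ΘLow a b c z) = T.Hup z := by
    intro z hz
    rw [ΘLow_eq, h.Θ_eq hU hz, act3_act3, act3_act3, SymplecticTriple.gInv, hf.inv_g hz]
    rfl
  have hΘ : ∀ a b c, Sm U (F.Θ a b c) := fun a b c =>
    (((h.smβ b c).frameD h.smβ a).add ((h.smβ c a).frameD h.smβ b)).add ((h.smβ a b).frameD h.smβ c)
  have hN : ∀ a b c, Sm U (F.ΘLow a b c) := fun a b c =>
    Sm.sum fun i => Sm.sum fun j => Sm.sum fun k => (((h.metric.smooth_inv a i).mul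
      (h.metric.smooth_inv b j)).mul (h.metric.smooth_inv c k)).mul (hΘ i j k)
  have hcov : ∀ d, (fun a b c => F.covΘ d a b c y) = frameDT F.β d (fun z a b c => F.ΘLow a b c z) y
      + (slot1 (connM F.Γ d y).transpose (fun a b c => F.ΘLow a b c y)
        + slot2 (connM F.Γ d y).transpose (fun a b c => F.ΘLow a b c y)
        + slot3 (connM F.Γ d y).transpose (fun a b c => F.ΘLow a b c y)) := by
    intro d
    funext a b c
    simp only [SymplecticTriple.covΘ, Finset.sum_add_distrib, Pi.add_apply, slot1, slot2, slot3, connM,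
      Matrix.transpose_apply, Matrix.of_apply]
    rfl
  have hact : ∀ d, act3 (F.β y).transpose (fun a b c => F.covΘ d a b c y)
      = fun p j k => ∑ i, F.β y d i * T.covHup i y p j k := by
    intro d
    rw [hcov, hf.act3_cov hy hN, hup y hy]
    funext p j k
    simp only [Pi.add_apply, StringTriple.covHup, mul_add, Finset.sum_add_distrib]
    congr 1
    · exact frameD_congr hU (fun z hz => congrFun (congrFun (congrFun (hup z hz) p) j) k) hy d
    · simp only [slot1, slot2, slot3, StringTriple.ΓE, Matrix.transpose_apply, Matrix.of_apply,
        Finset.sum_mul, Finset.mul_sum, mul_assoc]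
      congr 1
      · congr 1
        · exact Finset.sum_comm
        · exact Finset.sum_comm
      · exact Finset.sum_comm
  have hslot : ∀ d, slot2 (F.β y).transpose (slot3 (F.β y).transpose (fun a b c => F.covΘ d a b c y))
      = slot1 ((F.β y)⁻¹).transpose (fun p j k => ∑ i, F.β y d i * T.covHup i y p j k) := by
    intro d
    rw [← hact, act3, slot1_slot1, ← Matrix.transpose_mul, Matrix.mul_nonsing_inv _ hu]
    funext a b c
    simp [slot1, Matrix.one_apply]
  have hinv : ∀ p i, ∑ m, (F.β y)⁻¹ p m * F.β y m i = if p = i then 1 else 0 := fun p i => by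
    rw [← Matrix.mul_apply, Matrix.nonsing_inv_mul _ hu, Matrix.one_apply]
  ext j k
  have h1 : ∑ m, slot2 (F.β y).transpose (slot3 (F.β y).transpose
      (fun a b c => F.covΘ m a b c y)) m j k = ∑ i, T.covHup i y i j k := by
    simp only [hslot, slot1, Matrix.transpose_apply]
    calc ∑ m, ∑ p, (F.β y)⁻¹ p m * ∑ i, F.β y m i * T.covHup i y p j k
        = ∑ p, ∑ i, (∑ m, (F.β y)⁻¹ p m * F.β y m i) * T.covHup i y p j k := by
          rw [Finset.sum_comm]
          exact Finset.sum_congr rfl fun p _ => sum_mul_sum_mul _ _ _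
      _ = _ := by simp [hinv]
  rw [Matrix.of_apply, ← h1]
  simp only [slot2, slot3, Matrix.mul_apply, Matrix.transpose_apply, Matrix.of_apply, Finset.mul_sum,
    Finset.sum_mul]
  have e : ∀ f : Fin n → Fin n → Fin n → ℝ,
      ∑ k, ∑ j, ∑ m, f k j m = ∑ m, ∑ j, ∑ k, f k j m := by
    intro f
    rw [Finset.sum_comm, Finset.sum_congr rfl (fun x _ => Finset.sum_comm), Finset.sum_comm]
  rw [e]
  exact Finset.sum_congr rfl fun _ _ => Finset.sum_congr rfl fun _ _ =>
    Finset.sum_congr rfl fun _ _ => by ring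

theorem dφ_Θ_eq (hU : IsOpen U) (h : IsConfigOn U F) (hy : y ∈ U) :
    (F.β y).transpose * (Matrix.of fun a b => ∑ m, F.D m F.φ y * F.ΘLow m a b y) * F.β y
      = Matrix.of fun a b => ∑ i, pd i F.φ y * F.toStringTriple.Hup y i a b := by
  have hf := h.isLeviCivitaFrame hU
  have hup : act3 (F.β y).transpose (fun a b c => F.ΘLow a b c y) = F.toStringTriple.Hup y := by
    rw [ΘLow_eq, h.Θ_eq hU hy, act3_act3, act3_act3, SymplecticTriple.gInv, hf.inv_g hy]
    rfl
  ext j k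
  rw [← hup]
  simp only [act3_apply, SymplecticTriple.D, Matrix.mul_apply, Matrix.transpose_apply,
    Matrix.of_apply, Finset.mul_sum, Finset.sum_mul]
  have e : ∀ f : Fin n → Fin n → Fin n → Fin n → ℝ,
      ∑ k, ∑ j, ∑ m, ∑ i, f k j m i = ∑ i, ∑ m, ∑ j, ∑ k, f k j m i := by
    intro f
    rw [Finset.sum_comm]
    rw [Finset.sum_congr rfl (fun x _ => Finset.sum_comm), Finset.sum_comm]
    rw [Finset.sum_congr rfl (fun x _ => Finset.sum_congr rfl fun z _ => Finset.sum_comm)]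
    rw [Finset.sum_congr rfl (fun x _ => Finset.sum_comm), Finset.sum_comm]
  rw [e]
  exact Finset.sum_congr rfl fun _ _ => Finset.sum_congr rfl fun _ _ =>
    Finset.sum_congr rfl fun _ _ => Finset.sum_congr rfl fun _ _ => by ring

theorem conj_eq_zero_iff {E X : Matrix (Fin n) (Fin n) ℝ} (hE : IsUnit E.det) :
    E.transpose * X * E = 0 ↔ X = 0 := by
  have hE' : IsUnit E.transpose.det := by rwa [Matrix.det_transpose]
  refine ⟨fun h => ?_, fun h => by simp [h]⟩
  have h1 : E.transpose⁻¹ * (E.transpose * X * E) * E⁻¹ = X := by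
    rw [mul_assoc E.transpose, Matrix.nonsing_inv_mul_cancel_left _ _ hE',
      Matrix.mul_nonsing_inv_cancel_right _ _ hE]
  rw [← h1, h]
  simp

/-- The equations of motion of symplectic gravity are those of the bosonic string. -/
theorem equationsOfMotion_iff (hU : IsOpen U) (h : IsConfigOn U F) (hy : y ∈ U) :
    F.EquationsOfMotionAt y ↔ (∀ a b, F.toStringTriple.eomG a b y = 0) ∧
      F.toStringTriple.eomφ y = 0 ∧ ∀ b c, F.toStringTriple.eomB b c y = 0 := by
  have hf := h.isLeviCivitaFrame hU
  have hs := h.toStringTriple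
  have hu := h.unitβ y hy
  have hu' : IsUnit (F.β y).transpose.det := by rwa [Matrix.det_transpose]
  set T := F.toStringTriple with hT
  have hlap : ∑ a, ∑ b, F.gInv y a b * F.hess a b y = T.lap y := by
    have h1 := sum_mul_congr_frame (F.g y)⁻¹ (Matrix.of fun a b => T.hess a b y) (F.β y)
    rw [← hf.frameHess_eq hy h.smφ, hf.inv_g hy] at h1
    exact h1
  have e2 : (∀ a b, F.Ric a b y + 2 * F.hess a b y - (1 / 4) * F.ΘSqTensor a b y = 0)
      ↔ ∀ a b, T.eomG a b y = 0 := by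
    have h1 : (F.β y) * (Matrix.of fun a b => T.eomG a b y) * (F.β y).transpose
        = Matrix.of fun a b => F.Ric a b y + 2 * F.hess a b y - (1 / 4) * F.ΘSqTensor a b y := by
      have h2 : (Matrix.of fun a b => T.eomG a b y) = (Matrix.of fun a b => T.Ric a b y)
          + (2 : ℝ) • (Matrix.of fun a b => T.hess a b y) - (1 / 4 : ℝ) • T.HSqM y := by
        ext a b
        rfl
      have h3 : (Matrix.of fun a b => F.Ric a b y + 2 * F.hess a b y
          - (1 / 4) * F.ΘSqTensor a b y) = (Matrix.of fun a b => F.Ric a b y)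
          + (2 : ℝ) • (Matrix.of fun a b => F.hess a b y)
          - (1 / 4 : ℝ) • (Matrix.of fun a b => F.ΘSqTensor a b y) := by
        ext a b
        rfl
      have h4 : (Matrix.of fun a b => F.Ric a b y) = _ := hf.frameRic_eq hy
      have h5 : (Matrix.of fun a b => F.hess a b y) = _ := hf.frameHess_eq hy h.smφ
      rw [h2, h3, h4, h5, h.ΘSqTensor_eq hU hy]
      simp only [mul_add, mul_sub, add_mul, sub_mul, mul_smul_comm, smul_mul_assoc]
      rfl
    have h6 := conj_eq_zero_iff (X := Matrix.of fun a b => T.eomG a b y) hu'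
    rw [Matrix.transpose_transpose, h1] at h6
    constructor
    · intro h7 a b
      exact congrFun (congrFun (h6.1 (by ext a b; exact h7 a b)) a) b
    · intro h7 a b
      exact congrFun (congrFun (h6.2 (by ext a b; exact h7 a b)) a) b
  have e3 : (∀ a b, (1 / 2) * (∑ m, F.covΘ m m a b y) - ∑ m, F.D m F.φ y * F.ΘLow m a b y = 0)
      ↔ ∀ b c, T.eomB b c y = 0 := by
    have h1 : (F.β y).transpose * (Matrix.of fun a b => (1 / 2) * (∑ m, F.covΘ m m a b y)
        - ∑ m, F.D m F.φ y * F.ΘLow m a b y) * F.β y = Matrix.of fun a b => (1 / 2) *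
          (∑ i, T.covHup i y i a b - 2 * ∑ i, pd i F.φ y * T.Hup y i a b) := by
      have h2 : (Matrix.of fun a b => (1 / 2) * (∑ m, F.covΘ m m a b y)
          - ∑ m, F.D m F.φ y * F.ΘLow m a b y)
          = (1 / 2 : ℝ) • (Matrix.of fun a b => ∑ m, F.covΘ m m a b y)
            - Matrix.of fun a b => ∑ m, F.D m F.φ y * F.ΘLow m a b y := by
        ext a b
        rfl
      rw [h2, mul_sub, sub_mul, mul_smul_comm, smul_mul_assoc, h.div_Θ_eq hU hy, h.dφ_Θ_eq hU hy]
      ext a b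
      simp only [Matrix.sub_apply, Matrix.smul_apply, Matrix.of_apply, smul_eq_mul]
      ring
    have h6 := conj_eq_zero_iff (X := Matrix.of fun a b => (1 / 2) * (∑ m, F.covΘ m m a b y)
        - ∑ m, F.D m F.φ y * F.ΘLow m a b y) hu
    rw [h1] at h6
    have hw := (StringTriple.weight_pos hs.metric hy).ne'
    have h8 : ∀ b c, T.eomB b c y = 0 ↔ (1 / 2) *
          (∑ i, T.covHup i y i b c - 2 * ∑ i, pd i F.φ y * T.Hup y i b c) = 0 := by
      intro b c
      rw [StringTriple.eomB_eq hU hs hy, mul_eq_zero, mul_eq_zero]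
      constructor
      · rintro (h9 | h9)
        · exact absurd h9 hw
        · exact .inr h9
      · rintro (h9 | h9)
        · norm_num at h9
        · exact .inr h9
    simp only [h8]
    constructor
    · intro h7 a b
      exact congrFun (congrFun (h6.2 (by ext a b; exact h7 a b)) a) b
    · intro h7 a b
      exact congrFun (congrFun (h6.1 (by ext a b; exact h7 a b)) a) b
  unfold SymplecticTriple.EquationsOfMotionAt
  rw [e2, e3, hlap, h.kinetic_eq hU hy, h.ΘSq_eq hU hy]
  have htr : (∀ a b, T.eomG a b y = 0) → T.scalarCurv y + 2 * T.lap y - (1 / 4) * T.HSq y = 0 := by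
    intro h1
    have h2 : ∑ a, ∑ b, T.GInv y a b * T.eomG a b y
        = T.scalarCurv y + 2 * T.lap y - (1 / 4) * T.HSq y := by
      rw [StringTriple.HSq_eq_trace]
      simp only [StringTriple.eomG, StringTriple.scalarCurv, StringTriple.lap, mul_sub, mul_add,
        Finset.sum_add_distrib, Finset.sum_sub_distrib, Finset.mul_sum]
      congr 1
      · congr 1
        exact Finset.sum_congr rfl fun _ _ => Finset.sum_congr rfl fun _ _ => by ring
      · exact Finset.sum_congr rfl fun _ _ => Finset.sum_congr rfl fun _ _ => by ring
    rw [← h2]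
    simp [h1]
  constructor
  · rintro ⟨h1, h2, h3⟩
    refine ⟨h2, ?_, h3⟩
    have := htr h2
    unfold StringTriple.eomφ
    linarith
  · rintro ⟨h2, h1, h3⟩
    refine ⟨?_, h2, h3⟩
    have := htr h2
    unfold StringTriple.eomφ at h1
    linarith

end IsConfigOn

/-! ### Changes of coordinates -/

/-- `τ` is smooth on `U` with values in `U'` and has an invertible Jacobian matrix there. -/
structure IsLocalCoordChange {n : ℕ} (U U' : Set (Coord n)) (τ : Coord n → Coord n) : Prop where
  isOpen : IsOpen U
  isOpen' : IsOpen U'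
  smooth : ∀ k, Sm U (fun z => τ z k)
  mapsTo : ∀ y ∈ U, τ y ∈ U'
  unit : ∀ y ∈ U, IsUnit (jac τ y).det

namespace IsLocalCoordChange

variable {n : ℕ} {U U' : Set (Coord n)} {τ : Coord n → Coord n} {y : Coord n}

theorem differentiableAt (h : IsLocalCoordChange U U' τ) (hy : y ∈ U) : DifferentiableAt ℝ τ y :=
  differentiableAt_pi.2 fun k => (h.smooth k).differentiableAt hy

theorem jac_apply (h : IsLocalCoordChange U U' τ) (hy : y ∈ U) (k i : Fin n) :
    jac τ y k i = pd i (fun z => τ z k) y := by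
  have h1 : HasFDerivAt (fun z => τ z k) ((ContinuousLinearMap.proj k).comp (fderiv ℝ τ y)) y :=
    hasFDerivAt_pi'.1 (h.differentiableAt hy).hasFDerivAt k
  unfold pd
  rw [h1.fderiv, jac, LinearMap.toMatrix'_apply]
  simp only [ContinuousLinearMap.coe_coe, ContinuousLinearMap.comp_apply,
    ContinuousLinearMap.proj_apply]

theorem smM_jac (h : IsLocalCoordChange U U' τ) : SmM U (jac τ) := fun k i =>
  ((h.smooth k).pd i).congr h.isOpen fun _ hz => h.jac_apply hz k i

theorem sm_comp (h : IsLocalCoordChange U U' τ) {f : Coord n → ℝ} (hf : Sm U' f) :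
    Sm U (fun z => f (τ z)) := fun z hz =>
  ContDiffAt.comp z (hf _ (h.mapsTo z hz)) (contDiffAt_pi.2 fun k => h.smooth k z hz)

theorem pd_comp (h : IsLocalCoordChange U U' τ) {f : Coord n → ℝ} (hf : Sm U' f) (hy : y ∈ U)
    (i : Fin n) : pd i (fun z => f (τ z)) y = ∑ k, pd k f (τ y) * jac τ y k i := by
  have h1 : fderiv ℝ (fun z => f (τ z)) y = (fderiv ℝ f (τ y)).comp (fderiv ℝ τ y) :=
    fderiv_comp y (hf.differentiableAt (h.mapsTo y hy)) (h.differentiableAt hy)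
  have h2 : fderiv ℝ τ y (Pi.single i 1) = ∑ k, jac τ y k i • (Pi.single k 1 : Coord n) := by
    funext k
    simp only [jac, LinearMap.toMatrix'_apply, Finset.sum_apply, Pi.smul_apply, Pi.single_apply,
      smul_eq_mul, mul_ite, mul_one, mul_zero, Finset.sum_ite_eq, Finset.mem_univ, if_true,
      ContinuousLinearMap.coe_coe]
  unfold pd
  rw [h1, ContinuousLinearMap.comp_apply, h2, map_sum]
  refine Finset.sum_congr rfl fun k _ => ?_
  rw [map_smul, smul_eq_mul, mul_comm]

/-- The coordinate vectors of the target coordinates, as a frame in the source coordinates. -/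
def frame (τ : Coord n → Coord n) (z : Coord n) : Matrix (Fin n) (Fin n) ℝ := ((jac τ z)⁻¹).transpose

theorem frameD_comp (h : IsLocalCoordChange U U' τ) {f : Coord n → ℝ} (hf : Sm U' f) (hy : y ∈ U)
    (a : Fin n) : frameD (frame τ) a (fun z => f (τ z)) y = pd a f (τ y) := by
  have h1 : ∀ k, ∑ i, jac τ y k i * (jac τ y)⁻¹ i a = (1 : Matrix (Fin n) (Fin n) ℝ) k a := fun k => by
    rw [← Matrix.mul_apply, Matrix.mul_nonsing_inv _ (h.unit y hy)]
  have h2 : frameD (frame τ) a (fun z => f (τ z)) y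
      = ∑ k, pd k f (τ y) * ∑ i, jac τ y k i * (jac τ y)⁻¹ i a := by
    simp only [frameD, h.pd_comp hf hy, frame, Matrix.transpose_apply, Finset.mul_sum]
    rw [Finset.sum_comm]
    exact Finset.sum_congr rfl fun _ _ => Finset.sum_congr rfl fun _ _ => by ring
  rw [h2]
  simp [h1, Matrix.one_apply]

theorem pd_jac_symm (h : IsLocalCoordChange U U' τ) (hy : y ∈ U) (i j k : Fin n) :
    pd i (fun z => jac τ z k j) y = pd j (fun z => jac τ z k i) y := by
  rw [pd_congr i h.isOpen (fun z hz => h.jac_apply hz k j) hy,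
    pd_congr j h.isOpen (fun z hz => h.jac_apply hz k i) hy]
  exact pd_comm i j (h.smooth k) hy

/-- The columns of the inverse Jacobian are coordinate vector fields of the new coordinates, hence
commute. -/
theorem frame_bracket (h : IsLocalCoordChange U U' τ) (hy : y ∈ U) (a b k : Fin n) :
    frameD (frame τ) a (fun z => frame τ z b k) y = frameD (frame τ) b (fun z => frame τ z a k) y := by
  have key : ∀ a b, frameD (frame τ) a (fun z => frame τ z b k) y
      = -∑ p, (jac τ y)⁻¹ k p * ∑ q, ∑ i, (jac τ y)⁻¹ i a * (jac τ y)⁻¹ q b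
        * pd i (fun z => jac τ z p q) y := by
    intro a b
    have h1 : ∀ i, pd i (fun z => (jac τ z)⁻¹ k b) y
        = -((jac τ y)⁻¹ * pdM i (jac τ) y * (jac τ y)⁻¹) k b := fun i => by
      have h2 := congrFun (congrFun (pdM_inv i h.isOpen h.smM_jac h.unit hy) k) b
      exact h2
    simp only [frameD, frame, Matrix.transpose_apply]
    simp only [h1, Matrix.mul_apply, pdM_apply, mul_neg,
      Finset.sum_neg_distrib, Finset.mul_sum, Finset.sum_mul]
    congr 1
    rw [Finset.sum_comm, Finset.sum_congr rfl (fun x _ => Finset.sum_comm), Finset.sum_comm]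
    exact Finset.sum_congr rfl fun _ _ => Finset.sum_congr rfl fun _ _ =>
      Finset.sum_congr rfl fun _ _ => by ring
  rw [key, key]
  congr 1
  refine Finset.sum_congr rfl fun p _ => ?_
  congr 1
  rw [Finset.sum_comm]
  exact Finset.sum_congr rfl fun q _ => Finset.sum_congr rfl fun i _ => by
    rw [h.pd_jac_symm hy]; ring

/-- The Levi-Civita connection of the target coordinates, in the source coordinates. -/
theorem isLeviCivitaFrame (h : IsLocalCoordChange U U' τ) {T T' : StringTriple n}
    (hT : IsMetricOn U T.G) (hT' : IsMetricOn U' T'.G)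
    (hG : ∀ z ∈ U, T.G z = (jac τ z).transpose * T'.G (τ z) * jac τ z) :
    IsLeviCivitaFrame U T (frame τ) (fun z => T'.G (τ z)) (fun _ _ _ _ => 0)
      (fun p a b z => T'.Γ p a b (τ z)) where
  isOpen := h.isOpen
  metric := hT
  smE := (h.smM_jac.inv h.unit).transpose
  unitE := fun z hz => by
    rw [frame, Matrix.det_transpose]
    exact Matrix.isUnit_nonsing_inv_det _ (h.unit z hz)
  g_eq := fun z hz => by
    have h1 := h.unit z hz
    have h2 : IsUnit (jac τ z).transpose.det := by rwa [Matrix.det_transpose]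
    rw [hG z hz, frame, Matrix.transpose_transpose, Matrix.transpose_nonsing_inv]
    simp only [mul_assoc]
    rw [Matrix.nonsing_inv_mul_cancel_left _ _ h2, Matrix.mul_nonsing_inv _ h1, mul_one]
  bracket := fun z hz a b k => by
    rw [h.frame_bracket hz, sub_self]
    simp
  koszul := fun z hz p a b => by
    simp only [h.frameD_comp (hT'.smooth _ _) hz]
    simp [StringTriple.Γ, StringTriple.GInv]

/-- `H = dB` transforms as a three-form. -/
theorem H3_eq (h : IsLocalCoordChange U U' τ) {T T' : StringTriple n}
    (hT' : IsStringConfigOn U' T')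
    (hB : ∀ z ∈ U, T.B z = (jac τ z).transpose * T'.B (τ z) * jac τ z) (hy : y ∈ U) :
    T.H3 y = act3 (jac τ y).transpose (T'.H3 (τ y)) := by
  set J := jac τ y with hJ
  let S : Tensor3 n := fun a b c => ((pdM a (jac τ) y).transpose * T'.B (τ y) * J) b c
  have hS : ∀ a b c, S a b c = S b a c := by
    intro a b c
    simp only [S, mul_assoc]
    rw [Matrix.mul_apply, Matrix.mul_apply]
    exact Finset.sum_congr rfl fun k _ => by
      rw [Matrix.transpose_apply, Matrix.transpose_apply, pdM_apply, pdM_apply, h.pd_jac_symm hy]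
  let X : Tensor3 n := fun p q r => pd p (fun z => T'.B z q r) (τ y)
  have hBτ : SmM U (fun z => T'.B (τ z)) := fun q r => h.sm_comp (hT'.smB q r)
  have hd : ∀ a b c, pd a (fun z => T.B z b c) y = S a b c - S a c b + act3 J.transpose X a b c := by
    intro a b c
    have h1 : pdM a T.B y = pdM a (fun z => (jac τ z).transpose * T'.B (τ z) * jac τ z) y :=
      pdM_congr a h.isOpen hB hy
    rw [pdM_mul a (h.smM_jac.transpose.mul hBτ) h.smM_jac hy, pdM_mul a h.smM_jac.transpose hBτ hy,
      pdM_transpose, add_mul] at h1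
    have h2 : J.transpose * T'.B (τ y) * pdM a (jac τ) y
        = -((pdM a (jac τ) y).transpose * T'.B (τ y) * J).transpose := by
      simp only [Matrix.transpose_mul, Matrix.transpose_transpose, hT'.skew _ (h.mapsTo y hy), mul_assoc,
        neg_mul, mul_neg, neg_neg]
    have h3 : (J.transpose * pdM a (fun z => T'.B (τ z)) y * J) b c = act3 J.transpose X a b c := by
      rw [act3_apply]
      simp only [Matrix.mul_apply, Matrix.transpose_apply, pdM_apply, h.pd_comp (hT'.smB _ _) hy, X,
        Finset.sum_mul, Finset.mul_sum]
      rw [Finset.sum_congr rfl (fun x _ => Finset.sum_comm), Finset.sum_comm]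
      refine Finset.sum_congr rfl fun _ _ => ?_
      rw [Finset.sum_comm]
      exact Finset.sum_congr rfl fun _ _ => Finset.sum_congr rfl fun _ _ => by ring
    have h4 := congrFun (congrFun h1 b) c
    rw [h2, Matrix.add_apply, Matrix.add_apply, h3] at h4
    rw [pdM_apply] at h4
    rw [h4]
    simp only [S, Matrix.neg_apply, Matrix.transpose_apply]
    ring
  have hcyc : ∀ (Y : Tensor3 n) a b c, act3 J.transpose Y b c a
      = act3 J.transpose (fun p q r => Y q r p) a b c := by
    intro Y a b c
    rw [act3_apply, act3_apply]
    rw [Finset.sum_congr rfl (fun x _ => Finset.sum_comm), Finset.sum_comm]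
    exact Finset.sum_congr rfl fun _ _ => Finset.sum_congr rfl fun _ _ =>
      Finset.sum_congr rfl fun _ _ => by ring
  funext a b c
  have h5 : act3 J.transpose (T'.H3 (τ y)) a b c = act3 J.transpose X a b c
      + act3 J.transpose X b c a + act3 J.transpose X c a b := by
    rw [hcyc X a b c, (hcyc X b c a).trans (hcyc _ a b c)]
    simp only [act3_apply, ← Finset.sum_add_distrib, ← mul_add]
    rfl
  rw [h5, StringTriple.H3, StringTriple.H, hd, hd, hd]
  have h6 := hS a b c
  have h7 := hS a c b
  have h8 := hS b c a
  linarith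

/-- The Lagrangian of the bosonic string is a density. -/
theorem string_density_eq (h : IsLocalCoordChange U U' τ) {T T' : StringTriple n}
    (hT : IsStringConfigOn U T) (hT' : IsStringConfigOn U' T')
    (hlaw : ∀ z ∈ U, stringLaw (jac τ z) T T' z (τ z)) (hy : y ∈ U) :
    T.density y = |(jac τ y).det| * T'.density (τ y) := by
  have hf := h.isLeviCivitaFrame hT.metric hT'.metric fun z hz => (hlaw z hz).1
  have hτy := h.mapsTo y hy
  have hcurv : T.scalarCurv y = T'.scalarCurv (τ y) := by
    rw [← StringTriple.scalarCurv_eq_of_frame hf hy]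
    simp only [frameRiem, h.frameD_comp (StringTriple.sm_Γ hT'.metric _ _ _) hy, mul_zero,
      Finset.sum_const_zero, sub_zero]
    rfl
  have hkin : T.kinetic y = T'.kinetic (τ y) := by
    have h1 : ∀ a, frameD (frame τ) a T.φ y = pd a T'.φ (τ y) := fun a => by
      rw [frameD_congr h.isOpen (g := fun z => T'.φ (τ z)) (fun z hz => (hlaw z hz).2.2.symm) hy,
        h.frameD_comp hT'.smφ hy]
    rw [← StringTriple.kinetic_eq_of_frame hf hy]
    simp only [h1]
    rfl
  have hH : act3 (frame τ y) (T.H3 y) = T'.H3 (τ y) := by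
    rw [h.H3_eq hT' (fun z hz => (hlaw z hz).2.1) hy, act3_act3, frame, ← Matrix.transpose_mul,
      Matrix.mul_nonsing_inv _ (h.unit y hy), Matrix.transpose_one, act3_one]
  have hHsq : T.HSq y = T'.HSq (τ y) := by
    rw [← StringTriple.HSq_of_frame hf hy, hH, StringTriple.HSq_eq]
    rfl
  have hw : T.weight y = |(jac τ y).det| * T'.weight (τ y) := by
    have h1 : |(T.G y).det| = (jac τ y).det ^ 2 * |(T'.G (τ y)).det| := by
      rw [(hlaw y hy).1, Matrix.det_mul, Matrix.det_mul, Matrix.det_transpose, abs_mul, abs_mul,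
        ← sq_abs]
      ring
    rw [StringTriple.weight, StringTriple.weight, h1, Real.sqrt_mul (sq_nonneg _),
      Real.sqrt_sq_eq_abs, (hlaw y hy).2.2]
    ring
  have h2 : ∀ (S : StringTriple n) z, S.density z
      = S.weight z * (S.scalarCurv z - (1 / 12) * S.HSq z + 4 * S.kinetic z) := fun _ _ => rfl
  rw [h2, h2, hw, hcurv, hkin, hHsq]
  ring

end IsLocalCoordChange

theorem isLocalCoordChange_id {n : ℕ} {U : Set (Coord n)} (hU : IsOpen U) :
    IsLocalCoordChange U U id where
  isOpen := hU
  isOpen' := hU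
  smooth := fun k z _ => by simp only [id]; fun_prop
  mapsTo := fun _ hy => hy
  unit := fun y _ => by simp [jac]

/-- The Lagrangian depends only on the fields near the point. -/
theorem string_density_congr {n : ℕ} {U : Set (Coord n)} (hU : IsOpen U) {T T' : StringTriple n}
    (hT : IsStringConfigOn U T) (hT' : IsStringConfigOn U T') (hG : ∀ z ∈ U, T.G z = T'.G z)
    (hB : ∀ z ∈ U, T.B z = T'.B z) (hφ : ∀ z ∈ U, T.φ z = T'.φ z) {y : Coord n} (hy : y ∈ U) :
    T.density y = T'.density y := by
  have h1 := (isLocalCoordChange_id hU).string_density_eq hT hT' (fun z hz => by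
    have : jac (id : Coord n → Coord n) z = 1 := by simp [jac]
    rw [this]
    simp only [stringLaw, id, Matrix.transpose_one, one_mul, mul_one]
    exact ⟨hG z hz, hB z hz, (hφ z hz).symm⟩) hy
  simpa [jac] using h1

/-- The field redefinition is compatible with changes of coordinates. -/
theorem stringLaw_of_symplecticLaw {n : ℕ} {J : Matrix (Fin n) (Fin n) ℝ} (hJ : IsUnit J.det)
    {F F' : SymplecticTriple n} {y y' : Coord n} (h : symplecticLaw J F F' y y') :
    stringLaw J F.toStringTriple F'.toStringTriple y y' := by
  obtain ⟨hg, hβ, hφ⟩ := h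
  have hJ' : IsUnit J.transpose.det := by rwa [Matrix.det_transpose]
  have hinv : F'.βInv y' = J.transpose⁻¹ * F.βInv y * J⁻¹ := by
    rw [SymplecticTriple.βInv, hβ, Matrix.mul_inv_rev, Matrix.mul_inv_rev, mul_assoc]
    rfl
  have hB : F.βInv y = J.transpose * F'.βInv y' * J := by
    rw [hinv]
    simp only [mul_assoc]
    rw [Matrix.mul_nonsing_inv_cancel_left _ _ hJ', Matrix.nonsing_inv_mul _ hJ, mul_one]
  refine ⟨?_, hB, hφ⟩
  simp only [SymplecticTriple.toStringTriple]
  rw [hinv, hg]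
  simp only [mul_neg, neg_mul, mul_assoc]
  rw [Matrix.nonsing_inv_mul_cancel_left _ _ hJ, Matrix.mul_nonsing_inv_cancel_left _ _ hJ',
    Matrix.mul_nonsing_inv_cancel_left _ _ hJ', Matrix.nonsing_inv_mul _ hJ, mul_one]

/-- The Lagrangian of symplectic gravity is a density. -/
theorem IsLocalCoordChange.density_eq {n : ℕ} {U U' : Set (Coord n)} {τ : Coord n → Coord n}
    {y : Coord n} (h : IsLocalCoordChange U U' τ) {F F' : SymplecticTriple n}
    (hF : IsConfigOn U F) (hF' : IsConfigOn U' F')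
    (hlaw : ∀ z ∈ U, symplecticLaw (jac τ z) F F' z (τ z)) (hy : y ∈ U) :
    F.density y = |(jac τ y).det| * F'.density (τ y) := by
  rw [hF.density_eq h.isOpen hy, hF'.density_eq h.isOpen' (h.mapsTo y hy)]
  exact h.string_density_eq hF.toStringTriple hF'.toStringTriple
    (fun z hz => stringLaw_of_symplecticLaw (h.unit z hz) (hlaw z hz)) hy

/-! ### Families of fields -/

section Family

variable {P : Type*} [NormedAddCommGroup P] [NormedSpace ℝ P] {n : ℕ} {U : Set (Coord n)}

/-- The family `f p` of functions is jointly smooth at all points `(0, z)` with `z ∈ U`. -/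
def JSm (U : Set (Coord n)) (f : P → Coord n → ℝ) : Prop :=
  Sm (({0} : Set P) ×ˢ U) (fun q => f q.1 q.2)

/-- The entries of the family `M p` of matrix-valued functions are jointly smooth. -/
def JSmM (U : Set (Coord n)) (M : P → Coord n → Matrix (Fin n) (Fin n) ℝ) : Prop :=
  ∀ i j, JSm U (fun p z => M p z i j)

variable {f g : P → Coord n → ℝ} {M : P → Coord n → Matrix (Fin n) (Fin n) ℝ}

theorem JSm.at (hf : JSm U f) {z : Coord n} (hz : z ∈ U) :
    ContDiffAt ℝ ∞ (fun q : P × Coord n => f q.1 q.2) (0, z) := hf (0, z) ⟨rfl, hz⟩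

theorem JSm.pd (hf : JSm U f) (i : Fin n) : JSm U (fun p => pd i (f p)) := by
  rintro ⟨p, z⟩ ⟨hp, hz⟩
  obtain rfl : p = 0 := hp
  have h1 : ContDiffAt ℝ ∞ (Function.uncurry (fun q : P × Coord n => f q.1)) ((0, z), z) := by
    have h2 : ContDiffAt ℝ ∞ (fun r : (P × Coord n) × Coord n => (r.1.1, r.2)) ((0, z), z) := by
      fun_prop
    exact ContDiffAt.comp ((0, z), z) (hf.at hz) h2
  have h3 := ContDiffAt.fderiv (m := ∞) (x₀ := ((0 : P), z)) h1 contDiffAt_snd (by simp)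
  exact h3.clm_apply contDiffAt_const

theorem JSm.sm_zero (hf : JSm U f) : Sm U (f 0) := fun z hz =>
  ContDiffAt.comp z (g := fun q : P × Coord n => f q.1 q.2) (hf.at hz)
    (contDiffAt_const.prodMk contDiffAt_id)

theorem JSm.of_sm {f : Coord n → ℝ} (hf : Sm U f) : JSm U (fun _ : P => f) := by
  rintro ⟨p, z⟩ ⟨_, hz⟩
  exact ContDiffAt.comp (p, z) (hf z hz) contDiffAt_snd

theorem JSm.add (hf : JSm U f) (hg : JSm U g) : JSm U (fun p z => f p z + g p z) := Sm.add hf hg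

theorem JSm.sub (hf : JSm U f) (hg : JSm U g) : JSm U (fun p z => f p z - g p z) := Sm.sub hf hg

theorem JSm.mul (hf : JSm U f) (hg : JSm U g) : JSm U (fun p z => f p z * g p z) := Sm.mul hf hg

theorem JSm.sum {ι : Type*} {s : Finset ι} {F : ι → P → Coord n → ℝ} (h : ∀ i, JSm U (F i)) :
    JSm U (fun p z => ∑ i ∈ s, F i p z) := 
  Sm.sum (E := P × Coord n) (F := fun i q => F i q.1 q.2) h

theorem JSm.const (c : ℝ) : JSm U (fun (_ : P) _ => c) := Sm.const c

theorem JSm.param {ℓ : P → ℝ} (hℓ : ContDiff ℝ ∞ ℓ) : JSm U (fun (p : P) _ => ℓ p) :=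
  fun _ _ => (hℓ.comp contDiff_fst).contDiffAt

theorem JSmM.inv (hM : JSmM U M) (hu : ∀ z ∈ U, IsUnit (M 0 z).det) :
    JSmM U (fun p z => (M p z)⁻¹) :=
  SmM.inv (M := fun q : P × Coord n => M q.1 q.2) hM (by rintro ⟨p, z⟩ ⟨hp, hz⟩; obtain rfl : p = 0 := hp; exact hu z hz)

theorem JSmM.mul {N : P → Coord n → Matrix (Fin n) (Fin n) ℝ} (hM : JSmM U M) (hN : JSmM U N) :
    JSmM U (fun p z => M p z * N p z) :=
  SmM.mul (M := fun q : P × Coord n => M q.1 q.2) (N := fun q : P × Coord n => N q.1 q.2) hM hN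

theorem JSmM.neg (hM : JSmM U M) : JSmM U (fun p z => -M p z) :=
  SmM.neg (M := fun q : P × Coord n => M q.1 q.2) hM

/-- A jointly smooth family of string fields. -/
structure IsStringFamily (U : Set (Coord n)) (T : P → StringTriple n) : Prop where
  smG : JSmM U (fun p => (T p).G)
  smB : JSmM U (fun p => (T p).B)
  smφ : JSm U (fun p => (T p).φ)
  unit : ∀ z ∈ U, IsUnit ((T 0).G z).det

namespace IsStringFamily

variable {T : P → StringTriple n}

theorem jsm_GInv (h : IsStringFamily U T) (i j : Fin n) : JSm U (fun p z => (T p).GInv z i j) :=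
  h.smG.inv h.unit i j

theorem jsm_Γ (h : IsStringFamily U T) (i j k : Fin n) : JSm U (fun p => (T p).Γ i j k) :=
  JSm.mul (JSm.const _) (JSm.sum fun m => (h.jsm_GInv i m).mul
    (((JSm.pd (h.smG k m) j).add (JSm.pd (h.smG j m) k)).sub (JSm.pd (h.smG j k) m)))

theorem jsm_Riem (h : IsStringFamily U T) (d c a b : Fin n) :
    JSm U (fun p => (T p).Riem d c a b) :=
  (((h.jsm_Γ d b c).pd a).sub ((h.jsm_Γ d a c).pd b)).add (JSm.sum fun e =>
    ((h.jsm_Γ d a e).mul (h.jsm_Γ e b c)).sub ((h.jsm_Γ d b e).mul (h.jsm_Γ e a c)))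

theorem jsm_H (h : IsStringFamily U T) (a b c : Fin n) : JSm U (fun p => (T p).H a b c) :=
  ((JSm.pd (h.smB b c) a).add (JSm.pd (h.smB c a) b)).add (JSm.pd (h.smB a b) c)

theorem jsm_weight (h : IsStringFamily U T) : JSm U (fun p => (T p).weight) :=
  Sm.mul (SmM.sqrt_abs_det (M := fun q : P × Coord n => (T q.1).G q.2) h.smG
    (by rintro ⟨p, z⟩ ⟨hp, hz⟩; obtain rfl : p = 0 := hp; exact h.unit z hz))
    (Sm.exp ((Sm.const _).mul h.smφ))

/-- The Lagrangian of a smooth family of fields is jointly smooth. -/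
theorem jsm_density (h : IsStringFamily U T) : JSm U (fun p => (T p).density) :=
  h.jsm_weight.mul (((JSm.sum fun a => JSm.sum fun b => (h.jsm_GInv a b).mul
      (JSm.sum fun m => h.jsm_Riem m a m b)).sub
    ((JSm.const _).mul (JSm.sum fun a => JSm.sum fun b => JSm.sum fun c => JSm.sum fun i =>
      JSm.sum fun j => JSm.sum fun k => (((((h.jsm_GInv a i).mul (h.jsm_GInv b j)).mul
        (h.jsm_GInv c k)).mul (h.jsm_H a b c)).mul (h.jsm_H i j k))))).add
    ((JSm.const _).mul (JSm.sum fun a => JSm.sum fun b => ((h.jsm_GInv a b).mul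
      (h.smφ.pd a)).mul (h.smφ.pd b))))

end IsStringFamily

theorem IsStringConfigOn.isStringFamily {T : StringTriple n} (h : IsStringConfigOn U T) :
    IsStringFamily U (fun _ : P => T) :=
  ⟨fun i j => JSm.of_sm (h.metric.smooth i j), fun i j => JSm.of_sm (h.smB i j), JSm.of_sm h.smφ,
    h.metric.unit⟩

theorem IsStringConfigOn.sm_density {T : StringTriple n} (h : IsStringConfigOn U T) :
    Sm U T.density :=
  (h.isStringFamily (P := ℝ)).jsm_density.sm_zero

end Family

section Var

variable {n : ℕ} {U : Set (Coord n)}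

/-- `f` is a jointly smooth one-parameter family of functions with velocity `f'` at time `0`. -/
structure Var (U : Set (Coord n)) (f : ℝ → Coord n → ℝ) (f' : Coord n → ℝ) : Prop where
  sm : JSm U f
  hd : ∀ z ∈ U, HasDerivAt (fun t => f t z) (f' z) 0

variable {f g : ℝ → Coord n → ℝ} {f' g' : Coord n → ℝ}

namespace Var

theorem congr_velocity (hf : Var U f f') (h : ∀ z ∈ U, g' z = f' z) : Var U f g' :=
  ⟨hf.sm, fun z hz => by rw [h z hz]; exact hf.hd z hz⟩

theorem add (hf : Var U f f') (hg : Var U g g') :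
    Var U (fun t z => f t z + g t z) (fun z => f' z + g' z) :=
  ⟨hf.sm.add hg.sm, fun z hz => (hf.hd z hz).add (hg.hd z hz)⟩

theorem sub (hf : Var U f f') (hg : Var U g g') :
    Var U (fun t z => f t z - g t z) (fun z => f' z - g' z) :=
  ⟨hf.sm.sub hg.sm, fun z hz => (hf.hd z hz).sub (hg.hd z hz)⟩

theorem mul (hf : Var U f f') (hg : Var U g g') :
    Var U (fun t z => f t z * g t z) (fun z => f' z * g 0 z + f 0 z * g' z) :=
  ⟨hf.sm.mul hg.sm, fun z hz => (hf.hd z hz).mul (hg.hd z hz)⟩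

theorem const_mul (c : ℝ) (hf : Var U f f') : Var U (fun t z => c * f t z) (fun z => c * f' z) :=
  ⟨(JSm.const c).mul hf.sm, fun z hz => (hf.hd z hz).const_mul c⟩

theorem sum {ι : Type*} {s : Finset ι} {F : ι → ℝ → Coord n → ℝ} {F' : ι → Coord n → ℝ}
    (h : ∀ i, Var U (F i) (F' i)) : Var U (fun t z => ∑ i ∈ s, F i t z) (fun z => ∑ i ∈ s, F' i z) :=
  ⟨JSm.sum fun i => (h i).sm, fun z hz => HasDerivAt.fun_sum fun i _ => (h i).hd z hz⟩

theorem velocity_eq (hf : Var U f f') {z : Coord n} (hz : z ∈ U) :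
    f' z = fderiv ℝ (fun q : ℝ × Coord n => f q.1 q.2) (0, z) (1, 0) := by
  have h1 : DifferentiableAt ℝ (fun q : ℝ × Coord n => f q.1 q.2) (0, z) :=
    (hf.sm.at hz).differentiableAt (by simp)
  have h2 : HasDerivAt (fun t : ℝ => (t, z)) ((1 : ℝ), (0 : Coord n)) 0 :=
    (hasDerivAt_id 0).prodMk (hasDerivAt_const _ _)
  exact (hf.hd z hz).unique (HasFDerivAt.comp_hasDerivAt (0 : ℝ)
    (l := fun q : ℝ × Coord n => f q.1 q.2) h1.hasFDerivAt h2)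

theorem sm_velocity (hU : IsOpen U) (hf : Var U f f') : Sm U f' := by
  refine Sm.congr hU (f := fun z => fderiv ℝ (fun q : ℝ × Coord n => f q.1 q.2) (0, z) (1, 0))
    (fun z hz => ?_) (fun z hz => hf.velocity_eq hz)
  have h1 : ContDiffAt ℝ ∞ (fderiv ℝ (fun q : ℝ × Coord n => f q.1 q.2)) (0, z) :=
    (hf.sm.at hz).fderiv_right (by simp)
  exact (ContDiffAt.comp z h1 (contDiffAt_const.prodMk contDiffAt_id)).clm_apply contDiffAt_const

/-- The velocity of a partial derivative is the partial derivative of the velocity. -/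
theorem pd (hU : IsOpen U) (hf : Var U f f') (i : Fin n) :
    Var U (fun t => pd i (f t)) (pd i f') := by
  refine ⟨hf.sm.pd i, fun z hz => ?_⟩
  set g : ℝ × Coord n → ℝ := fun q => f q.1 q.2 with hg
  have hgz : ContDiffAt ℝ ∞ g (0, z) := hf.sm.at hz
  have hD : DifferentiableAt ℝ (fderiv ℝ g) (0, z) :=
    (hgz.fderiv_right (m := ∞) (by simp)).differentiableAt (by simp)
  have hs : IsSymmSndFDerivAt ℝ g (0, z) := hgz.isSymmSndFDerivAt (by
    rw [minSmoothness_of_isRCLikeNormedField]; exact WithTop.coe_le_coe.2 le_top)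
  have hev : ∀ᶠ q in nhds ((0 : ℝ), z), DifferentiableAt ℝ g q := by
    have h1 : ContDiffAt ℝ 1 g (0, z) := hgz.of_le (WithTop.coe_le_coe.2 le_top)
    filter_upwards [h1.eventually (by simp)] with q hq
    exact hq.differentiableAt (by simp)
  have hline : HasDerivAt (fun t : ℝ => (t, z)) ((1 : ℝ), (0 : Coord n)) 0 :=
    (hasDerivAt_id 0).prodMk (hasDerivAt_const _ _)
  have h1 : HasDerivAt (fun t : ℝ => fderiv ℝ g (t, z) (0, Pi.single i 1))
      (fderiv ℝ (fderiv ℝ g) (0, z) (1, 0) (0, Pi.single i 1)) 0 := by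
    have h2 : HasDerivAt (fun t : ℝ => fderiv ℝ g (t, z)) (fderiv ℝ (fderiv ℝ g) (0, z) (1, 0)) 0 :=
      HasFDerivAt.comp_hasDerivAt (0 : ℝ) (l := fderiv ℝ g) hD.hasFDerivAt hline
    simpa using h2.clm_apply (hasDerivAt_const (0 : ℝ) ((0 : ℝ), (Pi.single i 1 : Coord n)))
  have h3 : SymplecticGravity.pd i f' z = fderiv ℝ (fderiv ℝ g) (0, z) (0, Pi.single i 1) (1, 0) := by
    rw [pd_congr i hU (fun w hw => hf.velocity_eq hw) hz]
    have h4 : HasFDerivAt (fun w : Coord n => ((0 : ℝ), w))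
        (ContinuousLinearMap.inr ℝ ℝ (Coord n)) z := hasFDerivAt_prodMk_right _ _
    have h5 : HasFDerivAt (fun w : Coord n => fderiv ℝ g (0, w))
        ((fderiv ℝ (fderiv ℝ g) (0, z)).comp (ContinuousLinearMap.inr ℝ ℝ (Coord n))) z :=
      HasFDerivAt.comp z (g := fderiv ℝ g) hD.hasFDerivAt h4
    have h6 := h5.clm_apply (hasFDerivAt_const ((1 : ℝ), (0 : Coord n)) z)
    unfold SymplecticGravity.pd
    rw [h6.fderiv]
    simp
  rw [h3, hs.eq (0, Pi.single i 1) (1, 0)]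
  refine h1.congr_of_eventuallyEq ?_
  have hcont : Filter.Tendsto (fun t : ℝ => (t, z)) (nhds 0) (nhds (0, z)) :=
    hline.continuousAt
  filter_upwards [hcont.eventually hev] with t ht
  have h7 : HasFDerivAt (fun w : Coord n => (t, w)) (ContinuousLinearMap.inr ℝ ℝ (Coord n)) z :=
    hasFDerivAt_prodMk_right _ _
  have h8 : HasFDerivAt (f t) ((fderiv ℝ g (t, z)).comp (ContinuousLinearMap.inr ℝ ℝ (Coord n))) z :=
    HasFDerivAt.comp z (g := g) ht.hasFDerivAt h7
  unfold SymplecticGravity.pd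
  rw [h8.fderiv]
  simp

end Var

/-- Entrywise version of `Var`. -/
def VarM (U : Set (Coord n)) (M : ℝ → Coord n → Matrix (Fin n) (Fin n) ℝ)
    (M' : Coord n → Matrix (Fin n) (Fin n) ℝ) : Prop :=
  ∀ i j, Var U (fun t z => M t z i j) (fun z => M' z i j)

variable {M N : ℝ → Coord n → Matrix (Fin n) (Fin n) ℝ} {M' N' : Coord n → Matrix (Fin n) (Fin n) ℝ}

theorem VarM.jsm (hM : VarM U M M') : JSmM U M := fun i j => (hM i j).sm

theorem VarM.congr_velocity (hM : VarM U M M') (h : ∀ z ∈ U, N' z = M' z) : VarM U M N' :=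
  fun i j => (hM i j).congr_velocity fun z hz => by rw [h z hz]

theorem VarM.mul (hM : VarM U M M') (hN : VarM U N N') :
    VarM U (fun t z => M t z * N t z) (fun z => M' z * N 0 z + M 0 z * N' z) := by
  intro i j
  simp only [Matrix.mul_apply, Matrix.add_apply, ← Finset.sum_add_distrib]
  exact Var.sum fun k => (hM i k).mul (hN k j)

theorem VarM.add (hM : VarM U M M') (hN : VarM U N N') :
    VarM U (fun t z => M t z + N t z) (fun z => M' z + N' z) :=
  fun i j => (hM i j).add (hN i j)

theorem VarM.neg (hM : VarM U M M') : VarM U (fun t z => -M t z) (fun z => -M' z) :=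
  fun i j => ⟨Sm.neg (hM i j).sm, fun z hz => ((hM i j).hd z hz).neg⟩

theorem VarM.transpose (hM : VarM U M M') :
    VarM U (fun t z => (M t z).transpose) (fun z => (M' z).transpose) := fun i j => hM j i

theorem VarM.inv (hM : VarM U M M') (hu : ∀ z ∈ U, IsUnit (M 0 z).det) :
    VarM U (fun t z => (M t z)⁻¹) (fun z => -((M 0 z)⁻¹ * M' z * (M 0 z)⁻¹)) := by
  have hsm := hM.jsm.inv hu
  -- the velocity of the inverse exists, and the product rule determines it
  have hv : VarM U (fun t z => (M t z)⁻¹)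
      (fun z => Matrix.of fun i j => deriv (fun t => (M t z)⁻¹ i j) 0) := by
    intro i j
    refine ⟨hsm i j, fun z hz => ?_⟩
    have h1 : DifferentiableAt ℝ (fun q : ℝ × Coord n => (M q.1 q.2)⁻¹ i j) (0, z) :=
      ((hsm i j).at hz).differentiableAt (by simp)
    have h2 : DifferentiableAt ℝ (fun t : ℝ => (M t z)⁻¹ i j) 0 :=
      DifferentiableAt.comp (0 : ℝ) (g := fun q : ℝ × Coord n => (M q.1 q.2)⁻¹ i j)
        (f := fun t : ℝ => (t, z)) h1 (by fun_prop)
    exact h2.hasDerivAt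
  refine hv.congr_velocity fun z hz => ?_
  set X := Matrix.of fun i j => deriv (fun t => (M t z)⁻¹ i j) 0 with hX
  have h0 := hu z hz
  have hdet : ∀ᶠ t in nhds (0 : ℝ), IsUnit (M t z).det := by
    have h3 : Sm (({0} : Set ℝ) ×ˢ U) (fun q => (M q.1 q.2).det) :=
      SmM.det (M := fun q : ℝ × Coord n => M q.1 q.2) hM.jsm
    have h4 : ContinuousAt (fun t : ℝ => (M t z).det) 0 :=
      ContinuousAt.comp (g := fun q : ℝ × Coord n => (M q.1 q.2).det) (f := fun t : ℝ => (t, z))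
        (h3 (0, z) ⟨rfl, hz⟩).continuousAt (by fun_prop)
    filter_upwards [h4.eventually_ne h0.ne_zero] with t ht
    exact isUnit_iff_ne_zero.2 ht
  have h5 : M' z * (M 0 z)⁻¹ + M 0 z * X = 0 := by
    ext i j
    have h6 := ((hM.mul hv) i j).hd z hz
    have h7 : HasDerivAt (fun t => (M t z * (M t z)⁻¹) i j) 0 0 := by
      refine (hasDerivAt_const (0 : ℝ) ((1 : Matrix (Fin n) (Fin n) ℝ) i j)).congr_of_eventuallyEq ?_
      filter_upwards [hdet] with t ht
      rw [Matrix.mul_nonsing_inv _ ht]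
    exact h6.unique h7
  have h8 : (M 0 z)⁻¹ * (M' z * (M 0 z)⁻¹ + M 0 z * X) = 0 := by rw [h5, mul_zero]
  rw [mul_add, Matrix.nonsing_inv_mul_cancel_left _ _ h0] at h8
  rw [eq_neg_of_add_eq_zero_right h8, mul_assoc]

/-- The straight line `f + t f'`. -/
theorem Var.line {f f' : Coord n → ℝ} (hf : Sm U f) (hf' : Sm U f') :
    Var U (fun t z => f z + t * f' z) f' :=
  ⟨(JSm.of_sm hf).add ((JSm.param contDiff_id).mul (JSm.of_sm hf')), fun z _ => by
    simpa using ((hasDerivAt_id (0 : ℝ)).mul_const (f' z)).const_add (f z)⟩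

/-- `T` is a smooth family of string fields with velocity `V`. -/
structure StringVar (U : Set (Coord n)) (T : ℝ → StringTriple n) (V : StringTriple n) : Prop where
  isOpen : IsOpen U
  config : IsStringConfigOn U (T 0)
  varG : VarM U (fun t => (T t).G) V.G
  varB : VarM U (fun t => (T t).B) V.B
  varφ : Var U (fun t => (T t).φ) V.φ
  symm : ∀ z ∈ U, (V.G z).transpose = V.G z
  skew : ∀ z ∈ U, (V.B z).transpose = -V.B z

namespace StringVar

variable {T : ℝ → StringTriple n} {V : StringTriple n}

theorem isStringFamily (h : StringVar U T V) : IsStringFamily U T :=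
  ⟨h.varG.jsm, h.varB.jsm, h.varφ.sm, h.config.metric.unit⟩

theorem sm_VG (h : StringVar U T V) : SmM U V.G := fun i j => (h.varG i j).sm_velocity h.isOpen

theorem sm_VB (h : StringVar U T V) : SmM U V.B := fun i j => (h.varB i j).sm_velocity h.isOpen

theorem sm_Vφ (h : StringVar U T V) : Sm U V.φ := h.varφ.sm_velocity h.isOpen

end StringVar

end Var

/-! ### The first variation of the Lagrangian: velocities -/

section Perm

variable {n : ℕ}

theorem sum_swap23 (f : Fin n → Fin n → Fin n → ℝ) :
    ∑ a, ∑ b, ∑ c, f a b c = ∑ a, ∑ c, ∑ b, f a b c :=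
  Finset.sum_congr rfl fun _ _ => Finset.sum_comm

theorem sum_swap34 (f : Fin n → Fin n → Fin n → Fin n → ℝ) :
    ∑ a, ∑ b, ∑ c, ∑ d, f a b c d = ∑ a, ∑ b, ∑ d, ∑ c, f a b c d :=
  Finset.sum_congr rfl fun _ _ => Finset.sum_congr rfl fun _ _ => Finset.sum_comm

theorem sum_rot (f : Fin n → Fin n → Fin n → ℝ) :
    ∑ a, ∑ b, ∑ c, f a b c = ∑ a, ∑ b, ∑ c, f b c a := by
  rw [sum_swap23, Finset.sum_comm]

end Perm

namespace StringTriple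

variable {n : ℕ}

/-- The velocity `C^i_{jk}` of the Christoffel symbols under a variation of the metric. -/
def Cvar (T V : StringTriple n) (i j k : Fin n) (y : Coord n) : ℝ :=
  (1 / 2) * ∑ m, T.GInv y i m * (pd j (fun z => V.G z k m) y + pd k (fun z => V.G z j m) y
    - pd m (fun z => V.G z j k) y) - ∑ m, ∑ l, T.GInv y i m * V.G y m l * T.Γ l j k y

/-- The velocity of the Ricci tensor. -/
def Ricvar (T V : StringTriple n) (c b : Fin n) (y : Coord n) : ℝ :=
  ∑ a, (pd a (T.Cvar V a b c) y - pd b (T.Cvar V a a c) y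
    + ∑ e, ((T.Cvar V a a e y * T.Γ e b c y + T.Γ a a e y * T.Cvar V e b c y)
      - (T.Cvar V a b e y * T.Γ e a c y + T.Γ a b e y * T.Cvar V e a c y)))

/-- The variation of the metric with raised indices. -/
def hup (T V : StringTriple n) (y : Coord n) : Matrix (Fin n) (Fin n) ℝ :=
  T.GInv y * V.G y * T.GInv y

/-- The trace of the variation of the metric. -/
def htr (T V : StringTriple n) (y : Coord n) : ℝ := ∑ b, ∑ c, T.GInv y b c * V.G y b c

/-- The gradient `∂^a φ`. -/
def φup (T : StringTriple n) (a : Fin n) (y : Coord n) : ℝ := ∑ b, T.GInv y a b * pd b T.φ y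

end StringTriple

section TensorVar

variable {n : ℕ} {U : Set (Coord n)}

/-- Componentwise version of `Var` for tensors with three indices. -/
def VarT (U : Set (Coord n)) (X : ℝ → Coord n → Tensor3 n) (X' : Coord n → Tensor3 n) : Prop :=
  ∀ a b c, Var U (fun t z => X t z a b c) (fun z => X' z a b c)

variable {M : ℝ → Coord n → Matrix (Fin n) (Fin n) ℝ} {M' : Coord n → Matrix (Fin n) (Fin n) ℝ}
  {X : ℝ → Coord n → Tensor3 n} {X' : Coord n → Tensor3 n}

theorem VarT.slot1 (hM : VarM U M M') (hX : VarT U X X') : VarT U (fun t z => slot1 (M t z) (X t z))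
    (fun z => slot1 (M' z) (X 0 z) + slot1 (M 0 z) (X' z)) := by
  intro a b c
  simp only [Pi.add_apply, SymplecticGravity.slot1, ← Finset.sum_add_distrib]
  exact Var.sum fun k => (hM a k).mul (hX k b c)

theorem VarT.slot2 (hM : VarM U M M') (hX : VarT U X X') : VarT U (fun t z => slot2 (M t z) (X t z))
    (fun z => slot2 (M' z) (X 0 z) + slot2 (M 0 z) (X' z)) := by
  intro a b c
  simp only [Pi.add_apply, SymplecticGravity.slot2, ← Finset.sum_add_distrib]
  exact Var.sum fun k => (hM b k).mul (hX a k c)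

theorem VarT.slot3 (hM : VarM U M M') (hX : VarT U X X') : VarT U (fun t z => slot3 (M t z) (X t z))
    (fun z => slot3 (M' z) (X 0 z) + slot3 (M 0 z) (X' z)) := by
  intro a b c
  simp only [Pi.add_apply, SymplecticGravity.slot3, ← Finset.sum_add_distrib]
  exact Var.sum fun k => (hM c k).mul (hX a b k)

theorem sum_mul_slot1 (A : Matrix (Fin n) (Fin n) ℝ) (X Y : Tensor3 n) :
    ∑ a, ∑ b, ∑ c, X a b c * slot1 A Y a b c = ∑ a, ∑ i, A a i * pair23 X Y a i := by
  refine Finset.sum_congr rfl fun a _ => ?_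
  simp only [pair23, Matrix.of_apply, slot1, Finset.mul_sum]
  rw [sum_swap23, Finset.sum_comm]
  exact Finset.sum_congr rfl fun d _ => Finset.sum_congr rfl fun b _ =>
    Finset.sum_congr rfl fun c _ => by ring

/-- For a cyclic tensor the three indices may be treated alike. -/
theorem sum_mul_slots_cyc (A B C : Matrix (Fin n) (Fin n) ℝ) {X : Tensor3 n}
    (hX : ∀ a b c, X a b c = X b c a) :
    ∑ a, ∑ b, ∑ c, X a b c * slot1 A (slot2 B (slot3 C X)) a b c
      = ∑ a, ∑ b, ∑ c, X a b c * slot1 B (slot2 C (slot3 A X)) a b c := by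
  conv_lhs => rw [sum_rot, sum_rot]
  refine Finset.sum_congr rfl fun a _ => Finset.sum_congr rfl fun b _ =>
    Finset.sum_congr rfl fun c _ => ?_
  rw [hX c a b]
  congr 1
  simp only [slot1, slot2, slot3, Finset.mul_sum]
  rw [sum_rot]
  rw [sum_rot]
  exact Finset.sum_congr rfl fun i _ => Finset.sum_congr rfl fun j _ =>
    Finset.sum_congr rfl fun k _ => by rw [hX k i j]; ring

theorem sum_act3_adjoint (A : Matrix (Fin n) (Fin n) ℝ) (hA : A.transpose = A) (X Y : Tensor3 n) :
    ∑ a, ∑ b, ∑ c, X a b c * act3 A Y a b c = ∑ a, ∑ b, ∑ c, act3 A X a b c * Y a b c := by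
  have hs : ∀ i j, A i j = A j i := fun i j => congrFun (congrFun hA j) i
  simp only [act3_apply, Finset.mul_sum, Finset.sum_mul]
  have e : ∀ f : Fin n → Fin n → Fin n → Fin n → Fin n → Fin n → ℝ,
      ∑ a, ∑ b, ∑ c, ∑ i, ∑ j, ∑ k, f a b c i j k = ∑ i, ∑ j, ∑ k, ∑ a, ∑ b, ∑ c, f a b c i j k := by
    intro f
    have e1 : ∀ g : Fin n → Fin n → Fin n → Fin n → ℝ,
        ∑ a, ∑ b, ∑ c, ∑ i, g a b c i = ∑ i, ∑ a, ∑ b, ∑ c, g a b c i := by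
      intro g
      rw [sum_swap34, sum_swap23, Finset.sum_comm]
    rw [e1]
    refine Finset.sum_congr rfl fun i _ => ?_
    rw [e1]
    refine Finset.sum_congr rfl fun j _ => ?_
    rw [e1]
  rw [e]
  exact Finset.sum_congr rfl fun i _ => Finset.sum_congr rfl fun j _ =>
    Finset.sum_congr rfl fun k _ => Finset.sum_congr rfl fun a _ => Finset.sum_congr rfl fun b _ =>
    Finset.sum_congr rfl fun c _ => by rw [hs a i, hs b j, hs c k]; ring

end TensorVar

namespace StringVar

variable {n : ℕ} {U : Set (Coord n)} {T : ℝ → StringTriple n} {V : StringTriple n} {y : Coord n}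

theorem varGInv (h : StringVar U T V) :
    VarM U (fun t => (T t).GInv) (fun z => -(T 0).hup V z) :=
  h.varG.inv h.config.metric.unit

theorem varΓ (h : StringVar U T V) (i j k : Fin n) :
    Var U (fun t => (T t).Γ i j k) ((T 0).Cvar V i j k) := by
  have h1 : ∀ m, Var U (fun t z => pd j (fun z => (T t).G z k m) z + pd k (fun z => (T t).G z j m) z
      - pd m (fun z => (T t).G z j k) z) (fun z => pd j (fun z => V.G z k m) z
        + pd k (fun z => V.G z j m) z - pd m (fun z => V.G z j k) z) := fun m =>
    (((h.varG k m).pd h.isOpen j).add ((h.varG j m).pd h.isOpen k)).sub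
      ((h.varG j k).pd h.isOpen m)
  have h2 := Var.const_mul (1 / 2) (Var.sum (s := Finset.univ) fun m => (h.varGInv i m).mul (h1 m))
  refine h2.congr_velocity fun z hz => ?_
  have h3 : ∑ m, ∑ l, (T 0).GInv z i m * V.G z m l * (T 0).Γ l j k z
      = ∑ m, (T 0).hup V z i m * ((1 / 2) * (pd j (fun z => (T 0).G z k m) z
        + pd k (fun z => (T 0).G z j m) z - pd m (fun z => (T 0).G z j k) z)) := by
    have h4 : ∀ l, ∑ m, (T 0).GInv z i m * V.G z m l = ((T 0).GInv z * V.G z) i l := fun l => by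
      rw [Matrix.mul_apply]
    rw [Finset.sum_comm]
    simp only [← Finset.sum_mul, h4, StringTriple.hup]
    have h5 := sum_mul_sum_mul (fun l => ((T 0).GInv z * V.G z) i l) ((T 0).GInv z)
      (fun m => (1 / 2) * (pd j (fun z => (T 0).G z k m) z
        + pd k (fun z => (T 0).G z j m) z - pd m (fun z => (T 0).G z j k) z))
    simp only [← Matrix.mul_apply] at h5
    rw [← h5]
    refine Finset.sum_congr rfl fun l _ => ?_
    rw [StringTriple.Γ, Finset.mul_sum]
    congr 1
    exact Finset.sum_congr rfl fun m _ => by ring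
  rw [StringTriple.Cvar, h3]
  simp only [Matrix.neg_apply, Finset.mul_sum, ← Finset.sum_sub_distrib]
  exact Finset.sum_congr rfl fun m _ => by ring

theorem sm_Cvar (h : StringVar U T V) (i j k : Fin n) : Sm U ((T 0).Cvar V i j k) :=
  (h.varΓ i j k).sm_velocity h.isOpen

theorem varRic (h : StringVar U T V) (c b : Fin n) :
    Var U (fun t => (T t).Ric c b) ((T 0).Ricvar V c b) :=
  (Var.sum (s := Finset.univ) fun a => (((h.varΓ a b c).pd h.isOpen a).sub
    ((h.varΓ a a c).pd h.isOpen b)).add (Var.sum (s := Finset.univ) fun e =>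
      ((h.varΓ a a e).mul (h.varΓ e b c)).sub ((h.varΓ a b e).mul (h.varΓ e a c))))

theorem varScalarCurv (h : StringVar U T V) : Var U (fun t => (T t).scalarCurv)
    (fun z => ∑ a, ∑ b, (-(T 0).hup V z a b * (T 0).Ric a b z
      + (T 0).GInv z a b * (T 0).Ricvar V a b z)) :=
  Var.sum (s := Finset.univ) fun a => Var.sum (s := Finset.univ) fun b =>
    (h.varGInv a b).mul (h.varRic a b)

theorem GInv_symm (h : StringVar U T V) (hy : y ∈ U) (a b : Fin n) :
    (T 0).GInv y a b = (T 0).GInv y b a :=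
  congrFun (congrFun (h.config.metric.inv_symm hy) b) a

theorem V_symm (h : StringVar U T V) (hy : y ∈ U) (a b : Fin n) : V.G y a b = V.G y b a :=
  congrFun (congrFun (h.symm y hy) b) a

theorem varKinetic (h : StringVar U T V) : Var U (fun t => (T t).kinetic)
    (fun z => -(∑ a, ∑ b, (T 0).hup V z a b * (pd a (T 0).φ z * pd b (T 0).φ z))
      + 2 * ∑ a, (T 0).φup a z * pd a V.φ z) := by
  have h1 := Var.sum (s := Finset.univ) fun a => Var.sum (s := Finset.univ) fun b =>
    ((h.varGInv a b).mul (h.varφ.pd h.isOpen a)).mul (h.varφ.pd h.isOpen b)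
  refine h1.congr_velocity fun z hz => ?_
  simp only [add_mul, Finset.sum_add_distrib, Matrix.neg_apply]
  have h2 : ∑ a, ∑ b, (T 0).GInv z a b * pd a V.φ z * pd b (T 0).φ z
      = ∑ a, (T 0).φup a z * pd a V.φ z := by
    simp only [StringTriple.φup, Finset.sum_mul]
    exact Finset.sum_congr rfl fun a _ => Finset.sum_congr rfl fun b _ => by ring
  have h3 : ∑ a, ∑ b, (T 0).GInv z a b * pd a (T 0).φ z * pd b V.φ z
      = ∑ a, (T 0).φup a z * pd a V.φ z := by
    rw [Finset.sum_comm]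
    simp only [StringTriple.φup, Finset.sum_mul]
    exact Finset.sum_congr rfl fun a _ => Finset.sum_congr rfl fun b _ => by
      rw [h.GInv_symm hz a b]
  rw [h2, h3]
  simp only [neg_mul, Finset.sum_neg_distrib]
  simp only [mul_assoc]
  ring

theorem varH3 (h : StringVar U T V) : VarT U (fun t => (T t).H3) V.H3 := fun a b c =>
  (((h.varB b c).pd h.isOpen a).add ((h.varB c a).pd h.isOpen b)).add ((h.varB a b).pd h.isOpen c)

theorem varHSq (h : StringVar U T V) : Var U (fun t => (T t).HSq)
    (fun z => 6 * (∑ a, ∑ b, ∑ c, (T 0).Hup z a b c * pd a (fun w => V.B w b c) z)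
      - 3 * ∑ a, ∑ b, (T 0).hup V z a b * (T 0).HSqM z a b) := by
  have h1 := VarT.slot1 h.varGInv (VarT.slot2 h.varGInv (VarT.slot3 h.varGInv h.varH3))
  have h2 := Var.sum (s := Finset.univ) fun a => Var.sum (s := Finset.univ) fun b =>
    Var.sum (s := Finset.univ) fun c => (h.varH3 a b c).mul (h1 a b c)
  have h3 : (fun t => (T t).HSq) = fun t z => ∑ a, ∑ b, ∑ c, (T t).H3 z a b c
      * slot1 ((T t).GInv z) (slot2 ((T t).GInv z) (slot3 ((T t).GInv z) ((T t).H3 z))) a b c := by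
    funext t z
    rw [StringTriple.HSq_eq]
    rfl
  rw [h3]
  refine h2.congr_velocity fun z hz => ?_
  have hGs := h.config.metric.inv_symm hz
  set S := T 0 with hS
  set A := S.GInv z with hA
  set X := S.H3 z with hX
  set N := S.hup V z with hN
  have hXc : ∀ a b c, X a b c = X b c a := fun a b c => StringTriple.H_cyc a b c
  have hslot1 : slot1 (-N) = fun Y : Tensor3 n => -slot1 N Y := by
    funext Y a b c; simp [slot1]
  have hslot2 : slot2 (-N) = fun Y : Tensor3 n => -slot2 N Y := by
    funext Y a b c; simp [slot2]
  have hslot3 : slot3 (-N) = fun Y : Tensor3 n => -slot3 N Y := by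
    funext Y a b c; simp [slot3]
  have hneg1 : ∀ Y : Tensor3 n, slot1 A (-Y) = -slot1 A Y := by
    intro Y; funext a b c; simp [slot1]
  have hneg2 : ∀ Y : Tensor3 n, slot2 A (-Y) = -slot2 A Y := by
    intro Y; funext a b c; simp [slot2]
  have e1 : ∑ a, ∑ b, ∑ c, X a b c * slot1 N (slot2 A (slot3 A X)) a b c
      = ∑ a, ∑ b, N a b * S.HSqM z a b := sum_mul_slot1 _ _ _
  have e2 := (sum_mul_slots_cyc A N A hXc).trans e1
  have e3 := (sum_mul_slots_cyc A A N hXc).trans e2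
  have hcycV : ∀ a b c, V.H3 z a b c = pd a (fun w => V.B w b c) z + pd b (fun w => V.B w c a) z
      + pd c (fun w => V.B w a b) z := fun _ _ _ => rfl
  have e4 : ∑ a, ∑ b, ∑ c, S.Hup z a b c * V.H3 z a b c
      = 3 * ∑ a, ∑ b, ∑ c, S.Hup z a b c * pd a (fun w => V.B w b c) z := by
    have e5 : ∑ a, ∑ b, ∑ c, S.Hup z a b c * pd b (fun w => V.B w c a) z
        = ∑ a, ∑ b, ∑ c, S.Hup z a b c * pd a (fun w => V.B w b c) z := by
      conv_rhs => rw [sum_rot]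
      exact Finset.sum_congr rfl fun a _ => Finset.sum_congr rfl fun b _ =>
        Finset.sum_congr rfl fun c _ => by rw [StringTriple.Hup_cyc a b c]
    have e6 : ∑ a, ∑ b, ∑ c, S.Hup z a b c * pd c (fun w => V.B w a b) z
        = ∑ a, ∑ b, ∑ c, S.Hup z a b c * pd a (fun w => V.B w b c) z := by
      conv_rhs => rw [sum_rot, sum_rot]
      exact Finset.sum_congr rfl fun a _ => Finset.sum_congr rfl fun b _ =>
        Finset.sum_congr rfl fun c _ => by rw [StringTriple.Hup_cyc c a b]
    simp only [hcycV, mul_add, Finset.sum_add_distrib, e5, e6]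
    ring
  have e7 : ∑ a, ∑ b, ∑ c, X a b c * slot1 A (slot2 A (slot3 A (V.H3 z))) a b c
      = ∑ a, ∑ b, ∑ c, S.Hup z a b c * V.H3 z a b c := sum_act3_adjoint A hGs X _
  have e8 : ∑ a, ∑ b, ∑ c, V.H3 z a b c * slot1 A (slot2 A (slot3 A X)) a b c
      = ∑ a, ∑ b, ∑ c, S.Hup z a b c * V.H3 z a b c :=
    Finset.sum_congr rfl fun a _ => Finset.sum_congr rfl fun b _ =>
        Finset.sum_congr rfl fun c _ => mul_comm _ _
  change _ = ∑ a, ∑ b, ∑ c, (V.H3 z a b c * slot1 A (slot2 A (slot3 A X)) a b c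
    + X a b c * (slot1 (-N) (slot2 A (slot3 A X))
      + slot1 A (slot2 (-N) (slot3 A X) + slot2 A (slot3 (-N) X + slot3 A (V.H3 z)))) a b c)
  simp only [hslot1, hslot2, hslot3, slot1_add, slot2_add, hneg1, hneg2, Pi.add_apply, Pi.neg_apply,
    mul_add, mul_neg, Finset.sum_add_distrib, Finset.sum_neg_distrib, e1, e2, e3, e7, e8, e4]
  ring

theorem varWeight (h : StringVar U T V) : Var U (fun t => (T t).weight)
    (fun z => (T 0).weight z * ((1 / 2) * (T 0).htr V z - 2 * V.φ z)) := by
  refine ⟨h.isStringFamily.jsm_weight, fun z hz => ?_⟩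
  have h0 := (h.config.metric.unit z hz).ne_zero
  have h1 := hasDerivAt_det (c := fun t : ℝ => (T t).G z) (H := V.G z) (s := 0)
    (fun a b => (h.varG a b).hd z hz) (h.config.metric.unit z hz)
  have h2 := HasDerivAt.comp_of_eq (0 : ℝ) (hasDerivAt_sqrt_abs h0) h1 rfl
  have h3 := (((h.varφ.hd z hz).const_mul (-2)).exp)
  have h4 := h2.mul h3
  have h5 : (((T 0).G z)⁻¹ * V.G z).trace = (T 0).htr V z := by
    simp only [StringTriple.htr, Matrix.trace, Matrix.diag, Matrix.mul_apply, StringTriple.GInv]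
    exact Finset.sum_congr rfl fun a _ => Finset.sum_congr rfl fun b _ => by
      rw [h.V_symm hz]
  refine h4.congr_deriv ?_
  rw [h5]
  simp only [StringTriple.weight, Function.comp]
  field_simp
  ring

theorem varDensity (h : StringVar U T V) : Var U (fun t => (T t).density) (fun z =>
    (T 0).weight z * ((1 / 2) * (T 0).htr V z - 2 * V.φ z)
        * ((T 0).scalarCurv z - (1 / 12) * (T 0).HSq z + 4 * (T 0).kinetic z)
      + (T 0).weight z * ((∑ a, ∑ b, (-(T 0).hup V z a b * (T 0).Ric a b z
          + (T 0).GInv z a b * (T 0).Ricvar V a b z))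
        - (1 / 12) * (6 * (∑ a, ∑ b, ∑ c, (T 0).Hup z a b c * pd a (fun w => V.B w b c) z)
          - 3 * ∑ a, ∑ b, (T 0).hup V z a b * (T 0).HSqM z a b)
        + 4 * (-(∑ a, ∑ b, (T 0).hup V z a b * (pd a (T 0).φ z * pd b (T 0).φ z))
          + 2 * ∑ a, (T 0).φup a z * pd a V.φ z))) :=
  h.varWeight.mul ((h.varScalarCurv.sub (h.varHSq.const_mul (1 / 12))).add
    (h.varKinetic.const_mul 4))

end StringVar

/-! ### The first variation of the Lagrangian: the total derivative -/

namespace StringTriple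

variable {n : ℕ}

/-- The vector `g^{bc} C^a_{bc} - g^{ac} C^e_{ec}` of the Palatini identity. -/
def palatini (T V : StringTriple n) (a : Fin n) (y : Coord n) : ℝ :=
  ∑ b, ∑ c, T.GInv y b c * T.Cvar V a b c y - ∑ c, T.GInv y a c * ∑ e, T.Cvar V e e c y

/-- The current whose divergence is split off from the first variation of the Lagrangian. -/
def current (T V : StringTriple n) (a : Fin n) (y : Coord n) : ℝ :=
  T.weight y * T.palatini V a y + 2 * (T.weight y * ∑ m, T.hup V y a m * pd m T.φ y)
    + T.weight y * T.φup a y * (8 * V.φ y - 2 * T.htr V y)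
    - (1 / 2) * ∑ b, ∑ c, T.weight y * T.Hup y a b c * V.B y b c

/-- The pairing of the Euler–Lagrange expressions with a variation. -/
def elPairing (T V : StringTriple n) (y : Coord n) : ℝ :=
  T.weight y * ((∑ a, ∑ b, -(T.hup V y a b * T.eomG a b y))
      + ((1 / 2) * T.htr V y - 2 * V.φ y) * T.eomφ y)
    + (1 / 2) * ∑ b, ∑ c, T.eomB b c y * V.B y b c

/-- The velocities of the Christoffel symbols as matrices, arranged as in `ΓM`. -/
def CM (T V : StringTriple n) (i : Fin n) (y : Coord n) : Matrix (Fin n) (Fin n) ℝ :=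
  Matrix.of fun l k => T.Cvar V k i l y

theorem sum_trace_mul {Γ : Fin n → Fin n → Fin n → ℝ} (hΓ : ∀ a b c, Γ a b c = Γ a c b)
    (X : Matrix (Fin n) (Fin n) ℝ) (S : Fin n → ℝ) :
    ∑ a, ∑ b, (∑ l, Γ a a l * X l b) * S b = ∑ a, (∑ e, Γ e a e) * ∑ b, X a b * S b := by
  calc _ = ∑ a, ∑ b, ∑ l, Γ a a l * (X l b * S b) := by simp only [Finset.sum_mul, mul_assoc]
    _ = ∑ a, ∑ l, ∑ b, Γ a a l * (X l b * S b) := sum_swap23 _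
    _ = ∑ l, ∑ a, ∑ b, Γ a a l * (X l b * S b) := Finset.sum_comm
    _ = _ := Finset.sum_congr rfl fun l _ => by
      rw [Finset.sum_mul]
      exact Finset.sum_congr rfl fun a _ => by rw [Finset.mul_sum, hΓ a a l]

/-- The identity behind Palatini's formula, for arrays of numbers at one point. -/
theorem palatini_array (Gi : Matrix (Fin n) (Fin n) ℝ) (Γ C : Fin n → Fin n → Fin n → ℝ)
    (dC : Fin n → Fin n → Fin n → Fin n → ℝ) (hGi : ∀ a b, Gi a b = Gi b a)
    (hΓ : ∀ a b c, Γ a b c = Γ a c b) (hC : ∀ a b c, C a b c = C a c b) :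
    ∑ a, ((∑ e, Γ e a e) * (∑ b, ∑ c, Gi b c * C a b c - ∑ c, Gi a c * ∑ e, C e e c)
      + (∑ b, ∑ c, ((-∑ l, (Gi b l * Γ c a l + Γ b a l * Gi l c)) * C a b c + Gi b c * dC a a b c)
        - ∑ c, ((-∑ l, (Gi a l * Γ c a l + Γ a a l * Gi l c)) * (∑ e, C e e c)
          + Gi a c * ∑ e, dC a e e c)))
    = ∑ c, ∑ b, Gi c b * ∑ a, (dC a a b c - dC b a a c
      + ∑ e, ((C a a e * Γ e b c + Γ a a e * C e b c) - (C a b e * Γ e a c + Γ a b e * C e a c))) := by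
  have t1 : ∑ a, (∑ e, Γ e a e) * (∑ b, ∑ c, Gi b c * C a b c)
      = ∑ c, ∑ b, Gi c b * ∑ a, ∑ e, Γ a a e * C e b c := by
    have e1 : ∀ c b, ∑ a, ∑ e, Γ a a e * C e b c = ∑ a, (∑ e, Γ e a e) * C a b c := fun c b => by
      rw [Finset.sum_comm]
      exact Finset.sum_congr rfl fun a _ => by
        rw [Finset.sum_mul]
        exact Finset.sum_congr rfl fun e _ => by rw [hΓ e e a]
    simp only [e1, Finset.mul_sum]
    rw [Finset.sum_comm]
    refine Finset.sum_congr rfl fun b _ => ?_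
    rw [Finset.sum_comm]
    exact Finset.sum_congr rfl fun c _ => Finset.sum_congr rfl fun a _ => by
      rw [hC a c b, hGi b c]; ring
  have t2 : ∑ a, ∑ b, ∑ c, (-∑ l, (Gi b l * Γ c a l + Γ b a l * Gi l c)) * C a b c
      = -(∑ c, ∑ b, Gi c b * ∑ a, ∑ e, C a b e * Γ e a c)
        - ∑ c, ∑ b, Gi c b * ∑ a, ∑ e, Γ a b e * C e a c := by
    have e1 : ∑ a, ∑ b, ∑ c, ∑ l, Gi b l * Γ c a l * C a b c
        = ∑ c, ∑ b, ∑ a, ∑ e, Gi c b * (C a b e * Γ e a c) := by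
      calc _ = ∑ a, ∑ b, ∑ l, ∑ c, Gi b l * Γ c a l * C a b c := sum_swap34 _
        _ = ∑ a, ∑ l, ∑ b, ∑ c, Gi b l * Γ c a l * C a b c := sum_swap23 _
        _ = ∑ l, ∑ a, ∑ b, ∑ c, Gi b l * Γ c a l * C a b c := Finset.sum_comm
        _ = ∑ l, ∑ b, ∑ a, ∑ c, Gi b l * Γ c a l * C a b c := sum_swap23 _
        _ = _ := Finset.sum_congr rfl fun l _ => Finset.sum_congr rfl fun b _ =>
          Finset.sum_congr rfl fun a _ => Finset.sum_congr rfl fun c _ => by rw [hGi b l]; ring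
    have e2 : ∑ a, ∑ b, ∑ c, ∑ l, Γ b a l * Gi l c * C a b c
        = ∑ c, ∑ b, ∑ a, ∑ e, Gi c b * (Γ a b e * C e a c) := by
      calc _ = ∑ a, ∑ c, ∑ b, ∑ l, Γ b a l * Gi l c * C a b c := sum_swap23 _
        _ = ∑ c, ∑ a, ∑ b, ∑ l, Γ b a l * Gi l c * C a b c := Finset.sum_comm
        _ = ∑ c, ∑ a, ∑ l, ∑ b, Γ b a l * Gi l c * C a b c := sum_swap34 _
        _ = ∑ c, ∑ l, ∑ a, ∑ b, Γ b a l * Gi l c * C a b c := sum_swap23 _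
        _ = ∑ c, ∑ l, ∑ b, ∑ a, Γ b a l * Gi l c * C a b c := sum_swap34 _
        _ = _ := Finset.sum_congr rfl fun c _ => Finset.sum_congr rfl fun l _ =>
          Finset.sum_congr rfl fun b _ => Finset.sum_congr rfl fun a _ => by
            rw [hΓ b a l, hGi l c]; ring
    simp only [neg_mul, Finset.sum_mul, add_mul, Finset.sum_neg_distrib, Finset.sum_add_distrib,
      e1, e2, Finset.mul_sum]
    ring
  have t3 : ∑ a, ∑ c, (-∑ l, (Gi a l * Γ c a l + Γ a a l * Gi l c)) * (∑ e, C e e c)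
      = -(∑ c, ∑ b, Gi c b * ∑ a, ∑ e, C a a e * Γ e b c)
        - ∑ a, (∑ e, Γ e a e) * ∑ c, Gi a c * ∑ e, C e e c := by
    have e1 : ∑ a, ∑ c, (∑ l, Gi a l * Γ c a l) * (∑ e, C e e c)
        = ∑ c, ∑ b, Gi c b * ∑ a, ∑ e, C a a e * Γ e b c := by
      have key : ∀ S : Fin n → ℝ, ∑ a, ∑ c, (∑ l, Gi a l * Γ c a l) * S c
          = ∑ c, ∑ b, Gi c b * ∑ e, S e * Γ e b c := fun S => by
        simp only [Finset.mul_sum, Finset.sum_mul]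
        rw [sum_swap23]
        exact Finset.sum_congr rfl fun a _ => Finset.sum_congr rfl fun l _ =>
          Finset.sum_congr rfl fun c _ => by rw [hΓ c a l]; ring
      have e3 : ∀ c b, ∑ a, ∑ e, C a a e * Γ e b c = ∑ e, (∑ a, C a a e) * Γ e b c := fun c b => by
        rw [Finset.sum_comm]
        exact Finset.sum_congr rfl fun e _ => by rw [Finset.sum_mul]
      simp only [e3]
      exact key fun c => ∑ e, C e e c
    have e2 : ∑ a, ∑ c, (∑ l, Γ a a l * Gi l c) * (∑ e, C e e c)
        = ∑ a, (∑ e, Γ e a e) * ∑ c, Gi a c * ∑ e, C e e c :=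
      sum_trace_mul hΓ Gi fun c => ∑ e, C e e c
    simp only [neg_mul, Finset.sum_add_distrib, add_mul, Finset.sum_neg_distrib, e1, e2]
    ring
  have t4 : ∑ a, ∑ b, ∑ c, Gi b c * dC a a b c = ∑ c, ∑ b, Gi c b * ∑ a, dC a a b c := by
    simp only [Finset.mul_sum]
    rw [sum_rot, sum_rot, Finset.sum_comm]
    exact Finset.sum_congr rfl fun c _ => Finset.sum_congr rfl fun b _ =>
      Finset.sum_congr rfl fun a _ => by rw [hGi b c]
  have t5 : ∑ a, ∑ c, Gi a c * ∑ e, dC a e e c = ∑ c, ∑ b, Gi c b * ∑ a, dC b a a c := by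
    rw [Finset.sum_comm]
    exact Finset.sum_congr rfl fun c _ => Finset.sum_congr rfl fun a _ => by rw [hGi a c]
  obtain ⟨dG, hdG⟩ : ∃ dG : Fin n → Fin n → Fin n → ℝ,
      ∀ a b c, -∑ l, (Gi b l * Γ c a l + Γ b a l * Gi l c) = dG a b c := ⟨_, fun _ _ _ => rfl⟩
  simp only [hdG] at t2 t3 ⊢
  simp only [mul_sub, Finset.sum_add_distrib, Finset.sum_sub_distrib, t1, t2, t3, t4, t5]
  simp only [mul_add, mul_sub, Finset.sum_add_distrib, Finset.sum_sub_distrib]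
  ring

end StringTriple

namespace StringVar

variable {n : ℕ} {U : Set (Coord n)} {T : ℝ → StringTriple n} {V : StringTriple n} {y : Coord n}

theorem Cvar_symm (h : StringVar U T V) (hy : y ∈ U) (i j k : Fin n) :
    (T 0).Cvar V i j k y = (T 0).Cvar V i k j y := by
  have h1 : ∀ m, pd m (fun z => V.G z j k) y = pd m (fun z => V.G z k j) y := fun m =>
    pd_congr m h.isOpen (fun z hz => h.V_symm hz j k) hy
  unfold StringTriple.Cvar
  congr 1
  · congr 1
    exact Finset.sum_congr rfl fun m _ => by rw [h1 m]; ring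
  · exact Finset.sum_congr rfl fun m _ => Finset.sum_congr rfl fun l _ => by
      rw [StringTriple.Γ_symm h.isOpen h.config.metric hy]

theorem pdM_GInv (h : StringVar U T V) (hy : y ∈ U) (i : Fin n) :
    pdM i (T 0).GInv y
      = -((T 0).GInv y * (T 0).ΓM i y + ((T 0).ΓM i y).transpose * (T 0).GInv y) := by
  have hu := h.config.metric.unit y hy
  have h1 : pdM i (T 0).GInv y = _ := pdM_inv i h.isOpen h.config.metric.smooth h.config.metric.unit hy
  rw [h1, StringTriple.pdM_G h.isOpen h.config.metric hy, StringTriple.GInv, mul_add, add_mul,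
    mul_assoc, Matrix.mul_assoc ((T 0).ΓM i y), Matrix.mul_nonsing_inv _ hu, mul_one,
    ← Matrix.mul_assoc ((T 0).G y)⁻¹, Matrix.nonsing_inv_mul _ hu, one_mul]

/-- The symmetric part of the lowered velocity of the connection is the covariant derivative of the
velocity of the metric. -/
theorem pdM_VG (h : StringVar U T V) (hy : y ∈ U) (i : Fin n) :
    pdM i V.G y = (T 0).CM V i y * (T 0).G y + (T 0).G y * ((T 0).CM V i y).transpose
      + (T 0).ΓM i y * V.G y + V.G y * ((T 0).ΓM i y).transpose := by
  have hu := h.config.metric.unit y hy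
  set c : Matrix (Fin n) (Fin n) ℝ := Matrix.of fun k m => (1 / 2) * (pd i (fun z => V.G z k m) y
    + pd k (fun z => V.G z i m) y - pd m (fun z => V.G z i k) y)
      - ∑ l, V.G y m l * (T 0).Γ l i k y with hc
  have h1 : (T 0).CM V i y = c * (T 0).GInv y := by
    ext k p
    simp only [StringTriple.CM, StringTriple.Cvar, hc, Matrix.mul_apply, Matrix.of_apply]
    rw [Finset.mul_sum, ← Finset.sum_sub_distrib]
    refine Finset.sum_congr rfl fun m _ => ?_
    rw [h.GInv_symm hy p m]
    simp only [sub_mul, Finset.sum_mul]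
    congr 1
    · ring
    · exact Finset.sum_congr rfl fun l _ => by ring
  have h2 : (T 0).CM V i y * (T 0).G y = c := by
    rw [h1, StringTriple.GInv, mul_assoc, Matrix.nonsing_inv_mul _ hu, mul_one]
  have h3 : (T 0).G y * ((T 0).CM V i y).transpose = c.transpose := by
    rw [← h2, Matrix.transpose_mul, h.config.metric.symm y hy]
  rw [h2, h3]
  ext k m
  have h4 : pd i (fun z => V.G z m k) y = pd i (fun z => V.G z k m) y :=
    pd_congr i h.isOpen (fun z hz => h.V_symm hz m k) hy
  simp only [hc, pdM_apply, Matrix.add_apply, Matrix.of_apply, Matrix.transpose_apply,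
    Matrix.mul_apply, StringTriple.ΓM, h4]
  have h5 : ∑ l, V.G y m l * (T 0).Γ l i k y = ∑ l, (T 0).Γ l i k y * V.G y l m :=
    Finset.sum_congr rfl fun l _ => by rw [h.V_symm hy m l]; ring
  rw [h5]
  ring

theorem pdM_hup (h : StringVar U T V) (hy : y ∈ U) (i : Fin n) :
    pdM i ((T 0).hup V) y = -((T 0).hup V y * (T 0).ΓM i y + ((T 0).ΓM i y).transpose * (T 0).hup V y)
      + ((T 0).GInv y * (T 0).CM V i y + ((T 0).CM V i y).transpose * (T 0).GInv y) := by
  have hu := h.config.metric.unit y hy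
  have hGi : SmM U (T 0).GInv := h.config.metric.smooth_inv
  have h1 : pdM i ((T 0).hup V) y = _ := pdM_mul i (hGi.mul h.sm_VG) hGi hy
  rw [h1, pdM_mul i hGi h.sm_VG hy, h.pdM_GInv hy, h.pdM_VG hy, StringTriple.hup]
  set A := (T 0).GInv y
  set G := (T 0).G y
  have hAG : A * G = 1 := Matrix.nonsing_inv_mul _ hu
  have hGA : G * A = 1 := Matrix.mul_nonsing_inv _ hu
  set C := (T 0).CM V i y
  have e1 : A * (C * G) * A = A * C := by rw [mul_assoc, mul_assoc, hGA, mul_one]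
  have e2 : A * (G * C.transpose) * A = C.transpose * A := by rw [← mul_assoc A, hAG, one_mul]
  simp only [mul_add, add_mul, e1, e2]
  noncomm_ring

theorem pd_htr (h : StringVar U T V) (hy : y ∈ U) (i : Fin n) :
    pd i ((T 0).htr V) y = 2 * ∑ e, (T 0).Cvar V e e i y := by
  have hu := h.config.metric.unit y hy
  have hGi : SmM U (T 0).GInv := h.config.metric.smooth_inv
  have h0 : pd i ((T 0).htr V) y = (pdM i (fun z => (T 0).GInv z * V.G z) y).trace := by
    simp only [Matrix.trace, Matrix.diag, pdM_apply]
    rw [← pd_sum i (U := U) (fun k => (hGi.mul h.sm_VG) k k) hy]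
    refine pd_congr i h.isOpen (fun z hz => ?_) hy
    simp only [StringTriple.htr, Matrix.mul_apply]
    exact Finset.sum_congr rfl fun a _ => Finset.sum_congr rfl fun b _ => by rw [h.V_symm hz a b]
  rw [h0, pdM_mul i hGi h.sm_VG hy, h.pdM_GInv hy, h.pdM_VG hy]
  set A := (T 0).GInv y
  set G := (T 0).G y
  have hAG : A * G = 1 := Matrix.nonsing_inv_mul _ hu
  have hGA : G * A = 1 := Matrix.mul_nonsing_inv _ hu
  have e0 : ∑ e, (T 0).Cvar V e e i y = ((T 0).CM V i y).trace :=
    Finset.sum_congr rfl fun e _ => h.Cvar_symm hy _ _ _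
  rw [e0]
  set C := (T 0).CM V i y
  set X := (T 0).ΓM i y
  set W := V.G y
  have e1 : (A * (C * G)).trace = C.trace := by
    rw [Matrix.trace_mul_comm, mul_assoc, hGA, mul_one]
  have e2 : (A * (G * C.transpose)).trace = C.trace := by
    rw [← mul_assoc, hAG, one_mul, Matrix.trace_transpose]
  have e3 : (A * (W * X.transpose)).trace = (X.transpose * A * W).trace := by
    rw [← mul_assoc, Matrix.trace_mul_comm, mul_assoc]
  simp only [mul_add, neg_mul, add_mul, Matrix.trace_add, Matrix.trace_neg, e1, e2, e3,
    mul_assoc]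
  ring

theorem pd_mul_weight (h : StringVar U T V) {f : Coord n → ℝ} (hf : Sm U f) (hy : y ∈ U)
    (i : Fin n) : pd i (fun z => (T 0).weight z * f z) y
      = (T 0).weight y * (((∑ e, (T 0).Γ e i e y) * f y + pd i f y) - 2 * (pd i (T 0).φ y * f y)) := by
  rw [pd_mul i (StringTriple.sm_weight h.config.metric h.config.smφ) hf hy,
    StringTriple.pd_weight h.isOpen h.config.metric h.config.smφ hy]
  ring

theorem sm_GInv (h : StringVar U T V) : SmM U (T 0).GInv := h.config.metric.smooth_inv

theorem sm_palatini (h : StringVar U T V) (a : Fin n) : Sm U ((T 0).palatini V a) :=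
  (Sm.sum fun b => Sm.sum fun c => (h.sm_GInv b c).mul (h.sm_Cvar a b c)).sub
    (Sm.sum fun c => (h.sm_GInv a c).mul (Sm.sum fun e => h.sm_Cvar e e c))

theorem sm_hup (h : StringVar U T V) : SmM U ((T 0).hup V) :=
  (h.sm_GInv.mul h.sm_VG).mul h.sm_GInv

theorem sm_htr (h : StringVar U T V) : Sm U ((T 0).htr V) :=
  Sm.sum fun b => Sm.sum fun c => (h.sm_GInv b c).mul (h.sm_VG b c)

theorem sm_φup (h : StringVar U T V) (a : Fin n) : Sm U ((T 0).φup a) :=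
  Sm.sum fun b => (h.sm_GInv a b).mul (h.config.smφ.pd b)

theorem pd_GInv (h : StringVar U T V) (hy : y ∈ U) (i b c : Fin n) :
    pd i (fun z => (T 0).GInv z b c) y
      = -∑ l, ((T 0).GInv y b l * (T 0).Γ c i l y + (T 0).Γ b i l y * (T 0).GInv y l c) := by
  have h1 := congrFun (congrFun (h.pdM_GInv hy i) b) c
  simpa only [pdM_apply, Matrix.neg_apply, Matrix.add_apply, Matrix.mul_apply, StringTriple.ΓM,
    Matrix.of_apply, Matrix.transpose_apply, ← Finset.sum_add_distrib] using h1

/-- Palatini's formula, for the density weight `√|det G| e^{-2φ}`. -/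
theorem div_palatini (h : StringVar U T V) (hy : y ∈ U) :
    ∑ a, pd a (fun z => (T 0).weight z * (T 0).palatini V a z) y
      = (T 0).weight y * ((∑ a, ∑ b, (T 0).GInv y a b * (T 0).Ricvar V a b y)
        - 2 * ∑ a, pd a (T 0).φ y * (T 0).palatini V a y) := by
  have h1 : ∀ a, pd a ((T 0).palatini V a) y
      = ∑ b, ∑ c, ((-∑ l, ((T 0).GInv y b l * (T 0).Γ c a l y + (T 0).Γ b a l y * (T 0).GInv y l c))
            * (T 0).Cvar V a b c y + (T 0).GInv y b c * pd a ((T 0).Cvar V a b c) y)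
        - ∑ c, ((-∑ l, ((T 0).GInv y a l * (T 0).Γ c a l y + (T 0).Γ a a l y * (T 0).GInv y l c))
            * (∑ e, (T 0).Cvar V e e c y) + (T 0).GInv y a c * ∑ e, pd a ((T 0).Cvar V e e c) y) := by
    intro a
    have s1 : ∀ b c, Sm U fun z => (T 0).GInv z b c * (T 0).Cvar V a b c z := fun b c =>
      (h.sm_GInv b c).mul (h.sm_Cvar a b c)
    have s2 : ∀ c, Sm U fun z => ∑ e, (T 0).Cvar V e e c z := fun c => Sm.sum fun e => h.sm_Cvar e e c
    have s3 : ∀ c, Sm U fun z => (T 0).GInv z a c * ∑ e, (T 0).Cvar V e e c z := fun c =>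
      (h.sm_GInv a c).mul (s2 c)
    have e0 : pd a ((T 0).palatini V a) y = _ :=
      pd_sub a (Sm.sum fun b => Sm.sum fun c => s1 b c) (Sm.sum fun c => s3 c) hy
    rw [e0, pd_sum a (fun b => Sm.sum fun c => s1 b c) hy, pd_sum a s3 hy]
    congr 1
    · refine Finset.sum_congr rfl fun b _ => ?_
      rw [pd_sum a (s1 b) hy]
      refine Finset.sum_congr rfl fun c _ => ?_
      rw [pd_mul a (h.sm_GInv b c) (h.sm_Cvar a b c) hy, h.pd_GInv hy]
    · refine Finset.sum_congr rfl fun c _ => ?_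
      rw [pd_mul a (h.sm_GInv a c) (s2 c) hy, h.pd_GInv hy,
        pd_sum a (fun e => h.sm_Cvar e e c) hy]
  have h2 := StringTriple.palatini_array ((T 0).GInv y) (fun i j k => (T 0).Γ i j k y)
    (fun i j k => (T 0).Cvar V i j k y) (fun a i j k => pd a ((T 0).Cvar V i j k) y)
    (h.GInv_symm hy) (fun _ _ _ => StringTriple.Γ_symm h.isOpen h.config.metric hy _ _ _)
    (h.Cvar_symm hy)
  have h3 : ∑ a, ∑ b, (T 0).GInv y a b * (T 0).Ricvar V a b y = _ := h2.symm
  rw [h3]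
  simp only [h.pd_mul_weight (h.sm_palatini _) hy, h1, ← Finset.mul_sum, Finset.sum_sub_distrib]
  rfl

theorem sum_pd_hup (h : StringVar U T V) (hy : y ∈ U) (m : Fin n) :
    ∑ a, ((∑ e, (T 0).Γ e a e y) * (T 0).hup V y a m + pd a (fun z => (T 0).hup V z a m) y)
      = (T 0).palatini V m y + (∑ l, (T 0).GInv y m l * pd l ((T 0).htr V) y)
        - ∑ a, ∑ l, (T 0).hup V y a l * (T 0).Γ m a l y := by
  have h1 : ∀ a, pd a (fun z => (T 0).hup V z a m) y
      = -((∑ l, (T 0).hup V y a l * (T 0).Γ m a l y) + ∑ l, (T 0).Γ a a l y * (T 0).hup V y l m)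
        + ((∑ l, (T 0).GInv y a l * (T 0).Cvar V m a l y)
          + ∑ l, (T 0).Cvar V a a l y * (T 0).GInv y l m) := fun a => by
    have h2 := congrFun (congrFun (h.pdM_hup hy a) a) m
    simpa only [pdM_apply, Matrix.neg_apply, Matrix.add_apply, Matrix.mul_apply, StringTriple.ΓM,
      StringTriple.CM, Matrix.of_apply, Matrix.transpose_apply] using h2
  have h2 : ∑ a, ∑ l, (T 0).Γ a a l y * (T 0).hup V y l m
      = ∑ a, (∑ e, (T 0).Γ e a e y) * (T 0).hup V y a m := by
    rw [Finset.sum_comm]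
    exact Finset.sum_congr rfl fun a _ => by
      rw [Finset.sum_mul]
      exact Finset.sum_congr rfl fun e _ => by
        rw [StringTriple.Γ_symm h.isOpen h.config.metric hy]
  have h3 : ∑ a, ∑ l, (T 0).Cvar V a a l y * (T 0).GInv y l m
      = ∑ c, (T 0).GInv y m c * ∑ e, (T 0).Cvar V e e c y := by
    rw [Finset.sum_comm]
    exact Finset.sum_congr rfl fun a _ => by
      rw [Finset.mul_sum]
      exact Finset.sum_congr rfl fun e _ => by rw [h.GInv_symm hy]; ring
  simp only [h1, Finset.sum_add_distrib, Finset.sum_neg_distrib, h2, h3, h.pd_htr hy,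
    StringTriple.palatini]
  simp only [mul_left_comm _ (2 : ℝ), ← Finset.mul_sum]
  ring

theorem div_hup (h : StringVar U T V) (hy : y ∈ U) :
    ∑ a, pd a (fun z => (T 0).weight z * ∑ m, (T 0).hup V z a m * pd m (T 0).φ z) y
      = (T 0).weight y * ((∑ a, pd a (T 0).φ y * (T 0).palatini V a y)
        + (∑ a, (T 0).φup a y * pd a ((T 0).htr V) y)
        + (∑ a, ∑ b, (T 0).hup V y a b * (T 0).hess a b y)
        - 2 * ∑ a, ∑ b, (T 0).hup V y a b * (pd a (T 0).φ y * pd b (T 0).φ y)) := by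
  have h1 : ∀ a, pd a (fun z => ∑ m, (T 0).hup V z a m * pd m (T 0).φ z) y
      = ∑ m, (pd a (fun z => (T 0).hup V z a m) y * pd m (T 0).φ y
        + (T 0).hup V y a m * pd a (pd m (T 0).φ) y) := fun a => by
    rw [pd_sum a (fun m => (h.sm_hup a m).mul (h.config.smφ.pd m)) hy]
    exact Finset.sum_congr rfl fun m _ => pd_mul a (h.sm_hup a m) (h.config.smφ.pd m) hy
  have hs : ∀ a, Sm U (fun z => ∑ m, (T 0).hup V z a m * pd m (T 0).φ z) := fun a =>
    Sm.sum fun m => (h.sm_hup a m).mul (h.config.smφ.pd m)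
  have h2 : ∑ m, (∑ a, ((∑ e, (T 0).Γ e a e y) * (T 0).hup V y a m
      + pd a (fun z => (T 0).hup V z a m) y)) * pd m (T 0).φ y
      = (∑ a, pd a (T 0).φ y * (T 0).palatini V a y)
        + (∑ a, (T 0).φup a y * pd a ((T 0).htr V) y)
        - ∑ a, ∑ b, (T 0).hup V y a b * ∑ m, (T 0).Γ m a b y * pd m (T 0).φ y := by
    simp only [h.sum_pd_hup hy, add_mul, sub_mul, Finset.sum_add_distrib, Finset.sum_sub_distrib]
    congr 1
    · congr 1
      · exact Finset.sum_congr rfl fun a _ => mul_comm _ _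
      · simp only [StringTriple.φup, Finset.sum_mul]
        rw [Finset.sum_comm]
        exact Finset.sum_congr rfl fun a _ => Finset.sum_congr rfl fun b _ => by
          rw [h.GInv_symm hy]; ring
    · simp only [Finset.sum_mul, Finset.mul_sum]
      rw [sum_rot, sum_rot]
      exact Finset.sum_congr rfl fun a _ => Finset.sum_congr rfl fun b _ =>
        Finset.sum_congr rfl fun c _ => by ring
  have h3 : ∑ a, (∑ e, (T 0).Γ e a e y) * ∑ m, (T 0).hup V y a m * pd m (T 0).φ y
      = ∑ m, (∑ a, (∑ e, (T 0).Γ e a e y) * (T 0).hup V y a m) * pd m (T 0).φ y :=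
    sum_mul_sum_mul _ _ _
  have h4 : ∑ a, ∑ m, pd a (fun z => (T 0).hup V z a m) y * pd m (T 0).φ y
      = ∑ m, (∑ a, pd a (fun z => (T 0).hup V z a m) y) * pd m (T 0).φ y := by
    simp only [Finset.sum_mul]
    rw [Finset.sum_comm]
  have h5 : ∑ a, pd a (T 0).φ y * ∑ m, (T 0).hup V y a m * pd m (T 0).φ y
      = ∑ a, ∑ b, (T 0).hup V y a b * (pd a (T 0).φ y * pd b (T 0).φ y) := by
    simp only [Finset.mul_sum]
    exact Finset.sum_congr rfl fun a _ => Finset.sum_congr rfl fun b _ => by ring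
  simp only [Finset.sum_add_distrib, add_mul] at h2
  simp only [h.pd_mul_weight (hs _) hy, h1, ← Finset.mul_sum, Finset.sum_sub_distrib,
    Finset.sum_add_distrib, h3, h4, h5, StringTriple.hess, mul_sub]
  linear_combination (T 0).weight y * h2

theorem div_φup (h : StringVar U T V) {f : Coord n → ℝ} (hf : Sm U f) (hy : y ∈ U) :
    ∑ a, pd a (fun z => (T 0).weight z * (T 0).φup a z * f z) y
      = (T 0).weight y * (f y * ((T 0).lap y - 2 * (T 0).kinetic y)
        + ∑ a, (T 0).φup a y * pd a f y) := by
  have h1 : ∀ a, pd a ((T 0).φup a) y = (∑ b, pd a (fun z => (T 0).GInv z a b) y * pd b (T 0).φ y)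
      + ∑ b, (T 0).GInv y a b * pd a (pd b (T 0).φ) y := fun a => by
    unfold StringTriple.φup
    rw [pd_sum a (fun b => (h.sm_GInv a b).mul (h.config.smφ.pd b)) hy, ← Finset.sum_add_distrib]
    exact Finset.sum_congr rfl fun m _ => pd_mul a (h.sm_GInv a m) (h.config.smφ.pd m) hy
  have h2 : ∑ a, ((∑ e, (T 0).Γ e a e y) * (T 0).φup a y + pd a ((T 0).φup a) y) = (T 0).lap y := by
    have e1 : ∑ a, (∑ e, (T 0).Γ e a e y) * (T 0).φup a y
        = ∑ a, ∑ b, (∑ l, (T 0).Γ a a l y * (T 0).GInv y l b) * pd b (T 0).φ y :=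
      (StringTriple.sum_trace_mul (Γ := fun a b c => (T 0).Γ a b c y)
        (fun _ _ _ => StringTriple.Γ_symm h.isOpen h.config.metric hy _ _ _) _ _).symm
    have e2 : ∑ a, ∑ b, (∑ l, (T 0).GInv y a l * (T 0).Γ b a l y) * pd b (T 0).φ y
        = ∑ a, ∑ b, (T 0).GInv y a b * ∑ k, (T 0).Γ k a b y * pd k (T 0).φ y := by
      simp only [Finset.mul_sum, Finset.sum_mul]
      rw [sum_swap23]
      exact Finset.sum_congr rfl fun a _ => Finset.sum_congr rfl fun b _ =>
        Finset.sum_congr rfl fun c _ => by ring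
    simp only [h1, Finset.sum_add_distrib, h.pd_GInv hy, neg_mul, Finset.sum_neg_distrib, add_mul,
      e1, e2, StringTriple.lap, StringTriple.hess, mul_sub, Finset.sum_sub_distrib]
    ring
  have h3 : ∑ a, pd a (T 0).φ y * (T 0).φup a y = (T 0).kinetic y := by
    simp only [StringTriple.φup, Finset.mul_sum, StringTriple.kinetic]
    exact Finset.sum_congr rfl fun a _ => Finset.sum_congr rfl fun b _ => by ring
  have h4 : ∀ a, pd a (fun z => (T 0).weight z * (T 0).φup a z * f z) y
      = (T 0).weight y * (f y * ((∑ e, (T 0).Γ e a e y) * (T 0).φup a y + pd a ((T 0).φup a) y)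
        - 2 * f y * (pd a (T 0).φ y * (T 0).φup a y) + (T 0).φup a y * pd a f y) := fun a => by
    rw [pd_mul a ((StringTriple.sm_weight h.config.metric h.config.smφ).mul (h.sm_φup a)) hf hy,
      h.pd_mul_weight (h.sm_φup a) hy]
    ring
  simp only [h4, ← Finset.mul_sum, Finset.sum_add_distrib, Finset.sum_sub_distrib] at h2 ⊢
  rw [h2, h3]
  ring

theorem div_Hup (h : StringVar U T V) (hy : y ∈ U) :
    ∑ a, pd a (fun z => ∑ b, ∑ c, (T 0).weight z * (T 0).Hup z a b c * V.B z b c) y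
      = (∑ b, ∑ c, (T 0).eomB b c y * V.B y b c)
        + (T 0).weight y * ∑ a, ∑ b, ∑ c, (T 0).Hup y a b c * pd a (fun w => V.B w b c) y := by
  have s1 : ∀ a b c, Sm U fun z => (T 0).weight z * (T 0).Hup z a b c := fun a b c =>
    (StringTriple.sm_weight h.config.metric h.config.smφ).mul (StringTriple.sm_Hup h.config a b c)
  have h1 : ∀ a, pd a (fun z => ∑ b, ∑ c, (T 0).weight z * (T 0).Hup z a b c * V.B z b c) y
      = ∑ b, ∑ c, (pd a (fun z => (T 0).weight z * (T 0).Hup z a b c) y * V.B y b c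
        + (T 0).weight y * ((T 0).Hup y a b c * pd a (fun w => V.B w b c) y)) := fun a => by
    rw [pd_sum a (fun b => Sm.sum fun c => (s1 a b c).mul (h.sm_VB b c)) hy]
    refine Finset.sum_congr rfl fun b _ => ?_
    rw [pd_sum a (fun c => (s1 a b c).mul (h.sm_VB b c)) hy]
    refine Finset.sum_congr rfl fun c _ => ?_
    rw [pd_mul a (s1 a b c) (h.sm_VB b c) hy]
    ring
  simp only [h1, Finset.sum_add_distrib, ← Finset.mul_sum]
  congr 1
  rw [sum_rot, sum_rot]
  simp only [StringTriple.eomB, Finset.sum_mul]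

theorem sm_current (h : StringVar U T V) (a : Fin n) : Sm U ((T 0).current V a) := by
  have hw := StringTriple.sm_weight h.config.metric h.config.smφ
  exact (((hw.mul (h.sm_palatini a)).add ((Sm.const 2).mul (hw.mul (Sm.sum fun m =>
    (h.sm_hup a m).mul (h.config.smφ.pd m))))).add ((hw.mul (h.sm_φup a)).mul
      (((Sm.const 8).mul h.sm_Vφ).sub ((Sm.const 2).mul h.sm_htr)))).sub
    ((Sm.const (1 / 2)).mul (Sm.sum fun b => Sm.sum fun c =>
      (hw.mul (StringTriple.sm_Hup h.config a b c)).mul (h.sm_VB b c)))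

/-- The first variation of the Lagrangian is the Euler–Lagrange pairing plus a divergence. -/
theorem varDensity_eq (h : StringVar U T V) : Var U (fun t => (T t).density)
    (fun z => (T 0).elPairing V z + ∑ a, pd a ((T 0).current V a) z) := by
  refine h.varDensity.congr_velocity fun y hy => ?_
  have hw := StringTriple.sm_weight h.config.metric h.config.smφ
  have s1 : ∀ a, Sm U fun z => (T 0).weight z * (T 0).palatini V a z := fun a =>
    hw.mul (h.sm_palatini a)
  have s2 : ∀ a, Sm U fun z => (T 0).weight z * ∑ m, (T 0).hup V z a m * pd m (T 0).φ z := fun a =>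
    hw.mul (Sm.sum fun m => (h.sm_hup a m).mul (h.config.smφ.pd m))
  have sf : Sm U fun z => 8 * V.φ z - 2 * (T 0).htr V z :=
    ((Sm.const 8).mul h.sm_Vφ).sub ((Sm.const 2).mul h.sm_htr)
  have s3 : ∀ a, Sm U fun z => (T 0).weight z * (T 0).φup a z * (8 * V.φ z - 2 * (T 0).htr V z) :=
    fun a => (hw.mul (h.sm_φup a)).mul sf
  have s4 : ∀ a, Sm U fun z => ∑ b, ∑ c, (T 0).weight z * (T 0).Hup z a b c * V.B z b c := fun a =>
    Sm.sum fun b => Sm.sum fun c => (hw.mul (StringTriple.sm_Hup h.config a b c)).mul (h.sm_VB b c)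
  have h1 : ∀ a, pd a ((T 0).current V a) y
      = pd a (fun z => (T 0).weight z * (T 0).palatini V a z) y
        + 2 * pd a (fun z => (T 0).weight z * ∑ m, (T 0).hup V z a m * pd m (T 0).φ z) y
        + pd a (fun z => (T 0).weight z * (T 0).φup a z * (8 * V.φ z - 2 * (T 0).htr V z)) y
        - (1 / 2) * pd a (fun z => ∑ b, ∑ c, (T 0).weight z * (T 0).Hup z a b c * V.B z b c) y := by
    intro a
    rw [← pd_const_mul a 2 (s2 a) hy, ← pd_const_mul a (1 / 2) (s4 a) hy,
      ← pd_add a (s1 a) ((Sm.const 2).mul (s2 a)) hy,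
      ← pd_add a ((s1 a).add ((Sm.const 2).mul (s2 a))) (s3 a) hy,
      ← pd_sub a (((s1 a).add ((Sm.const 2).mul (s2 a))).add (s3 a))
        ((Sm.const (1 / 2)).mul (s4 a)) hy]
    rfl
  have h2 : ∀ a, pd a (fun z => 8 * V.φ z - 2 * (T 0).htr V z) y
      = 8 * pd a V.φ y - 2 * pd a ((T 0).htr V) y := fun a => by
    rw [pd_sub a ((Sm.const 8).mul h.sm_Vφ) ((Sm.const 2).mul h.sm_htr) hy,
      pd_const_mul a 8 h.sm_Vφ hy, pd_const_mul a 2 h.sm_htr hy]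
  have h3 : ∑ a, (T 0).φup a y * pd a (fun z => 8 * V.φ z - 2 * (T 0).htr V z) y
      = 8 * (∑ a, (T 0).φup a y * pd a V.φ y) - 2 * ∑ a, (T 0).φup a y * pd a ((T 0).htr V) y := by
    simp only [h2, mul_sub, Finset.sum_sub_distrib, mul_left_comm ((T 0).φup _ y),
      ← Finset.mul_sum]
  have h4 : ∑ a, ∑ b, -((T 0).hup V y a b * (T 0).eomG a b y)
      = -(∑ a, ∑ b, (T 0).hup V y a b * (T 0).Ric a b y)
        - 2 * (∑ a, ∑ b, (T 0).hup V y a b * (T 0).hess a b y)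
        + (1 / 4) * ∑ a, ∑ b, (T 0).hup V y a b * (T 0).HSqM y a b := by
    simp only [StringTriple.eomG, mul_sub, mul_add, Finset.sum_sub_distrib, Finset.sum_add_distrib,
      Finset.sum_neg_distrib, mul_left_comm ((T 0).hup V y _ _), ← Finset.mul_sum]
    ring
  have h5 : ∑ a, ∑ b, (-(T 0).hup V y a b * (T 0).Ric a b y
      + (T 0).GInv y a b * (T 0).Ricvar V a b y)
      = -(∑ a, ∑ b, (T 0).hup V y a b * (T 0).Ric a b y)
        + ∑ a, ∑ b, (T 0).GInv y a b * (T 0).Ricvar V a b y := by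
    simp only [neg_mul, Finset.sum_add_distrib, Finset.sum_neg_distrib]
  rw [h5]
  simp only [h1, Finset.sum_add_distrib, Finset.sum_sub_distrib, ← Finset.mul_sum]
  rw [h.div_palatini hy, h.div_hup hy, h.div_φup sf hy, h.div_Hup hy, h3, StringTriple.elPairing, h4,
    StringTriple.eomφ]
  ring

end StringVar

/-! ### Variations of the fields of symplectic gravity on a coordinate domain -/

/-- A smooth variation of the fields on a coordinate domain. -/
structure IsVariationOn {n : ℕ} (U : Set (Coord n)) (V : SymplecticTriple n) : Prop where
  smg : SmM U V.g
  smβ : SmM U V.β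
  smφ : Sm U V.φ
  symm : ∀ y ∈ U, (V.g y).transpose = V.g y
  skew : ∀ y ∈ U, (V.β y).transpose = -V.β y

theorem Sm.pos {E : Type*} [NormedAddCommGroup E] [NormedSpace ℝ E] {U : Set E} {f : E → ℝ}
    (hf : Sm U f) {y : E} (hy : y ∈ U) (h : IsUnit (f y)) : ∀ᶠ z in nhds y, IsUnit (f z) := by
  filter_upwards [(hf y hy).continuousAt.eventually_ne h.ne_zero] with z hz
  exact isUnit_iff_ne_zero.2 hz

section Family

variable {P : Type*} [NormedAddCommGroup P] [NormedSpace ℝ P] {n : ℕ} {U : Set (Coord n)}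

/-- A jointly smooth family of symmetric and skew fields through a field configuration. -/
structure IsSymplecticFamily (U : Set (Coord n)) (F : P → SymplecticTriple n) : Prop where
  isOpen : IsOpen U
  config : IsConfigOn U (F 0)
  smg : JSmM U (fun p => (F p).g)
  smβ : JSmM U (fun p => (F p).β)
  smφ : JSm U (fun p => (F p).φ)
  slice : ∀ p, IsVariationOn U (F p)

namespace IsSymplecticFamily

variable {F : P → SymplecticTriple n}

theorem isStringFamily (h : IsSymplecticFamily U F) :
    IsStringFamily U (fun p => (F p).toStringTriple) where
  smG := (((h.smβ.inv h.config.unitβ).mul h.smg).mul (h.smβ.inv h.config.unitβ)).neg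
  smB := h.smβ.inv h.config.unitβ
  smφ := h.smφ
  unit := h.config.toStringTriple.metric.unit

theorem eventually_config (h : IsSymplecticFamily U F) {z : Coord n} (hz : z ∈ U) :
    ∀ᶠ q in nhds ((0 : P), z), ∃ W, IsOpen W ∧ q.2 ∈ W ∧ IsConfigOn W (F q.1) := by
  have h1 : Sm (({0} : Set P) ×ˢ U) (fun q => ((F q.1).g q.2).det) :=
    SmM.det (M := fun q : P × Coord n => (F q.1).g q.2) h.smg
  have h2 : Sm (({0} : Set P) ×ˢ U) (fun q => ((F q.1).β q.2).det) :=
    SmM.det (M := fun q : P × Coord n => (F q.1).β q.2) h.smβ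
  have h3 : ∀ᶠ q in nhds ((0 : P), z), q.2 ∈ U ∧ IsUnit ((F q.1).g q.2).det
      ∧ IsUnit ((F q.1).β q.2).det :=
    ((continuousAt_snd.eventually (h.isOpen.mem_nhds hz))).and
      ((h1.pos (y := (0, z)) ⟨rfl, hz⟩ (h.config.metric.unit z hz)).and
        (h2.pos (y := (0, z)) ⟨rfl, hz⟩ (h.config.unitβ z hz)))
  filter_upwards [h3.eventually_nhds] with q hq
  have h4 : ∀ᶠ w in nhds q.2, w ∈ U ∧ IsUnit ((F q.1).g w).det ∧ IsUnit ((F q.1).β w).det := by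
    have h5 : Filter.Tendsto (fun w : Coord n => (q.1, w)) (nhds q.2) (nhds q) :=
      (Continuous.prodMk_right q.1).continuousAt
    exact h5.eventually hq
  obtain ⟨W, hW, hWo, hqW⟩ := eventually_nhds_iff.1 h4
  refine ⟨W, hWo, hqW, ⟨⟨(h.slice q.1).smg.mono fun w hw => (hW w hw).1,
    fun w hw => (h.slice q.1).symm w (hW w hw).1, fun w hw => (hW w hw).2.1⟩,
    (h.slice q.1).smβ.mono fun w hw => (hW w hw).1,
    fun w hw => (h.slice q.1).skew w (hW w hw).1, fun w hw => (hW w hw).2.2,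
    (h.slice q.1).smφ.mono fun w hw => (hW w hw).1⟩⟩

theorem eventually_density_eq (h : IsSymplecticFamily U F) {z : Coord n} (hz : z ∈ U) :
    ∀ᶠ q in nhds ((0 : P), z), (F q.1).density q.2 = (F q.1).toStringTriple.density q.2 := by
  filter_upwards [h.eventually_config hz] with q ⟨W, hW, hqW, hc⟩
  exact hc.density_eq hW hqW

theorem jsm_density (h : IsSymplecticFamily U F) : JSm U (fun p => (F p).density) := by
  rintro ⟨p, z⟩ ⟨hp, hz⟩
  obtain rfl : p = 0 := hp
  exact (h.isStringFamily.jsm_density.at hz).congr_of_eventuallyEq (h.eventually_density_eq hz)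

end IsSymplecticFamily

end Family

namespace SymplecticTriple

variable {n : ℕ} (F V : SymplecticTriple n)

/-- The multiple `f V` of a variation by a function. -/
def scale (f : Coord n → ℝ) : SymplecticTriple n where
  g y := f y • V.g y
  β y := f y • V.β y
  φ y := f y * V.φ y

/-- The velocity of the string fields under a variation of the symplectic gravity fields. -/
def stringVelocity : StringTriple n where
  G y := F.βInv y * V.β y * F.βInv y * F.g y * F.βInv y - F.βInv y * V.g y * F.βInv y
    + F.βInv y * F.g y * (F.βInv y * V.β y * F.βInv y)
  B y := -(F.βInv y * V.β y * F.βInv y)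
  φ := V.φ

/-- The first variation of the Lagrangian. -/
def firstVariation (y : Coord n) : ℝ := deriv (fun t : ℝ => (F.shift t V).density y) 0

variable {F V}

theorem shift_zero : F.shift 0 V = F := by
  simp [shift]

end SymplecticTriple

namespace IsVariationOn

variable {n : ℕ} {U : Set (Coord n)} {F V : SymplecticTriple n} {y : Coord n}

theorem scale (h : IsVariationOn U V) {f : Coord n → ℝ} (hf : Sm U f) :
    IsVariationOn U (V.scale f) where
  smg i j := hf.mul (h.smg i j)
  smβ i j := hf.mul (h.smβ i j)
  smφ := hf.mul h.smφ
  symm y hy := by simp only [SymplecticTriple.scale, Matrix.transpose_smul, h.symm y hy]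
  skew y hy := by simp only [SymplecticTriple.scale, Matrix.transpose_smul, h.skew y hy, smul_neg]

theorem shift (h : IsVariationOn U V) (hF : IsVariationOn U F) (t : ℝ) :
    IsVariationOn U (F.shift t V) where
  smg i j := (hF.smg i j).add ((Sm.const t).mul (h.smg i j))
  smβ i j := (hF.smβ i j).add ((Sm.const t).mul (h.smβ i j))
  smφ := hF.smφ.add ((Sm.const t).mul h.smφ)
  symm y hy := by
    simp only [SymplecticTriple.shift, Matrix.transpose_add, Matrix.transpose_smul, h.symm y hy,
      hF.symm y hy]
  skew y hy := by
    simp only [SymplecticTriple.shift, Matrix.transpose_add, Matrix.transpose_smul, h.skew y hy,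
      hF.skew y hy, smul_neg, neg_add]

end IsVariationOn

theorem IsConfigOn.isVariationOn {n : ℕ} {U : Set (Coord n)} {F : SymplecticTriple n}
    (h : IsConfigOn U F) : IsVariationOn U F :=
  ⟨h.metric.smooth, h.smβ, h.smφ, h.metric.symm, h.skew⟩

namespace IsConfigOn

variable {n : ℕ} {U : Set (Coord n)} {F V : SymplecticTriple n} {y : Coord n}

/-- The fields `F + ∑ᵢ pᵢ fᵢ V` form a smooth family with parameters `pᵢ`. -/
theorem isSymplecticFamily_scale (hU : IsOpen U) (h : IsConfigOn U F) (hV : IsVariationOn U V)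
    {ι : Type*} [Fintype ι] {f : ι → Coord n → ℝ} (hf : ∀ i, Sm U (f i)) :
    IsSymplecticFamily U
      (fun p : ι → ℝ => F.shift 1 (V.scale fun z => ∑ i, p i * f i z)) := by
  have hp : JSm U (fun (p : ι → ℝ) z => ∑ i, p i * f i z) := JSm.sum fun i =>
    (JSm.param (contDiff_apply ℝ ℝ i)).mul (JSm.of_sm (hf i))
  have h0 : F.shift 1 (V.scale fun z => ∑ i, (0 : ι → ℝ) i * f i z) = F := by
    simp [SymplecticTriple.shift, SymplecticTriple.scale]
  refine ⟨hU, by rw [h0]; exact h, fun i j => ?_, fun i j => ?_, ?_, fun p => ?_⟩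
  · exact (JSm.of_sm (h.metric.smooth i j)).add
      ((JSm.const 1).mul (hp.mul (JSm.of_sm (hV.smg i j))))
  · exact (JSm.of_sm (h.smβ i j)).add ((JSm.const 1).mul (hp.mul (JSm.of_sm (hV.smβ i j))))
  · exact (JSm.of_sm h.smφ).add ((JSm.const 1).mul (hp.mul (JSm.of_sm hV.smφ)))
  · exact (hV.scale (Sm.sum fun i => (Sm.const (p i)).mul (hf i))).shift h.isVariationOn 1

theorem isSymplecticFamily (hU : IsOpen U) (h : IsConfigOn U F) (hV : IsVariationOn U V) :
    IsSymplecticFamily U (fun t : ℝ => F.shift t V) := by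
  refine ⟨hU, by rw [SymplecticTriple.shift_zero]; exact h, fun i j => ?_, fun i j => ?_, ?_,
    fun p => ?_⟩
  · exact (JSm.of_sm (h.metric.smooth i j)).add
      ((JSm.param contDiff_id).mul (JSm.of_sm (hV.smg i j)))
  · exact (JSm.of_sm (h.smβ i j)).add ((JSm.param contDiff_id).mul (JSm.of_sm (hV.smβ i j)))
  · exact (JSm.of_sm h.smφ).add ((JSm.param contDiff_id).mul (JSm.of_sm hV.smφ))
  · exact hV.shift h.isVariationOn p

theorem hasDerivAt_density (hU : IsOpen U) (h : IsConfigOn U F) (hV : IsVariationOn U V)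
    (hy : y ∈ U) :
    HasDerivAt (fun t : ℝ => (F.shift t V).density y) (F.firstVariation V y) 0 := by
  have h1 := ((h.isSymplecticFamily hU hV).jsm_density.at hy).differentiableAt (by simp)
  have h2 : DifferentiableAt ℝ (fun t : ℝ => (F.shift t V).density y) 0 :=
    DifferentiableAt.comp (0 : ℝ) (g := fun q : ℝ × Coord n => (F.shift q.1 V).density q.2)
      (f := fun t : ℝ => (t, y)) h1 (by fun_prop)
  exact h2.hasDerivAt

theorem var_density (hU : IsOpen U) (h : IsConfigOn U F) (hV : IsVariationOn U V) :
    Var U (fun t => (F.shift t V).density) (F.firstVariation V) :=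
  ⟨(h.isSymplecticFamily hU hV).jsm_density, fun _ hz => h.hasDerivAt_density hU hV hz⟩

/-- The first variation of the Lagrangian is additive in the variation. -/
theorem firstVariation_sum (hU : IsOpen U) (h : IsConfigOn U F) (hV : IsVariationOn U V)
    {ι : Type*} [Fintype ι] {f : ι → Coord n → ℝ} (hf : ∀ i, Sm U (f i))
    (hy : y ∈ U) :
    F.firstVariation (V.scale fun z => ∑ i, f i z) y
      = ∑ i, F.firstVariation (V.scale (f i)) y := by
  classical
  have h1 := ((h.isSymplecticFamily_scale hU hV hf).jsm_density.at hy).differentiableAt (by simp)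
  set Φ : (ι → ℝ) → ℝ :=
    fun p => (F.shift 1 (V.scale fun z => ∑ i, p i * f i z)).density y with hΦ
  have h2 : DifferentiableAt ℝ Φ 0 :=
    DifferentiableAt.comp (0 : ι → ℝ)
      (g := fun q : (ι → ℝ) × Coord n =>
        (F.shift 1 (V.scale fun z => ∑ i, q.1 i * f i z)).density q.2)
      (f := fun p : ι → ℝ => (p, y)) h1 (by fun_prop)
  have h3 : ∀ v : ι → ℝ, deriv (fun t : ℝ => Φ (t • v)) 0 = fderiv ℝ Φ 0 v := fun v => by
    have h4 : HasDerivAt (fun t : ℝ => t • v) v 0 := by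
      simpa using (hasDerivAt_id (0 : ℝ)).smul_const v
    exact (HasFDerivAt.comp_hasDerivAt_of_eq (0 : ℝ) h2.hasFDerivAt h4 (by simp)).deriv
  have h5 : ∀ v : ι → ℝ, (fun t : ℝ => Φ (t • v))
      = fun t => (F.shift t (V.scale fun z => ∑ i, v i * f i z)).density y := fun v => by
    funext t
    have : F.shift 1 (V.scale fun z => ∑ i, (t • v) i * f i z)
        = F.shift t (V.scale fun z => ∑ i, v i * f i z) := by
      simp only [SymplecticTriple.shift, SymplecticTriple.scale, Pi.smul_apply, smul_eq_mul,
        mul_assoc, ← Finset.mul_sum, one_smul, one_mul, mul_smul]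
    simp only [hΦ, this]
  have h6 : ∀ v : ι → ℝ, F.firstVariation (V.scale fun z => ∑ i, v i * f i z) y
      = fderiv ℝ Φ 0 v := fun v => by rw [← h3 v, h5 v, SymplecticTriple.firstVariation]
  have h7 : F.firstVariation (V.scale fun z => ∑ i, f i z) y = fderiv ℝ Φ 0 1 := by
    rw [← h6 1]
    simp
  have h8 : ∀ i, F.firstVariation (V.scale (f i)) y = fderiv ℝ Φ 0 (Pi.single i 1) := fun i => by
    rw [← h6]
    congr 1
    simp [SymplecticTriple.scale, Pi.single_apply]
  rw [h7]
  simp only [h8, ← map_sum]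
  congr 1
  exact (Finset.univ_sum_single (1 : ι → ℝ)).symm

theorem stringVar (hU : IsOpen U) (h : IsConfigOn U F) (hV : IsVariationOn U V) :
    StringVar U (fun t => (F.shift t V).toStringTriple) (F.stringVelocity V) := by
  have vg : VarM U (fun t => (F.shift t V).g) V.g := fun i j =>
    Var.line (h.metric.smooth i j) (hV.smg i j)
  have vβ : VarM U (fun t => (F.shift t V).β) V.β := fun i j =>
    Var.line (h.smβ i j) (hV.smβ i j)
  have hu0 : ∀ z ∈ U, IsUnit ((F.shift 0 V).β z).det := by
    rw [SymplecticTriple.shift_zero]; exact h.unitβ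
  have vB := vβ.inv hu0
  refine ⟨hU, by rw [SymplecticTriple.shift_zero]; exact h.toStringTriple, ?_, ?_,
    Var.line h.smφ hV.smφ, fun z hz => ?_, fun z hz => ?_⟩
  · refine ((vB.mul vg).mul vB).neg.congr_velocity fun z hz => ?_
    simp only [SymplecticTriple.shift_zero, SymplecticTriple.stringVelocity, SymplecticTriple.βInv]
    noncomm_ring
  · refine vB.congr_velocity fun z hz => ?_
    simp only [SymplecticTriple.shift_zero, SymplecticTriple.stringVelocity, SymplecticTriple.βInv]
  · simp only [SymplecticTriple.stringVelocity, Matrix.transpose_add, Matrix.transpose_sub,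
      Matrix.transpose_mul, h.skew_inv hz, h.metric.symm z hz, hV.symm z hz, hV.skew z hz]
    noncomm_ring
  · simp only [SymplecticTriple.stringVelocity, Matrix.transpose_neg,
      Matrix.transpose_mul, h.skew_inv hz, hV.skew z hz]
    noncomm_ring

/-- The first variation of the symplectic gravity Lagrangian in terms of the string fields. -/
theorem firstVariation_eq (hU : IsOpen U) (h : IsConfigOn U F) (hV : IsVariationOn U V)
    (hy : y ∈ U) : F.firstVariation V y = F.toStringTriple.elPairing (F.stringVelocity V) y
      + ∑ a, pd a (F.toStringTriple.current (F.stringVelocity V) a) y := by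
  have h1 := (h.stringVar hU hV).varDensity_eq.hd y hy
  rw [SymplecticTriple.shift_zero] at h1
  refine (h.hasDerivAt_density hU hV hy).unique (h1.congr_of_eventuallyEq ?_)
  have h2 : Filter.Tendsto (fun t : ℝ => (t, y)) (nhds 0) (nhds (0, y)) :=
    (Continuous.prodMk_left y).continuousAt
  exact h2.eventually ((h.isSymplecticFamily hU hV).eventually_density_eq hy)

end IsConfigOn

namespace StringTriple

variable {n : ℕ} {U : Set (Coord n)} {T : StringTriple n} {X ξ : Coord n → Coord n} {y : Coord n}

/-- The transposed Jacobian matrix `∂_m X^i` of a vector field, row `m` and column `i`. -/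
def gradM (X : Coord n → Coord n) (y : Coord n) : Matrix (Fin n) (Fin n) ℝ :=
  Matrix.of fun m i => pd m (fun z => X z i) y

/-- The exterior derivative of a one-form. -/
def extD (ξ : Coord n → Coord n) (y : Coord n) : Matrix (Fin n) (Fin n) ℝ :=
  gradM ξ y - (gradM ξ y).transpose

/-- The Lie derivatives of the string fields along `X`, combined with the gauge transformation
`B ↦ B - dξ`. -/
def lieGauge (T : StringTriple n) (X ξ : Coord n → Coord n) : StringTriple n where
  G y := ∑ m, X y m • pdM m T.G y + gradM X y * T.G y + T.G y * (gradM X y).transpose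
  B y := ∑ m, X y m • pdM m T.B y + gradM X y * T.B y + T.B y * (gradM X y).transpose - extD ξ y
  φ y := ∑ m, X y m * pd m T.φ y

/-- The fields pulled back along `z ↦ z + t X(z)`, with a gauge transformation. -/
def flowGauge (T : StringTriple n) (X ξ : Coord n → Coord n) (t : ℝ) : StringTriple n where
  G y := (1 + t • gradM X y) * T.G (y + t • X y) * (1 + t • gradM X y).transpose
  B y := (1 + t • gradM X y) * T.B (y + t • X y) * (1 + t • gradM X y).transpose - t • extD ξ y
  φ y := T.φ (y + t • X y)

end StringTriple

namespace IsStringConfigOn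

open StringTriple

variable {n : ℕ} {U : Set (Coord n)} {T : StringTriple n} {X ξ : Coord n → Coord n} {y : Coord n}

theorem var_flow {f : Coord n → ℝ} (hf : Sm U f) (hX : ∀ k, Sm U fun z => X z k) :
    Var U (fun t z => f (z + t • X z)) (fun z => ∑ m, X z m * pd m f z) := by
  constructor
  · rintro ⟨p, z⟩ ⟨hp, hz⟩
    obtain rfl : p = 0 := hp
    have hXz : ContDiffAt ℝ ∞ X z := contDiffAt_pi.2 fun k => hX k z hz
    have h2 : ContDiffAt ℝ ∞ (fun q : ℝ × Coord n => q.2 + q.1 • X q.2) (0, z) :=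
      contDiffAt_snd.add (contDiffAt_fst.smul (ContDiffAt.comp ((0 : ℝ), z) hXz contDiffAt_snd))
    refine ContDiffAt.comp ((0 : ℝ), z) (g := f) ?_ h2
    simpa using hf z hz
  · intro z hz
    have h1 := hasDerivAt_line (v := X z) ((hf.differentiableAt hz))
    refine h1.congr_deriv ?_
    have h2 : X z = ∑ m, X z m • (Pi.single m 1 : Coord n) := by
      funext k
      simp [Finset.sum_apply, Pi.single_apply]
    conv_lhs => rw [h2]
    simp only [map_sum, map_smul, smul_eq_mul, pd]

theorem smM_gradM (hX : ∀ k, Sm U fun z => X z k) : SmM U (gradM X) := fun m i => (hX i).pd m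

theorem stringVar_flowGauge (hU : IsOpen U) (h : IsStringConfigOn U T)
    (hX : ∀ k, Sm U fun z => X z k) (hξ : ∀ k, Sm U fun z => ξ z k) :
    StringVar U (T.flowGauge X ξ) (T.lieGauge X ξ) := by
  have hA : VarM U (fun t z => 1 + t • gradM X z) (gradM X) := fun i j =>
    Var.line (f := fun _ => (1 : Matrix (Fin n) (Fin n) ℝ) i j) (Sm.const _) (smM_gradM hX i j)
  have hw : VarM U (fun t z => t • extD ξ z) (extD ξ) := fun i j =>
    Var.congr_velocity (f := fun t z => t * extD ξ z i j) (f' := fun z => extD ξ z i j) (by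
      have := Var.line (f := fun _ => (0 : ℝ)) (f' := fun z => extD ξ z i j) (Sm.const (U := U) _)
        ((smM_gradM hξ i j).sub (smM_gradM hξ j i))
      simpa only [zero_add] using this) fun _ _ => rfl
  have hG : VarM U (fun t z => T.G (z + t • X z)) (fun z => ∑ m, X z m • pdM m T.G z) := by
    intro i j
    refine (var_flow (h.metric.smooth i j) hX).congr_velocity fun z hz => ?_
    simp [Matrix.sum_apply]
  have hB : VarM U (fun t z => T.B (z + t • X z)) (fun z => ∑ m, X z m • pdM m T.B z) := by
    intro i j
    refine (var_flow (h.smB i j) hX).congr_velocity fun z hz => ?_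
    simp [Matrix.sum_apply]
  have e0 : T.flowGauge X ξ 0 = T := by simp [flowGauge]
  have hsG : ∀ z ∈ U, ∀ m, (pdM m T.G z).transpose = pdM m T.G z := fun z hz m => by
    rw [← pdM_transpose]
    exact pdM_congr m hU h.metric.symm hz
  have hsB : ∀ z ∈ U, ∀ m, (pdM m T.B z).transpose = -pdM m T.B z := fun z hz m => by
    rw [← pdM_transpose, ← pdM_neg]
    exact pdM_congr m hU h.skew hz
  refine ⟨hU, by rw [e0]; exact h, ?_, ?_, var_flow h.smφ hX, fun z hz => ?_, fun z hz => ?_⟩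
  · refine ((hA.mul hG).mul hA.transpose).congr_velocity fun z hz => ?_
    simp only [lieGauge, zero_smul, add_zero, one_mul, Matrix.transpose_one, mul_one]
    abel
  · simp only [flowGauge, sub_eq_add_neg]
    refine (((hA.mul hB).mul hA.transpose).add hw.neg).congr_velocity fun z hz => ?_
    simp only [lieGauge, zero_smul, add_zero, one_mul, Matrix.transpose_one, mul_one]
    abel
  · simp only [lieGauge, Matrix.transpose_add, Matrix.transpose_sum, Matrix.transpose_smul,
      hsG z hz, Matrix.transpose_mul, Matrix.transpose_transpose, h.metric.symm z hz]
    abel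
  · simp only [lieGauge, Matrix.transpose_add, Matrix.transpose_sub, Matrix.transpose_sum,
      Matrix.transpose_smul, extD,
      hsB z hz, Matrix.transpose_mul, Matrix.transpose_transpose, h.skew z hz, smul_neg,
      Finset.sum_neg_distrib, mul_neg, neg_mul]
    abel

end IsStringConfigOn

/-! ### Invariance of the Lagrangian under diffeomorphisms and gauge transformations -/

namespace IsStringConfigOn

open StringTriple

variable {n : ℕ} {U : Set (Coord n)} {T : StringTriple n} {X ξ : Coord n → Coord n} {y : Coord n}

/-- The displaced coordinates `z ↦ z + t X(z)` are a change of coordinates near `y` for small `t`. -/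
theorem eventually_coordChange (hU : IsOpen U) (hX : ∀ k, Sm U fun z => X z k) (hy : y ∈ U) :
    ∀ᶠ t in nhds (0 : ℝ), ∃ W ⊆ U, y ∈ W ∧ IsLocalCoordChange W U (fun z => z + t • X z) ∧
      ∀ z ∈ W, jac (fun z => z + t • X z) z = (1 + t • gradM X z).transpose := by
  have hXy : ContDiffAt ℝ ∞ X y := contDiffAt_pi.2 fun k => hX k y hy
  have h1 : ContinuousAt (fun q : ℝ × Coord n => q.2 + q.1 • X q.2) (0, y) :=
    continuousAt_snd.add (continuousAt_fst.smul
      (ContinuousAt.comp (f := fun q : ℝ × Coord n => q.2) hXy.continuousAt continuousAt_snd))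
  have h2 : JSmM U (fun (t : ℝ) z => 1 + t • gradM X z) := fun i j =>
    (JSm.const _).add ((JSm.param contDiff_id).mul (JSm.of_sm (smM_gradM hX i j)))
  have h3 : Sm (({0} : Set ℝ) ×ˢ U) (fun q => (1 + q.1 • gradM X q.2).det) :=
    SmM.det (M := fun q : ℝ × Coord n => 1 + q.1 • gradM X q.2) h2
  have h4 : ∀ᶠ q in nhds ((0 : ℝ), y), q.2 ∈ U ∧ q.2 + q.1 • X q.2 ∈ U
      ∧ IsUnit (1 + q.1 • gradM X q.2).det :=
    (continuousAt_snd.eventually (hU.mem_nhds hy)).and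
      ((h1.eventually (by simpa using hU.mem_nhds hy)).and
        (h3.pos (y := (0, y)) ⟨rfl, hy⟩ (by simp)))
  have h5 : Filter.Tendsto (fun t : ℝ => (t, y)) (nhds 0) (nhds (0, y)) :=
    (Continuous.prodMk_left y).continuousAt
  filter_upwards [h5.eventually h4.eventually_nhds] with t ht
  have h6 : Filter.Tendsto (fun w : Coord n => (t, w)) (nhds y) (nhds (t, y)) :=
    (Continuous.prodMk_right t).continuousAt
  obtain ⟨W, hW, hWo, hyW⟩ := eventually_nhds_iff.1 (h6.eventually ht)
  have hWU : W ⊆ U := fun w hw => (hW w hw).1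
  have hid : ∀ k, Sm W fun z : Coord n => z k := fun k z _ => by fun_prop
  have hsm : ∀ k, Sm W fun z => (z + t • X z) k := fun k =>
    (hid k).add ((Sm.const t).mul ((hX k).mono hWU))
  have hjac : ∀ z ∈ W, jac (fun z => z + t • X z) z = (1 + t • gradM X z).transpose := by
    intro z hz
    ext k i
    have e1 : HasFDerivAt (fun z => (z + t • X z) k)
        ((ContinuousLinearMap.proj k).comp (fderiv ℝ (fun z => z + t • X z) z)) z :=
      hasFDerivAt_pi'.1 (differentiableAt_pi.2 fun k => (hsm k).differentiableAt hz).hasFDerivAt k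
    have e2 : jac (fun z => z + t • X z) z k i = pd i (fun z => (z + t • X z) k) z := by
      unfold pd
      rw [e1.fderiv, jac, LinearMap.toMatrix'_apply]
      rfl
    have e3 : pd i (fun z : Coord n => z k) z = (1 : Matrix (Fin n) (Fin n) ℝ) i k := by
      unfold pd
      rw [(hasFDerivAt_apply k z).fderiv]
      simp [Matrix.one_apply, Pi.single_apply, eq_comm]
    have e4 : pd i (fun z => (z + t • X z) k) z
        = pd i (fun z => z k) z + pd i (fun z => t * X z k) z :=
      pd_add i (hid k) ((Sm.const t).mul ((hX k).mono hWU)) hz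
    rw [e2, e4, e3, pd_const_mul i t ((hX k).mono hWU) hz]
    rfl
  refine ⟨W, hWU, hyW, ⟨hWo, hU, hsm, fun z hz => (hW z hz).2.1, fun z hz => ?_⟩, hjac⟩
  rw [hjac z hz, Matrix.det_transpose]
  exact (hW z hz).2.2

theorem extD_zero : extD (0 : Coord n → Coord n) y = 0 := by
  ext i j
  simp [extD, gradM, pd]

/-- A gauge transformation does not change the field strength. -/
theorem H_flowGauge (hξ : ∀ k, Sm U fun z => ξ z k) {t : ℝ}
    {W : Set (Coord n)} (hWU : W ⊆ U) (hB : SmM W (T.flowGauge X 0 t).B) {z : Coord n} (hz : z ∈ W)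
    (a b c : Fin n) : (T.flowGauge X ξ t).H a b c z = (T.flowGauge X 0 t).H a b c z := by
  have hzU := hWU hz
  have h1 : ∀ a b c, pd a (fun w => (T.flowGauge X ξ t).B w b c) z
      = pd a (fun w => (T.flowGauge X 0 t).B w b c) z
        - t * (pd a (pd b fun w => ξ w c) z - pd a (pd c fun w => ξ w b) z) := fun a b c => by
    have e1 : (fun w => (T.flowGauge X ξ t).B w b c) = fun w => (T.flowGauge X 0 t).B w b c
        - t * (pd b (fun w => ξ w c) w - pd c (fun w => ξ w b) w) := by
      funext w
      simp only [flowGauge, extD_zero, smul_zero, sub_zero]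
      rfl
    have s1 : Sm W fun w => pd b (fun w => ξ w c) w - pd c (fun w => ξ w b) w :=
      (((hξ c).pd b).sub ((hξ b).pd c)).mono hWU
    rw [e1, pd_sub a (hB b c) ((Sm.const t).mul s1) hz, pd_const_mul a t s1 hz,
      pd_sub a (((hξ c).pd b).mono hWU) (((hξ b).pd c).mono hWU) hz]
  simp only [StringTriple.H, h1]
  rw [pd_comm c a (hξ b) hzU, pd_comm b a (hξ c) hzU, pd_comm c b (hξ a) hzU]
  ring

/-- The string Lagrangian depends on `B` only through `H = dB`, which makes it gauge invariant. -/
theorem density_congr_H {T T' : StringTriple n} (hG : T.G = T'.G) (hφ : T.φ = T'.φ)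
    (hH : ∀ a b c, T.H a b c y = T'.H a b c y) : T.density y = T'.density y := by
  have hΓ : T.Γ = T'.Γ := by
    funext i j k z
    simp only [StringTriple.Γ, StringTriple.GInv, hG]
  simp only [StringTriple.density, StringTriple.scalarCurv, StringTriple.Ric, StringTriple.Riem,
    StringTriple.GInv, StringTriple.HSq, StringTriple.kinetic, hG, hφ, hH, hΓ]

/-- To first order in `t` the diffeomorphism generated by `X` is `z ↦ z + t X z`, with Jacobian
`1 + t ∂X`; pulling back along it and adding an exact two-form to `B` multiplies the Lagrangian by
the Jacobian determinant only. -/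
theorem eventually_density_flowGauge (hU : IsOpen U) (h : IsStringConfigOn U T)
    (hX : ∀ k, Sm U fun z => X z k) (hξ : ∀ k, Sm U fun z => ξ z k) (hy : y ∈ U) :
    ∀ᶠ t in nhds (0 : ℝ), (T.flowGauge X ξ t).density y
      = |(1 + t • gradM X y).det| * T.density (y + t • X y) := by
  filter_upwards [eventually_coordChange hU hX hy] with t ⟨W, hWU, hyW, hτ, hjac⟩
  have hJ : SmM W fun z => (1 + t • gradM X z) := fun i j =>
    (Sm.const _).add ((Sm.const t).mul ((smM_gradM hX i j).mono hWU))
  have hunit : ∀ z ∈ W, IsUnit (1 + t • gradM X z).det := fun z hz => by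
    rw [← Matrix.det_transpose, ← hjac z hz]
    exact hτ.unit z hz
  have hB : SmM W (T.flowGauge X 0 t).B := by
    have e : (T.flowGauge X 0 t).B = fun z => (1 + t • gradM X z) * T.B (z + t • X z)
        * (1 + t • gradM X z).transpose := by
      funext z
      simp only [flowGauge, extD_zero, smul_zero, sub_zero]
    rw [e]
    exact (hJ.mul fun i j => hτ.sm_comp (h.smB i j)).mul hJ.transpose
  have hS : IsStringConfigOn W (T.flowGauge X 0 t) := by
    refine ⟨⟨(hJ.mul fun i j => hτ.sm_comp (h.metric.smooth i j)).mul hJ.transpose, fun z hz => ?_,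
      fun z hz => ?_⟩, hB, fun z hz => ?_, hτ.sm_comp h.smφ⟩
    · simp only [flowGauge, Matrix.transpose_mul, Matrix.transpose_transpose,
        h.metric.symm _ (hτ.mapsTo z hz), mul_assoc]
    · simp only [flowGauge, Matrix.det_mul, Matrix.det_transpose]
      exact ((hunit z hz).mul (h.metric.unit _ (hτ.mapsTo z hz))).mul (hunit z hz)
    · simp only [flowGauge, extD_zero, smul_zero, sub_zero, Matrix.transpose_mul,
        Matrix.transpose_transpose, h.skew _ (hτ.mapsTo z hz), mul_assoc, neg_mul, mul_neg]
  have h1 := hτ.string_density_eq hS h (fun z hz => by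
    rw [hjac z hz]
    refine ⟨?_, ?_, rfl⟩
    · simp only [flowGauge, Matrix.transpose_transpose]
    · simp only [flowGauge, extD_zero, smul_zero, sub_zero, Matrix.transpose_transpose]) hyW
  rw [hjac y hyW, Matrix.det_transpose] at h1
  rw [← h1]
  exact density_congr_H rfl rfl fun a b c => H_flowGauge hξ hWU hB hyW a b c

/-- The Lagrangian varies by a total derivative under Lie derivatives and gauge transformations. -/
theorem elPairing_lieGauge (hU : IsOpen U) (h : IsStringConfigOn U T)
    (hX : ∀ k, Sm U fun z => X z k) (hξ : ∀ k, Sm U fun z => ξ z k) (hy : y ∈ U) :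
    T.elPairing (T.lieGauge X ξ) y + ∑ a, pd a (T.current (T.lieGauge X ξ) a) y
      = ∑ m, pd m (fun z => X z m * T.density z) y := by
  have h1 := (h.stringVar_flowGauge hU hX hξ).varDensity_eq.hd y hy
  have e0 : T.flowGauge X ξ 0 = T := by simp [flowGauge]
  rw [e0] at h1
  have h2 : HasDerivAt (fun t : ℝ => (1 + t • gradM X y).det) (gradM X y).trace 0 := by
    have := hasDerivAt_det (c := fun t : ℝ => 1 + t • gradM X y) (H := gradM X y) (s := 0)
      (fun a b => by
        simpa using ((hasDerivAt_id (0 : ℝ)).mul_const (gradM X y a b)).const_add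
          ((1 : Matrix (Fin n) (Fin n) ℝ) a b)) (by simp)
    simpa using this
  have h3 := (var_flow h.sm_density hX).hd y hy
  have h4 := h2.mul h3
  have h5 : ∀ᶠ t in nhds (0 : ℝ), 0 < (1 + t • gradM X y).det :=
    h2.continuousAt.eventually (lt_mem_nhds (by simp))
  have h6 := h1.unique (h4.congr_of_eventuallyEq (by
    filter_upwards [h5, h.eventually_density_flowGauge hU hX hξ hy] with t ht1 ht2
    rw [ht2, abs_of_pos ht1]
    rfl))
  rw [h6]
  have h7 : ∀ m, pd m (fun z => X z m * T.density z) y = gradM X y m m * T.density y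
      + X y m * pd m T.density y := fun m => pd_mul m (hX m) h.sm_density hy
  simp only [h7, Finset.sum_add_distrib, zero_smul, add_zero, Matrix.det_one, one_mul,
    ← Finset.sum_mul]
  rfl

end IsStringConfigOn

namespace IsConfigOn

open StringTriple

variable {n : ℕ} {U : Set (Coord n)} {F : SymplecticTriple n} {X ξ : Coord n → Coord n} {y : Coord n}

theorem diffeoVariation_g (y : Coord n) : (F.diffeoVariation X).g y
    = ∑ m, X y m • pdM m F.g y - (gradM X y).transpose * F.g y - F.g y * gradM X y := by
  ext i j
  simp only [SymplecticTriple.diffeoVariation, Matrix.of_apply, Matrix.sub_apply, Matrix.sum_apply,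
    Matrix.smul_apply, pdM_apply, smul_eq_mul, Matrix.mul_apply, Matrix.transpose_apply, gradM,
    Finset.sum_sub_distrib]
  simp only [mul_comm]

theorem diffeoVariation_β (y : Coord n) : (F.diffeoVariation X).β y
    = ∑ m, X y m • pdM m F.β y - (gradM X y).transpose * F.β y - F.β y * gradM X y := by
  ext i j
  simp only [SymplecticTriple.diffeoVariation, Matrix.of_apply, Matrix.sub_apply, Matrix.sum_apply,
    Matrix.smul_apply, pdM_apply, smul_eq_mul, Matrix.mul_apply, Matrix.transpose_apply, gradM,
    Finset.sum_sub_distrib]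
  simp only [mul_comm]

theorem isVariationOn_diffeoVariation (hU : IsOpen U) (h : IsConfigOn U F)
    (hX : ∀ k, Sm U fun z => X z k) : IsVariationOn U (F.diffeoVariation X) where
  smg i j := Sm.sum (s := Finset.univ) fun m => (((hX m).mul ((h.metric.smooth i j).pd m)).sub
    ((h.metric.smooth m j).mul ((hX i).pd m))).sub ((h.metric.smooth i m).mul ((hX j).pd m))
  smβ i j := Sm.sum (s := Finset.univ) fun m => (((hX m).mul ((h.smβ i j).pd m)).sub
    ((h.smβ m j).mul ((hX i).pd m))).sub ((h.smβ i m).mul ((hX j).pd m))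
  smφ := Sm.sum (s := Finset.univ) fun m => (hX m).mul (h.smφ.pd m)
  symm z hz := by
    have hs : ∀ m, (pdM m F.g z).transpose = pdM m F.g z := fun m => by
      rw [← pdM_transpose]
      exact pdM_congr m hU h.metric.symm hz
    simp only [diffeoVariation_g, Matrix.transpose_sub, Matrix.transpose_sum, Matrix.transpose_smul,
      hs, Matrix.transpose_mul, Matrix.transpose_transpose, h.metric.symm z hz]
    abel
  skew z hz := by
    have hs : ∀ m, (pdM m F.β z).transpose = -pdM m F.β z := fun m => by
      rw [← pdM_transpose, ← pdM_neg]
      exact pdM_congr m hU h.skew hz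
    simp only [diffeoVariation_β, Matrix.transpose_sub, Matrix.transpose_sum, Matrix.transpose_smul,
      hs, Matrix.transpose_mul, Matrix.transpose_transpose, h.skew z hz, smul_neg,
      Finset.sum_neg_distrib, mul_neg, neg_mul]
    abel

/-- The image of a one-form under the anchor `β`. -/
def anchor (F : SymplecticTriple n) (ξ : Coord n → Coord n) (z : Coord n) : Coord n :=
  fun m => ∑ k, ξ z k * F.β z k m

theorem sm_anchor (h : IsConfigOn U F) (hξ : ∀ k, Sm U fun z => ξ z k) (k : Fin n) :
    Sm U fun z => anchor F ξ z k := Sm.sum fun i => (hξ i).mul (h.smβ i k)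

theorem gradM_anchor (h : IsConfigOn U F) (hξ : ∀ k, Sm U fun z => ξ z k) (hy : y ∈ U) :
    gradM (anchor F ξ) y = gradM ξ y * F.β y
      + Matrix.of fun m i => ∑ k, ξ y k * pd m (fun z => F.β z k i) y := by
  ext m i
  simp only [gradM, anchor, Matrix.of_apply, Matrix.add_apply, Matrix.mul_apply]
  rw [pd_sum m (fun k => (hξ k).mul (h.smβ k i)) hy, ← Finset.sum_add_distrib]
  exact Finset.sum_congr rfl fun k _ => pd_mul m (hξ k) (h.smβ k i) hy

theorem sum_anchor (f : Coord n → ℝ) :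
    ∑ m, ξ y m * F.D m f y = ∑ m, anchor F ξ y m * pd m f y := by
  simp only [SymplecticTriple.D, anchor]
  exact sum_mul_sum_mul _ _ _

/-- A `β`-diffeomorphism is a diffeomorphism along `β ξ` up to a two-form transformation. -/
theorem betaVariation_g (hU : IsOpen U) (h : IsConfigOn U F) (hξ : ∀ k, Sm U fun z => ξ z k)
    (hy : y ∈ U) : (F.betaVariation ξ).g y = (F.diffeoVariation (anchor F ξ)).g y
      + F.β y * extD ξ y * F.g y + F.g y * extD ξ y * F.β y := by
  set R : Matrix (Fin n) (Fin n) ℝ := Matrix.of fun m i => ∑ k, ξ y k * pd m (fun z => F.β z k i) y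
    with hR
  have hβs : ∀ m i k, pd m (fun z => F.β z i k) y = -pd m (fun z => F.β z k i) y := fun m i k => by
    rw [← pd_neg]
    exact pd_congr m hU (fun z hz => congrFun (congrFun (h.skew z hz) k) i) hy
  have h1 : ∀ i m, F.D i (fun z => ξ z m) y + ∑ k, ξ y k * F.Q m i k y
      = (F.β y * gradM ξ y - R.transpose) i m := fun i m => by
    simp only [SymplecticTriple.D, SymplecticTriple.Q, Matrix.sub_apply, Matrix.mul_apply, gradM, hR,
      Matrix.of_apply, Matrix.transpose_apply, hβs m i, mul_neg, Finset.sum_neg_distrib]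
    ring
  have h2 : (F.betaVariation ξ).g y = ∑ m, anchor F ξ y m • pdM m F.g y
      + (F.β y * gradM ξ y - R.transpose) * F.g y
      + F.g y * (F.β y * gradM ξ y - R.transpose).transpose := by
    ext i j
    simp only [SymplecticTriple.betaVariation, Matrix.of_apply, sum_anchor, h1]
    rw [Matrix.add_apply, Matrix.add_apply, Matrix.mul_apply, Matrix.mul_apply, Matrix.sum_apply]
    simp only [Matrix.smul_apply, pdM_apply, smul_eq_mul, Matrix.transpose_apply,
      mul_comm (F.g y _ j)]
  rw [h2, diffeoVariation_g, gradM_anchor h hξ hy, ← hR, extD]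
  simp only [Matrix.transpose_sub, Matrix.transpose_add, Matrix.transpose_mul,
    Matrix.transpose_transpose, h.skew y hy]
  noncomm_ring

theorem betaVariation_β (hU : IsOpen U) (h : IsConfigOn U F) (hξ : ∀ k, Sm U fun z => ξ z k)
    (hy : y ∈ U) : (F.betaVariation ξ).β y = (F.diffeoVariation (anchor F ξ)).β y
      + F.β y * extD ξ y * F.β y := by
  set R : Matrix (Fin n) (Fin n) ℝ := Matrix.of fun m i => ∑ k, ξ y k * pd m (fun z => F.β z k i) y
    with hR
  have hβs : ∀ m i k, pd m (fun z => F.β z i k) y = -pd m (fun z => F.β z k i) y := fun m i k => by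
    rw [← pd_neg]
    exact pd_congr m hU (fun z hz => congrFun (congrFun (h.skew z hz) k) i) hy
  have h1 : ∀ i j, ∑ m, ξ y m * F.D i (fun z => F.β z m j) y = (F.β y * R) i j := fun i j => by
    simp only [SymplecticTriple.D, hR, Matrix.mul_apply, Matrix.of_apply, Finset.mul_sum]
    rw [Finset.sum_comm]
    exact Finset.sum_congr rfl fun a _ => Finset.sum_congr rfl fun b _ => by ring
  have h1' : ∀ i j, ∑ m, ξ y m * F.D i (fun z => F.β z j m) y = -(F.β y * R) i j := fun i j => by
    rw [← h1, ← Finset.sum_neg_distrib]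
    refine Finset.sum_congr rfl fun m _ => ?_
    simp only [SymplecticTriple.D, hβs _ j m, mul_neg, Finset.sum_neg_distrib]
  have h2 : (F.betaVariation ξ).β y = ∑ m, anchor F ξ y m • pdM m F.β y
      - F.β y * R + (F.β y * R).transpose := by
    ext i j
    simp only [SymplecticTriple.betaVariation, SymplecticTriple.Θ, Matrix.of_apply, mul_add,
      Finset.sum_add_distrib, sum_anchor, h1, h1']
    rw [Matrix.add_apply, Matrix.sub_apply, Matrix.sum_apply]
    simp only [Matrix.smul_apply, pdM_apply, smul_eq_mul, Matrix.transpose_apply]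
    ring
  rw [h2, diffeoVariation_β, gradM_anchor h hξ hy, ← hR, extD]
  simp only [Matrix.transpose_add, Matrix.transpose_mul, h.skew y hy]
  noncomm_ring

theorem betaVariation_φ (y : Coord n) :
    (F.betaVariation ξ).φ y = (F.diffeoVariation (anchor F ξ)).φ y := sum_anchor _

theorem smM_extD (hξ : ∀ k, Sm U fun z => ξ z k) : SmM U (extD ξ) := fun i j =>
  (IsStringConfigOn.smM_gradM hξ i j).sub (IsStringConfigOn.smM_gradM hξ j i)

theorem extD_transpose : (extD ξ y).transpose = -extD ξ y := by
  simp [extD]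

theorem isVariationOn_betaVariation (hU : IsOpen U) (h : IsConfigOn U F)
    (hξ : ∀ k, Sm U fun z => ξ z k) : IsVariationOn U (F.betaVariation ξ) := by
  have hd := isVariationOn_diffeoVariation hU h (h.sm_anchor hξ)
  have hE := smM_extD hξ
  refine ⟨fun i j => ?_, fun i j => ?_, ?_, fun z hz => ?_, fun z hz => ?_⟩
  · refine Sm.congr hU (f := fun z => ((F.diffeoVariation (anchor F ξ)).g z
      + F.β z * extD ξ z * F.g z + F.g z * extD ξ z * F.β z) i j) ?_
      fun z hz => by rw [betaVariation_g hU h hξ hz]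
    exact ((hd.smg.add ((h.smβ.mul hE).mul h.metric.smooth)).add
      ((h.metric.smooth.mul hE).mul h.smβ)) i j
  · refine Sm.congr hU (f := fun z => ((F.diffeoVariation (anchor F ξ)).β z
      + F.β z * extD ξ z * F.β z) i j) ?_ fun z hz => by rw [betaVariation_β hU h hξ hz]
    exact (hd.smβ.add ((h.smβ.mul hE).mul h.smβ)) i j
  · exact hd.smφ.congr hU fun z _ => betaVariation_φ z
  · simp only [betaVariation_g hU h hξ hz, Matrix.transpose_add, Matrix.transpose_mul,
      hd.symm z hz, h.skew z hz, h.metric.symm z hz, extD_transpose]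
    noncomm_ring
  · simp only [betaVariation_β hU h hξ hz, Matrix.transpose_add, Matrix.transpose_mul,
      hd.skew z hz, h.skew z hz, extD_transpose]
    noncomm_ring

/-- A combined infinitesimal diffeomorphism and two-form transformation of the symplectic gravity
fields corresponds to a diffeomorphism and gauge transformation of the string fields. -/
theorem stringVelocity_eq (hU : IsOpen U) (h : IsConfigOn U F) {V : SymplecticTriple n}
    (hg : V.g y = (F.diffeoVariation X).g y + F.β y * extD ξ y * F.g y + F.g y * extD ξ y * F.β y)
    (hβ : V.β y = (F.diffeoVariation X).β y + F.β y * extD ξ y * F.β y)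
    (hφ : V.φ y = (F.diffeoVariation X).φ y) (hy : y ∈ U) :
    (F.stringVelocity V).G y = (F.toStringTriple.lieGauge X ξ).G y
    ∧ (F.stringVelocity V).B y = (F.toStringTriple.lieGauge X ξ).B y
    ∧ (F.stringVelocity V).φ y = (F.toStringTriple.lieGauge X ξ).φ y := by
  have hu := h.unitβ y hy
  set B := F.βInv y with hBdef
  set β := F.β y with hβdef
  have e1 : B * β = 1 := Matrix.nonsing_inv_mul _ hu
  have e2 : β * B = 1 := Matrix.mul_nonsing_inv _ hu
  have hBsm : SmM U F.βInv := h.smβ.inv h.unitβ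
  have dB : ∀ m, pdM m F.βInv y = -(B * pdM m F.β y * B) := fun m =>
    pdM_inv m hU h.smβ h.unitβ hy
  have dG : ∀ m, pdM m F.toStringTriple.G y = -(pdM m F.βInv y * F.g y * B
      + B * pdM m F.g y * B + B * F.g y * pdM m F.βInv y) := fun m => by
    have : pdM m F.toStringTriple.G y
        = -pdM m (fun z => F.βInv z * F.g z * F.βInv z) y := pdM_neg m
    rw [this, pdM_mul m (hBsm.mul h.metric.smooth) hBsm hy, pdM_mul m hBsm h.metric.smooth hy]
    noncomm_ring
  set S := ∑ m, X y m • pdM m F.β y with hS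
  set Sg := ∑ m, X y m • pdM m F.g y with hSg
  have sB : ∑ m, X y m • pdM m F.βInv y = -(B * S * B) := by
    simp only [dB, hS, Finset.mul_sum, Finset.sum_mul, ← Finset.sum_neg_distrib, smul_neg,
      Matrix.mul_smul, Matrix.smul_mul]
  have sG : ∑ m, X y m • pdM m F.toStringTriple.G y = -(-(B * S * B) * F.g y * B + B * Sg * B
      + B * F.g y * (-(B * S * B))) := by
    rw [← sB]
    simp only [dG, hSg, Finset.mul_sum, Finset.sum_mul, Finset.sum_neg_distrib, smul_neg,
      Matrix.mul_smul, Matrix.smul_mul, smul_add, Finset.sum_add_distrib]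
  have hb : B * V.β y * B = B * S * B - B * (gradM X y).transpose - gradM X y * B + extD ξ y := by
    rw [hβ, diffeoVariation_β, ← hS, ← hβdef]
    have e3 : B * ((gradM X y).transpose * β) * B = B * (gradM X y).transpose := by
      rw [mul_assoc, mul_assoc, e2, mul_one]
    have e4 : B * (β * gradM X y) * B = gradM X y * B := by
      rw [← mul_assoc, e1, one_mul]
    have e5 : B * (β * extD ξ y * β) * B = extD ξ y := by
      rw [← mul_assoc, ← mul_assoc, e1, one_mul, mul_assoc, e2, mul_one]
    simp only [mul_add, mul_sub, add_mul, sub_mul, e3, e4, e5]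
  refine ⟨?_, ?_, hφ⟩
  · simp only [SymplecticTriple.stringVelocity, lieGauge]
    rw [sG, ← hBdef, hb, hg, diffeoVariation_g, ← hSg]
    have hG : F.toStringTriple.G y = -(B * F.g y * B) := rfl
    have e3 : B * (β * extD ξ y * F.g y) * B = extD ξ y * F.g y * B := by
      rw [← mul_assoc, ← mul_assoc, e1, one_mul]
    have e4 : B * (F.g y * extD ξ y * β) * B = B * F.g y * extD ξ y := by
      rw [← mul_assoc, mul_assoc, e2, mul_one, ← mul_assoc]
    rw [hG]
    simp only [mul_add, mul_sub, add_mul, sub_mul, e3, e4]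
    noncomm_ring
  · simp only [SymplecticTriple.stringVelocity, lieGauge]
    have hB : F.toStringTriple.B = F.βInv := rfl
    rw [hB, sB, ← hBdef, hb]
    noncomm_ring

/-- A variation of `(ĝ, β, φ)` made of a Lie derivative along `X` and of the gauge transformation of
`B = β⁻¹` by `dξ` at fixed `G = -β⁻¹ ĝ β⁻¹` changes the Lagrangian by the divergence of `X ℒ`.
With `ξ = 0` this is the diffeomorphism symmetry; the `β`-diffeomorphisms are another special
case. -/
theorem firstVariation_lieGauge (hU : IsOpen U) (h : IsConfigOn U F)
    (hX : ∀ k, Sm U fun z => X z k) (hξ : ∀ k, Sm U fun z => ξ z k) {V : SymplecticTriple n}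
    (hV : IsVariationOn U V)
    (hg : ∀ z ∈ U, V.g z = (F.diffeoVariation X).g z + F.β z * extD ξ z * F.g z
      + F.g z * extD ξ z * F.β z)
    (hβ : ∀ z ∈ U, V.β z = (F.diffeoVariation X).β z + F.β z * extD ξ z * F.β z)
    (hφ : ∀ z ∈ U, V.φ z = (F.diffeoVariation X).φ z) (hy : y ∈ U) :
    F.firstVariation V y = ∑ m, pd m (fun z => X z m * F.density z) y := by
  have h1 : StringVar U (F.toStringTriple.flowGauge X ξ) (F.stringVelocity V) := by
    have h2 := h.toStringTriple.stringVar_flowGauge hU hX hξ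
    have h3 := fun z (hz : z ∈ U) => stringVelocity_eq hU h (hg z hz) (hβ z hz) (hφ z hz) hz
    exact ⟨hU, h2.config, h2.varG.congr_velocity fun z hz => (h3 z hz).1,
      h2.varB.congr_velocity fun z hz => (h3 z hz).2.1,
      h2.varφ.congr_velocity fun z hz => (h3 z hz).2.2,
      fun z hz => by rw [(h3 z hz).1]; exact h2.symm z hz,
      fun z hz => by rw [(h3 z hz).2.1]; exact h2.skew z hz⟩
  have e0 : F.toStringTriple.flowGauge X ξ 0 = F.toStringTriple := by simp [flowGauge]
  have h4 := h1.varDensity_eq.hd y hy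
  have h5 := (h.toStringTriple.stringVar_flowGauge hU hX hξ).varDensity_eq.hd y hy
  have h6 := h4.unique h5
  rw [e0] at h6
  rw [h.firstVariation_eq hU hV hy, h6, h.toStringTriple.elPairing_lieGauge hU hX hξ hy]
  exact Finset.sum_congr rfl fun m _ => pd_congr m hU (fun z hz => by rw [h.density_eq hU hz]) hy

theorem firstVariation_diffeoVariation (hU : IsOpen U) (h : IsConfigOn U F)
    (hX : ∀ k, Sm U fun z => X z k) (hy : y ∈ U) : F.firstVariation (F.diffeoVariation X) y
      = ∑ m, pd m (fun z => X z m * F.density z) y :=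
  firstVariation_lieGauge (ξ := 0) hU h hX (fun _ => Sm.const 0)
    (isVariationOn_diffeoVariation hU h hX)
    (fun z _ => by simp [IsStringConfigOn.extD_zero]) (fun z _ => by simp [IsStringConfigOn.extD_zero])
    (fun _ _ => rfl) hy

theorem firstVariation_betaVariation (hU : IsOpen U) (h : IsConfigOn U F)
    (hξ : ∀ k, Sm U fun z => ξ z k) (hy : y ∈ U) : F.firstVariation (F.betaVariation ξ) y
      = ∑ m, pd m (fun z => (∑ k, ξ z k * F.β z k m) * F.density z) y :=
  firstVariation_lieGauge hU h (h.sm_anchor hξ) hξ (isVariationOn_betaVariation hU h hξ)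
    (fun _ hz => betaVariation_g hU h hξ hz) (fun _ hz => betaVariation_β hU h hξ hz)
    (fun z _ => betaVariation_φ z) hy

end IsConfigOn

/-! ### Covariance of the infinitesimal symmetries -/

namespace IsLocalCoordChange

open StringTriple IsConfigOn

variable {n : ℕ} {U U' : Set (Coord n)} {τ : Coord n → Coord n} {y : Coord n}
  {F F' : SymplecticTriple n} {X X' ξ ξ' : Coord n → Coord n}

/-- Partial derivatives along a vector field of a composition with a change of coordinates. -/
theorem sum_pd_comp (h : IsLocalCoordChange U U' τ) {f : Coord n → ℝ} (hf : Sm U' f)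
    (hX : vectorLaw (jac τ y) X X' y (τ y)) (hy : y ∈ U) :
    ∑ k, X' (τ y) k * pd k f (τ y) = ∑ i, X y i * pd i (fun z => f (τ z)) y := by
  rw [show X' (τ y) = (jac τ y).mulVec (X y) from hX]
  simp only [h.pd_comp hf hy, Matrix.mulVec, dotProduct, Finset.sum_mul, Finset.mul_sum]
  rw [Finset.sum_comm]
  exact Finset.sum_congr rfl fun i _ => Finset.sum_congr rfl fun k _ => by ring

theorem sum_pdM_comp (h : IsLocalCoordChange U U' τ) {M : Coord n → Matrix (Fin n) (Fin n) ℝ}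
    (hM : SmM U' M) (hX : vectorLaw (jac τ y) X X' y (τ y)) (hy : y ∈ U) :
    ∑ k, X' (τ y) k • pdM k M (τ y) = ∑ i, X y i • pdM i (fun z => M (τ z)) y := by
  ext a b
  simp only [Matrix.sum_apply, Matrix.smul_apply, smul_eq_mul, pdM_apply]
  exact h.sum_pd_comp (hM a b) hX hy

/-- The Lie derivative of a contravariant two-tensor is a contravariant two-tensor. -/
theorem lie_tensor (h : IsLocalCoordChange U U' τ) {M M' : Coord n → Matrix (Fin n) (Fin n) ℝ}
    (hM : SmM U M) (hM' : SmM U' M') (hXs : ∀ k, Sm U fun z => X z k)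
    (hXs' : ∀ k, Sm U' fun z => X' z k)
    (hlaw : ∀ z ∈ U, M' (τ z) = jac τ z * M z * (jac τ z).transpose)
    (hX : ∀ z ∈ U, vectorLaw (jac τ z) X X' z (τ z)) (hy : y ∈ U) :
    ∑ m, X' (τ y) m • pdM m M' (τ y) - (gradM X' (τ y)).transpose * M' (τ y)
        - M' (τ y) * gradM X' (τ y)
      = jac τ y * (∑ m, X y m • pdM m M y - (gradM X y).transpose * M y - M y * gradM X y)
        * (jac τ y).transpose := by
  have hJ := h.smM_jac
  set J := jac τ y with hJdef
  set E : Matrix (Fin n) (Fin n) ℝ := ∑ m, X y m • pdM m (jac τ) y with hE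
  have h1 : ∑ m, X' (τ y) m • pdM m M' (τ y) = E * M y * J.transpose
      + J * (∑ m, X y m • pdM m M y) * J.transpose + J * M y * E.transpose := by
    rw [h.sum_pdM_comp hM' (hX y hy) hy]
    have e1 : ∀ i, pdM i (fun z => M' (τ z)) y = pdM i (jac τ) y * M y * J.transpose
        + J * pdM i M y * J.transpose + J * M y * (pdM i (jac τ) y).transpose := fun i => by
      rw [pdM_congr i h.isOpen hlaw hy, pdM_mul i (hJ.mul hM) hJ.transpose hy, pdM_mul i hJ hM hy,
        pdM_transpose]
      noncomm_ring
    simp only [e1, hE, smul_add, Finset.sum_add_distrib, Finset.sum_mul, Finset.mul_sum,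
      Matrix.transpose_sum, Matrix.transpose_smul, Matrix.smul_mul, Matrix.mul_smul]
  have h2 : J.transpose * gradM X' (τ y) = E.transpose + gradM X y * J.transpose := by
    ext m i
    have e1 : pd m (fun z => X' (τ z) i) y = ∑ k, pd k (fun z => X' z i) (τ y) * J k m :=
      h.pd_comp (hXs' i) hy m
    have e2 : pd m (fun z => X' (τ z) i) y = ∑ l, (pd m (fun z => jac τ z i l) y * X y l
        + J i l * pd m (fun z => X z l) y) := by
      rw [pd_congr m h.isOpen (g := fun z => ∑ l, jac τ z i l * X z l)
        (fun z hz => by rw [show X' (τ z) = _ from hX z hz]; rfl) hy,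
        pd_sum m (fun l => (hJ i l).mul (hXs l)) hy]
      exact Finset.sum_congr rfl fun l _ => pd_mul m (hJ i l) (hXs l) hy
    have e3 : ∀ l, pd m (fun z => jac τ z i l) y = pd l (fun z => jac τ z i m) y := fun l => by
      rw [pd_congr m h.isOpen (fun z hz => h.jac_apply hz i l) hy,
        pd_congr l h.isOpen (fun z hz => h.jac_apply hz i m) hy]
      exact pd_comm m l (h.smooth i) hy
    simp only [Matrix.mul_apply, Matrix.transpose_apply, Matrix.add_apply, gradM, Matrix.of_apply, hE,
      Matrix.sum_apply, Matrix.smul_apply, smul_eq_mul, pdM_apply]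
    rw [Finset.sum_congr rfl fun k _ => mul_comm (J k m) _, ← e1, e2, Finset.sum_add_distrib]
    congr 1
    · exact Finset.sum_congr rfl fun l _ => by rw [e3]; ring
    · exact Finset.sum_congr rfl fun l _ => mul_comm _ _
  have h3 : (gradM X' (τ y)).transpose * J = E + J * (gradM X y).transpose := by
    have := congrArg Matrix.transpose h2
    simpa only [Matrix.transpose_mul, Matrix.transpose_add, Matrix.transpose_transpose] using this
  have h4 : (gradM X' (τ y)).transpose * M' (τ y)
      = (E + J * (gradM X y).transpose) * M y * J.transpose := by
    rw [hlaw y hy, ← h3, ← hJdef]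
    noncomm_ring
  have h5 : M' (τ y) * gradM X' (τ y) = J * M y * (E.transpose + gradM X y * J.transpose) := by
    rw [hlaw y hy, ← h2, ← hJdef]
    noncomm_ring
  rw [h1, h4, h5]
  noncomm_ring

theorem symplecticLaw_diffeoVariation (h : IsLocalCoordChange U U' τ) (hF : IsConfigOn U F)
    (hF' : IsConfigOn U' F') (hXs : ∀ k, Sm U fun z => X z k) (hXs' : ∀ k, Sm U' fun z => X' z k)
    (hlaw : ∀ z ∈ U, symplecticLaw (jac τ z) F F' z (τ z))
    (hX : ∀ z ∈ U, vectorLaw (jac τ z) X X' z (τ z)) (hy : y ∈ U) :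
    symplecticLaw (jac τ y) (F.diffeoVariation X) (F'.diffeoVariation X') y (τ y) := by
  refine ⟨?_, ?_, ?_⟩
  · rw [diffeoVariation_g, diffeoVariation_g]
    exact h.lie_tensor hF.metric.smooth hF'.metric.smooth hXs hXs' (fun z hz => (hlaw z hz).1) hX hy
  · rw [diffeoVariation_β, diffeoVariation_β]
    exact h.lie_tensor hF.smβ hF'.smβ hXs hXs' (fun z hz => (hlaw z hz).2.1) hX hy
  · exact (h.sum_pd_comp hF'.smφ (hX y hy) hy).trans (Finset.sum_congr rfl fun i _ => by
      rw [pd_congr i h.isOpen (fun z hz => (hlaw z hz).2.2) hy])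

theorem vectorLaw_anchor {J : Matrix (Fin n) (Fin n) ℝ} {y' : Coord n}
    (hlaw : symplecticLaw J F F' y y') (hξ : oneFormLaw J ξ ξ' y y') :
    vectorLaw J (anchor F ξ) (anchor F' ξ') y y' := by
  have e : ∀ (F : SymplecticTriple n) (ξ : Coord n → Coord n) z,
      anchor F ξ z = (F.β z).transpose.mulVec (ξ z) := fun F ξ z => by
    funext m
    simp only [anchor, Matrix.mulVec, dotProduct, Matrix.transpose_apply]
    exact Finset.sum_congr rfl fun k _ => mul_comm _ _
  unfold vectorLaw
  rw [e, e, hlaw.2.1, show ξ y = _ from hξ]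
  simp only [Matrix.mulVec_mulVec, Matrix.transpose_mul, Matrix.transpose_transpose, mul_assoc]

/-- The exterior derivative of a one-form is a tensor: the second derivatives of the change of
coordinates are symmetric and cancel. -/
theorem extD_law (h : IsLocalCoordChange U U' τ) (hξs' : ∀ k, Sm U' fun z => ξ' z k)
    (hξ : ∀ z ∈ U, oneFormLaw (jac τ z) ξ ξ' z (τ z)) (hy : y ∈ U) :
    extD ξ y = (jac τ y).transpose * extD ξ' (τ y) * jac τ y := by
  have hJ := h.smM_jac
  set J := jac τ y with hJdef
  set S : Matrix (Fin n) (Fin n) ℝ := Matrix.of fun m i =>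
    ∑ k, pd m (fun z => jac τ z k i) y * ξ' (τ y) k with hS
  have hsymm : S.transpose = S := by
    ext m i
    simp only [hS, Matrix.transpose_apply, Matrix.of_apply]
    refine Finset.sum_congr rfl fun k _ => ?_
    rw [pd_congr m h.isOpen (fun z hz => h.jac_apply hz k i) hy,
      pd_congr i h.isOpen (fun z hz => h.jac_apply hz k m) hy, pd_comm m i (h.smooth k) hy]
  have h1 : gradM ξ y = S + J.transpose * gradM ξ' (τ y) * J := by
    ext m i
    have e1 : pd m (fun z => ξ z i) y = ∑ k, (pd m (fun z => jac τ z k i) y * ξ' (τ y) k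
        + J k i * pd m (fun z => ξ' (τ z) k) y) := by
      rw [pd_congr m h.isOpen (g := fun z => ∑ k, jac τ z k i * ξ' (τ z) k)
        (fun z hz => by rw [show ξ z = _ from hξ z hz]; rfl) hy,
        pd_sum m (fun k => (hJ k i).mul (h.sm_comp (hξs' k))) hy]
      exact Finset.sum_congr rfl fun k _ => pd_mul m (hJ k i) (h.sm_comp (hξs' k)) hy
    simp only [gradM, Matrix.of_apply, Matrix.add_apply, hS, e1, Finset.sum_add_distrib]
    congr 1
    simp only [h.pd_comp (hξs' _) hy, Matrix.mul_apply, Matrix.transpose_apply, Matrix.of_apply,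
      ← hJdef]
    exact Finset.sum_congr rfl fun k _ => by
      rw [mul_comm]
      congr 1
      exact Finset.sum_congr rfl fun l _ => mul_comm _ _
  rw [extD, extD, h1, Matrix.transpose_add, hsymm]
  simp only [Matrix.transpose_mul, Matrix.transpose_transpose]
  noncomm_ring

theorem symplecticLaw_betaVariation (h : IsLocalCoordChange U U' τ) (hF : IsConfigOn U F)
    (hF' : IsConfigOn U' F') (hξs : ∀ k, Sm U fun z => ξ z k) (hξs' : ∀ k, Sm U' fun z => ξ' z k)
    (hlaw : ∀ z ∈ U, symplecticLaw (jac τ z) F F' z (τ z))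
    (hξ : ∀ z ∈ U, oneFormLaw (jac τ z) ξ ξ' z (τ z)) (hy : y ∈ U) :
    symplecticLaw (jac τ y) (F.betaVariation ξ) (F'.betaVariation ξ') y (τ y) := by
  have hτy := h.mapsTo y hy
  obtain ⟨h1, h2, h3⟩ := h.symplecticLaw_diffeoVariation hF hF' (hF.sm_anchor hξs)
    (hF'.sm_anchor hξs') hlaw (fun z hz => vectorLaw_anchor (hlaw z hz) (hξ z hz)) hy
  have hw := h.extD_law hξs' hξ hy
  obtain ⟨hg, hβ, -⟩ := hlaw y hy
  refine ⟨?_, ?_, ?_⟩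
  · rw [betaVariation_g h.isOpen' hF' hξs' hτy, betaVariation_g h.isOpen hF hξs hy, h1, hw, hg, hβ]
    noncomm_ring
  · rw [betaVariation_β h.isOpen' hF' hξs' hτy, betaVariation_β h.isOpen hF hξs hy, h2, hw, hβ]
    noncomm_ring
  · rw [betaVariation_φ, betaVariation_φ, h3]

end IsLocalCoordChange

/-! ### Fields and densities on a manifold -/

open MeasureTheory

section Transition

variable {n : ℕ} {M N : Type*}
  [TopologicalSpace M] [ChartedSpace (Coord n) M]
  [TopologicalSpace N] [ChartedSpace (Coord n) N]

/-- The Jacobian matrix of a composition. -/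
theorem jac_comp {σ τ : Coord n → Coord n} {y : Coord n} (hσ : DifferentiableAt ℝ σ (τ y))
    (hτ : DifferentiableAt ℝ τ y) : jac (fun z => σ (τ z)) y = jac σ (τ y) * jac τ y := by
  have h1 : fderiv ℝ (fun z => σ (τ z)) y = (fderiv ℝ σ (τ y)).comp (fderiv ℝ τ y) :=
    fderiv_comp y hσ hτ
  rw [jac, h1, jac, jac, ← LinearMap.toMatrix'_comp]
  rfl

theorem jac_congr {σ τ : Coord n → Coord n} {y : Coord n} (h : σ =ᶠ[nhds y] τ) :
    jac σ y = jac τ y := by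
  rw [jac, jac, h.fderiv_eq]

theorem jac_id (y : Coord n) : jac (fun z => z) y = 1 := by simp [jac]

/-- The coordinates in `e'` of the image under `ψ`, as a function of the coordinates in `e`. -/
def trans (ψ : M → N) (e : OpenPartialHomeomorph M (Coord n)) (e' : OpenPartialHomeomorph N (Coord n))
    (z : Coord n) : Coord n := e' (ψ (e.symm z))

/-- The domain of `trans`. -/
def transDom (ψ : M → N) (e : OpenPartialHomeomorph M (Coord n))
    (e' : OpenPartialHomeomorph N (Coord n)) : Set (Coord n) :=
  e.target ∩ {z | ψ (e.symm z) ∈ e'.source}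

variable (ψ : M ≃ₘ^∞⟮𝓘(ℝ, Coord n), 𝓘(ℝ, Coord n)⟯ N)
  {e : OpenPartialHomeomorph M (Coord n)} {e' : OpenPartialHomeomorph N (Coord n)}

theorem isOpen_transDom : IsOpen (transDom ψ e e') :=
  e.isOpen_inter_preimage_symm (e'.open_source.preimage ψ.continuous)

theorem contDiffAt_trans (he : e ∈ smoothCharts n M) (he' : e' ∈ smoothCharts n N) {y : Coord n}
    (hy : y ∈ transDom ψ e e') : ContDiffAt ℝ ∞ (trans ψ e e') y := by
  have h1 : ContMDiffAt 𝓘(ℝ, Coord n) 𝓘(ℝ, Coord n) ∞ e.symm y :=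
    contMDiffAt_symm_of_mem_maximalAtlas he hy.1
  have h2 : ContMDiffAt 𝓘(ℝ, Coord n) 𝓘(ℝ, Coord n) ∞ e' (ψ (e.symm y)) :=
    contMDiffAt_of_mem_maximalAtlas he' hy.2
  have h3 : ContMDiffAt 𝓘(ℝ, Coord n) 𝓘(ℝ, Coord n) ∞ (fun z => ψ (e.symm z)) y :=
    (ψ.contMDiff (e.symm y)).comp y h1
  exact (ContMDiffAt.comp y h2 h3).contDiffAt

theorem trans_mem {y : Coord n} (hy : y ∈ transDom ψ e e') :
    trans ψ e e' y ∈ transDom ψ.symm e' e := by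
  refine ⟨e'.map_source hy.2, ?_⟩
  simp only [Set.mem_ofPred_eq, trans, e'.left_inv hy.2, ψ.symm_apply_apply]
  exact e.map_target hy.1

theorem trans_symm_trans {y : Coord n} (hy : y ∈ transDom ψ e e') :
    trans ψ.symm e' e (trans ψ e e' y) = y := by
  simp only [trans, e'.left_inv hy.2, ψ.symm_apply_apply, e.right_inv hy.1]

theorem isLocalCoordChange_trans (he : e ∈ smoothCharts n M) (he' : e' ∈ smoothCharts n N) :
    IsLocalCoordChange (transDom ψ e e') e'.target (trans ψ e e') where
  isOpen := isOpen_transDom ψ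
  isOpen' := e'.open_target
  smooth k z hz := contDiffAt_pi.1 (contDiffAt_trans ψ he he' hz) k
  mapsTo y hy := (trans_mem ψ hy).1
  unit y hy := by
    have h1 := jac_comp ((contDiffAt_trans ψ.symm he' he (trans_mem ψ hy)).differentiableAt (by simp))
      ((contDiffAt_trans ψ he he' hy).differentiableAt (by simp))
    have h2 : (fun z => trans ψ.symm e' e (trans ψ e e' z)) =ᶠ[nhds y] fun z => z := by
      filter_upwards [(isOpen_transDom ψ).mem_nhds hy] with z hz
      exact trans_symm_trans ψ hz
    rw [jac_congr h2, jac_id] at h1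
    exact Matrix.isUnit_det_of_left_inverse h1.symm

end Transition

section Config

variable {n : ℕ} {M N : Type*}
  [TopologicalSpace M] [ChartedSpace (Coord n) M]
  [TopologicalSpace N] [ChartedSpace (Coord n) N]
  {F V : ChartFamily n M (SymplecticTriple n)} {e : OpenPartialHomeomorph M (Coord n)}

theorem IsVariation.isVariationOn (h : IsVariation V) (he : e ∈ smoothCharts n M) :
    IsVariationOn e.target (V e) where
  smg i j := Sm.of_contDiffOn e.open_target (h.smooth_g e he i j)
  smβ i j := Sm.of_contDiffOn e.open_target (h.smooth_β e he i j)
  smφ := Sm.of_contDiffOn e.open_target (h.smooth_φ e he)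
  symm := h.symm_g e he
  skew := h.skew_β e he

theorem isVariation_of_local (h : ∀ e ∈ smoothCharts n M, IsVariationOn e.target (V e))
    (ht : RelatedUnder symplecticLaw (id : M → M) V V) : IsVariation V where
  smooth_g e he i j := ((h e he).smg i j).contDiffOn
  smooth_β e he i j := ((h e he).smβ i j).contDiffOn
  smooth_φ e he := (h e he).smφ.contDiffOn
  symm_g e he := (h e he).symm
  skew_β e he := (h e he).skew
  tensorial := ht

theorem IsSymplecticConfig.isConfigOn (h : IsSymplecticConfig F) (he : e ∈ smoothCharts n M) :
    IsConfigOn e.target (F e) where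
  metric := ⟨(h.toIsVariation.isVariationOn he).smg, h.symm_g e he, h.nondeg_g e he⟩
  smβ := (h.toIsVariation.isVariationOn he).smβ
  skew := h.skew_β e he
  unitβ := h.nondeg_β e he
  smφ := (h.toIsVariation.isVariationOn he).smφ

theorem IsStringConfig.isStringConfigOn {T : ChartFamily n M (StringTriple n)}
    (h : IsStringConfig T) (he : e ∈ smoothCharts n M) : IsStringConfigOn e.target (T e) where
  metric := ⟨fun i j => Sm.of_contDiffOn e.open_target (h.smooth_G e he i j), h.symm_G e he,
    h.nondeg_G e he⟩
  smB i j := Sm.of_contDiffOn e.open_target (h.smooth_B e he i j)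
  skew := h.skew_B e he
  smφ := Sm.of_contDiffOn e.open_target (h.smooth_φ e he)

theorem IsVectorField.sm {X : ChartFamily n M (Coord n → Coord n)} (h : IsVectorField X)
    (he : e ∈ smoothCharts n M) (k : Fin n) : Sm e.target fun z => X e z k :=
  Sm.of_contDiffOn e.open_target (contDiffOn_pi.1 (h.smooth e he) k)

theorem IsOneForm.sm {ξ : ChartFamily n M (Coord n → Coord n)} (h : IsOneForm ξ)
    (he : e ∈ smoothCharts n M) (k : Fin n) : Sm e.target fun z => ξ e z k :=
  Sm.of_contDiffOn e.open_target (contDiffOn_pi.1 (h.smooth e he) k)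

/-- The transformation law of a density of weight one. -/
def densityLaw (J : Matrix (Fin n) (Fin n) ℝ) (ρ ρ' : Coord n → ℝ) (y y' : Coord n) : Prop :=
  ρ y = |J.det| * ρ' y'

theorem IsLocalCoordChange.mono {U U' W : Set (Coord n)} {τ : Coord n → Coord n}
    (h : IsLocalCoordChange U U' τ) (hW : IsOpen W) (hWU : W ⊆ U) : IsLocalCoordChange W U' τ :=
  ⟨hW, h.isOpen', fun k => (h.smooth k).mono hWU, fun y hy => h.mapsTo y (hWU hy),
    fun y hy => h.unit y (hWU hy)⟩

theorem IsLocalCoordChange.restrict {U U' W : Set (Coord n)} {τ : Coord n → Coord n}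
    (h : IsLocalCoordChange U U' τ) (hW : IsOpen W) :
    IsLocalCoordChange (U ∩ τ ⁻¹' W) (U' ∩ W) τ := by
  have hc : ContinuousOn τ U := fun y hy => (h.differentiableAt hy).continuousAt.continuousWithinAt
  exact ⟨hc.isOpen_inter_preimage h.isOpen hW, h.isOpen'.inter hW,
    fun k => (h.smooth k).mono Set.inter_subset_left, fun y hy => ⟨h.mapsTo y hy.1, hy.2⟩,
    fun y hy => h.unit y hy.1⟩

/-- The Lagrangian is a density. -/
theorem relatedUnder_density (ψ : M ≃ₘ^∞⟮𝓘(ℝ, Coord n), 𝓘(ℝ, Coord n)⟯ N)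
    {F' : ChartFamily n N (SymplecticTriple n)} (hF : IsSymplecticConfig F)
    (hF' : IsSymplecticConfig F') (h : RelatedUnder symplecticLaw ψ F F') :
    RelatedUnder densityLaw ψ (fun e => (F e).density) (fun e => (F' e).density) := by
  intro e he e' he' y hy hy'
  have hτ := isLocalCoordChange_trans ψ he he'
  exact hτ.density_eq ((hF.isConfigOn he).mono Set.inter_subset_left) (hF'.isConfigOn he')
    (fun z hz => h e he e' he' z hz.1 hz.2) ⟨hy, hy'⟩

theorem symplecticLaw_shift {J : Matrix (Fin n) (Fin n) ℝ} {F F' V V' : SymplecticTriple n}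
    {y y' : Coord n} (h : symplecticLaw J F F' y y') (hV : symplecticLaw J V V' y y') (t : ℝ) :
    symplecticLaw J (F.shift t V) (F'.shift t V') y y' := by
  obtain ⟨h1, h2, h3⟩ := h
  obtain ⟨k1, k2, k3⟩ := hV
  refine ⟨?_, ?_, ?_⟩
  · simp only [SymplecticTriple.shift, h1, k1, mul_add, add_mul, Matrix.mul_smul, Matrix.smul_mul]
  · simp only [SymplecticTriple.shift, h2, k2, mul_add, add_mul, Matrix.mul_smul, Matrix.smul_mul]
  · simp only [SymplecticTriple.shift, h3, k3]

theorem relatedUnder_id_iff {α : Type*}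
    {law : Matrix (Fin n) (Fin n) ℝ → α → α → Coord n → Coord n → Prop} {A B : ChartFamily n M α} :
    RelatedUnder law (Diffeomorph.refl 𝓘(ℝ, Coord n) M ∞) A B ↔ RelatedUnder law (id : M → M) A B :=
  Iff.rfl

/-- The first variation of the Lagrangian is a density. -/
theorem relatedUnder_firstVariation (hF : IsSymplecticConfig F) (hV : IsVariation V) :
    RelatedUnder densityLaw (id : M → M) (fun e => (F e).firstVariation (V e))
      (fun e => (F e).firstVariation (V e)) := by
  intro e he e' he' y hy hy'
  set τ := trans (Diffeomorph.refl 𝓘(ℝ, Coord n) M ∞) e e' with hτdef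
  have hτ := isLocalCoordChange_trans (Diffeomorph.refl 𝓘(ℝ, Coord n) M ∞) he he'
  have hyd : y ∈ transDom (Diffeomorph.refl 𝓘(ℝ, Coord n) M ∞) e e' := ⟨hy, hy'⟩
  have hτy : τ y ∈ e'.target := hτ.mapsTo y hyd
  have f1 := (hF.isConfigOn he).isSymplecticFamily e.open_target (hV.isVariationOn he)
  have f2 := (hF.isConfigOn he').isSymplecticFamily e'.open_target (hV.isVariationOn he')
  have d1 := (hF.isConfigOn he).hasDerivAt_density e.open_target (hV.isVariationOn he) hy
  have d2 := (hF.isConfigOn he').hasDerivAt_density e'.open_target (hV.isVariationOn he') hτy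
  have t1 : Filter.Tendsto (fun t : ℝ => (t, y)) (nhds 0) (nhds (0, y)) :=
    (Continuous.prodMk_left y).continuousAt
  have t2 : Filter.Tendsto (fun t : ℝ => (t, τ y)) (nhds 0) (nhds (0, τ y)) :=
    (Continuous.prodMk_left (τ y)).continuousAt
  have heq : ∀ᶠ t in nhds (0 : ℝ), ((F e).shift t (V e)).density y
      = |(jac τ y).det| * ((F e').shift t (V e')).density (τ y) := by
    filter_upwards [t1.eventually (f1.eventually_config hy),
      t2.eventually (f2.eventually_config hτy)] with t ⟨W, hW, hyW, hc⟩ ⟨W', hW', hyW', hc'⟩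
    have h1 := (hτ.restrict hW').mono ((hτ.restrict hW').isOpen.inter hW) Set.inter_subset_left
    refine h1.density_eq (hc.mono Set.inter_subset_right) (hc'.mono Set.inter_subset_right)
      (fun z hz => ?_) ⟨⟨hyd, hyW'⟩, hyW⟩
    exact symplecticLaw_shift (hF.tensorial e he e' he' z hz.1.1.1 hz.1.1.2)
      (hV.tensorial e he e' he' z hz.1.1.1 hz.1.1.2) t
  exact d1.unique ((d2.const_mul _).congr_of_eventuallyEq heq)

end Config

/-! ### Integration of densities over compact regions -/

theorem isCompact_image_chart {n : ℕ} {M : Type*} [TopologicalSpace M]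
    {e : OpenPartialHomeomorph M (Coord n)} {C : Set M}
    (hC : IsCompact C) (hCe : C ⊆ e.source) : IsCompact (e '' C) :=
  hC.image_of_continuousOn (e.continuousOn.mono hCe)

/-- The components of the family are continuous in every chart. -/
def ContinuousInCharts {n : ℕ} {M : Type*} [TopologicalSpace M] [ChartedSpace (Coord n) M]
    (ρ : ChartFamily n M (Coord n → ℝ)) : Prop :=
  ∀ e ∈ smoothCharts n M, ContinuousOn (ρ e) e.target

section PatchIntegral

variable {n : ℕ} {M N : Type*} [TopologicalSpace M] [ChartedSpace (Coord n) M]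
  [TopologicalSpace N] [ChartedSpace (Coord n) N]
  {ρ : ChartFamily n M (Coord n → ℝ)} {ρ' : ChartFamily n N (Coord n → ℝ)}
  {P : Patches n M} {P' : Patches n N} {A B C : Set M}
  {e : OpenPartialHomeomorph M (Coord n)} {e' : OpenPartialHomeomorph N (Coord n)}

theorem integrableOn_image_chart (hρ : ContinuousInCharts ρ) (he : e ∈ smoothCharts n M)
    (hC : IsCompact C) (hCe : C ⊆ e.source) (hAC : A ⊆ C) : IntegrableOn (ρ e) (e '' A) := by
  have h1 : e '' C ⊆ e.target := by
    rintro _ ⟨x, hx, rfl⟩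
    exact e.map_source (hCe hx)
  exact (((hρ e he).mono h1).integrableOn_compact (isCompact_image_chart hC hCe)).mono_set
    (Set.image_mono hAC)

theorem ValidPatches.tail {p : OpenPartialHomeomorph M (Coord n) × Set M}
    (h : ValidPatches (p :: P)) : ValidPatches P := fun q hq => h q (List.mem_cons_of_mem _ hq)

theorem patchIntegral_eq_zero
    (h : ∀ p ∈ P, ∀ x ∈ A, x ∈ p.2 → ρ p.1 (p.1 x) = 0) : patchIntegral ρ P A = 0 := by
  induction P generalizing A with
  | nil => rfl
  | cons p P ih =>
    obtain ⟨e, C⟩ := p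
    have h1 : ∫ y in e '' (A ∩ C), ρ e y = 0 := by
      refine setIntegral_eq_zero_of_forall_eq_zero ?_
      rintro _ ⟨x, hx, rfl⟩
      exact h (e, C) (by simp) x hx.1 hx.2
    rw [patchIntegral, h1, zero_add]
    exact ih fun p hp x hx hxp => h p (by simp [hp]) x hx.1 hxp

theorem isCompact_region (hP : ValidPatches P) : IsCompact (region P) := by
  have h1 : region P = ⋃ p ∈ {p | p ∈ P}, p.2 := by
    ext x
    simp [region]
  rw [h1]
  exact P.finite_toSet.isCompact_biUnion fun p hp => (hP p hp).2.1

variable [MeasurableSpace M] [BorelSpace M]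

theorem measurableSet_image_chart {e : OpenPartialHomeomorph M (Coord n)} {A : Set M}
    (hA : MeasurableSet A) (hAe : A ⊆ e.source) : MeasurableSet (e '' A) := by
  have h1 : e '' A = Subtype.val '' (e.target.domRestrict e.symm ⁻¹' A) := by
    ext z
    constructor
    · rintro ⟨x, hx, rfl⟩
      refine ⟨⟨e x, e.map_source (hAe hx)⟩, ?_, rfl⟩
      change e.symm (e x) ∈ A
      rwa [e.left_inv (hAe hx)]
    · rintro ⟨⟨w, hw⟩, hwA, rfl⟩
      exact ⟨e.symm w, hwA, e.right_inv hw⟩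
  rw [h1]
  exact MeasurableSet.subtype_image e.open_target.measurableSet
    ((continuousOn_iff_continuous_domRestrict.1 e.continuousOn_symm).measurable hA)

theorem integral_image_chart_split (hρ : ContinuousInCharts ρ) (he : e ∈ smoothCharts n M)
    (hC : IsCompact C) (hCe : C ⊆ e.source) (hAC : A ⊆ C) (hA : MeasurableSet A)
    (hB : MeasurableSet B) :
    ∫ y in e '' A, ρ e y = (∫ y in e '' (A ∩ B), ρ e y) + ∫ y in e '' (A \ B), ρ e y := by
  have h1 : e '' A = e '' (A ∩ B) ∪ e '' (A \ B) := by
    rw [← Set.image_union, Set.inter_union_sdiff]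
  have hd : Disjoint (e '' (A ∩ B)) (e '' (A \ B)) := by
    rw [Set.disjoint_left]
    rintro _ ⟨x, hx, rfl⟩ ⟨x', hx', h⟩
    have : x' = x := e.injOn (hCe (hAC hx'.1)) (hCe (hAC hx.1)) h
    exact hx'.2 (this ▸ hx.2)
  rw [h1, setIntegral_union hd
    (measurableSet_image_chart (hA.diff hB) (Set.sdiff_subset.trans (hAC.trans hCe)))
    (integrableOn_image_chart hρ he hC hCe (Set.inter_subset_left.trans hAC))
    (integrableOn_image_chart hρ he hC hCe (Set.sdiff_subset.trans hAC))]

section Diffeo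

variable (ψ : M ≃ₘ^∞⟮𝓘(ℝ, Coord n), 𝓘(ℝ, Coord n)⟯ N)

/-- Change of variables between two charts. -/
theorem integral_image_chart_eq (hlaw : RelatedUnder densityLaw ψ ρ ρ') (he : e ∈ smoothCharts n M)
    (he' : e' ∈ smoothCharts n N) (hA : MeasurableSet A) (hAe : A ⊆ e.source)
    (hAe' : A ⊆ ψ ⁻¹' e'.source) : ∫ y in e '' A, ρ e y = ∫ y in e' '' (ψ '' A), ρ' e' y := by
  have hdom : e '' A ⊆ transDom ψ e e' := by
    rintro _ ⟨x, hx, rfl⟩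
    refine ⟨e.map_source (hAe hx), ?_⟩
    simp only [Set.mem_ofPred_eq, e.left_inv (hAe hx)]
    exact hAe' hx
  have himg : e' '' (ψ '' A) = trans ψ e e' '' (e '' A) := by
    simp only [Set.image_image]
    exact Set.image_congr fun x hx => by simp only [trans, e.left_inv (hAe hx)]
  have hinj : Set.InjOn (trans ψ e e') (e '' A) := fun a ha b hb hab => by
    rw [← trans_symm_trans ψ (hdom ha), hab, trans_symm_trans ψ (hdom hb)]
  rw [himg, integral_image_eq_integral_abs_det_fderiv_smul volume (measurableSet_image_chart hA hAe)
    (fun y hy => ((contDiffAt_trans ψ he he' (hdom hy)).differentiableAt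
      (by simp)).hasFDerivAt.hasFDerivWithinAt) hinj]
  refine setIntegral_congr_fun (measurableSet_image_chart hA hAe) fun y hy => ?_
  have h1 := hlaw e he e' he' y (hdom hy).1 (hdom hy).2
  rw [densityLaw] at h1
  rw [h1, jac, LinearMap.det_toMatrix', smul_eq_mul]
  rfl

theorem measurableSet_image_diffeo [MeasurableSpace N] [BorelSpace N] (hA : MeasurableSet A) :
    MeasurableSet (ψ '' A) := by
  have h1 : ψ '' A = ψ.symm ⁻¹' A := ψ.toEquiv.image_eq_preimage_symm A
  rw [h1]
  exact ψ.symm.continuous.measurable hA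

end Diffeo

variable [T2Space M] [T2Space N] [MeasurableSpace N] [BorelSpace N]

theorem patchIntegral_split (hρ : ContinuousInCharts ρ) (hP : ValidPatches P)
    (hA : MeasurableSet A) (hB : MeasurableSet B) :
    patchIntegral ρ P A = patchIntegral ρ P (A ∩ B) + patchIntegral ρ P (A \ B) := by
  induction P generalizing A with
  | nil => simp [patchIntegral]
  | cons p P ih =>
    obtain ⟨e, C⟩ := p
    obtain ⟨he, hC, hCe⟩ := hP (e, C) (by simp)
    have hCm : MeasurableSet C := hC.isClosed.measurableSet
    have h1 := integral_image_chart_split (B := B) hρ he hC hCe Set.inter_subset_right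
      (hA.inter hCm) hB
    have h2 := ih hP.tail (A := A \ C) (hA.diff hCm)
    have e1 : A ∩ C ∩ B = A ∩ B ∩ C := Set.inter_right_comm _ _ _
    have e2 : (A ∩ C) \ B = A \ B ∩ C := by ext; simp only [Set.mem_sdiff, Set.mem_inter_iff]; tauto
    have e3 : A \ C ∩ B = (A ∩ B) \ C := by ext; simp only [Set.mem_sdiff, Set.mem_inter_iff]; tauto
    have e4 : (A \ C) \ B = (A \ B) \ C := by ext; simp only [Set.mem_sdiff]; tauto
    rw [e1, e2] at h1
    rw [e3, e4] at h2
    simp only [patchIntegral, h1, h2]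
    ring

theorem patchIntegral_inter_region (hρ : ContinuousInCharts ρ) (hP : ValidPatches P)
    (hA : MeasurableSet A) (hB : MeasurableSet B) (h : A ∩ region P ⊆ B) :
    patchIntegral ρ P A = patchIntegral ρ P (A ∩ B) := by
  rw [patchIntegral_split hρ hP hA hB, patchIntegral_eq_zero (A := A \ B), add_zero]
  intro p hp x hx hxp
  exact absurd (h ⟨hx.1, p, hp, hxp⟩) hx.2

variable (ψ : M ≃ₘ^∞⟮𝓘(ℝ, Coord n), 𝓘(ℝ, Coord n)⟯ N)

/-- If the region lies in a single chart of the target manifold, the sum over patches collapses to one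
integral in that chart. This is the change of variables formula, applied patch by patch. -/
theorem patchIntegral_eq_integral_chart (hρ' : ContinuousInCharts ρ')
    (hlaw : RelatedUnder densityLaw ψ ρ ρ') (hP : ValidPatches P) (he' : e' ∈ smoothCharts n N)
    {C' : Set N} (hC' : IsCompact C') (hCe' : C' ⊆ e'.source) (hA : MeasurableSet A)
    (hAP : A ⊆ region P) (hAC' : ψ '' A ⊆ C') :
    patchIntegral ρ P A = ∫ y in e' '' (ψ '' A), ρ' e' y := by
  induction P generalizing A with
  | nil =>
    have : A = ∅ := Set.eq_empty_of_forall_notMem fun x hx => by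
      obtain ⟨p, hp, -⟩ := hAP hx
      simp at hp
    simp [this, patchIntegral]
  | cons p P ih =>
    obtain ⟨e, C⟩ := p
    obtain ⟨he, hC, hCe⟩ := hP (e, C) (by simp)
    have hCm : MeasurableSet C := hC.isClosed.measurableSet
    have h1 := ih hP.tail (A := A \ C) (hA.diff hCm) (fun x hx => by
      obtain ⟨p, hp, hxp⟩ := hAP hx.1
      rcases List.mem_cons.1 hp with rfl | hp
      · exact absurd hxp hx.2
      · exact ⟨p, hp, hxp⟩) ((Set.image_mono Set.sdiff_subset).trans hAC')
    have h2 := integral_image_chart_eq ψ hlaw he he' (A := A ∩ C) (hA.inter hCm)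
      (Set.inter_subset_right.trans hCe)
      (fun x hx => hCe' (hAC' (Set.mem_image_of_mem ψ hx.1)))
    have h3 := integral_image_chart_split (B := ψ '' C) hρ' he' hC' hCe' hAC'
      (measurableSet_image_diffeo ψ hA) (measurableSet_image_diffeo ψ hCm)
    have hinj : Function.Injective (ψ : M → N) := ψ.injective
    rw [← Set.image_inter hinj, ← Set.image_sdiff hinj] at h3
    rw [patchIntegral, h1, h2, h3]

/-- Integrals of densities do not depend on the charts. -/
theorem patchIntegral_image (hρ : ContinuousInCharts ρ) (hρ' : ContinuousInCharts ρ')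
    (hlaw : RelatedUnder densityLaw ψ ρ ρ') (hP : ValidPatches P) (hP' : ValidPatches P')
    (hA : MeasurableSet A) (hAP : A ⊆ region P) (hAP' : ψ '' A ⊆ region P') :
    patchIntegral ρ P A = patchIntegral ρ' P' (ψ '' A) := by
  induction P' generalizing A with
  | nil =>
    have : A = ∅ := Set.eq_empty_of_forall_notMem fun x hx => by
      obtain ⟨p, hp, -⟩ := hAP' (Set.mem_image_of_mem ψ hx)
      simp at hp
    rw [this, patchIntegral_eq_zero (by simp)]
    rfl
  | cons p P' ih =>
    obtain ⟨e', C'⟩ := p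
    obtain ⟨he', hC', hCe'⟩ := hP' (e', C') (by simp)
    have hB : MeasurableSet (ψ ⁻¹' C') := ψ.continuous.measurable hC'.isClosed.measurableSet
    have hi : ψ '' (A ∩ ψ ⁻¹' C') = ψ '' A ∩ C' := Set.image_inter_preimage _ _ _
    have hd : ψ '' (A \ ψ ⁻¹' C') = ψ '' A \ C' := by
      have hinj : Function.Injective (ψ : M → N) := ψ.injective
      have hsurj : Function.Surjective (ψ : M → N) := ψ.surjective
      rw [Set.image_sdiff hinj, Set.image_preimage_eq _ hsurj]
    have h1 := patchIntegral_eq_integral_chart ψ hρ' hlaw hP he' hC' hCe' (A := A ∩ ψ ⁻¹' C')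
      (hA.inter hB) (Set.inter_subset_left.trans hAP) (by rw [hi]; exact Set.inter_subset_right)
    have h2 := ih hP'.tail (A := A \ ψ ⁻¹' C') (hA.diff hB) (Set.sdiff_subset.trans hAP) (by
      rw [hd]
      intro x hx
      obtain ⟨p, hp, hxp⟩ := hAP' hx.1
      rcases List.mem_cons.1 hp with rfl | hp
      · exact absurd hxp hx.2
      · exact ⟨p, hp, hxp⟩)
    rw [patchIntegral_split hρ hP hA hB, h1, h2, hi, hd, patchIntegral]

theorem patchIntegral_univ (hρ : ContinuousInCharts ρ) (hP : ValidPatches P) :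
    patchIntegral ρ P Set.univ = patchIntegral ρ P (region P) := by
  rw [patchIntegral_inter_region hρ hP MeasurableSet.univ
    (isCompact_region hP).isClosed.measurableSet Set.inter_subset_right, Set.univ_inter]

/-- The integral of a density does not depend on the patches that cover the region, and is
transported by diffeomorphisms. -/
theorem patchIntegral_univ_eq (hρ : ContinuousInCharts ρ) (hρ' : ContinuousInCharts ρ')
    (hlaw : RelatedUnder densityLaw ψ ρ ρ') (hP : ValidPatches P) (hP' : ValidPatches P')
    (h : ψ '' region P = region P') :
    patchIntegral ρ P Set.univ = patchIntegral ρ' P' Set.univ := by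
  rw [patchIntegral_univ hρ hP, patchIntegral_univ hρ' hP', ← h]
  exact patchIntegral_image ψ hρ hρ' hlaw hP hP' (isCompact_region hP).isClosed.measurableSet
    subset_rfl h.subset

/-- The integral of a density which vanishes outside a compact part of one chart. -/
theorem patchIntegral_of_vanish (hρ : ContinuousInCharts ρ)
    (hlaw : RelatedUnder densityLaw (id : M → M) ρ ρ) (hP : ValidPatches P)
    (he : e ∈ smoothCharts n M) (hC : IsCompact C) (hCe : C ⊆ e.source) (hCP : C ⊆ region P)
    (hv : ∀ e ∈ smoothCharts n M, ∀ y ∈ e.target, e.symm y ∉ C → ρ e y = 0) :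
    patchIntegral ρ P Set.univ = ∫ y in e '' C, ρ e y := by
  have hCm : MeasurableSet C := hC.isClosed.measurableSet
  rw [patchIntegral_split hρ hP MeasurableSet.univ hCm, Set.univ_inter,
    patchIntegral_eq_zero (A := Set.univ \ C), add_zero]
  · have h1 := patchIntegral_eq_integral_chart (Diffeomorph.refl 𝓘(ℝ, Coord n) M ∞) hρ
      (relatedUnder_id_iff.2 hlaw) hP he hC hCe hCm hCP (by simp)
    simpa using h1
  · intro p hp x hx hxp
    obtain ⟨hpc, -, hps⟩ := hP p hp
    exact hv p.1 hpc _ (p.1.map_source (hps hxp)) (by rw [p.1.left_inv (hps hxp)]; exact hx.2)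

theorem patchIntegral_congr {ρ₁ ρ₂ : ChartFamily n M (Coord n → ℝ)} (hP : ValidPatches P)
    (hA : MeasurableSet A) (h : ∀ e ∈ smoothCharts n M, ∀ y ∈ e.target, ρ₁ e y = ρ₂ e y) :
    patchIntegral ρ₁ P A = patchIntegral ρ₂ P A := by
  induction P generalizing A with
  | nil => rfl
  | cons p P ih =>
    obtain ⟨e, C⟩ := p
    obtain ⟨he, hC, hCe⟩ := hP (e, C) (by simp)
    have hCm : MeasurableSet C := hC.isClosed.measurableSet
    rw [patchIntegral, patchIntegral, ih hP.tail (hA.diff hCm)]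
    congr 1
    refine setIntegral_congr_fun
      (measurableSet_image_chart (hA.inter hCm) (Set.inter_subset_right.trans hCe)) ?_
    rintro _ ⟨x, hx, rfl⟩
    exact h e he _ (e.map_source (hCe hx.2))

theorem patchIntegral_sum {ι : Type*} (s : Finset ι) {ρs : ι → ChartFamily n M (Coord n → ℝ)}
    (hρ : ∀ i, ContinuousInCharts (ρs i)) (hP : ValidPatches P) :
    patchIntegral (fun e y => ∑ i ∈ s, ρs i e y) P A = ∑ i ∈ s, patchIntegral (ρs i) P A := by
  induction P generalizing A with
  | nil => simp [patchIntegral]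
  | cons p P ih =>
    obtain ⟨e, C⟩ := p
    obtain ⟨he, hC, hCe⟩ := hP (e, C) (by simp)
    simp only [patchIntegral, ih hP.tail, Finset.sum_add_distrib]
    rw [integral_finsetSum]
    exact fun i _ => integrableOn_image_chart (hρ i) he hC hCe Set.inter_subset_right

/-- A density which splits into pieces supported in charts and with vanishing integrals has
vanishing integral. -/
theorem patchIntegral_eq_zero_of_pieces {ι : Type*} [Fintype ι] (hP : ValidPatches P)
    {ρs : ι → ChartFamily n M (Coord n → ℝ)} (hρ : ∀ i, ContinuousInCharts (ρs i))
    (hlaw : ∀ i, RelatedUnder densityLaw (id : M → M) (ρs i) (ρs i))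
    {es : ι → OpenPartialHomeomorph M (Coord n)} (hes : ∀ i, es i ∈ smoothCharts n M)
    {Cs : ι → Set M} (hCs : ∀ i, IsCompact (Cs i)) (hCes : ∀ i, Cs i ⊆ (es i).source)
    (hCP : ∀ i, Cs i ⊆ region P)
    (hv : ∀ i, ∀ e ∈ smoothCharts n M, ∀ y ∈ e.target, e.symm y ∉ Cs i → ρs i e y = 0)
    (hsum : ∀ e ∈ smoothCharts n M, ∀ y ∈ e.target, ρ e y = ∑ i, ρs i e y)
    (h0 : ∀ i, ∫ y in es i '' Cs i, ρs i (es i) y = 0) : patchIntegral ρ P Set.univ = 0 := by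
  rw [patchIntegral_congr hP MeasurableSet.univ hsum, patchIntegral_sum _ hρ hP]
  exact Finset.sum_eq_zero fun i _ => by
    rw [patchIntegral_of_vanish (hρ i) (hlaw i) hP (hes i) (hCs i) (hCes i) (hCP i) (hv i), h0 i]

end PatchIntegral

/-! ### Divergences and derivatives of integrals -/

section Stokes

variable {n : ℕ} {U K s : Set (Coord n)}

/-- A smooth function on `U` vanishing outside a compact subset extends by zero. -/
theorem contDiff_indicator (hU : IsOpen U) (hK : IsCompact K) (hKU : K ⊆ U) {f : Coord n → ℝ}
    (hf : Sm U f) (hv : ∀ y ∈ U, y ∉ K → f y = 0) : ContDiff ℝ ∞ (K.indicator f) := by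
  rw [contDiff_iff_contDiffAt]
  intro y
  by_cases hy : y ∈ U
  · refine (hf y hy).congr_of_eventuallyEq ?_
    filter_upwards [hU.mem_nhds hy] with z hz
    by_cases hzK : z ∈ K
    · rw [Set.indicator_of_mem hzK]
    · rw [Set.indicator_of_notMem hzK, hv z hz hzK]
  · have h0 : ContDiffAt ℝ ∞ (fun _ : Coord n => (0 : ℝ)) y := contDiffAt_const
    refine h0.congr_of_eventuallyEq ?_
    filter_upwards [hK.isClosed.isOpen_compl.mem_nhds fun h => hy (hKU h)] with z hz
    exact Set.indicator_of_notMem hz _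

theorem integral_pd_eq_zero {f : Coord n → ℝ} (hf : ContDiff ℝ ∞ f) (hc : HasCompactSupport f)
    (i : Fin n) : ∫ y, pd i f y = 0 := by
  have h1 : Continuous fun y => fderiv ℝ f y (Pi.single i 1) :=
    (hf.continuous_fderiv (by simp)).clm_apply continuous_const
  have h2 : HasCompactSupport fun y => fderiv ℝ f y (Pi.single i 1) :=
    (hc.fderiv ℝ).comp_left (g := fun L : Coord n →L[ℝ] ℝ => L (Pi.single i 1)) (by simp)
  have h3 := integral_mul_fderiv_eq_neg_fderiv_mul_of_integrable (μ := (volume : Measure (Coord n)))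
    (f := fun _ : Coord n => (1 : ℝ)) (g := f) (v := Pi.single i 1) (by simp)
    (by simpa using h1.integrable_of_hasCompactSupport h2)
    (by simpa using hf.continuous.integrable_of_hasCompactSupport hc)
    (fun _ _ => differentiableAt_const _) (fun y _ => hf.contDiffAt.differentiableAt (by simp))
  simpa [pd] using h3

/-- The divergence theorem for currents vanishing outside a compact set. -/
theorem setIntegral_div_eq_zero (hU : IsOpen U) (hK : IsCompact K) (hKU : K ⊆ U)
    {Z : Fin n → Coord n → ℝ} (hZ : ∀ a, Sm U (Z a)) (hv : ∀ a, ∀ y ∈ U, y ∉ K → Z a y = 0) :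
    ∫ y in K, ∑ a, pd a (Z a) y = 0 := by
  have h1 : ∀ a, ContDiff ℝ ∞ (K.indicator (Z a)) := fun a =>
    contDiff_indicator hU hK hKU (hZ a) (hv a)
  have h2 : ∀ a, HasCompactSupport (K.indicator (Z a)) := fun a =>
    HasCompactSupport.intro hK fun y hy => Set.indicator_of_notMem hy _
  have h3 : ∫ y in K, ∑ a, pd a (Z a) y = ∫ y in K, ∑ a, pd a (K.indicator (Z a)) y := by
    refine setIntegral_congr_fun hK.measurableSet fun y hy => Finset.sum_congr rfl fun a _ => ?_
    refine pd_congr a hU (fun z hz => ?_) (hKU hy)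
    by_cases hzK : z ∈ K
    · rw [Set.indicator_of_mem hzK]
    · rw [Set.indicator_of_notMem hzK, hv a z hz hzK]
  have h4 : ∀ a, ∀ y, y ∉ K → pd a (K.indicator (Z a)) y = 0 := fun a y hy => by
    rw [pd_congr a hK.isClosed.isOpen_compl (g := fun _ => 0)
      (fun z hz => Set.indicator_of_notMem hz _) hy, pd_const]
  rw [h3, setIntegral_eq_integral_of_forall_compl_eq_zero fun y hy =>
    Finset.sum_eq_zero fun a _ => h4 a y hy]
  rw [integral_finsetSum]
  · exact Finset.sum_eq_zero fun a _ => integral_pd_eq_zero (h1 a) (h2 a) a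
  · intro a _
    have h5 : Continuous fun y => pd a (K.indicator (Z a)) y :=
      ((h1 a).continuous_fderiv (by simp)).clm_apply continuous_const
    exact h5.integrable_of_hasCompactSupport (HasCompactSupport.intro hK (h4 a))

/-- Differentiation of an integral over part of a compact set. -/
theorem hasDerivAt_setIntegral (hK : IsCompact K) (hKU : K ⊆ U) (hs : MeasurableSet s) (hsK : s ⊆ K)
    {f : ℝ → Coord n → ℝ} {f' : Coord n → ℝ} (hf : Var U f f') :
    HasDerivAt (fun t => ∫ y in s, f t y) (∫ y in s, f' y) 0 := by
  set g : ℝ × Coord n → ℝ := fun q => f q.1 q.2 with hg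
  set Ω : Set (ℝ × Coord n) := {q | ContDiffAt ℝ 1 g q} with hΩ
  have hΩo : IsOpen Ω := isOpen_iff_mem_nhds.2 fun q hq => by
    have hq' : ContDiffAt ℝ 1 g q := hq
    exact hq'.eventually (by simp)
  have hsub : ({0} : Set ℝ) ×ˢ K ⊆ Ω := by
    rintro ⟨t, z⟩ ⟨ht, hz⟩
    obtain rfl : t = 0 := ht
    exact (hf.sm.at (hKU hz)).of_le (WithTop.coe_le_coe.2 le_top)
  obtain ⟨u, v, hu, hv, h0u, hKv, huv⟩ := generalized_tube_lemma isCompact_singleton hK hΩo hsub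
  obtain ⟨ε, hε, hεu⟩ := Metric.isOpen_iff.1 hu 0 (h0u rfl)
  have hΩK : ∀ t ∈ Metric.closedBall (0 : ℝ) (ε / 2), ∀ z ∈ K, (t, z) ∈ Ω := fun t ht z hz =>
    huv ⟨hεu (Metric.closedBall_subset_ball (half_lt_self hε) ht), hKv hz⟩
  have hD : ContinuousOn (fun q => fderiv ℝ g q (1, 0)) Ω := fun q hq => by
    have hq' : ContDiffAt ℝ 1 g q := hq
    have h1 : ContDiffAt ℝ 0 (fderiv ℝ g) q := hq'.fderiv_right (m := 0) (by simp)
    exact (h1.continuousAt.clm_apply continuousAt_const).continuousWithinAt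
  have hgc : ContinuousOn g Ω := fun q hq => by
    have hq' : ContDiffAt ℝ 1 g q := hq
    exact hq'.continuousAt.continuousWithinAt
  have hcomp : IsCompact (Metric.closedBall (0 : ℝ) (ε / 2) ×ˢ K) :=
    (isCompact_closedBall _ _).prod hK
  obtain ⟨C, hC⟩ := hcomp.exists_bound_of_continuousOn (hD.mono fun q hq => hΩK q.1 hq.1 q.2 hq.2)
  have hder : ∀ t ∈ Metric.closedBall (0 : ℝ) (ε / 2), ∀ z ∈ K,
      HasDerivAt (fun t => f t z) (fderiv ℝ g (t, z) (1, 0)) t := fun t ht z hz => by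
    have h0 : ContDiffAt ℝ 1 g (t, z) := hΩK t ht z hz
    have h1 : DifferentiableAt ℝ g (t, z) := h0.differentiableAt (by simp)
    have h2 : HasDerivAt (fun t : ℝ => (t, z)) ((1 : ℝ), (0 : Coord n)) t :=
      (hasDerivAt_id t).prodMk (hasDerivAt_const _ _)
    exact HasFDerivAt.comp_hasDerivAt t (l := g) h1.hasFDerivAt h2
  have hslice : ∀ t ∈ Metric.closedBall (0 : ℝ) (ε / 2), ∀ {h : ℝ × Coord n → ℝ},
      ContinuousOn h Ω → ContinuousOn (fun z => h (t, z)) K := fun t ht h hh =>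
    hh.comp (by fun_prop) fun z hz => hΩK t ht z hz
  have hball : Metric.closedBall (0 : ℝ) (ε / 2) ∈ nhds (0 : ℝ) :=
    Metric.closedBall_mem_nhds _ (half_pos hε)
  have h00 : (0 : ℝ) ∈ Metric.closedBall (0 : ℝ) (ε / 2) := Metric.mem_closedBall_self (by positivity)
  have hfin : volume s ≠ ⊤ := ((measure_mono hsK).trans_lt hK.measure_lt_top).ne
  have h1 := hasDerivAt_integral_of_dominated_loc_of_deriv_le (μ := volume.restrict s)
    (F := fun t z => f t z) (F' := fun t z => fderiv ℝ g (t, z) (1, 0)) (bound := fun _ => C)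
    (x₀ := (0 : ℝ)) hball
    (by
      filter_upwards [hball] with t ht
      exact ((hslice t ht hgc).mono hsK).aestronglyMeasurable hs)
    (((hslice 0 h00 hgc).integrableOn_compact hK).mono_set hsK)
    (((hslice 0 h00 hD).mono hsK).aestronglyMeasurable hs)
    ((ae_restrict_iff' hs).2 (Filter.Eventually.of_forall fun z hz t ht =>
      hC (t, z) ⟨ht, hsK hz⟩))
    (integrableOn_const hfin)
    ((ae_restrict_iff' hs).2 (Filter.Eventually.of_forall fun z hz t ht =>
      hder t ht z (hsK hz)))
  refine h1.2.congr_deriv (setIntegral_congr_fun hs fun z hz => ?_)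
  exact (hf.velocity_eq (hKU (hsK hz))).symm

end Stokes

section Config

variable {n : ℕ} {M : Type*} [TopologicalSpace M] [ChartedSpace (Coord n) M]
  {F V : ChartFamily n M (SymplecticTriple n)}

theorem continuousInCharts_firstVariation (hF : IsSymplecticConfig F) (hV : IsVariation V) :
    ContinuousInCharts (fun e => (F e).firstVariation (V e)) := fun e he =>
  (((hF.isConfigOn he).var_density e.open_target (hV.isVariationOn he)).sm_velocity
    e.open_target).continuousOn

theorem IsSymplecticConfig.sm_density (hF : IsSymplecticConfig F)
    {e : OpenPartialHomeomorph M (Coord n)} (he : e ∈ smoothCharts n M) :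
    Sm e.target (F e).density :=
  ((hF.isConfigOn he).toStringTriple.sm_density).congr e.open_target fun _ hz =>
    (hF.isConfigOn he).density_eq e.open_target hz

end Config

section Manifold

variable {n : ℕ} {M : Type*} [TopologicalSpace M] [ChartedSpace (Coord n) M]
  [MeasurableSpace M] [BorelSpace M] [T2Space M]

/-- Differentiation under the integral sign, for densities that depend smoothly on a parameter. -/
theorem hasDerivAt_patchIntegral {ρ : ℝ → ChartFamily n M (Coord n → ℝ)}
    {ρ' : ChartFamily n M (Coord n → ℝ)}
    (h : ∀ e ∈ smoothCharts n M, Var e.target (fun t => ρ t e) (ρ' e)) {P : Patches n M}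
    (hP : ValidPatches P) {A : Set M} (hA : MeasurableSet A) :
    HasDerivAt (fun t => patchIntegral (ρ t) P A) (patchIntegral ρ' P A) 0 := by
  induction P generalizing A with
  | nil => exact hasDerivAt_const _ _
  | cons p P ih =>
    obtain ⟨e, C⟩ := p
    obtain ⟨he, hC, hCe⟩ := hP (e, C) (by simp)
    have hCm : MeasurableSet C := hC.isClosed.measurableSet
    have h1 : e '' C ⊆ e.target := by
      rintro _ ⟨x, hx, rfl⟩
      exact e.map_source (hCe hx)
    exact (hasDerivAt_setIntegral (isCompact_image_chart hC hCe) h1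
      (measurableSet_image_chart (hA.inter hCm) (Set.inter_subset_right.trans hCe))
      (Set.image_mono Set.inter_subset_right) (h e he)).add (ih hP.tail (hA.diff hCm))

variable {F V : ChartFamily n M (SymplecticTriple n)}

/-- The first variation of the action. -/
theorem hasDerivAt_symplecticAction (κ : ℝ) (hF : IsSymplecticConfig F) (hV : IsVariation V)
    {P : Patches n M} (hP : ValidPatches P) :
    HasDerivAt (fun t : ℝ => symplecticAction κ (fun e => (F e).shift t (V e)) P)
      (1 / (2 * κ ^ 2)
        * patchIntegral (fun e => (F e).firstVariation (V e)) P Set.univ) 0 :=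
  (hasDerivAt_patchIntegral (fun e he => (hF.isConfigOn he).var_density e.open_target
    (hV.isVariationOn he)) hP MeasurableSet.univ).const_mul _

end Manifold

/-! ### Localization in charts -/

namespace IsConfigOn

variable {n : ℕ} {U : Set (Coord n)} {F V V' : SymplecticTriple n} {y : Coord n}

/-- The first variation depends only on the variation near the point. -/
theorem firstVariation_congr (hU : IsOpen U) (h : IsConfigOn U F) (hV : IsVariationOn U V)
    (hg : ∀ z ∈ U, V.g z = V'.g z) (hβ : ∀ z ∈ U, V.β z = V'.β z) (hφ : ∀ z ∈ U, V.φ z = V'.φ z)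
    (hy : y ∈ U) : F.firstVariation V y = F.firstVariation V' y := by
  have hV' : IsVariationOn U V' := ⟨fun i j => (hV.smg i j).congr hU fun z hz => by rw [hg z hz],
    fun i j => (hV.smβ i j).congr hU fun z hz => by rw [hβ z hz],
    hV.smφ.congr hU fun z hz => (hφ z hz).symm, fun z hz => by rw [← hg z hz]; exact hV.symm z hz,
    fun z hz => by rw [← hβ z hz]; exact hV.skew z hz⟩
  have t1 : Filter.Tendsto (fun t : ℝ => (t, y)) (nhds 0) (nhds (0, y)) :=
    (Continuous.prodMk_left y).continuousAt
  refine ((h.hasDerivAt_density hU hV hy).unique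
    ((h.hasDerivAt_density hU hV' hy).congr_of_eventuallyEq ?_))
  filter_upwards [t1.eventually ((h.isSymplecticFamily hU hV).eventually_config hy),
    t1.eventually ((h.isSymplecticFamily hU hV').eventually_config hy)]
    with t ⟨W, hW, hyW, hc⟩ ⟨W', hW', hyW', hc'⟩
  have hUW : IsOpen (U ∩ (W ∩ W')) := hU.inter (hW.inter hW')
  have c1 := hc.mono (Set.inter_subset_right.trans Set.inter_subset_left : U ∩ (W ∩ W') ⊆ W)
  have c2 := hc'.mono (Set.inter_subset_right.trans Set.inter_subset_right : U ∩ (W ∩ W') ⊆ W')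
  refine (isLocalCoordChange_id hUW).density_eq c1 c2 (fun z hz => ?_) ⟨hy, hyW, hyW'⟩ |>.trans ?_
  · have : jac (id : Coord n → Coord n) z = 1 := jac_id z
    rw [this]
    simp only [symplecticLaw, SymplecticTriple.shift, id, Matrix.transpose_one, one_mul, mul_one,
      hg z hz.1, hβ z hz.1, hφ z hz.1, and_self]
  · have : jac (id : Coord n → Coord n) y = 1 := jac_id y
    rw [this]
    simp

theorem firstVariation_eq_zero (hU : IsOpen U) (h : IsConfigOn U F) (hg : ∀ z ∈ U, V.g z = 0)
    (hβ : ∀ z ∈ U, V.β z = 0) (hφ : ∀ z ∈ U, V.φ z = 0) (hy : y ∈ U) :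
    F.firstVariation V y = 0 := by
  have h0 : IsVariationOn U (⟨0, 0, 0⟩ : SymplecticTriple n) :=
    ⟨fun _ _ => Sm.const 0, fun _ _ => Sm.const 0, Sm.const 0, fun _ _ => Matrix.transpose_zero,
      fun _ _ => by simp⟩
  rw [← firstVariation_congr hU h h0 (V' := V) (fun z hz => (hg z hz).symm)
    (fun z hz => (hβ z hz).symm) (fun z hz => (hφ z hz).symm) hy]
  simp [SymplecticTriple.firstVariation, SymplecticTriple.shift]

end IsConfigOn

/-! ### Localization of variations, and the symmetries of the action -/

/-- The current is local in the variation. -/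
theorem StringTriple.current_eq_zero {n : ℕ} {W : Set (Coord n)} {T V : StringTriple n} {y : Coord n}
    (hW : IsOpen W) (hG : ∀ z ∈ W, V.G z = 0) (hB : ∀ z ∈ W, V.B z = 0) (hφ : ∀ z ∈ W, V.φ z = 0)
    (hy : y ∈ W) (a : Fin n) : T.current V a y = 0 := by
  have h1 : ∀ i j k, pd i (fun z => V.G z j k) y = 0 := fun i j k => by
    rw [pd_congr i hW (g := fun _ => 0) (fun z hz => by rw [hG z hz]; rfl) hy, pd_const]
  have h2 : ∀ i j k, T.Cvar V i j k y = 0 := fun i j k => by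
    simp [Cvar, h1, hG y hy]
  simp [current, palatini, h2, hup, htr, hG y hy, hB y hy, hφ y hy]

namespace IsConfigOn

variable {n : ℕ} {U K : Set (Coord n)} {F V : SymplecticTriple n}

theorem current_stringVelocity_eq_zero (hU : IsOpen U) (hK : IsCompact K)
    (hv : ∀ y ∈ U, y ∉ K → V.g y = 0 ∧ V.β y = 0 ∧ V.φ y = 0) {y : Coord n} (hy : y ∈ U)
    (hyK : y ∉ K) (a : Fin n) : F.toStringTriple.current (F.stringVelocity V) a y = 0 := by
  refine StringTriple.current_eq_zero (hU.inter hK.isClosed.isOpen_compl) (fun z hz => ?_)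
    (fun z hz => ?_) (fun z hz => (hv z hz.1 hz.2).2.2) ⟨hy, hyK⟩ a
  · obtain ⟨h1, h2, -⟩ := hv z hz.1 hz.2
    simp [SymplecticTriple.stringVelocity, h1, h2]
  · obtain ⟨-, h2, -⟩ := hv z hz.1 hz.2
    simp [SymplecticTriple.stringVelocity, h2]

theorem sm_elPairing (hU : IsOpen U) (h : IsConfigOn U F) (hV : IsVariationOn U V) :
    Sm U (F.toStringTriple.elPairing (F.stringVelocity V)) := by
  have hs := h.stringVar hU hV
  have h1 : ∀ a, Sm U (F.toStringTriple.current (F.stringVelocity V) a) := fun a => by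
    have := hs.sm_current a
    rwa [SymplecticTriple.shift_zero] at this
  refine (((h.var_density hU hV).sm_velocity hU).sub (Sm.sum (s := Finset.univ)
    fun a => (h1 a).pd a)).congr hU fun z hz => ?_
  rw [h.firstVariation_eq hU hV hz]
  ring

/-- The first variation of the action of a coordinate domain. -/
theorem setIntegral_firstVariation (hU : IsOpen U) (h : IsConfigOn U F) (hV : IsVariationOn U V)
    (hK : IsCompact K) (hKU : K ⊆ U)
    (hv : ∀ y ∈ U, y ∉ K → V.g y = 0 ∧ V.β y = 0 ∧ V.φ y = 0) :
    ∫ y in K, F.firstVariation V y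
      = ∫ y in K, F.toStringTriple.elPairing (F.stringVelocity V) y := by
  have hs := h.stringVar hU hV
  have h1 : ∀ a, Sm U (F.toStringTriple.current (F.stringVelocity V) a) := fun a => by
    have := hs.sm_current a
    rwa [SymplecticTriple.shift_zero] at this
  have h2 : Sm U fun y => ∑ a, pd a (F.toStringTriple.current (F.stringVelocity V) a) y :=
    Sm.sum fun a => (h1 a).pd a
  have hint : ∀ {f : Coord n → ℝ}, Sm U f → IntegrableOn f K := fun hf =>
    (hf.continuousOn.mono hKU).integrableOn_compact hK
  rw [setIntegral_congr_fun hK.measurableSet fun y hy => h.firstVariation_eq hU hV (hKU hy),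
    integral_add (hint (h.sm_elPairing hU hV)) (hint h2),
    setIntegral_div_eq_zero hU hK hKU h1 (fun a y hy hyK =>
      current_stringVelocity_eq_zero hU hK hv hy hyK a), add_zero]

end IsConfigOn

section PartitionOfUnity

variable {n : ℕ} {M : Type*} [TopologicalSpace M] [ChartedSpace (Coord n) M]

/-- The coordinates of a point which is not in a closed set `C` have a neighbourhood of such points. -/
theorem isOpen_coord_compl {e : OpenPartialHomeomorph M (Coord n)} {C : Set M} (hC : IsClosed C) :
    IsOpen (e.target ∩ {y | e.symm y ∉ C}) :=
  e.isOpen_inter_preimage_symm hC.isOpen_compl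

theorem sm_comp_symm {f : M → ℝ} (hf : ContMDiff 𝓘(ℝ, Coord n) 𝓘(ℝ) ∞ f)
    {e : OpenPartialHomeomorph M (Coord n)} (he : e ∈ smoothCharts n M) :
    Sm e.target fun y => f (e.symm y) := fun y hy =>
  (ContMDiffAt.comp y (hf (e.symm y)) (contMDiffAt_symm_of_mem_maximalAtlas he hy)).contDiffAt

/-- A partition of unity on the region of a list of patches, subordinate to the charts. -/
structure IsPartition (P : Patches n M) (f : Fin P.length → M → ℝ) : Prop where
  smooth : ∀ i, ContMDiff 𝓘(ℝ, Coord n) 𝓘(ℝ) ∞ (f i)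
  subset : ∀ i, tsupport (f i) ⊆ (P.get i).1.source
  sum_eq : ∀ x ∈ region P, ∑ i, f i x = 1

theorem exists_isPartition [IsManifold 𝓘(ℝ, Coord n) ∞ M] [T2Space M] [SigmaCompactSpace M]
    {P : Patches n M} (hP : ValidPatches P) : ∃ f, IsPartition P f := by
  obtain ⟨f, hf⟩ := SmoothPartitionOfUnity.exists_isSubordinate 𝓘(ℝ, Coord n)
    (s := region P) (isCompact_region hP).isClosed (fun i : Fin P.length => (P.get i).1.source)
    (fun i => (P.get i).1.open_source) (by
      rintro x ⟨p, hp, hx⟩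
      obtain ⟨i, rfl⟩ := List.get_of_mem hp
      exact Set.mem_iUnion.2 ⟨i, (hP _ (List.get_mem P i)).2.2 hx⟩)
  refine ⟨fun i => f i, fun i => (f i).contMDiff, hf, fun x hx => ?_⟩
  rw [← finsum_eq_sum_of_fintype]
  exact f.sum_eq_one hx

/-- The part of the region of the patches on which a member of the partition may be nonzero. -/
def piece (P : Patches n M) (f : Fin P.length → M → ℝ) (i : Fin P.length) : Set M :=
  tsupport (f i) ∩ region P

variable {P : Patches n M} {f : Fin P.length → M → ℝ}

theorem isCompact_piece (hP : ValidPatches P) (i : Fin P.length) : IsCompact (piece P f i) :=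
  (isCompact_region hP).inter_left (isClosed_tsupport _)

theorem eq_zero_or_of_notMem_piece {i : Fin P.length} {x : M} (hx : x ∉ piece P f i) :
    f i x = 0 ∨ x ∉ region P := by
  by_cases h : x ∈ region P
  · exact Or.inl (image_eq_zero_of_notMem_tsupport fun h' => hx ⟨h', h⟩)
  · exact Or.inr h

/-- Multiplication of a field of vectors or covectors by a function. -/
def scaleField (f : M → ℝ) (X : ChartFamily n M (Coord n → Coord n)) :
    ChartFamily n M (Coord n → Coord n) := fun e y => f (e.symm y) • X e y

variable {X : ChartFamily n M (Coord n → Coord n)}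

theorem IsVectorField.scaleField (hX : IsVectorField X) {f : M → ℝ}
    (hf : ContMDiff 𝓘(ℝ, Coord n) 𝓘(ℝ) ∞ f) : IsVectorField (scaleField f X) where
  smooth e he := (sm_comp_symm hf he).contDiffOn.smul (hX.smooth e he)
  tensorial e he e' he' y hy hy' := by
    have h1 := hX.tensorial e he e' he' y hy hy'
    simp only [vectorLaw, id, SymplecticGravity.scaleField] at h1 hy' ⊢
    rw [h1, e'.left_inv hy', Matrix.mulVec_smul]

theorem IsOneForm.scaleField (hX : IsOneForm X) {f : M → ℝ}
    (hf : ContMDiff 𝓘(ℝ, Coord n) 𝓘(ℝ) ∞ f) : IsOneForm (scaleField f X) where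
  smooth e he := (sm_comp_symm hf he).contDiffOn.smul (hX.smooth e he)
  tensorial e he e' he' y hy hy' := by
    have h1 := hX.tensorial e he e' he' y hy hy'
    simp only [oneFormLaw, id, SymplecticGravity.scaleField] at h1 hy' ⊢
    rw [h1, e'.left_inv hy', Matrix.mulVec_smul]

theorem IsVariation.scale {V : ChartFamily n M (SymplecticTriple n)} (hV : IsVariation V) {f : M → ℝ}
    (hf : ContMDiff 𝓘(ℝ, Coord n) 𝓘(ℝ) ∞ f) :
    IsVariation fun e => (V e).scale fun y => f (e.symm y) := by
  refine isVariation_of_local (fun e he => (hV.isVariationOn he).scale (sm_comp_symm hf he)) ?_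
  intro e he e' he' y hy hy'
  obtain ⟨h1, h2, h3⟩ := hV.tensorial e he e' he' y hy hy'
  simp only [id] at h1 h2 h3 hy' ⊢
  refine ⟨?_, ?_, ?_⟩
  · simp only [SymplecticTriple.scale, h1, e'.left_inv hy', Matrix.mul_smul, Matrix.smul_mul]
  · simp only [SymplecticTriple.scale, h2, e'.left_inv hy', Matrix.mul_smul, Matrix.smul_mul]
  · simp only [SymplecticTriple.scale, h3, e'.left_inv hy']

theorem scaleField_vanishes (hX : VanishesOutside (region P) X) (i : Fin P.length) :
    VanishesOutside (piece P f i) (scaleField (f i) X) := fun e he y hy hyC => by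
  rcases eq_zero_or_of_notMem_piece hyC with h | h
  · simp [scaleField, h]
  · simp [scaleField, hX e he y hy h]

theorem sum_scaleField (hf : IsPartition P f) (hX : VanishesOutside (region P) X)
    {e : OpenPartialHomeomorph M (Coord n)} (he : e ∈ smoothCharts n M) {y : Coord n}
    (hy : y ∈ e.target) : X e y = ∑ i, scaleField (f i) X e y := by
  simp only [scaleField, ← Finset.sum_smul]
  by_cases h : e.symm y ∈ region P
  · rw [hf.sum_eq _ h, one_smul]
  · rw [hX e he y hy h, smul_zero]

end PartitionOfUnity

section Action

variable {n : ℕ} {M : Type*} [TopologicalSpace M] [ChartedSpace (Coord n) M]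
  [MeasurableSpace M] [BorelSpace M] [T2Space M]
  {F V : ChartFamily n M (SymplecticTriple n)} {P : Patches n M} {f : Fin P.length → M → ℝ}

/-- The action is stationary along a variation which splits into pieces that are supported in
charts and whose first variations integrate to zero. -/
theorem hasDerivAt_symplecticAction_zero (κ : ℝ) (hF : IsSymplecticConfig F) (hV : IsVariation V)
    (hP : ValidPatches P) (hf : IsPartition P f)
    {Vs : Fin P.length → ChartFamily n M (SymplecticTriple n)} (hVs : ∀ i, IsVariation (Vs i))
    (hv : ∀ i, ∀ e ∈ smoothCharts n M, ∀ y ∈ e.target, e.symm y ∉ piece P f i →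
      (F e).firstVariation (Vs i e) y = 0)
    (hsum : ∀ e ∈ smoothCharts n M, ∀ y ∈ e.target,
      (F e).firstVariation (V e) y = ∑ i, (F e).firstVariation (Vs i e) y)
    (h0 : ∀ i, ∫ y in (P.get i).1 '' piece P f i,
      (F (P.get i).1).firstVariation (Vs i (P.get i).1) y = 0) :
    HasDerivAt (fun t : ℝ => symplecticAction κ (fun e => (F e).shift t (V e)) P) 0 0 := by
  refine (hasDerivAt_symplecticAction κ hF hV hP).congr_deriv ?_
  rw [patchIntegral_eq_zero_of_pieces hP
    (fun i => continuousInCharts_firstVariation hF (hVs i))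
    (fun i => relatedUnder_firstVariation hF (hVs i))
    (fun i => (hP _ (List.get_mem P i)).1) (isCompact_piece hP)
    (fun i => Set.inter_subset_left.trans (hf.subset i)) (fun i => Set.inter_subset_right) hv
    hsum h0, mul_zero]

/-- The action is stationary along variations which change the Lagrangian by the divergence of the
current `X L`, where `X` vanishes outside the region of integration. -/
theorem hasDerivAt_symplecticAction_zero_of_currents (κ : ℝ) (hF : IsSymplecticConfig F)
    (hV : IsVariation V) (hP : ValidPatches P) (hf : IsPartition P f)
    {Vs : Fin P.length → ChartFamily n M (SymplecticTriple n)} (hVs : ∀ i, IsVariation (Vs i))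
    {X : ChartFamily n M (Coord n → Coord n)}
    {Xs : Fin P.length → ChartFamily n M (Coord n → Coord n)}
    (hXs : ∀ i, ∀ e ∈ smoothCharts n M, ∀ k, Sm e.target fun z => Xs i e z k)
    (hXv : ∀ i, VanishesOutside (piece P f i) (Xs i))
    (hXsum : ∀ e ∈ smoothCharts n M, ∀ y ∈ e.target, X e y = ∑ i, Xs i e y)
    (hdiv : ∀ e ∈ smoothCharts n M, ∀ y ∈ e.target, (F e).firstVariation (V e) y
      = ∑ m, pd m (fun z => X e z m * (F e).density z) y)
    (hdivs : ∀ i, ∀ e ∈ smoothCharts n M, ∀ y ∈ e.target, (F e).firstVariation (Vs i e) y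
      = ∑ m, pd m (fun z => Xs i e z m * (F e).density z) y) :
    HasDerivAt (fun t : ℝ => symplecticAction κ (fun e => (F e).shift t (V e)) P) 0 0 := by
  have hsm : ∀ i, ∀ e ∈ smoothCharts n M, ∀ k, Sm e.target fun z => Xs i e z k * (F e).density z :=
    fun i e he k => (hXs i e he k).mul (hF.sm_density he)
  refine hasDerivAt_symplecticAction_zero κ hF hV hP hf hVs (fun i e he y hy hyC => ?_)
    (fun e he y hy => ?_) (fun i => ?_)
  · rw [hdivs i e he y hy]
    refine Finset.sum_eq_zero fun m _ => ?_
    rw [pd_congr m (isOpen_coord_compl (isCompact_piece hP i).isClosed) (g := fun _ => 0)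
      (fun z hz => by rw [hXv i e he z hz.1 hz.2]; exact zero_mul _) ⟨hy, hyC⟩, pd_const]
  · rw [hdiv e he y hy, Finset.sum_congr rfl fun i _ => hdivs i e he y hy, Finset.sum_comm]
    refine Finset.sum_congr rfl fun m _ => ?_
    rw [← pd_sum m (fun i => hsm i e he m) hy]
    refine pd_congr m e.open_target (fun z hz => ?_) hy
    rw [hXsum e he z hz, Finset.sum_apply, Finset.sum_mul]
  · obtain ⟨he, -, -⟩ := hP _ (List.get_mem P i)
    have hsub : piece P f i ⊆ (P.get i).1.source := Set.inter_subset_left.trans (hf.subset i)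
    have hKU : (P.get i).1 '' piece P f i ⊆ (P.get i).1.target := by
      rintro _ ⟨x, hx, rfl⟩
      exact (P.get i).1.map_source (hsub hx)
    have hK := isCompact_image_chart (isCompact_piece hP i) hsub
    rw [setIntegral_congr_fun hK.measurableSet fun y hy => hdivs i _ he y (hKU hy)]
    refine setIntegral_div_eq_zero (P.get i).1.open_target hK hKU (hsm i _ he) fun a y hy hyK => ?_
    rw [hXv i _ he y hy fun h => hyK ⟨_, h, (P.get i).1.right_inv hy⟩]
    exact zero_mul _

variable {X ξ : ChartFamily n M (Coord n → Coord n)}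

theorem isVariation_diffeoVariation {n : ℕ} {M : Type*} [TopologicalSpace M]
    [ChartedSpace (Coord n) M] {F : ChartFamily n M (SymplecticTriple n)}
    {X : ChartFamily n M (Coord n → Coord n)} (hF : IsSymplecticConfig F) (hX : IsVectorField X) :
    IsVariation fun e => (F e).diffeoVariation (X e) := by
  refine isVariation_of_local (fun e he => IsConfigOn.isVariationOn_diffeoVariation e.open_target
    (hF.isConfigOn he) (hX.sm he)) ?_
  intro e he e' he' y hy hy'
  exact (isLocalCoordChange_trans (Diffeomorph.refl 𝓘(ℝ, Coord n) M ∞) he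
    he').symplecticLaw_diffeoVariation ((hF.isConfigOn he).mono Set.inter_subset_left)
    (hF.isConfigOn he') (fun k => (hX.sm he k).mono Set.inter_subset_left) (hX.sm he')
    (fun z hz => hF.tensorial e he e' he' z hz.1 hz.2)
    (fun z hz => hX.tensorial e he e' he' z hz.1 hz.2) ⟨hy, hy'⟩

theorem isVariation_betaVariation {n : ℕ} {M : Type*} [TopologicalSpace M]
    [ChartedSpace (Coord n) M] {F : ChartFamily n M (SymplecticTriple n)}
    {ξ : ChartFamily n M (Coord n → Coord n)} (hF : IsSymplecticConfig F) (hξ : IsOneForm ξ) :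
    IsVariation fun e => (F e).betaVariation (ξ e) := by
  refine isVariation_of_local (fun e he => IsConfigOn.isVariationOn_betaVariation e.open_target
    (hF.isConfigOn he) (hξ.sm he)) ?_
  intro e he e' he' y hy hy'
  exact (isLocalCoordChange_trans (Diffeomorph.refl 𝓘(ℝ, Coord n) M ∞) he
    he').symplecticLaw_betaVariation ((hF.isConfigOn he).mono Set.inter_subset_left)
    (hF.isConfigOn he') (fun k => (hξ.sm he k).mono Set.inter_subset_left) (hξ.sm he')
    (fun z hz => hF.tensorial e he e' he' z hz.1 hz.2)
    (fun z hz => hξ.tensorial e he e' he' z hz.1 hz.2) ⟨hy, hy'⟩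

variable [IsManifold 𝓘(ℝ, Coord n) ∞ M] [SigmaCompactSpace M]

theorem hasDerivAt_symplecticAction_diffeoVariation (κ : ℝ) (hF : IsSymplecticConfig F)
    (hX : IsVectorField X) (hP : ValidPatches P) (hXP : VanishesOutside (region P) X) :
    HasDerivAt (fun t : ℝ => symplecticAction κ
      (fun e => (F e).shift t ((F e).diffeoVariation (X e))) P) 0 0 := by
  obtain ⟨f, hf⟩ := exists_isPartition hP
  have hXs : ∀ i, IsVectorField (scaleField (f i) X) := fun i => hX.scaleField (hf.smooth i)
  exact hasDerivAt_symplecticAction_zero_of_currents κ hF (isVariation_diffeoVariation hF hX) hP hf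
    (fun i => isVariation_diffeoVariation hF (hXs i)) (fun i e he => (hXs i).sm he)
    (scaleField_vanishes hXP) (fun e he y hy => sum_scaleField hf hXP he hy)
    (fun e he y hy => IsConfigOn.firstVariation_diffeoVariation e.open_target (hF.isConfigOn he)
      (hX.sm he) hy)
    (fun i e he y hy => IsConfigOn.firstVariation_diffeoVariation e.open_target (hF.isConfigOn he)
      ((hXs i).sm he) hy)

theorem hasDerivAt_symplecticAction_betaVariation (κ : ℝ) (hF : IsSymplecticConfig F)
    (hξ : IsOneForm ξ) (hP : ValidPatches P) (hξP : VanishesOutside (region P) ξ) :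
    HasDerivAt (fun t : ℝ => symplecticAction κ
      (fun e => (F e).shift t ((F e).betaVariation (ξ e))) P) 0 0 := by
  obtain ⟨f, hf⟩ := exists_isPartition hP
  have hξs : ∀ i, IsOneForm (scaleField (f i) ξ) := fun i => hξ.scaleField (hf.smooth i)
  refine hasDerivAt_symplecticAction_zero_of_currents κ hF (isVariation_betaVariation hF hξ) hP hf
    (X := fun e => IsConfigOn.anchor (F e) (ξ e))
    (Xs := fun i e => IsConfigOn.anchor (F e) (scaleField (f i) ξ e))
    (fun i => isVariation_betaVariation hF (hξs i))
    (fun i e he => (hF.isConfigOn he).sm_anchor ((hξs i).sm he))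
    (fun i e he y hy hyC => ?_) (fun e he y hy => ?_)
    (fun e he y hy => IsConfigOn.firstVariation_betaVariation e.open_target (hF.isConfigOn he)
      (hξ.sm he) hy)
    (fun i e he y hy => IsConfigOn.firstVariation_betaVariation e.open_target (hF.isConfigOn he)
      ((hξs i).sm he) hy)
  · funext m
    simp [IsConfigOn.anchor, scaleField_vanishes hξP i e he y hy hyC]
  · funext m
    simp only [IsConfigOn.anchor, Finset.sum_apply, sum_scaleField hf hξP he hy, Finset.sum_mul]
    exact Finset.sum_comm

/-- A configuration which satisfies the Euler–Lagrange equations is stationary. -/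
theorem isStationary_of_elPairing_eq_zero (κ : ℝ) (hF : IsSymplecticConfig F)
    (h : ∀ e ∈ smoothCharts n M, ∀ y ∈ e.target, ∀ W : StringTriple n,
      (F e).toStringTriple.elPairing W y = 0) : IsStationary κ F := by
  intro V hV P hP hVP
  obtain ⟨f, hf⟩ := exists_isPartition hP
  have hvan : ∀ i, VariationVanishesOutside (piece P f i)
      fun e => (V e).scale fun y => f i (e.symm y) := by
    intro i e he y hy hyC
    rcases eq_zero_or_of_notMem_piece hyC with h0 | h0
    · simp [SymplecticTriple.scale, h0]
    · obtain ⟨h1, h2, h3⟩ := hVP e he y hy h0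
      simp [SymplecticTriple.scale, h1, h2, h3]
  have hVs : ∀ i, IsVariation fun e => (V e).scale fun y => f i (e.symm y) :=
    fun i => hV.scale (hf.smooth i)
  refine hasDerivAt_symplecticAction_zero κ hF hV hP hf hVs (fun i e he y hy hyC => ?_)
    (fun e he y hy => ?_) (fun i => ?_)
  · have hW := isOpen_coord_compl (e := e) (isCompact_piece (f := f) hP i).isClosed
    exact IsConfigOn.firstVariation_eq_zero hW ((hF.isConfigOn he).mono Set.inter_subset_left)
      (fun z hz => (hvan i e he z hz.1 hz.2).1) (fun z hz => (hvan i e he z hz.1 hz.2).2.1)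
      (fun z hz => (hvan i e he z hz.1 hz.2).2.2) ⟨hy, hyC⟩
  · have hone : ∀ z ∈ e.target, (∑ i, f i (e.symm z) = 1)
        ∨ ((V e).g z = 0 ∧ (V e).β z = 0 ∧ (V e).φ z = 0) := fun z hz => by
      by_cases hzP : e.symm z ∈ region P
      · exact Or.inl (hf.sum_eq _ hzP)
      · exact Or.inr (hVP e he z hz hzP)
    rw [← (hF.isConfigOn he).firstVariation_sum e.open_target (hV.isVariationOn he)
      (fun i => sm_comp_symm (hf.smooth i) he) hy]
    refine IsConfigOn.firstVariation_congr e.open_target (hF.isConfigOn he) (hV.isVariationOn he)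
      (fun z hz => ?_) (fun z hz => ?_) (fun z hz => ?_) hy
    all_goals
      rcases hone z hz with h1 | ⟨h1, h2, h3⟩
      · simp [SymplecticTriple.scale, h1]
      · simp [SymplecticTriple.scale, h1, h2, h3]
  · obtain ⟨he, -, -⟩ := hP _ (List.get_mem P i)
    have hsub : piece P f i ⊆ (P.get i).1.source := Set.inter_subset_left.trans (hf.subset i)
    have hKU : (P.get i).1 '' piece P f i ⊆ (P.get i).1.target := by
      rintro _ ⟨x, hx, rfl⟩
      exact (P.get i).1.map_source (hsub hx)
    have hK := isCompact_image_chart (isCompact_piece hP i) hsub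
    rw [(hF.isConfigOn he).setIntegral_firstVariation (P.get i).1.open_target
      ((hVs i).isVariationOn he) hK hKU fun y hy hyK =>
        hvan i _ he y hy fun h' => hyK ⟨_, h', (P.get i).1.right_inv hy⟩]
    exact setIntegral_eq_zero_of_forall_eq_zero fun y hy => h _ he y (hKU hy) _

end Action

/-! ### The Euler–Lagrange equations on a coordinate domain -/

namespace StringTriple

variable {n : ℕ} {U : Set (Coord n)} {T : StringTriple n} {y : Coord n}

/-- The Ricci tensor is symmetric: the trace `Γ^a_{ab}` of the Christoffel symbols is a gradient. -/
theorem Ric_symm (hU : IsOpen U) (hG : IsMetricOn U T.G) (hφ : Sm U T.φ) (hy : y ∈ U) (c b : Fin n) :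
    T.Ric c b y = T.Ric b c y := by
  have hτ : ∀ i, Sm U fun z => ∑ e, T.Γ e i e z := fun i => Sm.sum fun e => sm_Γ hG e i e
  have hw := sm_weight hG hφ
  have h1 : ∀ i j, pd i (pd j T.weight) y = T.weight y * ((∑ e, T.Γ e i e y) - 2 * pd i T.φ y)
      * ((∑ e, T.Γ e j e y) - 2 * pd j T.φ y)
      + T.weight y * (pd i (fun z => ∑ e, T.Γ e j e z) y - 2 * pd i (pd j T.φ) y) := fun i j => by
    rw [pd_congr i hU (fun z hz => pd_weight hU hG hφ hz j) hy,
      pd_mul i hw ((hτ j).sub ((Sm.const 2).mul (hφ.pd j))) hy, pd_weight hU hG hφ hy i,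
      pd_sub i (hτ j) ((Sm.const 2).mul (hφ.pd j)) hy, pd_const_mul i 2 (hφ.pd j) hy]
  have h2 : pd c (fun z => ∑ e, T.Γ e b e z) y = pd b (fun z => ∑ e, T.Γ e c e z) y := by
    have h3 := h1 c b
    rw [pd_comm c b hw hy, h1 b c, pd_comm c b hφ hy] at h3
    have h4 := (weight_pos hG hy).ne'
    refine mul_left_cancel₀ h4 ?_
    linarith
  have h5 : ∀ i j, ∑ a, pd i (T.Γ a a j) y = pd i (fun z => ∑ e, T.Γ e j e z) y := fun i j => by
    rw [pd_sum i (fun e => sm_Γ hG e j e) hy]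
    exact Finset.sum_congr rfl fun a _ => pd_congr i hU (fun z hz => Γ_symm hU hG hz a a j) hy
  have h6 : ∀ c b, T.Ric c b y = ∑ a, pd a (T.Γ a b c) y - pd b (fun z => ∑ e, T.Γ e c e z) y
      + ∑ a, ∑ e, T.Γ a a e y * T.Γ e b c y - ∑ a, ∑ e, T.Γ a b e y * T.Γ e a c y := fun c b => by
    rw [← h5]
    simp only [Ric, Riem, Finset.sum_add_distrib, Finset.sum_sub_distrib]
    ring
  rw [h6, h6, h2]
  congr 1
  · congr 1
    · congr 1
      exact Finset.sum_congr rfl fun a _ => pd_congr a hU (fun z hz => Γ_symm hU hG hz a b c) hy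
    · exact Finset.sum_congr rfl fun a _ => Finset.sum_congr rfl fun e _ => by
        rw [Γ_symm hU hG hy e b c]
  · rw [Finset.sum_comm]
    exact Finset.sum_congr rfl fun a _ => Finset.sum_congr rfl fun e _ => by
      rw [Γ_symm hU hG hy a e c, Γ_symm hU hG hy e b a]
      ring

theorem HSqM_symm (hG : IsMetricOn U T.G) (hy : y ∈ U) :
    (T.HSqM y).transpose = T.HSqM y := by
  have hg : (T.GInv y).transpose = T.GInv y := hG.inv_symm hy
  rw [HSqM, pair23_comm, pair23_slot2, pair23_slot3, hg, slot3_slot2]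

theorem eomG_symm (hU : IsOpen U) (h : IsStringConfigOn U T) (hy : y ∈ U) (a b : Fin n) :
    T.eomG a b y = T.eomG b a y := by
  have h1 : T.hess a b y = T.hess b a y := by
    unfold hess
    rw [pd_comm a b h.smφ hy]
    congr 1
    exact Finset.sum_congr rfl fun k _ => by rw [Γ_symm hU h.metric hy k a b]
  have h2 : T.HSqM y a b = T.HSqM y b a := congrFun (congrFun (HSqM_symm h.metric hy) b) a
  rw [eomG, eomG, Ric_symm hU h.metric h.smφ hy a b, h1, h2]

theorem eomB_skew (hU : IsOpen U) (h : IsStringConfigOn U T) (hy : y ∈ U) (b c : Fin n) :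
    T.eomB b c y = -T.eomB c b y := by
  unfold eomB
  rw [← Finset.sum_neg_distrib]
  refine Finset.sum_congr rfl fun a _ => ?_
  rw [← pd_neg]
  exact pd_congr a hU (fun z hz => by rw [Hup_skew23 hU h hz a b c]; ring) hy

theorem sm_Ric (h : IsStringConfigOn U T) (a b : Fin n) : Sm U (T.Ric a b) :=
  Sm.sum fun m => ((h.isStringFamily (P := ℝ)).jsm_Riem m a m b).sm_zero

theorem sm_hess (h : IsStringConfigOn U T) (a b : Fin n) : Sm U (T.hess a b) :=
  ((h.smφ.pd b).pd a).sub (Sm.sum fun k => (sm_Γ h.metric k a b).mul (h.smφ.pd k))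

theorem sm_HSqM (h : IsStringConfigOn U T) (a b : Fin n) : Sm U fun z => T.HSqM z a b := by
  change Sm U fun z => ∑ i, ∑ j, T.H a i j z * ∑ k, T.GInv z i k * ∑ l, T.GInv z j l * T.H b k l z
  exact Sm.sum fun i => Sm.sum fun j => (sm_H h a i j).mul (Sm.sum fun k =>
    (h.metric.smooth_inv i k).mul (Sm.sum fun l => (h.metric.smooth_inv j l).mul (sm_H h b k l)))

theorem sm_eomG (h : IsStringConfigOn U T) (a b : Fin n) : Sm U (T.eomG a b) :=
  ((sm_Ric h a b).add ((Sm.const _).mul (sm_hess h a b))).sub ((Sm.const _).mul (sm_HSqM h a b))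

theorem sm_eomφ (hU : IsOpen U) (h : IsStringConfigOn U T) : Sm U T.eomφ := by
  have h1 : Sm U T.HSq := (Sm.sum (s := Finset.univ) fun a => Sm.sum (s := Finset.univ) fun b =>
    (h.metric.smooth_inv a b).mul (sm_HSqM h a b)).congr hU fun z _ => HSq_eq_trace
  exact (((Sm.sum fun a => Sm.sum fun b => (h.metric.smooth_inv a b).mul (sm_Ric h a b)).sub
    ((Sm.const _).mul h1)).add ((Sm.const _).mul (Sm.sum fun a => Sm.sum fun b =>
      (h.metric.smooth_inv a b).mul (sm_hess h a b)))).sub ((Sm.const _).mul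
      (Sm.sum fun a => Sm.sum fun b =>
        ((h.metric.smooth_inv a b).mul (h.smφ.pd a)).mul (h.smφ.pd b)))

theorem sm_eomB (h : IsStringConfigOn U T) (b c : Fin n) : Sm U (T.eomB b c) :=
  Sm.sum fun a => ((sm_weight h.metric h.smφ).mul (sm_Hup h a b c)).pd a

/-- The Euler–Lagrange pairing is homogeneous, so a variation may be multiplied by a bump function. -/
theorem elPairing_smul {V W : StringTriple n} {r : ℝ} (hG : W.G y = r • V.G y)
    (hB : W.B y = r • V.B y) (hφ : W.φ y = r * V.φ y) :
    T.elPairing W y = r * T.elPairing V y := by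
  have h1 : T.htr W y = r * T.htr V y := by
    simp only [htr, hG, Matrix.smul_apply, smul_eq_mul, Finset.mul_sum]
    exact Finset.sum_congr rfl fun _ _ => Finset.sum_congr rfl fun _ _ => by ring
  have h2 : ∀ a b, T.hup W y a b = r * T.hup V y a b := fun a b => by
    simp only [hup, hG, Matrix.mul_smul, Matrix.smul_mul, Matrix.smul_apply, smul_eq_mul]
  have h3 : ∑ a, ∑ b, -(T.hup W y a b * T.eomG a b y)
      = r * ∑ a, ∑ b, -(T.hup V y a b * T.eomG a b y) := by
    simp only [h2, Finset.mul_sum]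
    exact Finset.sum_congr rfl fun _ _ => Finset.sum_congr rfl fun _ _ => by ring
  have h4 : ∑ b, ∑ c, T.eomB b c y * W.B y b c = r * ∑ b, ∑ c, T.eomB b c y * V.B y b c := by
    simp only [hB, Matrix.smul_apply, smul_eq_mul, Finset.mul_sum]
    exact Finset.sum_congr rfl fun _ _ => Finset.sum_congr rfl fun _ _ => by ring
  rw [elPairing, h1, h3, h4, hφ, elPairing]
  ring

end StringTriple

theorem sum_sq_eq_zero {n : ℕ} {f : Fin n → Fin n → ℝ} (h : ∑ a, ∑ b, f a b * f a b = 0)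
    (a b : Fin n) : f a b = 0 := by
  have h1 := (Finset.sum_eq_zero_iff_of_nonneg fun a _ =>
    Finset.sum_nonneg fun b _ => mul_self_nonneg (f a b)).1 h a (Finset.mem_univ a)
  exact mul_self_eq_zero.1 ((Finset.sum_eq_zero_iff_of_nonneg fun b _ =>
    mul_self_nonneg (f a b)).1 h1 b (Finset.mem_univ b))

namespace IsConfigOn

variable {n : ℕ} {U : Set (Coord n)} {F V : SymplecticTriple n} {y : Coord n}

/-- The first variation of the action vanishes for all compactly supported variations in `U`. -/
def IsStationaryOn (U : Set (Coord n)) (F : SymplecticTriple n) : Prop :=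
  ∀ V, IsVariationOn U V → ∀ K, IsCompact K → K ⊆ U →
    (∀ y ∈ U, y ∉ K → V.g y = 0 ∧ V.β y = 0 ∧ V.φ y = 0) → ∫ y in K, F.firstVariation V y = 0

/-- The fundamental lemma of the calculus of variations. -/
theorem elPairing_eq_zero_of_nonneg (hU : IsOpen U) (h : IsConfigOn U F) (hs : IsStationaryOn U F)
    (hV : IsVariationOn U V)
    (hpos : ∀ z ∈ U, 0 ≤ F.toStringTriple.elPairing (F.stringVelocity V) z) (hy : y ∈ U) :
    F.toStringTriple.elPairing (F.stringVelocity V) y = 0 := by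
  obtain ⟨r, hr, hrU⟩ := Metric.nhds_basis_closedBall.mem_iff.1 (hU.mem_nhds hy)
  let f : ContDiffBump y := ⟨r / 2, r, half_pos hr, half_lt_self hr⟩
  have hfs : Sm U f := fun z _ => f.contDiff.contDiffAt
  have hK : IsCompact (Metric.closedBall y r) := isCompact_closedBall y r
  have hscale : ∀ z, F.toStringTriple.elPairing (F.stringVelocity (V.scale f)) z
      = f z * F.toStringTriple.elPairing (F.stringVelocity V) z := fun z =>
    StringTriple.elPairing_smul (by
      simp only [SymplecticTriple.stringVelocity, SymplecticTriple.scale, Matrix.mul_smul,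
        Matrix.smul_mul, smul_add, smul_sub]) (by
      simp only [SymplecticTriple.stringVelocity, SymplecticTriple.scale, Matrix.mul_smul,
        Matrix.smul_mul, smul_neg]) rfl
  have hv : ∀ z ∈ U, z ∉ Metric.closedBall y r →
      (V.scale f).g z = 0 ∧ (V.scale f).β z = 0 ∧ (V.scale f).φ z = 0 := fun z _ hz => by
    have h0 : f z = 0 := f.zero_of_le_dist (le_of_lt (not_le.1 hz))
    simp [SymplecticTriple.scale, h0]
  have h1 := hs _ (hV.scale hfs) _ hK hrU hv
  rw [h.setIntegral_firstVariation hU (hV.scale hfs) hK hrU hv] at h1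
  have hsm := h.sm_elPairing hU (hV.scale hfs)
  have hcont := hsm.continuousOn.mono hrU
  have hnn : ∀ z ∈ Metric.closedBall y r,
      0 ≤ F.toStringTriple.elPairing (F.stringVelocity (V.scale f)) z := fun z hz => by
    rw [hscale]
    exact mul_nonneg f.nonneg (hpos z (hrU hz))
  rw [setIntegral_eq_zero_iff_of_nonneg_ae
    ((ae_restrict_iff' hK.measurableSet).2 (Filter.Eventually.of_forall hnn))
    (hcont.integrableOn_compact hK)] at h1
  have h2 := Measure.eqOn_open_of_ae_eq
    (ae_restrict_of_ae_restrict_of_subset Metric.ball_subset_closedBall h1) Metric.isOpen_ball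
    (hcont.mono Metric.ball_subset_closedBall) continuousOn_const (Metric.mem_ball_self hr)
  rw [hscale] at h2
  exact (mul_eq_zero.1 h2).resolve_left (f.pos_of_mem_ball (Metric.mem_ball_self hr)).ne'

/-- A configuration which is stationary on a coordinate domain satisfies the equations of motion. -/
theorem equationsOfMotion_of_isStationaryOn (hU : IsOpen U) (h : IsConfigOn U F)
    (hs : IsStationaryOn U F) (hy : y ∈ U) : F.EquationsOfMotionAt y := by
  have hT := h.toStringTriple
  set T := F.toStringTriple with hTdef
  have hw : ∀ z ∈ U, 0 < T.weight z := fun z hz => StringTriple.weight_pos hT.metric hz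
  have eφ : ∀ z ∈ U, T.eomφ z = 0 := fun z hz => by
    set V : SymplecticTriple n := ⟨0, 0, fun z => -T.eomφ z⟩ with hVdef
    have hV : IsVariationOn U V := ⟨fun _ _ => Sm.const 0, fun _ _ => Sm.const 0,
      (StringTriple.sm_eomφ hU hT).neg, fun _ _ => Matrix.transpose_zero, fun _ _ => by simp [hVdef]⟩
    have hp : ∀ z, T.elPairing (F.stringVelocity V) z = 2 * T.weight z * (T.eomφ z * T.eomφ z) :=
      fun z => by
        simp [StringTriple.elPairing, SymplecticTriple.stringVelocity, StringTriple.hup,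
          StringTriple.htr, hVdef]
        ring
    have h1 := h.elPairing_eq_zero_of_nonneg hU hs hV (fun z hz => by
      rw [hp]
      exact mul_nonneg (mul_nonneg zero_le_two (hw z hz).le) (mul_self_nonneg _)) hz
    rw [hp] at h1
    exact mul_self_eq_zero.1 ((mul_eq_zero.1 h1).resolve_left (by have := hw z hz; positivity))
  have eG : ∀ z ∈ U, ∀ a b, T.eomG a b z = 0 := fun z hz => by
    -- with this variation of `ĝ` the metric `G` varies by `-G E G`, where `E` is `eomG`
    set E : Coord n → Matrix (Fin n) (Fin n) ℝ := fun z => Matrix.of fun a b => T.eomG a b z with hE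
    set V : SymplecticTriple n := ⟨fun z => F.β z * (T.G z * E z * T.G z) * F.β z, 0, 0⟩ with hVdef
    have hEs : ∀ z ∈ U, (E z).transpose = E z := fun z hz => by
      ext a b
      exact StringTriple.eomG_symm hU hT hz b a
    have hEsm : SmM U E := fun a b => StringTriple.sm_eomG hT a b
    have hV : IsVariationOn U V := ⟨(h.smβ.mul ((hT.metric.smooth.mul hEsm).mul
      hT.metric.smooth)).mul h.smβ, fun _ _ => Sm.const 0, Sm.const 0, fun z hz => by
        simp only [hVdef, Matrix.transpose_mul, h.skew z hz, hT.metric.symm z hz, hEs z hz, neg_mul,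
          mul_neg, neg_neg, mul_assoc], fun _ _ => by simp [hVdef]⟩
    have hp : ∀ z ∈ U, T.elPairing (F.stringVelocity V) z
        = T.weight z * ∑ a, ∑ b, T.eomG a b z * T.eomG a b z := fun z hz => by
      have hβ := h.unitβ z hz
      have hG := hT.metric.unit z hz
      have h1 : (F.stringVelocity V).G z = -(T.G z * E z * T.G z) := by
        simp only [SymplecticTriple.stringVelocity, hVdef, SymplecticTriple.βInv, Pi.zero_apply,
          mul_zero, zero_mul, add_zero, zero_sub, mul_assoc, Matrix.mul_nonsing_inv _ hβ, mul_one,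
          Matrix.nonsing_inv_mul_cancel_left _ _ hβ]
      have h2 : T.hup (F.stringVelocity V) z = -E z := by
        simp only [StringTriple.hup, h1, StringTriple.GInv, mul_neg, neg_mul, mul_assoc,
          Matrix.mul_nonsing_inv _ hG, mul_one, Matrix.nonsing_inv_mul_cancel_left _ _ hG]
      have h3 : (F.stringVelocity V).B z = 0 := by
        simp [SymplecticTriple.stringVelocity, hVdef]
      rw [StringTriple.elPairing, h2, h3, eφ z hz]
      simp [hE]
    have h1 := h.elPairing_eq_zero_of_nonneg hU hs hV (fun z hz => by
      rw [hp z hz]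
      exact mul_nonneg (hw z hz).le (Finset.sum_nonneg fun a _ => Finset.sum_nonneg fun b _ =>
        mul_self_nonneg _)) hz
    rw [hp z hz] at h1
    exact sum_sq_eq_zero ((mul_eq_zero.1 h1).resolve_left (hw z hz).ne')
  have eB : ∀ z ∈ U, ∀ b c, T.eomB b c z = 0 := fun z hz => by
    -- with this variation of `β` the two-form `B` varies by `eomB`
    set E : Coord n → Matrix (Fin n) (Fin n) ℝ := fun z => Matrix.of fun a b => T.eomB a b z with hE
    set V : SymplecticTriple n := ⟨0, fun z => -(F.β z * E z * F.β z), 0⟩ with hVdef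
    have hEs : ∀ z ∈ U, (E z).transpose = -E z := fun z hz => by
      ext a b
      exact StringTriple.eomB_skew hU hT hz b a
    have hEsm : SmM U E := fun a b => StringTriple.sm_eomB hT a b
    have hV : IsVariationOn U V := ⟨fun _ _ => Sm.const 0, ((h.smβ.mul hEsm).mul h.smβ).neg,
      Sm.const 0, fun _ _ => Matrix.transpose_zero, fun z hz => by
        simp only [hVdef, Matrix.transpose_mul, Matrix.transpose_neg, h.skew z hz, hEs z hz, neg_mul,
          mul_neg, neg_neg, mul_assoc]⟩
    have hp : ∀ z ∈ U, T.elPairing (F.stringVelocity V) z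
        = (1 / 2) * ∑ b, ∑ c, T.eomB b c z * T.eomB b c z := fun z hz => by
      have hβ := h.unitβ z hz
      have h1 : (F.stringVelocity V).B z = E z := by
        simp only [SymplecticTriple.stringVelocity, hVdef, SymplecticTriple.βInv, neg_mul, mul_neg,
          neg_neg, mul_assoc, Matrix.mul_nonsing_inv _ hβ, mul_one,
          Matrix.nonsing_inv_mul_cancel_left _ _ hβ]
      rw [StringTriple.elPairing, h1, eφ z hz]
      simp [hE, eG z hz]
    have h1 := h.elPairing_eq_zero_of_nonneg hU hs hV (fun z hz => by
      rw [hp z hz]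
      exact mul_nonneg (by norm_num) (Finset.sum_nonneg fun a _ => Finset.sum_nonneg fun b _ =>
        mul_self_nonneg _)) hz
    rw [hp z hz] at h1
    exact sum_sq_eq_zero ((mul_eq_zero.1 h1).resolve_left (by norm_num))
  exact (h.equationsOfMotion_iff hU hy).2 ⟨eG y hy, eφ y hy, eB y hy⟩

theorem elPairing_eq_zero (hU : IsOpen U) (h : IsConfigOn U F) (hy : y ∈ U)
    (he : F.EquationsOfMotionAt y) (W : StringTriple n) : F.toStringTriple.elPairing W y = 0 := by
  obtain ⟨h1, h2, h3⟩ := (h.equationsOfMotion_iff hU hy).1 he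
  simp [StringTriple.elPairing, h1, h2, h3]

end IsConfigOn

/-! ### Stationary configurations on a manifold -/

section Extend

variable {n : ℕ} {M : Type*} [TopologicalSpace M] [ChartedSpace (Coord n) M]
  {e₀ e e' : OpenPartialHomeomorph M (Coord n)} {A : Coord n → Matrix (Fin n) (Fin n) ℝ}
  {f : Coord n → ℝ} {K : Set (Coord n)} {y : Coord n}

/-- The coordinates in `e'` as a function of the coordinates in `e`. -/
abbrev transition (e e' : OpenPartialHomeomorph M (Coord n)) : Coord n → Coord n :=
  trans (Diffeomorph.refl 𝓘(ℝ, Coord n) M ∞) e e'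

/-- The domain of `transition`. -/
abbrev transitionDom (e e' : OpenPartialHomeomorph M (Coord n)) : Set (Coord n) :=
  transDom (Diffeomorph.refl 𝓘(ℝ, Coord n) M ∞) e e'

theorem transition_mem (hy : y ∈ transitionDom e e') : transition e e' y ∈ transitionDom e' e :=
  trans_mem (Diffeomorph.refl 𝓘(ℝ, Coord n) M ∞) hy

theorem isLocalCoordChange_transition (he : e ∈ smoothCharts n M) (he' : e' ∈ smoothCharts n M) :
    IsLocalCoordChange (transitionDom e e') (transitionDom e' e) (transition e e') :=
  have h := isLocalCoordChange_trans (Diffeomorph.refl 𝓘(ℝ, Coord n) M ∞) he he'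
  ⟨h.isOpen, isOpen_transDom _, h.smooth, fun _ hy => transition_mem hy, h.unit⟩

open Classical in
/-- The contravariant two-tensor on `M` with components `A` in the chart `e₀`, extended by zero outside
the domain of `e₀`. -/
def extendTensor (e₀ : OpenPartialHomeomorph M (Coord n)) (A : Coord n → Matrix (Fin n) (Fin n) ℝ)
    (e : OpenPartialHomeomorph M (Coord n)) (y : Coord n) : Matrix (Fin n) (Fin n) ℝ :=
  if e.symm y ∈ e₀.source then
    jac (transition e₀ e) (transition e e₀ y) * A (transition e e₀ y)
      * (jac (transition e₀ e) (transition e e₀ y)).transpose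
  else 0

open Classical in
/-- The function on `M` given by `f` in the chart `e₀`, extended by zero outside the domain of `e₀`. -/
def extendFun (e₀ : OpenPartialHomeomorph M (Coord n)) (f : Coord n → ℝ)
    (e : OpenPartialHomeomorph M (Coord n)) (y : Coord n) : ℝ :=
  if e.symm y ∈ e₀.source then f (transition e e₀ y) else 0

theorem extendTensor_of_notMem (hA : ∀ z ∈ e₀.target, z ∉ K → A z = 0)
    (hy : e.symm y ∉ e₀.symm '' K) : extendTensor e₀ A e y = 0 := by
  unfold extendTensor
  split_ifs with h
  · have h1 : transition e e₀ y ∉ K := fun hK => hy ⟨_, hK, e₀.left_inv h⟩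
    have h2 : A (transition e e₀ y) = 0 := hA _ (e₀.map_source h) h1
    rw [h2, mul_zero, zero_mul]
  · rfl

theorem extendFun_of_notMem (hf : ∀ z ∈ e₀.target, z ∉ K → f z = 0)
    (hy : e.symm y ∉ e₀.symm '' K) : extendFun e₀ f e y = 0 := by
  unfold extendFun
  split_ifs with h
  · exact hf _ (e₀.map_source h) fun hK => hy ⟨_, hK, e₀.left_inv h⟩
  · rfl

theorem extendTensor_self (hy : y ∈ e₀.target) : extendTensor e₀ A e₀ y = A y := by
  have h1 : ∀ z ∈ e₀.target, transition e₀ e₀ z = z := fun z hz => e₀.right_inv hz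
  have h2 : jac (transition e₀ e₀) y = 1 := by
    rw [jac_congr (τ := fun z => z)
      (Filter.eventually_of_mem (e₀.open_target.mem_nhds hy) h1), jac_id]
  rw [extendTensor, if_pos (e₀.map_target hy), h1 y hy, h2, Matrix.transpose_one, mul_one, one_mul]

theorem extendFun_self (hy : y ∈ e₀.target) : extendFun e₀ f e₀ y = f y := by
  rw [extendFun, if_pos (e₀.map_target hy)]
  exact congrArg f (e₀.right_inv hy)

/-- A function in the chart `e` is smooth if it is smooth on the domain of `e₀` and vanishes outside
a compact subset of that domain. -/
theorem sm_of_sm_transitionDom [T2Space M] (hK : IsCompact K) (hKe : K ⊆ e₀.target)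
    {f : Coord n → ℝ} (h1 : Sm (transitionDom e e₀) f)
    (h2 : ∀ y ∈ e.target, e.symm y ∉ e₀.symm '' K → f y = 0) : Sm e.target f := by
  intro y hy
  by_cases hyK : e.symm y ∈ e₀.symm '' K
  · refine h1 y ⟨hy, ?_⟩
    obtain ⟨z, hz, hzy⟩ := hyK
    change e.symm y ∈ e₀.source
    rw [← hzy]
    exact e₀.map_target (hKe hz)
  · have hC : IsClosed (e₀.symm '' K) :=
      (hK.image_of_continuousOn (e₀.continuousOn_symm.mono hKe)).isClosed
    have h0 : ContDiffAt ℝ ∞ (fun _ : Coord n => (0 : ℝ)) y := contDiffAt_const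
    refine h0.congr_of_eventuallyEq ?_
    filter_upwards [(isOpen_coord_compl hC).mem_nhds ⟨hy, hyK⟩] with z hz
    exact h2 z hz.1 hz.2

theorem smM_extendTensor [T2Space M] (he₀ : e₀ ∈ smoothCharts n M) (he : e ∈ smoothCharts n M)
    (hK : IsCompact K) (hKe : K ⊆ e₀.target) (hA : SmM e₀.target A)
    (hv : ∀ z ∈ e₀.target, z ∉ K → A z = 0) : SmM e.target (extendTensor e₀ A e) := by
  intro i j
  have hτ := isLocalCoordChange_transition he he₀
  have hJ := (isLocalCoordChange_transition he₀ he).smM_jac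
  refine sm_of_sm_transitionDom hK hKe ?_ fun y _ hyK => by
    rw [extendTensor_of_notMem hv hyK]; rfl
  have h1 : SmM (transitionDom e₀ e)
      (fun z => jac (transition e₀ e) z * A z * (jac (transition e₀ e) z).transpose) :=
    (hJ.mul (hA.mono Set.inter_subset_left)).mul hJ.transpose
  refine (hτ.sm_comp (h1 i j)).congr hτ.isOpen fun z hz => ?_
  have hz' : e.symm z ∈ e₀.source := hz.2
  rw [extendTensor, if_pos hz']

theorem sm_extendFun [T2Space M] (he₀ : e₀ ∈ smoothCharts n M) (he : e ∈ smoothCharts n M)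
    (hK : IsCompact K) (hKe : K ⊆ e₀.target) (hf : Sm e₀.target f)
    (hv : ∀ z ∈ e₀.target, z ∉ K → f z = 0) : Sm e.target (extendFun e₀ f e) := by
  have hτ := isLocalCoordChange_transition he he₀
  refine sm_of_sm_transitionDom hK hKe ?_ fun y _ hyK => extendFun_of_notMem hv hyK
  refine (hτ.sm_comp (hf.mono Set.inter_subset_left)).congr hτ.isOpen fun z hz => ?_
  have hz' : e.symm z ∈ e₀.source := hz.2
  rw [extendFun, if_pos hz']

theorem extendTensor_tensorial (he₀ : e₀ ∈ smoothCharts n M) (he : e ∈ smoothCharts n M)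
    (he' : e' ∈ smoothCharts n M) (hy : y ∈ transitionDom e e') :
    extendTensor e₀ A e' (transition e e' y)
      = jac (transition e e') y * extendTensor e₀ A e y * (jac (transition e e') y).transpose := by
  have hy' : e.symm y ∈ e'.source := hy.2
  have h1 : e'.symm (transition e e' y) = e.symm y := e'.left_inv hy'
  unfold extendTensor
  rw [h1]
  split_ifs with h
  · have h2 : transition e' e₀ (transition e e' y) = transition e e₀ y := congrArg e₀ h1
    have hd : y ∈ transitionDom e e₀ := ⟨hy.1, h⟩
    set z := transition e e₀ y with hz
    have hzd : z ∈ transitionDom e₀ e := transition_mem hd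
    have hzy : transition e₀ e z = y :=
      trans_symm_trans (Diffeomorph.refl 𝓘(ℝ, Coord n) M ∞) hd
    have h3 : jac (transition e₀ e') z = jac (transition e e') y * jac (transition e₀ e) z := by
      have h4 := jac_comp (σ := transition e e') (τ := transition e₀ e) (y := z)
        (by rw [hzy]; exact (isLocalCoordChange_transition he he').differentiableAt hy)
        ((isLocalCoordChange_transition he₀ he).differentiableAt hzd)
      rw [hzy] at h4
      rw [← h4]
      refine jac_congr ?_
      filter_upwards [(isLocalCoordChange_transition he₀ he).isOpen.mem_nhds hzd] with w hw
      exact (congrArg e' (e.left_inv hw.2)).symm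
    rw [h2, h3, Matrix.transpose_mul]
    simp only [mul_assoc]
  · simp

theorem extendFun_tensorial (hy : y ∈ transitionDom e e') :
    extendFun e₀ f e' (transition e e' y) = extendFun e₀ f e y := by
  have hy' : e.symm y ∈ e'.source := hy.2
  have h1 : e'.symm (transition e e' y) = e.symm y := e'.left_inv hy'
  have h2 : transition e' e₀ (transition e e' y) = transition e e₀ y := congrArg e₀ h1
  unfold extendFun
  rw [h1, h2]

theorem extendTensor_transpose : (extendTensor e₀ A e y).transpose
    = extendTensor e₀ (fun z => (A z).transpose) e y := by
  unfold extendTensor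
  split_ifs
  · simp only [Matrix.transpose_mul, Matrix.transpose_transpose, mul_assoc]
  · exact Matrix.transpose_zero

theorem extendTensor_congr {A' : Coord n → Matrix (Fin n) (Fin n) ℝ}
    (h : ∀ z ∈ e₀.target, A z = A' z) : extendTensor e₀ A e y = extendTensor e₀ A' e y := by
  unfold extendTensor
  split_ifs with hy
  · have h1 : A (transition e e₀ y) = A' (transition e e₀ y) := h _ (e₀.map_source hy)
    rw [h1]
  · rfl

theorem extendTensor_neg : extendTensor e₀ (fun z => -A z) e y = -extendTensor e₀ A e y := by
  unfold extendTensor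
  split_ifs
  · simp only [mul_neg, neg_mul]
  · exact neg_zero.symm

/-- The variation with components `V` in the chart `e₀`, extended by zero. -/
def extendVariation (e₀ : OpenPartialHomeomorph M (Coord n)) (V : SymplecticTriple n) :
    ChartFamily n M (SymplecticTriple n) := fun e =>
  ⟨extendTensor e₀ V.g e, extendTensor e₀ V.β e, extendFun e₀ V.φ e⟩

theorem isVariation_extendVariation [T2Space M] (he₀ : e₀ ∈ smoothCharts n M)
    {V : SymplecticTriple n} (hV : IsVariationOn e₀.target V) (hK : IsCompact K)
    (hKe : K ⊆ e₀.target)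
    (hv : ∀ y ∈ e₀.target, y ∉ K → V.g y = 0 ∧ V.β y = 0 ∧ V.φ y = 0) :
    IsVariation (extendVariation e₀ V) := by
  refine isVariation_of_local (fun e he => ⟨?_, ?_, ?_, fun y _ => ?_, fun y _ => ?_⟩) ?_
  · exact smM_extendTensor he₀ he hK hKe hV.smg fun z hz hzK => (hv z hz hzK).1
  · exact smM_extendTensor he₀ he hK hKe hV.smβ fun z hz hzK => (hv z hz hzK).2.1
  · exact sm_extendFun he₀ he hK hKe hV.smφ fun z hz hzK => (hv z hz hzK).2.2
  · exact extendTensor_transpose.trans (extendTensor_congr hV.symm)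
  · exact extendTensor_transpose.trans ((extendTensor_congr hV.skew).trans extendTensor_neg)
  · exact fun e he e' he' y hy hy' => ⟨extendTensor_tensorial he₀ he he' ⟨hy, hy'⟩,
      extendTensor_tensorial he₀ he he' ⟨hy, hy'⟩, extendFun_tensorial ⟨hy, hy'⟩⟩

end Extend

section Stationary

variable {n : ℕ} {M : Type*} [TopologicalSpace M] [ChartedSpace (Coord n) M]
  [MeasurableSpace M] [BorelSpace M] [T2Space M] {F : ChartFamily n M (SymplecticTriple n)}

/-- Variations supported in a chart extend by zero to the manifold, so stationarity passes to charts. -/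
theorem IsStationary.isStationaryOn {κ : ℝ} (hκ : κ ≠ 0) (hF : IsSymplecticConfig F)
    (hs : IsStationary κ F) {e : OpenPartialHomeomorph M (Coord n)} (he : e ∈ smoothCharts n M) :
    IsConfigOn.IsStationaryOn e.target (F e) := by
  intro V hV K hK hKe hv
  have hVar := isVariation_extendVariation he hV hK hKe hv
  set P : Patches n M := [(e, e.symm '' K)] with hPdef
  have hsub : e.symm '' K ⊆ e.source := by
    rintro _ ⟨z, hz, rfl⟩
    exact e.map_target (hKe hz)
  have hP : ValidPatches P := by
    intro p hp
    obtain rfl := List.mem_singleton.1 hp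
    exact ⟨he, hK.image_of_continuousOn (e.continuousOn_symm.mono hKe), hsub⟩
  have hreg : region P = e.symm '' K := by
    ext x
    simp [region, hPdef]
  have hvan : VariationVanishesOutside (region P) (extendVariation e V) := by
    rw [hreg]
    exact fun e' _ y _ hy => ⟨extendTensor_of_notMem (fun z hz hzK => (hv z hz hzK).1) hy,
      extendTensor_of_notMem (fun z hz hzK => (hv z hz hzK).2.1) hy,
      extendFun_of_notMem (fun z hz hzK => (hv z hz hzK).2.2) hy⟩
  have h1 := (hasDerivAt_symplecticAction κ hF hVar hP).unique (hs _ hVar P hP hvan)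
  have himg : e '' (Set.univ ∩ e.symm '' K) = K := by
    rw [Set.univ_inter, Set.image_image]
    exact (Set.image_congr fun z hz => e.right_inv (hKe hz)).trans (Set.image_id' K)
  have h2 : patchIntegral (fun e' => (F e').firstVariation (extendVariation e V e')) P Set.univ
      = ∫ y in K, (F e).firstVariation (extendVariation e V e) y := by
    rw [hPdef, patchIntegral, patchIntegral, himg, add_zero]
  rw [h2] at h1
  rw [setIntegral_congr_fun hK.measurableSet fun y hy =>
    IsConfigOn.firstVariation_congr (V' := extendVariation e V e) e.open_target (hF.isConfigOn he) hV
      (fun z hz => (extendTensor_self hz).symm) (fun z hz => (extendTensor_self hz).symm)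
      (fun z hz => (extendFun_self hz).symm) (hKe hy)]
  exact (mul_eq_zero.1 h1).resolve_left (by positivity)

/-- Stationary configurations are the solutions of the equations of motion. -/
theorem isStationary_iff [IsManifold 𝓘(ℝ, Coord n) ∞ M] [SigmaCompactSpace M] {κ : ℝ} (hκ : κ ≠ 0)
    (hF : IsSymplecticConfig F) : IsStationary κ F ↔
      ∀ e ∈ smoothCharts n M, ∀ y ∈ e.target, (F e).EquationsOfMotionAt y :=
  ⟨fun hs _ he _ hy => (hF.isConfigOn he).equationsOfMotion_of_isStationaryOn
      (OpenPartialHomeomorph.open_target _) (hs.isStationaryOn hκ hF he) hy,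
    fun h => isStationary_of_elPairing_eq_zero κ hF fun e he _ hy W =>
      (hF.isConfigOn he).elPairing_eq_zero e.open_target hy (h e he _ hy) W⟩

end Stationary

/-! ### The field redefinition on a manifold -/

section Redefinition

variable {n : ℕ} {M : Type*} [TopologicalSpace M] [ChartedSpace (Coord n) M]
  {F : ChartFamily n M (SymplecticTriple n)} {T : ChartFamily n M (StringTriple n)}

theorem IsSymplecticConfig.isStringConfig (hF : IsSymplecticConfig F) :
    IsStringConfig fun e => (F e).toStringTriple where
  smooth_G _ he i j := ((hF.isConfigOn he).toStringTriple.metric.smooth i j).contDiffOn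
  smooth_B _ he i j := ((hF.isConfigOn he).toStringTriple.smB i j).contDiffOn
  smooth_φ _ he := (hF.isConfigOn he).toStringTriple.smφ.contDiffOn
  symm_G _ he := (hF.isConfigOn he).toStringTriple.metric.symm
  skew_B _ he := (hF.isConfigOn he).toStringTriple.skew
  nondeg_G _ he := (hF.isConfigOn he).toStringTriple.metric.unit
  tensorial e he e' he' y hy hy' := stringLaw_of_symplecticLaw
    ((isLocalCoordChange_transition he he').unit y ⟨hy, hy'⟩) (hF.tensorial e he e' he' y hy hy')

theorem IsStringConfigOn.toSymplecticTriple {U : Set (Coord n)} {T : StringTriple n}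
    (h : IsStringConfigOn U T) (hB : ∀ y ∈ U, IsUnit (T.B y).det) :
    IsConfigOn U T.toSymplecticTriple where
  metric :=
    { smooth := (((h.smB.inv hB).mul h.metric.smooth).mul (h.smB.inv hB)).neg
      symm := fun z hz => by
        simp only [StringTriple.toSymplecticTriple, Matrix.transpose_neg, Matrix.transpose_mul,
          Matrix.transpose_nonsing_inv, h.skew z hz, h.metric.symm z hz, inv_neg_matrix (hB z hz),
          neg_mul, mul_neg, neg_neg, mul_assoc]
      unit := fun z hz => by
        have h1 := Matrix.isUnit_nonsing_inv_det _ (hB z hz)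
        simp only [StringTriple.toSymplecticTriple, Matrix.det_neg, Matrix.det_mul]
        exact ((isUnit_neg_one (α := ℝ)).pow _).mul ((h1.mul (h.metric.unit z hz)).mul h1) }
  smβ := h.smB.inv hB
  skew := fun z hz => by
    simp only [StringTriple.toSymplecticTriple, Matrix.transpose_nonsing_inv, h.skew z hz,
      inv_neg_matrix (hB z hz)]
  unitβ := fun z hz => Matrix.isUnit_nonsing_inv_det _ (hB z hz)
  smφ := h.smφ

theorem symplecticLaw_of_stringLaw {J : Matrix (Fin n) (Fin n) ℝ} (hJ : IsUnit J.det)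
    {T T' : StringTriple n} {y y' : Coord n} (h : stringLaw J T T' y y') :
    symplecticLaw J T.toSymplecticTriple T'.toSymplecticTriple y y' := by
  obtain ⟨hG, hB, hφ⟩ := h
  have hJ' : IsUnit J.transpose.det := by rwa [Matrix.det_transpose]
  have h1 : (T'.B y')⁻¹ = J * (T.B y)⁻¹ * J.transpose := by
    rw [hB, Matrix.mul_inv_rev, Matrix.mul_inv_rev]
    simp only [mul_assoc]
    rw [Matrix.nonsing_inv_mul _ hJ', mul_one, Matrix.mul_nonsing_inv_cancel_left _ _ hJ]
  refine ⟨?_, h1, hφ⟩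
  simp only [StringTriple.toSymplecticTriple]
  rw [h1, hG]
  simp only [mul_neg, neg_mul, mul_assoc]

theorem IsStringConfig.isSymplecticConfig (hT : IsStringConfig T)
    (hB : ∀ e ∈ smoothCharts n M, ∀ y ∈ e.target, IsUnit ((T e).B y).det) :
    IsSymplecticConfig fun e => (T e).toSymplecticTriple where
  toIsVariation := isVariation_of_local
    (fun e he => ((hT.isStringConfigOn he).toSymplecticTriple (hB e he)).isVariationOn)
    fun e he e' he' y hy hy' => symplecticLaw_of_stringLaw
      ((isLocalCoordChange_transition he he').unit y ⟨hy, hy'⟩) (hT.tensorial e he e' he' y hy hy')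
  nondeg_g e he := ((hT.isStringConfigOn he).toSymplecticTriple (hB e he)).metric.unit
  nondeg_β e he := ((hT.isStringConfigOn he).toSymplecticTriple (hB e he)).unitβ

theorem toStringTriple_toSymplecticTriple_G {T : StringTriple n} {y : Coord n}
    (hB : IsUnit (T.B y).det) : T.toSymplecticTriple.toStringTriple.G y = T.G y := by
  simp only [SymplecticTriple.toStringTriple, StringTriple.toSymplecticTriple,
    SymplecticTriple.βInv, Matrix.nonsing_inv_nonsing_inv _ hB, mul_neg, neg_mul, neg_neg, mul_assoc,
    Matrix.nonsing_inv_mul _ hB, mul_one, Matrix.mul_nonsing_inv_cancel_left _ _ hB]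

theorem toStringTriple_toSymplecticTriple_B {T : StringTriple n} {y : Coord n}
    (hB : IsUnit (T.B y).det) : T.toSymplecticTriple.toStringTriple.B y = T.B y :=
  Matrix.nonsing_inv_nonsing_inv _ hB

theorem IsStringConfigOn.density_toSymplecticTriple {U : Set (Coord n)} (hU : IsOpen U)
    {T : StringTriple n} (h : IsStringConfigOn U T) (hB : ∀ y ∈ U, IsUnit (T.B y).det) {y : Coord n}
    (hy : y ∈ U) : T.toSymplecticTriple.density y = T.density y := by
  have h1 := h.toSymplecticTriple hB
  rw [h1.density_eq hU hy]
  exact string_density_congr hU h1.toStringTriple h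
    (fun z hz => toStringTriple_toSymplecticTriple_G (hB z hz))
    (fun z hz => toStringTriple_toSymplecticTriple_B (hB z hz)) (fun _ _ => rfl) hy

end Redefinition

/-! ### The action on a manifold -/

theorem symplecticAction_eq {n : ℕ} {M N : Type*} [TopologicalSpace M] [ChartedSpace (Coord n) M]
    [TopologicalSpace N] [ChartedSpace (Coord n) N] [T2Space M] [T2Space N] [MeasurableSpace M]
    [BorelSpace M] [MeasurableSpace N] [BorelSpace N] (κ : ℝ)
    (ψ : M ≃ₘ^∞⟮𝓘(ℝ, Coord n), 𝓘(ℝ, Coord n)⟯ N) {F : ChartFamily n M (SymplecticTriple n)}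
    {F' : ChartFamily n N (SymplecticTriple n)} (hF : IsSymplecticConfig F)
    (hF' : IsSymplecticConfig F') (h : RelatedUnder symplecticLaw ψ F F') {P : Patches n M}
    {P' : Patches n N} (hP : ValidPatches P) (hP' : ValidPatches P')
    (hPP' : ψ '' region P = region P') : symplecticAction κ F P = symplecticAction κ F' P' := by
  rw [symplecticAction, symplecticAction, patchIntegral_univ_eq ψ
    (fun e he => (hF.sm_density he).continuousOn) (fun e he => (hF'.sm_density he).continuousOn)
    (relatedUnder_density ψ hF hF' h) hP hP' hPP']

end SymplecticGravity
end

theorem mainTheorem7 {n : ℕ} {M N : Type*}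
    [TopologicalSpace M] [ChartedSpace (SymplecticGravity.Coord n) M]
    [IsManifold 𝓘(ℝ, SymplecticGravity.Coord n) ∞ M] [T2Space M] [SigmaCompactSpace M]
    [TopologicalSpace N] [ChartedSpace (SymplecticGravity.Coord n) N]
    [IsManifold 𝓘(ℝ, SymplecticGravity.Coord n) ∞ N] [T2Space N] [SigmaCompactSpace N]
    (κ : ℝ) (hκ : κ ≠ 0)
    (F : SymplecticGravity.ChartFamily n M (SymplecticGravity.SymplecticTriple n))
    (hF : SymplecticGravity.IsSymplecticConfig F) :
    -- the Lagrangian density is smooth in every chart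
    (∀ e ∈ SymplecticGravity.smoothCharts n M, ContDiffOn ℝ ∞ (F e).density e.target) ∧
    -- invariance under finite diffeomorphisms (`F` is the pull-back of `F'` along `ψ`)
    (∀ (ψ : M ≃ₘ^∞⟮𝓘(ℝ, SymplecticGravity.Coord n), 𝓘(ℝ, SymplecticGravity.Coord n)⟯ N)
      (F' : SymplecticGravity.ChartFamily n N (SymplecticGravity.SymplecticTriple n)),
      SymplecticGravity.IsSymplecticConfig F' →
      SymplecticGravity.RelatedUnder SymplecticGravity.symplecticLaw ψ F F' →
      ∀ (P : SymplecticGravity.Patches n M) (P' : SymplecticGravity.Patches n N),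
        SymplecticGravity.ValidPatches P → SymplecticGravity.ValidPatches P' →
        ψ '' SymplecticGravity.region P = SymplecticGravity.region P' →
        SymplecticGravity.symplecticAction κ F P = SymplecticGravity.symplecticAction κ F' P') ∧
    -- independence of the charts used to compute the action
    (∀ P P' : SymplecticGravity.Patches n M,
        SymplecticGravity.ValidPatches P → SymplecticGravity.ValidPatches P' →
        SymplecticGravity.region P = SymplecticGravity.region P' →
        SymplecticGravity.symplecticAction κ F P = SymplecticGravity.symplecticAction κ F P') ∧
    -- invariance under infinitesimal diffeomorphisms
    (∀ X : SymplecticGravity.ChartFamily n M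
        (SymplecticGravity.Coord n → SymplecticGravity.Coord n),
      SymplecticGravity.IsVectorField X →
      SymplecticGravity.IsVariation (fun e => (F e).diffeoVariation (X e)) ∧
      (∀ e ∈ SymplecticGravity.smoothCharts n M, ∀ y ∈ e.target,
        HasDerivAt (fun t : ℝ => ((F e).shift t ((F e).diffeoVariation (X e))).density y)
          (∑ m, SymplecticGravity.pd m (fun z => X e z m * (F e).density z) y) 0) ∧
      ∀ P : SymplecticGravity.Patches n M, SymplecticGravity.ValidPatches P →
        SymplecticGravity.VanishesOutside (SymplecticGravity.region P) X →
        HasDerivAt (fun t : ℝ => SymplecticGravity.symplecticAction κ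
          (fun e => (F e).shift t ((F e).diffeoVariation (X e))) P) 0 0) ∧
    -- invariance under `β`-diffeomorphisms, up to a total derivative
    (∀ ξ : SymplecticGravity.ChartFamily n M
        (SymplecticGravity.Coord n → SymplecticGravity.Coord n),
      SymplecticGravity.IsOneForm ξ →
      SymplecticGravity.IsVariation (fun e => (F e).betaVariation (ξ e)) ∧
      (∀ e ∈ SymplecticGravity.smoothCharts n M, ∀ y ∈ e.target,
        HasDerivAt (fun t : ℝ => ((F e).shift t ((F e).betaVariation (ξ e))).density y)
          (∑ m, SymplecticGravity.pd m
            (fun z => (∑ k, ξ e z k * (F e).β z k m) * (F e).density z) y) 0) ∧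
      ∀ P : SymplecticGravity.Patches n M, SymplecticGravity.ValidPatches P →
        SymplecticGravity.VanishesOutside (SymplecticGravity.region P) ξ →
        HasDerivAt (fun t : ℝ => SymplecticGravity.symplecticAction κ
          (fun e => (F e).shift t ((F e).betaVariation (ξ e))) P) 0 0) ∧
    -- the field redefinition, from symplectic gravity to the string effective action
    (SymplecticGravity.IsStringConfig (fun e => (F e).toStringTriple) ∧
      (∀ e ∈ SymplecticGravity.smoothCharts n M, ∀ y ∈ e.target,
        (F e).β y = ((F e).toStringTriple.B y)⁻¹ ∧
        (F e).g y = -((F e).β y * (F e).toStringTriple.G y * (F e).β y) ∧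
        (F e).toStringTriple.density y = (F e).density y) ∧
      ∀ P : SymplecticGravity.Patches n M, SymplecticGravity.ValidPatches P →
        SymplecticGravity.stringAction κ (fun e => (F e).toStringTriple) P
          = SymplecticGravity.symplecticAction κ F P) ∧
    -- the field redefinition, from the string effective action to symplectic gravity
    (∀ T : SymplecticGravity.ChartFamily n M (SymplecticGravity.StringTriple n),
      SymplecticGravity.IsStringConfig T →
      (∀ e ∈ SymplecticGravity.smoothCharts n M, ∀ y ∈ e.target, IsUnit ((T e).B y).det) →
      SymplecticGravity.IsSymplecticConfig (fun e => (T e).toSymplecticTriple) ∧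
      (∀ e ∈ SymplecticGravity.smoothCharts n M, ∀ y ∈ e.target,
        (T e).toSymplecticTriple.toStringTriple.G y = (T e).G y ∧
        (T e).toSymplecticTriple.toStringTriple.B y = (T e).B y ∧
        (T e).toSymplecticTriple.toStringTriple.φ y = (T e).φ y) ∧
      ∀ P : SymplecticGravity.Patches n M, SymplecticGravity.ValidPatches P →
        SymplecticGravity.symplecticAction κ (fun e => (T e).toSymplecticTriple) P
          = SymplecticGravity.stringAction κ T P) ∧
    -- the field equations
    (SymplecticGravity.IsStationary κ F ↔
      ∀ e ∈ SymplecticGravity.smoothCharts n M, ∀ y ∈ e.target, (F e).EquationsOfMotionAt y) := by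
  let _ : MeasurableSpace M := borel M
  have _ : BorelSpace M := ⟨rfl⟩
  let _ : MeasurableSpace N := borel N
  have _ : BorelSpace N := ⟨rfl⟩
  refine ⟨fun e he => (hF.sm_density he).contDiffOn, ?_, ?_, ?_, ?_, ?_, ?_,
    SymplecticGravity.isStationary_iff hκ hF⟩
  · intro ψ F' hF' h P P' hP hP' hPP'
    exact SymplecticGravity.symplecticAction_eq κ ψ hF hF' h hP hP' hPP'
  · intro P P' hP hP' hPP'
    exact SymplecticGravity.symplecticAction_eq κ
      (Diffeomorph.refl 𝓘(ℝ, SymplecticGravity.Coord n) M ∞) hF hF hF.tensorial hP hP'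
      ((Set.image_id _).trans hPP')
  · intro X hX
    refine ⟨SymplecticGravity.isVariation_diffeoVariation hF hX, fun e he y hy => ?_,
      fun P hP hXP => SymplecticGravity.hasDerivAt_symplecticAction_diffeoVariation κ hF hX hP hXP⟩
    have hc := hF.isConfigOn he
    rw [← SymplecticGravity.IsConfigOn.firstVariation_diffeoVariation e.open_target hc (hX.sm he) hy]
    exact hc.hasDerivAt_density e.open_target
      (SymplecticGravity.IsConfigOn.isVariationOn_diffeoVariation e.open_target hc (hX.sm he)) hy
  · intro ξ hξ
    refine ⟨SymplecticGravity.isVariation_betaVariation hF hξ, fun e he y hy => ?_,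
      fun P hP hξP => SymplecticGravity.hasDerivAt_symplecticAction_betaVariation κ hF hξ hP hξP⟩
    have hc := hF.isConfigOn he
    rw [← SymplecticGravity.IsConfigOn.firstVariation_betaVariation e.open_target hc (hξ.sm he) hy]
    exact hc.hasDerivAt_density e.open_target
      (SymplecticGravity.IsConfigOn.isVariationOn_betaVariation e.open_target hc (hξ.sm he)) hy
  · have hd : ∀ e ∈ SymplecticGravity.smoothCharts n M, ∀ y ∈ e.target,
        (F e).toStringTriple.density y = (F e).density y := fun e he y hy =>
      ((hF.isConfigOn he).density_eq e.open_target hy).symm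
    refine ⟨hF.isStringConfig, fun e he y hy => ⟨?_, ?_, hd e he y hy⟩, fun P hP => ?_⟩
    · exact (Matrix.nonsing_inv_nonsing_inv _ ((hF.isConfigOn he).unitβ y hy)).symm
    · rw [(hF.isConfigOn he).g_eq hy, (hF.isConfigOn he).skew y hy, mul_neg]
    · rw [SymplecticGravity.stringAction, SymplecticGravity.symplecticAction,
        SymplecticGravity.patchIntegral_congr hP MeasurableSet.univ hd]
  · intro T hT hB
    refine ⟨hT.isSymplecticConfig hB, fun e he y hy =>
      ⟨SymplecticGravity.toStringTriple_toSymplecticTriple_G (hB e he y hy),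
        SymplecticGravity.toStringTriple_toSymplecticTriple_B (hB e he y hy), rfl⟩, fun P hP => ?_⟩
    rw [SymplecticGravity.stringAction, SymplecticGravity.symplecticAction,
      SymplecticGravity.patchIntegral_congr hP MeasurableSet.univ fun e he y hy =>
        (hT.isStringConfigOn he).density_toSymplecticTriple e.open_target (hB e he) hy]
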